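/- Let $n\ge 1$, let $B^n$ be the unit ball of $\mathbb C^n$, $S=\partial B^n$, $\sigma$ the surface measure on $S$, $m$ Lebesgue measure on $\mathbb C^n$, $z\overline w=\sum_k z_k\overline{w_k}$, $d(z,w)=|1-z\overline w|$ and $B(x,R)=\{y: d(x,y)<R\}$. **Dimensions and measures.** Let $E\subset S$ be closed. For $x\in E$ let $N(x,R,k)$ be the maximal number of points of $E\cap B(x,kR)$ with mutual $d$-distances at least $R$. The upper dimension $\Upsilon(E)$ is the infimum of the $\gamma\in\mathbb R$ for which there is $C$ with $N(x,R,k)\le Ck^\gamma$ for all $x\in E$, $0<R<kR\le 1$; the lower dimension $\Lambda(E)$ is the supremum of the $\gamma$ for which there is $C>0$ with $N(x,R,k)\ge Ck^\gamma$ for the same $x,R,k$. A probability measure $\mu$ with support $E$ lies in $U_\gamma(E)$ if $\mu(B(x,kR))\le Ck^\gamma\mu(B(x,R))$ for some $C$ and all $x\in E$, $0<R<kR\le1$; it lies in $L_\gamma(E)$ if it lies in some $U_{\gamma'}(E)$ and $\mu(B(x,kR))\ge Ck^\gamma\mu(B(x,R))$ for some $C>0$ and all such $x,R,k$. **Jets.**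 Let $e(z)=(e_1(z),\dots,e_n(z))$, $z\ne0$, be a Borel measurable orthonormal frame with $e_n(z)=z/|z|$ (so $e_1(z),\dots,e_{n-1}(z)$ span the complex-tangential directions at $z$), continuous at $\mu$-almost every point of $E$. Put $w_k(z,\zeta)=(z-\zeta)\overline{e_k(\zeta)}$, and for $j\in\mathbb N^n$ let $\omega(j)=j_n+\frac12(j_1+\dots+j_{n-1})$ and let $D^jF(z)$ be the $j$-th complex derivative of $F$ at $z$ in the coordinates centred at $z$, that is, $D^jF(z)=\partial_{v_1}^{j_1}\cdots\partial_{v_n}^{j_n}F(z)$ with $v_k=e_k(z)$ held fixed. For a jet $f=\{f_j\}_{\omega(j)\le\alpha}$ of functions on $E$ let $$T^\alpha_yf(x)=\sum_{\omega(j)\le\alpha}\frac1{j!}f_j(y)\,w(x,y)^j,\qquad \Delta_j(y,x)=f_j(x)-D^j_xT^\alpha_yf(x).$$ Then $f\in B^p_\alpha(\mu)$ means that, for all $\omega(j)\le\alpha$, $f_j\in L^p(\mu)$ and $$\iint_{E\times E}\frac{|\Delta_j(t,s)|^p}{d(s,t)^{p(\alpha-\omega(j))-\lambda}}\,\frac{d\mu(t)\,d\mu(s)}{\mu(B(t,d(t,s)))^2}<\infty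 ,$$ where $\lambda$ is the exponent fixed in the theorem. **Extension.** For $q\in\mathbb R$ and $z\in B^n$ put (principal branch) $$h_q(z)=\int_E\frac{d\mu(y)}{(1-z\overline y)^{q}},\qquad \mathcal E(f)(z)=\frac1{h_q(z)}\int_E\frac{T^\alpha_yf(z)}{(1-z\overline y)^q}\,d\mu(y).$$ We say that $h_q$ satisfies the lower bound if there is $C>0$ such that $|h_q(z)|\ge C\,d(z,E)^{-q}\mu(B_z)$ for all $z\in B^n$, where $d(z,E)=\inf_{w\in E}d(z,w)$, $B_z=B(z_0,3d(z,E))$ and $z_0\in E$ is a point with $d(z,z_0)=d(z,E)$. **Triebel–Lizorkin spaces.** Let $NF(z)=\sum_kz_k\,\partial F/\partial z_k$ and $R=I+N$. For $p,r>0$, $\beta\ge0$, $HF^{p,r}_\beta(B^n)$ is the set of holomorphic $F$ on $B^n$ with $$\int_S\Big(\int_0^1(1-t^2)^{([\beta]+1-\beta)r-1}\,|R^{[\beta]+1}F(tz)|^r\,dt\Big)^{p/r}d\sigma(z)<\infty .$$ **Theorem.** Let $1\le p<\infty$, $\alpha>0$ and $\upsilon,\lambda\in\mathbb R$ be such that $\upsilon<n$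 and no integer multiple of $\frac12$ lies in $[\alpha,\alpha+\frac{\upsilon-\lambda}p]$. There is $q_0$, depending only on $n,p,\alpha,\upsilon,\lambda$, such that the following holds. Let $E\subset S$ be closed with $\Upsilon(E)<n$, $\Upsilon(E)\le\upsilon$ and $\lambda\le\Lambda(E)$, let $\mu\in U_\upsilon(E)\cap L_\lambda(E)$, let $e$ be a frame as above, let $q\ge q_0$ be such that $h_q$ satisfies the lower bound, and let $f=\{f_j\}_{\omega(j)\le\alpha}\in B^p_\alpha(\mu)$. Then, with $\beta=\alpha+\frac{n-\lambda}p$, $$\mathcal E(f)\in HF^{p,1}_\beta(B^n).$$ Moreover, for every $\gamma$ with $\omega(\gamma)<\alpha$ and $\mu$-almost every $\zeta\in E$, the function $D^\gamma\mathcal E(f)$ is integrable over $B^n\cap B(\zeta,\delta)$ for all small $\delta>0$, and $$\lim_{\delta\to0}\frac1{m(B^n\cap B(\zeta,\delta))}\int_{B^n\cap B(\zeta,\delta)}D^\gamma\mathcal E(f)\,dm=f_\gamma(\zeta),\qquad \lim_{\delta\to0}\frac1{m(B^n\cap B(\zeta,\delta))}\int_{B^n\cap B(\zeta,\delta)}|D^\gamma\mathcal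 E(f)-f_\gamma(\zeta)|\,dm=0 .$$ -/

import Mathlib

open MeasureTheory Filter Topology

namespace NonIso

noncomputable section

/-- Complex Euclidean space of dimension `n = m + 1`. -/
abbrev Cn (m : ℕ) : Type := EuclideanSpace ℂ (Fin (m + 1))

/-- `τ(z, w) = 1 - z · w̄`, where `z · w̄ = ∑ zₖ conj(wₖ)`. -/
def tau {m : ℕ} (z w : Cn m) : ℂ := 1 - inner ℂ w z

/-- The non-isotropic pseudo-distance `d(z, w) = |1 - z · w̄|`. -/
def dist {m : ℕ} (z w : Cn m) : ℝ := ‖tau z w‖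

/-- The ball `B(x, R)` of the pseudo-distance. -/
def dBall {m : ℕ} (x : Cn m) (R : ℝ) : Set (Cn m) := {y | dist x y < R}

/-- `d(z, E) = inf {d(z, w) : w ∈ E}`. -/
def distSet {m : ℕ} (z : Cn m) (E : Set (Cn m)) : ℝ := ⨅ w : E, dist z w

/-! ### Upper and lower dimension -/

/-- `F` is a finite set of points of `E ∩ B(x, kR)` with mutual distances at least `R`; the largest
cardinality of such a set is `N(x, R, k)`. -/
def IsPacking {m : ℕ} (E : Set (Cn m)) (x : Cn m) (R k : ℝ) (F : Finset (Cn m)) : Prop :=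
  (∀ a ∈ F, a ∈ E ∧ a ∈ dBall x (k * R)) ∧ ∀ a ∈ F, ∀ b ∈ F, a ≠ b → R ≤ dist a b

/-- `E ∈ Υ_γ`: `N(x, R, k) ≤ C k^γ` for all `x ∈ E` and `0 < R < kR ≤ 1`. -/
def UpperClass {m : ℕ} (E : Set (Cn m)) (γ : ℝ) : Prop :=
  ∃ C : ℝ, ∀ x ∈ E, ∀ R k : ℝ, 0 < R → R < k * R → k * R ≤ 1 →
    ∀ F : Finset (Cn m), IsPacking E x R k F → (F.card : ℝ) ≤ C * k ^ γ

/-- `E ∈ Λ_γ`: `N(x, R, k) ≥ C k^γ` for all `x ∈ E` and `0 < R < kR ≤ 1`, with `C > 0`. -/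
def LowerClass {m : ℕ} (E : Set (Cn m)) (γ : ℝ) : Prop :=
  ∃ C : ℝ, 0 < C ∧ ∀ x ∈ E, ∀ R k : ℝ, 0 < R → R < k * R → k * R ≤ 1 →
    ∃ F : Finset (Cn m), IsPacking E x R k F ∧ C * k ^ γ ≤ (F.card : ℝ)

/-- The upper dimension `Υ(E)`. -/
def upperDim {m : ℕ} (E : Set (Cn m)) : ℝ := sInf {γ | UpperClass E γ}

/-- The lower dimension `Λ(E)`. -/
def lowerDim {m : ℕ} (E : Set (Cn m)) : ℝ := sSup {γ | LowerClass E γ}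

/-- `μ ∈ U_γ(E)`: `μ` is a probability measure with support `E` and
`μ(B(x, kR)) ≤ C k^γ μ(B(x, R))` for all `x ∈ E` and `0 < R < kR ≤ 1`. -/
structure MemU {m : ℕ} (E : Set (Cn m)) (γ : ℝ) (μ : Measure (Cn m)) : Prop where
  prob : IsProbabilityMeasure μ
  compl_null : μ Eᶜ = 0
  ball_pos : ∀ x ∈ E, ∀ R : ℝ, 0 < R → 0 < μ (dBall x R)
  growth : ∃ C : ℝ, ∀ x ∈ E, ∀ R k : ℝ, 0 < R → R < k * R → k * R ≤ 1 →
    μ.real (dBall x (k * R)) ≤ C * k ^ γ * μ.real (dBall x R)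

/-- `μ ∈ L_γ(E)`: `μ` is a doubling measure (it lies in some `U_γ'(E)`) and
`μ(B(x, kR)) ≥ C k^γ μ(B(x, R))` for all `x ∈ E` and `0 < R < kR ≤ 1`, with `C > 0`. -/
structure MemL {m : ℕ} (E : Set (Cn m)) (γ : ℝ) (μ : Measure (Cn m)) : Prop where
  doubling : ∃ γ' : ℝ, MemU E γ' μ
  growth : ∃ C : ℝ, 0 < C ∧ ∀ x ∈ E, ∀ R k : ℝ, 0 < R → R < k * R → k * R ≤ 1 →
    C * k ^ γ * μ.real (dBall x R) ≤ μ.real (dBall x (k * R))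

/-! ### Coordinates, jets and Taylor polynomials -/

/-- A Borel unitary frame: at each `z ≠ 0` the vectors `e z 0, …, e z m` are orthonormal, the last
one is the complex normal direction `z / |z|`, hence the others span the complex-tangential
space at `z`. -/
structure IsFrame {m : ℕ} (e : Cn m → Fin (m + 1) → Cn m) : Prop where
  measurable : Measurable e
  orthonormal : ∀ z : Cn m, z ≠ 0 → Orthonormal ℂ (e z)
  normal : ∀ z : Cn m, z ≠ 0 → e z (Fin.last m) = ((‖z‖⁻¹ : ℝ) : ℂ) • z

/-- The coordinates `w(z, ζ)` centred at `ζ`, so that `z = ζ + ∑ₖ wₖ(z, ζ) eₖ(ζ)`. -/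
def coord {m : ℕ} (e : Cn m → Fin (m + 1) → Cn m) (z ζ : Cn m) (k : Fin (m + 1)) : ℂ :=
  inner ℂ (e ζ k) (z - ζ)

/-- The weight `ω(j) = jₙ + (j₁ + ⋯ + jₙ₋₁) / 2` of a multi-index. -/
def weight {m : ℕ} (j : Fin (m + 1) → ℕ) : ℝ :=
  (j (Fin.last m) : ℝ) + (∑ k : Fin m, (j k.castSucc : ℝ)) / 2

/-- The finite set of the multi-indices of weight at most `α`; see `mem_indices`. -/
def indices (m : ℕ) (α : ℝ) : Finset (Fin (m + 1) → ℕ) :=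
  open scoped Classical in
  (Fintype.piFinset fun _ => Finset.range (⌊2 * α⌋₊ + 1)).filter fun j => weight j ≤ α

theorem mem_indices {m : ℕ} {α : ℝ} {j : Fin (m + 1) → ℕ} :
    j ∈ indices m α ↔ weight j ≤ α := by
  classical
  simp only [indices, Finset.mem_filter, Fintype.mem_piFinset, Finset.mem_range, Nat.lt_succ_iff,
    and_iff_right_iff_imp]
  intro h k
  apply Nat.le_floor
  have hs : ∀ i : Fin m, (j i.castSucc : ℝ) ≤ ∑ k : Fin m, (j k.castSucc : ℝ) := fun i =>
    Finset.single_le_sum (f := fun k : Fin m => (j k.castSucc : ℝ))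
      (fun _ _ => Nat.cast_nonneg _) (Finset.mem_univ i)
  have h0 : (0 : ℝ) ≤ ∑ k : Fin m, (j k.castSucc : ℝ) :=
    Finset.sum_nonneg fun _ _ => Nat.cast_nonneg _
  have hl : (0 : ℝ) ≤ j (Fin.last m) := Nat.cast_nonneg _
  unfold weight at h
  induction k using Fin.lastCases with
  | last => linarith
  | cast i => linarith [hs i]

/-- A jet is a family of functions indexed by multi-indices `j`; only the components with
`ω(j) ≤ α` enter the definitions below. -/
abbrev Jet (m : ℕ) : Type := (Fin (m + 1) → ℕ) → Cn m → ℂ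

/-- The non-isotropic Taylor polynomial
`T^α_y f(x) = ∑_{ω(j) ≤ α} (1 / j!) f_j(y) w(x, y)^j`. -/
def taylor {m : ℕ} (e : Cn m → Fin (m + 1) → Cn m) (α : ℝ) (f : Jet m) (y x : Cn m) : ℂ :=
  ∑ j ∈ indices m α,
    ((∏ k, ((j k).factorial : ℂ))⁻¹ * f j y * ∏ k, coord e x y k ^ j k)

/-- The constant-coefficient operator `∂_{v 0}^{j 0} ⋯ ∂_{v m}^{j m}` of complex directional
derivatives. -/
def dirDeriv {m : ℕ} (v : Fin (m + 1) → Cn m) (j : Fin (m + 1) → ℕ) (F : Cn m → ℂ) : Cn m → ℂ :=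
  (List.finRange (m + 1)).foldr
    (fun k G => (fun (H : Cn m → ℂ) (z : Cn m) => fderiv ℂ H z (v k))^[j k] G) F

/-- `D^j F(z)`: the `j`-th derivative of `F` at `z` with respect to the coordinates centred
at `z`. -/
def wDeriv {m : ℕ} (e : Cn m → Fin (m + 1) → Cn m) (j : Fin (m + 1) → ℕ) (F : Cn m → ℂ)
    (z : Cn m) : ℂ :=
  dirDeriv (e z) j F z

/-- `Δ_j(y, x) = f_j(x) - D^j T^α_y f(x)`. -/
def remainder {m : ℕ} (e : Cn m → Fin (m + 1) → Cn m) (α : ℝ) (f : Jet m)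
    (j : Fin (m + 1) → ℕ) (y x : Cn m) : ℂ :=
  f j x - wDeriv e j (taylor e α f y) x

/-- The jet `f` lies in the non-isotropic Besov space `B^p_α(μ)` (whose norm also depends on `λ`):
for `ω(j) ≤ α`, `f_j ∈ L^p(μ)` and
`∬ |Δ_j(t,s)|^p d(s,t)^{-(p(α - ω(j)) - λ)} μ[t,s]^{-2} dμ(t) dμ(s) < ∞`, where
`μ[t,s] = μ(B(t, d(t,s)))`. The integrand vanishes for `t = s ∈ E`, as `Δ_j(t,t) = 0`. -/
def MemBesov {m : ℕ} (e : Cn m → Fin (m + 1) → Cn m) (p α lam : ℝ) (μ : Measure (Cn m))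
    (f : Jet m) : Prop :=
  ∀ j : Fin (m + 1) → ℕ, weight j ≤ α →
    MemLp (f j) (ENNReal.ofReal p) μ ∧
    ∫⁻ x : Cn m × Cn m,
      ‖remainder e α f j x.1 x.2‖ₑ ^ p
        * ENNReal.ofReal (dist x.2 x.1 ^ (-(p * (α - weight j) - lam)))
        * ((μ (dBall x.1 (dist x.1 x.2))) ^ 2)⁻¹ ∂(μ.prod μ) < ⊤

/-! ### The extension operator -/

/-- `h_q(z) = ∫ (1 - z · w̄)^{-q} dμ(w)`, with the principal branch: `Re (1 - z · w̄) > 0` for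
`|z| < 1 = |w|`. -/
def hq {m : ℕ} (q : ℝ) (μ : Measure (Cn m)) (z : Cn m) : ℂ :=
  ∫ w, tau z w ^ (-(q : ℂ)) ∂μ

/-- `𝓔(f)(z) = h_q(z)⁻¹ ∫ T^α_y f(z) (1 - z · ȳ)^{-q} dμ(y)`. -/
def ext {m : ℕ} (e : Cn m → Fin (m + 1) → Cn m) (q α : ℝ) (μ : Measure (Cn m)) (f : Jet m)
    (z : Cn m) : ℂ :=
  (hq q μ z)⁻¹ * ∫ y, taylor e α f y z * tau z y ^ (-(q : ℂ)) ∂μ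

/-- The lower bound `|h_q(z)| ≥ C d(z, E)^{-q} μ(B_z)` in the unit ball, where
`B_z = B(z₀, 3 d(z, E))` and `z₀` is a point of `E` nearest to `z`. -/
def HasLowerBound {m : ℕ} (E : Set (Cn m)) (q : ℝ) (μ : Measure (Cn m)) : Prop :=
  ∃ C : ℝ, 0 < C ∧ ∀ z ∈ Metric.ball (0 : Cn m) 1, ∃ z₀ ∈ E, dist z z₀ = distSet z E ∧
    C * distSet z E ^ (-q) * μ.real (dBall z₀ (3 * distSet z E)) ≤ ‖hq q μ z‖

/-! ### Holomorphic Triebel–Lizorkin spaces and boundary values -/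

/-- `R¹ = I + N`, where `N F(z) = ∑ zₖ ∂F/∂zₖ(z)`. -/
def radial {m : ℕ} (F : Cn m → ℂ) (z : Cn m) : ℂ := F z + fderiv ℂ F z z

/-- `F ∈ HF^{p,r}_β(Bⁿ)`: `F` is holomorphic in the unit ball and
`∫_S (∫₀¹ (1 - t²)^{([β]+1-β) r - 1} |R^{[β]+1} F(tz)|^r dt)^{p/r} dσ(z) < ∞`
(used for `p, r > 0` and `β ≥ 0`). -/
def MemHF {m : ℕ} (p r β : ℝ) (F : Cn m → ℂ) : Prop :=
  DifferentiableOn ℂ F (Metric.ball 0 1) ∧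
  ∫⁻ z : Metric.sphere (0 : Cn m) 1,
    (∫⁻ t in Set.Ioo (0 : ℝ) 1,
      ENNReal.ofReal ((1 - t ^ 2) ^ (((⌊β⌋₊ : ℝ) + 1 - β) * r - 1))
        * ‖(radial^[⌊β⌋₊ + 1] F) ((t : ℂ) • (z : Cn m))‖ₑ ^ r) ^ (p / r)
    ∂(volume : Measure (Cn m)).toSphere < ⊤

/-- The part of the ball `B(ζ, δ)` inside the unit ball. -/
def innerBall {m : ℕ} (ζ : Cn m) (δ : ℝ) : Set (Cn m) := Metric.ball 0 1 ∩ dBall ζ δ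

/-- `G`, defined in the unit ball, takes the value `c` at the boundary point `ζ` as a limit of
volume averages over `B(ζ, δ)`, and `ζ` is a Lebesgue point for this value. -/
def HasMeanValue {m : ℕ} (G : Cn m → ℂ) (ζ : Cn m) (c : ℂ) : Prop :=
  (∀ᶠ δ in 𝓝[>] (0 : ℝ), IntegrableOn G (innerBall ζ δ)) ∧
  Tendsto (fun δ : ℝ => ⨍ z in innerBall ζ δ, G z) (𝓝[>] 0) (𝓝 c) ∧
  Tendsto (fun δ : ℝ => ⨍ z in innerBall ζ δ, ‖G z - c‖) (𝓝[>] 0) (𝓝 0)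

end

end NonIso

/-! Write ρ = d(z,E) and U = μ(B(z,6ρ)), and call s ∈ E near z when d(z,s) < 6ρ. The weights
h_q(z)⁻¹(1 − z·ȳ)^{-q} have total integral one, so 𝓔(f)(z) − T_s(z) is the integral of (T_y −
T_s)(z) against them (`ext_sub_taylor`). The polynomial T_y − T_s, expanded in the coordinates at s,
has the jet differences `jetDiff` as coefficients, up to factorials, and its monomial of index i is
O(ρ^ω(i)) at z. Together with the lower bound for h_q this gives the pointwise estimate by U⁻¹ ∑
ρ^ω(i) ∫ |jetDiff_i(y,s)| (ρ/d(z,y))^q dμ(y) (`exists_enorm_ext_sub_taylor_le`).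

The estimate remains true when z is displaced by a small multiple of √ρ in the complex-tangential
directions and of ρ in the normal one, because every 1 − z·ȳ then changes by a factor close to one
(`exists_perturbation`). Cauchy's estimates therefore turn it into bounds for derivatives: D^γ costs
ρ^{-ω(γ)} and R^k costs ρ^{-k}. Since s is arbitrary among the near points, the bounds may be
averaged over s, which produces `avgKernel`.

Integrals of p-th powers are handled by Jensen and Fubini. For a measure giving mass O(r^κ) to balls
of radius r about points of E, the integral of ρ^{λ-pα-κ} `avgKernel`^p is at most a constant times
∬ |jetDiff_i(y,s)|^p W(s,y), where W is the dyadic sum `kernelW` (`exists_lintegral_avgKernel_le`).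
If ω(i) < α, then W is dominated by the Besov kernel (`exists_kernelW_le`) and jetDiff_i is −Δ_i. If
ω(i) > α + (υ−λ)/p, then W is integrable in each variable separately, and f_j ∈ L^p suffices because
jetDiff_i is bounded by sums of |f_j|. Weights are half-integers, so the hypothesis on the interval
[α, α + (υ−λ)/p] excludes every other i (`kernelNorm_jetDiff_lt_top`).

For the Triebel–Lizorkin norm put k = [β]+1 and a = k − β. Hölder's inequality along rays, with a
small loss ε, reduces the norm to the integral above for the measure d(z,E)^{-η}(1−t)^{a-1} dt dσ(z)
with η = ε(p−1). This has dimension κ = n + a − η near E as soon as η + υ < n, which is possible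
since υ < n; and β = α + (n−λ)/p is the value for which the exponents match
(`lintegral_ray_avgKernel_lt_top`).

For the boundary values, D^γ𝓔(f)(z) − f_γ(ζ) is split into D^γ(𝓔(f) − T_s)(z), D^γ(T_s − T_ζ)(z) and
D^γT_ζ(z) − f_γ(ζ), the first two averaged over s near z. If H is one of the resulting bounds for
the first two, then ∫ d(z,ζ)^{-(n+1)} H^p dm is finite for almost every ζ; since B(ζ,δ) ∩ Bⁿ has
volume of order δ^{n+1}, the means of H vanish (`VanishingMean.of_lintegral`). The third term tends
to zero because the frame is continuous at ζ. -/

namespace NonIso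

/-! ### Holomorphic functions on finite-dimensional spaces: Cauchy estimates and parameter
integrals. -/

section HolomorphicCalculus

variable {X : Type*} [NormedAddCommGroup X] [NormedSpace ℂ X]

/-- Cauchy's estimate on each complex line through `x`, in the disc that reaches distance `ε / 2`;
this is the source of the factor 2. -/
theorem norm_fderiv_le_div_of_bound {F : X → ℂ} {x : X} {ε M : ℝ} (hε : 0 < ε)
    (hd : DifferentiableOn ℂ F (Metric.ball x ε)) (hb : ∀ y ∈ Metric.ball x ε, ‖F y‖ ≤ M) :
    ‖fderiv ℂ F x‖ ≤ 2 * M / ε := by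
  have hM : 0 ≤ M := (norm_nonneg _).trans (hb x (Metric.mem_ball_self hε))
  refine ContinuousLinearMap.opNorm_le_bound _ (by positivity) fun v => ?_
  rcases eq_or_ne v 0 with rfl | hv
  · simp
  have hv' : 0 < ‖v‖ := norm_pos_iff.2 hv
  set R : ℝ := ε / (2 * ‖v‖) with hR
  have hRpos : 0 < R := by positivity
  have hmem : ∀ ξ : ℂ, ‖ξ‖ ≤ R → x + ξ • v ∈ Metric.ball x ε := by
    intro ξ hξ
    rw [mem_ball_iff_norm, add_sub_cancel_left, norm_smul]
    calc ‖ξ‖ * ‖v‖ ≤ R * ‖v‖ := by gcongr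
      _ = ε / 2 := by rw [hR]; field_simp
      _ < ε := by linarith
  have hline : HasDerivAt (fun ξ : ℂ => x + ξ • v) v 0 := by
    simpa using ((hasDerivAt_id (0 : ℂ)).smul_const v).const_add x
  have hFx : HasFDerivAt F (fderiv ℂ F x) (x + (0 : ℂ) • v) := by
    simpa using (hd.differentiableAt (Metric.ball_mem_nhds x hε)).hasFDerivAt
  have hder : HasDerivAt (fun ξ : ℂ => F (x + ξ • v)) (fderiv ℂ F x v) 0 :=
    hFx.comp_hasDerivAt (0 : ℂ) hline
  have hdc : DiffContOnCl ℂ (fun ξ : ℂ => F (x + ξ • v)) (Metric.ball 0 R) := by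
    refine DifferentiableOn.diffContOnCl (fun ξ hξ => ?_)
    have hξ' : ‖ξ‖ ≤ R := by
      have := Metric.closure_ball_subset_closedBall hξ
      simpa using this
    have h1 := hd.differentiableAt (Metric.isOpen_ball.mem_nhds (hmem ξ hξ'))
    exact (h1.comp (f := fun ξ : ℂ => x + ξ • v) ξ (by fun_prop)).differentiableWithinAt
  have := Complex.norm_deriv_le_of_forall_mem_sphere_norm_le hRpos hdc (C := M) (fun ξ hξ =>
    hb _ (hmem ξ (by simpa using hξ.le)))
  rw [hder.deriv] at this
  calc ‖fderiv ℂ F x v‖ ≤ M / R := this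
    _ = 2 * M / ε * ‖v‖ := by rw [hR]; field_simp

variable [FiniteDimensional ℂ X]

theorem aestronglyMeasurable_clm_of_apply {α : Type*} [MeasurableSpace α] {μ : Measure α}
    {L : α → X →L[ℂ] ℂ} (h : ∀ v, AEStronglyMeasurable (fun a => L a v) μ) :
    AEStronglyMeasurable L μ := by
  let b := Module.finBasis ℂ X
  have : L = fun a => ∑ i, (L a (b i)) • (LinearMap.toContinuousLinearMap (b.coord i)) := by
    funext a
    ext v
    conv_lhs => rw [← b.sum_repr v, map_sum]
    simp [-Module.Basis.sum_repr, mul_comm]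
  rw [this]
  exact Finset.aestronglyMeasurable_fun_sum _ fun i _ => (h (b i)).smul_const _

/-- Only the family itself has to be dominated: holomorphy and Cauchy's estimate on balls of radius
`ε / 2` dominate its derivative. -/
theorem differentiableAt_integral_of_bound {α : Type*} [MeasurableSpace α] {μ : Measure α}
    {g : X → α → ℂ} {b : α → ℝ} {x₀ : X} {ε : ℝ} (hε : 0 < ε)
    (hm : ∀ x ∈ Metric.ball x₀ ε, AEStronglyMeasurable (g x) μ)
    (hd : ∀ᵐ a ∂μ, DifferentiableOn ℂ (fun x => g x a) (Metric.ball x₀ ε))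
    (hb : ∀ᵐ a ∂μ, ∀ x ∈ Metric.ball x₀ ε, ‖g x a‖ ≤ b a) (hbi : Integrable b μ) :
    DifferentiableAt ℂ (fun x => ∫ a, g x a ∂μ) x₀ := by
  have hx₀ : x₀ ∈ Metric.ball x₀ ε := Metric.mem_ball_self hε
  have hsub : ∀ x ∈ Metric.ball x₀ (ε / 2), Metric.ball x (ε / 2) ⊆ Metric.ball x₀ ε := by
    intro x hx
    refine Metric.ball_subset_ball' ?_
    rw [Metric.mem_ball] at hx
    linarith
  have key := hasFDerivAt_integral_of_dominated_of_fderiv_le (𝕜 := ℂ) (μ := μ) (F := g)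
    (F' := fun x a => fderiv ℂ (fun x => g x a) x) (x₀ := x₀) (bound := fun a => 2 * b a / (ε / 2))
    (Metric.ball_mem_nhds x₀ (half_pos hε)) ?_ ?_ ?_ ?_ ?_ ?_
  · exact key.differentiableAt
  · exact Filter.eventually_of_mem (Metric.ball_mem_nhds x₀ hε) hm
  · exact hbi.mono' (hm x₀ hx₀) (hb.mono fun a ha => ha x₀ hx₀)
  · refine aestronglyMeasurable_clm_of_apply fun v => ?_
    -- The derivative is a limit of difference quotients with steps `1 / (k + N + 1)`; the shift `N
    -- > ‖v‖ / ε` keeps all their base points in the ball.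
    obtain ⟨N, hN⟩ := exists_nat_gt (‖v‖ / ε)
    let c : ℕ → ℂ := fun k => ((k + N + 1 : ℕ) : ℂ)
    have hc : ∀ k, ‖c k‖ = (k : ℝ) + N + 1 := fun k => by
      simp only [c, Complex.norm_natCast]; push_cast; ring
    have hpos : ∀ k, 0 < ‖c k‖ := fun k => by rw [hc]; positivity
    have hmem : ∀ k, x₀ + (c k)⁻¹ • v ∈ Metric.ball x₀ ε := by
      intro k
      rw [mem_ball_iff_norm, add_sub_cancel_left, norm_smul, norm_inv, inv_mul_lt_iff₀ (hpos k), hc]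
      rw [div_lt_iff₀ hε] at hN
      have : (0 : ℝ) ≤ k := Nat.cast_nonneg k
      nlinarith
    refine aestronglyMeasurable_of_tendsto_ae atTop
      (f := fun k a => c k • (g (x₀ + (c k)⁻¹ • v) a - g x₀ a))
      (fun k => AEStronglyMeasurable.const_smul ((hm _ (hmem k)).sub (hm _ hx₀)) (c k)) ?_
    filter_upwards [hd] with a ha
    refine (ha.differentiableAt (Metric.ball_mem_nhds x₀ hε)).hasFDerivAt.lim v ?_
    simp_rw [hc]
    exact tendsto_atTop_add_const_right _ _
      (tendsto_atTop_add_const_right _ _ tendsto_natCast_atTop_atTop)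
  · filter_upwards [hd, hb] with a ha hba x hx
    exact norm_fderiv_le_div_of_bound (half_pos hε) (ha.mono (hsub x hx))
      fun y hy => hba y (hsub x hx hy)
  · exact (hbi.const_mul 2).div_const _
  · filter_upwards [hd] with a ha x hx
    exact (ha.differentiableAt (Metric.isOpen_ball.mem_nhds
      (Metric.ball_subset_ball (by linarith) hx))).hasFDerivAt

/-- Cauchy's formula writes the derivative along `v`, for all `x` near `x₀`, as an integral of `F (x
+ ξ • v)` over one fixed circle, and holomorphy in `x` passes under that integral. -/
theorem differentiableOn_fderiv_apply {F : X → ℂ} {U : Set X} (hU : IsOpen U)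
    (hF : DifferentiableOn ℂ F U) (v : X) :
    DifferentiableOn ℂ (fun x => fderiv ℂ F x v) U := by
  intro x₀ hx₀
  refine DifferentiableAt.differentiableWithinAt ?_
  obtain ⟨M, hM⟩ : ∃ M, ∀ᶠ x in 𝓝 x₀, ‖F x‖ ≤ M := by
    refine ⟨‖F x₀‖ + 1, ?_⟩
    have hc := ((hF.differentiableAt (hU.mem_nhds hx₀)).continuousAt).norm
    exact hc.eventually (eventually_le_nhds (by linarith))
  obtain ⟨ε, hε, hball⟩ := Metric.eventually_nhds_iff_ball.1 (hM.and (hU.eventually_mem hx₀))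
  -- The circle of radius `r` moves points by less than `ε / 2`; the `+ 1` covers `v = 0`.
  set r : ℝ := ε / (2 * (‖v‖ + 1)) with hr
  have hrpos : 0 < r := by positivity
  have hrv : r * ‖v‖ < ε / 2 := by
    have hv := norm_nonneg v
    rw [hr, div_mul_eq_mul_div, div_lt_div_iff₀ (by positivity) (by positivity)]
    nlinarith
  have hmem : ∀ x ∈ Metric.ball x₀ (ε / 2), ∀ ξ : ℂ, ‖ξ‖ ≤ r →
      x + ξ • v ∈ Metric.ball x₀ ε := by
    intro x hx ξ hξ
    rw [mem_ball_iff_norm] at hx ⊢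
    calc ‖x + ξ • v - x₀‖ = ‖(x - x₀) + ξ • v‖ := by congr 1; abel
      _ ≤ ‖x - x₀‖ + ‖ξ‖ * ‖v‖ := (norm_add_le _ _).trans (by rw [norm_smul])
      _ ≤ ‖x - x₀‖ + r * ‖v‖ := by gcongr
      _ < ε := by linarith
  have hmem' : ∀ x ∈ Metric.ball x₀ (ε / 2), ∀ θ : ℝ,
      x + circleMap 0 r θ • v ∈ Metric.ball x₀ ε := fun x hx θ =>
    hmem x hx _ (by simp [abs_of_pos hrpos])
  have hFd : ∀ x ∈ Metric.ball x₀ ε, DifferentiableAt ℂ F x := fun x hx =>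
    hF.differentiableAt (hU.mem_nhds (hball x hx).2)
  let g : X → ℝ → ℂ := fun x θ => deriv (circleMap 0 r) θ •
    (((circleMap 0 r θ - 0) ^ 2)⁻¹ • F (x + circleMap 0 r θ • v))
  have heq : ∀ x ∈ Metric.ball x₀ (ε / 2), fderiv ℂ F x v =
      (2 * Real.pi * Complex.I)⁻¹ • ∫ θ in Set.Ioc 0 (2 * Real.pi), g x θ := by
    intro x hx
    set O : Set ℂ := (fun ξ : ℂ => x + ξ • v) ⁻¹' Metric.ball x₀ ε
    have hO : IsOpen O := Metric.isOpen_ball.preimage (by fun_prop)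
    have hFO : DifferentiableOn ℂ (fun ξ : ℂ => F (x + ξ • v)) O := fun ξ hξ =>
      ((hFd _ hξ).comp (f := fun ξ : ℂ => x + ξ • v) ξ (by fun_prop)).differentiableWithinAt
    have h1 := Complex.cderiv_eq_deriv hO hFO hrpos (z := 0) (fun ξ hξ =>
      hmem x hx ξ (by simpa using hξ))
    have hline : HasDerivAt (fun ξ : ℂ => x + ξ • v) v 0 := by
      simpa using ((hasDerivAt_id (0 : ℂ)).smul_const v).const_add x
    have hFx : HasFDerivAt F (fderiv ℂ F x) (x + (0 : ℂ) • v) := by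
      simpa using (hFd x (Metric.ball_subset_ball (by linarith) hx)).hasFDerivAt
    have hder : HasDerivAt (fun ξ : ℂ => F (x + ξ • v)) (fderiv ℂ F x v) 0 :=
      hFx.comp_hasDerivAt (0 : ℂ) hline
    rw [← hder.deriv, ← h1, Complex.cderiv, circleIntegral,
      intervalIntegral.integral_of_le Real.two_pi_pos.le]
  have hdi : DifferentiableAt ℂ (fun x => ∫ θ in Set.Ioc 0 (2 * Real.pi), g x θ) x₀ := by
    have hcont : ∀ x ∈ Metric.ball x₀ (ε / 2), Continuous (g x) := by
      intro x hx
      have h1 : Continuous fun θ : ℝ => F (x + circleMap 0 r θ • v) := by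
        rw [continuous_iff_continuousAt]
        intro θ
        exact ((hFd _ (hmem' x hx θ)).continuousAt).comp
          (f := fun θ : ℝ => x + circleMap 0 r θ • v) (by fun_prop)
      have h2 : Continuous fun θ : ℝ => ((circleMap 0 r θ - 0) ^ 2)⁻¹ := by
        refine Continuous.inv₀ (by fun_prop) fun θ => ?_
        simp [circleMap, hrpos.ne']
      have h3 : Continuous fun θ : ℝ => deriv (circleMap 0 r) θ := by
        simp only [deriv_circleMap]
        fun_prop
      exact h3.smul (h2.smul h1)
    refine differentiableAt_integral_of_bound (half_pos hε) (b := fun _ => r * ((r ^ 2)⁻¹ * M))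
      (fun x hx => (hcont x hx).aestronglyMeasurable) (Eventually.of_forall fun θ => ?_)
      (Eventually.of_forall fun θ x hx => ?_) ?_
    · intro x hx
      have h1 : DifferentiableAt ℂ (fun x => F (x + circleMap 0 r θ • v)) x :=
        (hFd _ (hmem' x hx θ)).comp (f := fun x => x + circleMap 0 r θ • v) x (by fun_prop)
      exact ((h1.const_smul (((circleMap 0 r θ - 0) ^ 2)⁻¹ : ℂ)).const_smul
        (deriv (circleMap 0 r) θ : ℂ)).differentiableWithinAt
    · have := (hball _ (hmem' x hx θ)).1
      simp only [g, norm_smul, deriv_circleMap, norm_mul, norm_inv, norm_pow, sub_zero,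
        norm_circleMap_zero, Complex.norm_I, mul_one, abs_of_pos hrpos]
      gcongr
    · exact integrable_const _
  refine (hdi.const_smul ((2 * Real.pi * Complex.I)⁻¹ : ℂ)).congr_of_eventuallyEq ?_
  exact Filter.eventually_of_mem (Metric.ball_mem_nhds x₀ (half_pos hε)) heq

theorem contDiffOn_nat_of_differentiableOn {U : Set X} (hU : IsOpen U) (N : ℕ) :
    ∀ {F : X → ℂ}, DifferentiableOn ℂ F U → ContDiffOn ℂ N F U := by
  induction N with
  | zero => intro F hF; exact contDiffOn_zero.2 hF.continuousOn
  | succ N ih =>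
    intro F hF
    rw [Nat.cast_succ, contDiffOn_succ_iff_fderiv_of_isOpen hU]
    exact ⟨hF, by simp, contDiffOn_clm_apply.2 fun v =>
      ih (differentiableOn_fderiv_apply hU hF v)⟩

theorem differentiableOn_fderiv {F : X → ℂ} {U : Set X} (hU : IsOpen U)
    (hF : DifferentiableOn ℂ F U) : DifferentiableOn ℂ (fderiv ℂ F) U := by
  have := contDiffOn_nat_of_differentiableOn hU 2 hF
  have h2 := ((contDiffOn_succ_iff_fderiv_of_isOpen (n := 1) hU).1 (by exact_mod_cast this)).2.2
  exact h2.differentiableOn (by norm_num)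

end HolomorphicCalculus
-- Iterated directional derivatives, polydiscs and the radial operator.
section DirectionalDerivatives

variable {m : ℕ}

/-- The directions of `∂_{v 0}^{j 0} ⋯ ∂_{v m}^{j m}`, listed with multiplicity. -/
def steps (j : Fin (m + 1) → ℕ) : List (Fin (m + 1)) :=
  (List.finRange (m + 1)).flatMap fun k => List.replicate (j k) k

/-- Iterated complex directional derivatives along a list of directions. -/
noncomputable def listDeriv (v : Fin (m + 1) → Cn m) (l : List (Fin (m + 1))) (F : Cn m → ℂ) : Cn m → ℂ :=
  l.foldr (fun k G z => fderiv ℂ G z (v k)) F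

theorem listDeriv_cons (v : Fin (m + 1) → Cn m) (k : Fin (m + 1)) (l : List (Fin (m + 1)))
    (F : Cn m → ℂ) (z : Cn m) :
    listDeriv v (k :: l) F z = fderiv ℂ (listDeriv v l F) z (v k) := rfl

/-- Flattening the nested iterates into one list allows inductions that treat one derivative at a
time. -/
theorem dirDeriv_eq_listDeriv (v : Fin (m + 1) → Cn m) (j : Fin (m + 1) → ℕ) (F : Cn m → ℂ) :
    dirDeriv v j F = listDeriv v (steps j) F := by
  have hrep : ∀ (k : Fin (m + 1)) (N : ℕ) (G : Cn m → ℂ),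
      (fun (H : Cn m → ℂ) (z : Cn m) => fderiv ℂ H z (v k))^[N] G =
        (List.replicate N k).foldr (fun k G z => fderiv ℂ G z (v k)) G := by
    intro k N G
    induction N with
    | zero => rfl
    | succ N ih => rw [Function.iterate_succ_apply', ih, List.replicate_succ, List.foldr_cons]
  unfold dirDeriv listDeriv steps
  induction List.finRange (m + 1) with
  | nil => rfl
  | cons k l ih => rw [List.foldr_cons, List.flatMap_cons, List.foldr_append, ← ih, hrep]

theorem differentiableOn_listDeriv {U : Set (Cn m)} (hU : IsOpen U) {F : Cn m → ℂ}
    (hF : DifferentiableOn ℂ F U) (v : Fin (m + 1) → Cn m) (l : List (Fin (m + 1))) :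
    DifferentiableOn ℂ (listDeriv v l F) U := by
  induction l with
  | nil => exact hF
  | cons k l ih => exact differentiableOn_fderiv_apply hU ih (v k)

theorem listDeriv_eq_sum {U : Set (Cn m)} (hU : IsOpen U) {ι : Type*} (s : Finset ι) (c : ι → ℂ)
    {F : Cn m → ℂ} {G : ι → Cn m → ℂ} (hG : ∀ i ∈ s, DifferentiableOn ℂ (G i) U)
    (hF : ∀ z ∈ U, F z = ∑ i ∈ s, c i * G i z) (v : Fin (m + 1) → Cn m)
    (l : List (Fin (m + 1))) :
    ∀ z ∈ U, listDeriv v l F z = ∑ i ∈ s, c i * listDeriv v l (G i) z := by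
  induction l with
  | nil => exact hF
  | cons k l ih =>
    intro z hz
    have h1 : listDeriv v l F =ᶠ[𝓝 z] fun z => ∑ i ∈ s, c i * listDeriv v l (G i) z :=
      Filter.eventually_of_mem (hU.mem_nhds hz) ih
    have hd : ∀ i ∈ s, DifferentiableAt ℂ (listDeriv v l (G i)) z := fun i hi =>
      (differentiableOn_listDeriv hU (hG i hi) v l).differentiableAt (hU.mem_nhds hz)
    rw [listDeriv_cons, h1.fderiv_eq, fderiv_fun_sum fun i hi => (hd i hi).const_mul _]
    simp only [_root_.sum_apply]
    refine Finset.sum_congr rfl fun i hi => ?_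
    rw [fderiv_const_mul (hd i hi)]
    rfl

theorem dirDeriv_eq_sum {U : Set (Cn m)} (hU : IsOpen U) {ι : Type*} (s : Finset ι) (c : ι → ℂ)
    {F : Cn m → ℂ} {G : ι → Cn m → ℂ} (hG : ∀ i ∈ s, DifferentiableOn ℂ (G i) U)
    (hF : ∀ z ∈ U, F z = ∑ i ∈ s, c i * G i z) (v : Fin (m + 1) → Cn m)
    (j : Fin (m + 1) → ℕ) {z : Cn m} (hz : z ∈ U) :
    dirDeriv v j F z = ∑ i ∈ s, c i * dirDeriv v j (G i) z := by
  simp only [dirDeriv_eq_listDeriv]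
  exact listDeriv_eq_sum hU s c hG hF v (steps j) z hz

theorem dirDeriv_sub {U : Set (Cn m)} (hU : IsOpen U) {F G : Cn m → ℂ}
    (hF : DifferentiableOn ℂ F U) (hG : DifferentiableOn ℂ G U) (v : Fin (m + 1) → Cn m)
    (j : Fin (m + 1) → ℕ) {z : Cn m} (hz : z ∈ U) :
    dirDeriv v j (fun x => F x - G x) z = dirDeriv v j F z - dirDeriv v j G z := by
  have := dirDeriv_eq_sum hU (Finset.univ : Finset Bool) (fun b => cond b 1 (-1))
    (F := fun x => F x - G x) (G := fun b => cond b F G) (by rintro (_ | _) _ <;> assumption)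
    (fun z _ => by simp [sub_eq_add_neg]) v j hz
  simpa [sub_eq_add_neg] using this

/-- The closed polydisc with centre `z`, axes `v` and polyradius `r`. -/
def polydisc (v : Fin (m + 1) → Cn m) (z : Cn m) (r : Fin (m + 1) → ℝ) : Set (Cn m) :=
  {x | ∃ ξ : Fin (m + 1) → ℂ, (∀ k, ‖ξ k‖ ≤ r k) ∧ x = z + ∑ k, ξ k • v k}

/-- One-variable Cauchy estimates, one derivative at a time: each derivative costs a fraction `h` of
the polyradius. The parameter `t`, the size of the polydisc that remains, is what makes the
induction close. -/
theorem norm_listDeriv_le {U : Set (Cn m)} (hU : IsOpen U) {F : Cn m → ℂ}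
    (hF : DifferentiableOn ℂ F U) (v : Fin (m + 1) → Cn m) {z : Cn m} {r : Fin (m + 1) → ℝ}
    (hr : ∀ k, 0 < r k) {h M : ℝ} (hh : 0 < h) (l : List (Fin (m + 1))) :
    ∀ t : ℝ, polydisc v z (fun k => (t + l.length * h) * r k) ⊆ U →
    (∀ x ∈ polydisc v z (fun k => (t + l.length * h) * r k), ‖F x‖ ≤ M) →
    ∀ x ∈ polydisc v z (fun k => t * r k),
      ‖listDeriv v l F x‖ ≤ M * (l.map fun k => (h * r k)⁻¹).prod := by
  induction l with
  | nil => intro t _ hM x hx; simpa [listDeriv] using hM x (by simpa using hx)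
  | cons k l ih =>
    intro t hsub hM x hx
    have hlen : t + ((k :: l).length : ℝ) * h = (t + h) + l.length * h := by
      simp only [List.length_cons]; push_cast; ring
    rw [hlen] at hsub hM
    have hIH := ih (t + h) hsub hM
    set B := M * (l.map fun k => (h * r k)⁻¹).prod
    have hle : polydisc v z (fun k => (t + h) * r k) ⊆
        polydisc v z (fun k => ((t + h) + l.length * h) * r k) := by
      rintro y ⟨ξ, hξ, rfl⟩
      refine ⟨ξ, fun i => (hξ i).trans ?_, rfl⟩
      have := (hr i).le
      have : (0 : ℝ) ≤ l.length * h := by positivity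
      exact mul_le_mul_of_nonneg_right (by linarith) ‹_›
    have hR : 0 < h * r k := mul_pos hh (hr k)
    have hmem : ∀ ξ : ℂ, ‖ξ‖ ≤ h * r k →
        x + ξ • v k ∈ polydisc v z (fun k => (t + h) * r k) := by
      intro ξ hξ
      obtain ⟨η, hη, rfl⟩ := hx
      refine ⟨fun i => η i + if i = k then ξ else 0, fun i => ?_, ?_⟩
      · change _ ≤ (t + h) * r i
        rw [add_mul]
        refine (norm_add_le _ _).trans (add_le_add (hη i) ?_)
        split_ifs with hi
        · rw [hi]; exact hξ
        · rw [norm_zero]; exact (mul_pos hh (hr i)).le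
      · simp [add_smul, Finset.sum_add_distrib, add_assoc, ite_smul]
    have hG := differentiableOn_listDeriv hU hF v l
    have hxU : ∀ ξ : ℂ, ‖ξ‖ ≤ h * r k → x + ξ • v k ∈ U := fun ξ hξ => hsub (hle (hmem ξ hξ))
    have hline : HasDerivAt (fun ξ : ℂ => x + ξ • v k) (v k) 0 := by
      simpa using ((hasDerivAt_id (0 : ℂ)).smul_const (v k)).const_add x
    have hGx : HasFDerivAt (listDeriv v l F) (fderiv ℂ (listDeriv v l F) x)
        (x + (0 : ℂ) • v k) := by
      have : x ∈ U := by simpa using hxU 0 (by simpa using hR.le)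
      simpa using (hG.differentiableAt (hU.mem_nhds this)).hasFDerivAt
    have hder : HasDerivAt (fun ξ : ℂ => listDeriv v l F (x + ξ • v k))
        (fderiv ℂ (listDeriv v l F) x (v k)) 0 := hGx.comp_hasDerivAt (0 : ℂ) hline
    have hdc : DiffContOnCl ℂ (fun ξ : ℂ => listDeriv v l F (x + ξ • v k))
        (Metric.ball 0 (h * r k)) := by
      refine DifferentiableOn.diffContOnCl (fun ξ hξ => ?_)
      have hξ' : ‖ξ‖ ≤ h * r k := by
        have := Metric.closure_ball_subset_closedBall hξ
        simpa using this
      have h1 := hG.differentiableAt (hU.mem_nhds (hxU ξ hξ'))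
      exact (h1.comp (f := fun ξ : ℂ => x + ξ • v k) ξ (by fun_prop)).differentiableWithinAt
    have := Complex.norm_deriv_le_of_forall_mem_sphere_norm_le hR hdc (C := B) (fun ξ hξ =>
      hIH _ (hmem ξ (by simpa using hξ.le)))
    rw [hder.deriv] at this
    rw [listDeriv_cons, List.map_cons, List.prod_cons]
    refine this.trans_eq ?_
    rw [div_eq_mul_inv]; ring

/-- Cauchy's estimate in a polydisc. -/
theorem exists_norm_dirDeriv_le (j : Fin (m + 1) → ℕ) :
    ∃ C : ℝ, 0 < C ∧ ∀ {U : Set (Cn m)} {F : Cn m → ℂ} {v : Fin (m + 1) → Cn m} {z : Cn m}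
      {r : Fin (m + 1) → ℝ} {M : ℝ}, IsOpen U → DifferentiableOn ℂ F U → (∀ k, 0 < r k) →
      polydisc v z r ⊆ U → (∀ x ∈ polydisc v z r, ‖F x‖ ≤ M) →
      ‖dirDeriv v j F z‖ ≤ C * M * ∏ k, (r k)⁻¹ ^ j k := by
  set N : ℕ := (steps j).length
  -- The total loss `N * h` is at most one, and the `+ 1` keeps `h` positive when there are no
  -- derivatives.
  set h : ℝ := ((N : ℝ) + 1)⁻¹ with hh
  have hhpos : 0 < h := by positivity
  have hprod : ∀ g : Fin (m + 1) → ℝ, ((steps j).map g).prod = ∏ k, g k ^ j k := by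
    intro g
    have : ∀ l : List (Fin (m + 1)),
        ((l.flatMap fun k => List.replicate (j k) k).map g).prod =
          (l.map fun k => g k ^ j k).prod := by
      intro l
      induction l with
      | nil => rfl
      | cons k l ih => simp [List.flatMap_cons, ih]
    rw [steps, this, ← List.ofFn_eq_map, List.prod_ofFn]
  refine ⟨∏ k, h⁻¹ ^ j k, Finset.prod_pos fun k _ => by positivity, ?_⟩
  intro U F v z r M hU hF hr hsub hM
  have hle : polydisc v z (fun k => (0 + (steps j).length * h) * r k) ⊆ polydisc v z r := by
    rintro y ⟨ξ, hξ, rfl⟩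
    refine ⟨ξ, fun i => (hξ i).trans ?_, rfl⟩
    have h1 : 0 + ((steps j).length : ℝ) * h ≤ 1 := by
      rw [zero_add, hh, ← div_eq_mul_inv, div_le_one (by positivity)]
      simp [N]
    have := (hr i).le
    calc (0 + ((steps j).length : ℝ) * h) * r i ≤ 1 * r i := by gcongr
      _ = r i := one_mul _
  have := norm_listDeriv_le hU hF v hr hhpos (steps j) 0 (hle.trans hsub)
    (fun x hx => hM x (hle hx)) z ⟨0, by simp, by simp⟩
  rw [hprod] at this
  rw [dirDeriv_eq_listDeriv]
  refine this.trans_eq ?_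
  simp only [mul_inv, mul_pow, Finset.prod_mul_distrib]
  ring

/-- Directional derivatives of a holomorphic family along holomorphically varying directions
are jointly holomorphic. -/
theorem differentiableOn_dirDeriv_param {P : Type*} [NormedAddCommGroup P] [NormedSpace ℂ P]
    [FiniteDimensional ℂ P] {O : Set (P × Cn m)} (hO : IsOpen O) {G : P × Cn m → ℂ}
    (hG : DifferentiableOn ℂ G O) {V : P → Fin (m + 1) → Cn m} (hV : Differentiable ℂ V)
    (j : Fin (m + 1) → ℕ) :
    DifferentiableOn ℂ (fun x : P × Cn m => dirDeriv (V x.1) j (fun z => G (x.1, z)) x.2) O := by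
  simp only [dirDeriv_eq_listDeriv]
  induction steps j with
  | nil => exact hG
  | cons k l ih =>
    -- The derivative in `z` is the full derivative of the joint function in the direction `(0, V
    -- x.1 k)`, so the parameter stays fixed although the direction depends on it.
    have heq : ∀ x ∈ O, listDeriv (V x.1) (k :: l) (fun z => G (x.1, z)) x.2 =
        fderiv ℂ (fun x : P × Cn m => listDeriv (V x.1) l (fun z => G (x.1, z)) x.2) x
          (0, V x.1 k) := by
      intro x hx
      have h1 := (ih.differentiableAt (hO.mem_nhds hx)).hasFDerivAt
      have h2 : HasFDerivAt (fun z : Cn m => (x.1, z)) (ContinuousLinearMap.inr ℂ P (Cn m)) x.2 :=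
        hasFDerivAt_prodMk_right x.1 x.2
      have h3 : HasFDerivAt (fun z : Cn m => listDeriv (V x.1) l (fun z => G (x.1, z)) z) _ x.2 :=
        HasFDerivAt.comp x.2 (f := fun z : Cn m => (x.1, z)) h1 h2
      rw [listDeriv_cons]
      erw [h3.fderiv]
      rfl
    refine DifferentiableOn.congr ?_ heq
    refine (differentiableOn_fderiv hO ih).clm_apply ?_
    have hVk : Differentiable ℂ fun p => V p k := differentiable_pi.1 hV k
    have : Differentiable ℂ fun x : P × Cn m => ((0 : P), V x.1 k) :=
      (differentiable_const 0).prodMk (hVk.comp differentiable_fst)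
    exact this.differentiableOn

/-- The iterates of `I + N` are the derivatives of `ξ ↦ e^ξ F(e^ξ z)` at the origin. -/
theorem iterate_radial_eq_iteratedDeriv {U : Set (Cn m)} (hU : IsOpen U) (k : ℕ) :
    ∀ {F : Cn m → ℂ}, DifferentiableOn ℂ F U → DifferentiableOn ℂ (radial^[k] F) U ∧
      ∀ z ∈ U, (radial^[k] F) z =
        iteratedDeriv k (fun ξ : ℂ => Complex.exp ξ * F (Complex.exp ξ • z)) 0 := by
  have hrad : ∀ {F : Cn m → ℂ}, DifferentiableOn ℂ F U → DifferentiableOn ℂ (radial F) U :=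
    fun hF => hF.add ((differentiableOn_fderiv hU hF).clm_apply differentiableOn_id)
  induction k with
  | zero => intro F hF; exact ⟨hF, fun z _ => by simp⟩
  | succ k ih =>
    intro F hF
    rw [Function.iterate_succ_apply]
    refine ⟨(ih (hrad hF)).1, fun z hz => ?_⟩
    rw [(ih (hrad hF)).2 z hz, iteratedDeriv_succ']
    refine Filter.EventuallyEq.iteratedDeriv_eq k ?_
    have hcont : ContinuousAt (fun ξ : ℂ => Complex.exp ξ • z) 0 := by fun_prop
    have hev : ∀ᶠ ξ : ℂ in 𝓝 0, Complex.exp ξ • z ∈ U :=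
      hcont.eventually_mem (hU.mem_nhds (by simpa using hz))
    filter_upwards [hev] with ξ hξ
    -- By the chain rule the derivative of `e^ξ F(e^ξ z)` is `e^ξ (radial F)(e^ξ z)`, the same
    -- expression with `radial F` for `F`.
    have h1 : HasDerivAt (fun ξ : ℂ => Complex.exp ξ • z) (Complex.exp ξ • z) ξ :=
      (Complex.hasDerivAt_exp ξ).smul_const z
    have h2 := ((hF.differentiableAt (hU.mem_nhds hξ)).hasFDerivAt).comp_hasDerivAt ξ h1
    have h3 := (Complex.hasDerivAt_exp ξ).mul h2
    have h4 : deriv (fun ξ : ℂ => Complex.exp ξ * F (Complex.exp ξ • z)) ξ = _ := h3.deriv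
    rw [h4]
    simp only [radial, Function.comp_apply]
    ring

end DirectionalDerivatives
-- The pseudo-distance on the closed ball, distance to a set, and frames.
section Geometry

variable {m : ℕ}

theorem dist_nonneg (a b : Cn m) : 0 ≤ dist a b := norm_nonneg _

theorem dist_comm (a b : Cn m) : dist a b = dist b a := by
  unfold dist tau
  rw [← inner_conj_symm a b, ← RCLike.norm_conj (1 - inner ℂ b a)]
  simp

theorem continuous_tau_comp {α : Type*} [TopologicalSpace α] {f g : α → Cn m} (hf : Continuous f)
    (hg : Continuous g) : Continuous fun a => tau (f a) (g a) := by
  unfold tau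
  exact continuous_const.sub (hg.inner hf)

theorem continuous_dist_comp {α : Type*} [TopologicalSpace α] {f g : α → Cn m}
    (hf : Continuous f) (hg : Continuous g) : Continuous fun a => dist (f a) (g a) := by
  unfold dist
  exact (continuous_tau_comp hf hg).norm

theorem measurable_tau {α : Type*} [MeasurableSpace α] {f g : α → Cn m} (hf : Measurable f)
    (hg : Measurable g) : Measurable fun a => tau (f a) (g a) := by
  unfold tau
  exact measurable_const.sub (hg.inner hf)

theorem measurable_dist {α : Type*} [MeasurableSpace α] {f g : α → Cn m} (hf : Measurable f)
    (hg : Measurable g) : Measurable fun a => dist (f a) (g a) := by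
  unfold dist
  exact (measurable_tau hf hg).norm

theorem tau_add (z v y : Cn m) : tau (z + v) y = tau z y - inner ℂ y v := by
  unfold tau; rw [inner_add_right]; ring

theorem norm_inner_le_one {a b : Cn m} (ha : ‖a‖ ≤ 1) (hb : ‖b‖ ≤ 1) : ‖inner ℂ a b‖ ≤ 1 :=
  (norm_inner_le_norm a b).trans (mul_le_one₀ ha (norm_nonneg _) hb)

theorem dist_le_two {a b : Cn m} (ha : ‖a‖ ≤ 1) (hb : ‖b‖ ≤ 1) : dist a b ≤ 2 := by
  unfold dist tau
  refine (norm_sub_le _ _).trans ?_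
  have := norm_inner_le_one hb ha
  rw [norm_one]; linarith

theorem one_sub_norm_le_re_tau (z : Cn m) {w : Cn m} (hw : ‖w‖ ≤ 1) :
    1 - ‖z‖ ≤ (tau z w).re := by
  unfold tau
  have h1 : (inner ℂ w z).re ≤ ‖z‖ := by
    refine (Complex.re_le_norm _).trans ((norm_inner_le_norm _ _).trans ?_)
    exact mul_le_of_le_one_left (norm_nonneg _) hw
  simp only [Complex.sub_re, Complex.one_re]; linarith

theorem one_sub_norm_le_dist (z : Cn m) {w : Cn m} (hw : ‖w‖ ≤ 1) : 1 - ‖z‖ ≤ dist z w :=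
  (one_sub_norm_le_re_tau z hw).trans (Complex.re_le_norm _)

theorem re_tau_pos {z w : Cn m} (hz : ‖z‖ < 1) (hw : ‖w‖ ≤ 1) : 0 < (tau z w).re :=
  (sub_pos.2 hz).trans_le (one_sub_norm_le_re_tau z hw)

/-- Since `|a|, |b| ≤ 1`, expanding the square leaves at most `2 Re (1 - a · b̄)`. Tangential
displacements are thus only controlled by the square root of the pseudo-distance. -/
theorem norm_sub_sq_le {a b : Cn m} (ha : ‖a‖ ≤ 1) (hb : ‖b‖ ≤ 1) :
    ‖a - b‖ ^ 2 ≤ 2 * dist a b := by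
  have h1 := norm_sub_sq (𝕜 := ℂ) a b
  have h2 : (tau a b).re ≤ dist a b := Complex.re_le_norm _
  have h3 : (tau a b).re = 1 - RCLike.re (inner ℂ a b) := by
    rw [inner_re_symm]; simp [tau]
  have h4 : ‖a‖ ^ 2 ≤ 1 := pow_le_one₀ (norm_nonneg _) ha
  have h5 : ‖b‖ ^ 2 ≤ 1 := pow_le_one₀ (norm_nonneg _) hb
  rw [h1]; linarith

theorem norm_sub_le_sqrt {a b : Cn m} (ha : ‖a‖ ≤ 1) (hb : ‖b‖ ≤ 1) :
    ‖a - b‖ ≤ Real.sqrt (2 * dist a b) :=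
  Real.le_sqrt_of_sq_le (norm_sub_sq_le ha hb)

/-- In the exact identity for `1 - a · c̄` the two error terms are `1 - |b|²`, at most the sum of
the two distances, and an inner product of increments, bounded by the same sum through
`norm_sub_sq_le`. Hence the constant 3. -/
theorem dist_triangle {a b c : Cn m} (ha : ‖a‖ ≤ 1) (hb : ‖b‖ ≤ 1) (hc : ‖c‖ ≤ 1) :
    dist a c ≤ 3 * (dist a b + dist b c) := by
  have key : tau a c = tau a b + tau b c - (1 - (‖b‖ : ℂ) ^ 2) - inner ℂ (c - b) (a - b) := by
    unfold tau
    simp only [inner_sub_left, inner_sub_right]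
    rw [inner_self_eq_norm_sq_to_K]
    simp only [Complex.coe_algebraMap]
    ring
  have h1 := norm_sub_sq_le ha hb
  have h2 := norm_sub_sq_le hb hc
  have h3 : ‖inner ℂ (c - b) (a - b)‖ ≤ ‖b - c‖ * ‖a - b‖ := by
    rw [norm_sub_rev b c]; exact norm_inner_le_norm _ _
  have h4 : ‖(1 - (‖b‖ : ℂ) ^ 2)‖ ≤ dist a b + dist b c := by
    have : (1 - (‖b‖ : ℂ) ^ 2) = ((1 - ‖b‖ ^ 2 : ℝ) : ℂ) := by push_cast; ring
    rw [this, Complex.norm_real, Real.norm_of_nonneg (by nlinarith [norm_nonneg b])]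
    have h := one_sub_norm_le_dist b ha
    have h' := one_sub_norm_le_dist b hc
    rw [dist_comm] at h
    nlinarith [norm_nonneg b]
  have h5 : dist a c ≤ dist a b + dist b c + (dist a b + dist b c) + ‖b - c‖ * ‖a - b‖ := by
    unfold dist at *
    rw [key]
    refine (norm_sub_le _ _).trans (add_le_add ((norm_sub_le _ _).trans
      (add_le_add (norm_add_le _ _) h4)) h3)
  have h6 := dist_nonneg b c
  nlinarith [sq_nonneg (‖b - c‖ - ‖a - b‖), dist_nonneg a b]

theorem dist_eq_zero_imp {a b : Cn m} (ha : ‖a‖ ≤ 1) (hb : ‖b‖ ≤ 1) (h : dist a b = 0) : a = b := by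
  have := norm_sub_sq_le ha hb
  rw [h, mul_zero] at this
  have h0 : ‖a - b‖ = 0 := by nlinarith [norm_nonneg (a - b)]
  exact sub_eq_zero.1 (norm_eq_zero.1 h0)

theorem dist_self_of_norm_one {a : Cn m} (ha : ‖a‖ = 1) : dist a a = 0 := by
  unfold dist tau
  rw [inner_self_eq_norm_sq_to_K, ha]
  simp

theorem isOpen_dBall (x : Cn m) (R : ℝ) : IsOpen (dBall x R) :=
  isOpen_lt (continuous_dist_comp continuous_const continuous_id) continuous_const

theorem measurableSet_dBall (x : Cn m) (R : ℝ) : MeasurableSet (dBall x R) :=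
  (isOpen_dBall x R).measurableSet

theorem dBall_mono (x : Cn m) {R R' : ℝ} (h : R ≤ R') : dBall x R ⊆ dBall x R' :=
  fun _ hy => lt_of_lt_of_le hy h

/-- The change in `1 - z · w̄` is `(1 - t) z · w̄`, and `1 - t` is itself at most the distance from
`t z` to `w`. -/
theorem dist_smul_right_le {t : ℝ} (ht0 : 0 ≤ t) (ht1 : t ≤ 1) {z w : Cn m} (hz : ‖z‖ ≤ 1)
    (hw : ‖w‖ ≤ 1) : dist ((t : ℂ) • z) w ≤ dist z w + (1 - t) ∧
      dist z w ≤ 2 * dist ((t : ℂ) • z) w := by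
  have hi := norm_inner_le_one hw hz
  have h1 : tau ((t : ℂ) • z) w = tau z w + ((1 - t : ℝ) : ℂ) * inner ℂ w z := by
    unfold tau; rw [inner_smul_right]; push_cast; ring
  have h2 : ‖((1 - t : ℝ) : ℂ) * inner ℂ w z‖ ≤ 1 - t := by
    rw [norm_mul, Complex.norm_real, Real.norm_of_nonneg (by linarith)]
    exact mul_le_of_le_one_right (by linarith) hi
  constructor
  · unfold dist
    rw [h1]
    exact (norm_add_le _ _).trans (by linarith)
  · have h3 : 1 - t ≤ dist ((t : ℂ) • z) w := by
      refine le_trans ?_ (one_sub_norm_le_dist ((t : ℂ) • z) hw)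
      rw [norm_smul, Complex.norm_real, Real.norm_of_nonneg ht0]
      nlinarith [norm_nonneg z]
    have h4 : tau z w = tau ((t : ℂ) • z) w - ((1 - t : ℝ) : ℂ) * inner ℂ w z := by rw [h1]; ring
    have h5 : dist z w ≤ dist ((t : ℂ) • z) w + (1 - t) := by
      unfold dist
      rw [h4]
      exact (norm_sub_le _ _).trans (by linarith)
    linarith

/-! ### Distance to a set -/

theorem distSet_le {E : Set (Cn m)} (z : Cn m) {w : Cn m} (hw : w ∈ E) : distSet z E ≤ dist z w :=
  ciInf_le (f := fun w : E => dist z w) ⟨0, by rintro _ ⟨w, rfl⟩; exact dist_nonneg _ _⟩ ⟨w, hw⟩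

theorem le_distSet {E : Set (Cn m)} (hE : E.Nonempty) {z : Cn m} {c : ℝ}
    (h : ∀ w ∈ E, c ≤ dist z w) : c ≤ distSet z E := by
  have := hE.to_subtype
  exact le_ciInf fun w => h w w.2

theorem distSet_nonneg (E : Set (Cn m)) (z : Cn m) : 0 ≤ distSet z E :=
  Real.iInf_nonneg fun _ => dist_nonneg _ _

theorem distSet_lt_iff {E : Set (Cn m)} (hE : E.Nonempty) {z : Cn m} {c : ℝ} :
    distSet z E < c ↔ ∃ w ∈ E, dist z w < c := by
  constructor
  · intro h
    by_contra! h'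
    exact absurd (le_distSet hE h') (not_le.2 h)
  · rintro ⟨w, hw, h⟩
    exact (distSet_le z hw).trans_lt h

theorem measurable_distSet {E : Set (Cn m)} (hE : E.Nonempty) :
    Measurable fun z => distSet z E := by
  refine measurable_of_Iio fun c => ?_
  have : (fun z => distSet z E) ⁻¹' Set.Iio c = ⋃ w ∈ E, {z | dist z w < c} := by
    ext z
    simp only [Set.mem_preimage, Set.mem_Iio, Set.mem_iUnion, Set.mem_ofPred_eq,
      distSet_lt_iff hE, exists_prop]
  rw [this]
  refine (isOpen_biUnion fun w _ => ?_).measurableSet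
  exact isOpen_lt (continuous_dist_comp continuous_id continuous_const) continuous_const

theorem one_sub_norm_le_distSet {E : Set (Cn m)} (hE : E.Nonempty) (hS : E ⊆ Metric.sphere 0 1)
    (z : Cn m) : 1 - ‖z‖ ≤ distSet z E :=
  le_distSet hE fun _ hw => one_sub_norm_le_dist z (mem_sphere_zero_iff_norm.1 (hS hw)).le

theorem distSet_pos {E : Set (Cn m)} (hE : E.Nonempty) (hS : E ⊆ Metric.sphere 0 1) {z : Cn m}
    (hz : ‖z‖ < 1) : 0 < distSet z E :=
  (sub_pos.2 hz).trans_le (one_sub_norm_le_distSet hE hS z)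

theorem distSet_le_two {E : Set (Cn m)} (hE : E.Nonempty) (hS : E ⊆ Metric.sphere 0 1) {z : Cn m}
    (hz : ‖z‖ ≤ 1) : distSet z E ≤ 2 := by
  obtain ⟨w, hw⟩ := hE
  exact (distSet_le z hw).trans (dist_le_two hz (mem_sphere_zero_iff_norm.1 (hS hw)).le)

/-! ### Frames -/

section Frame

variable {e : Cn m → Fin (m + 1) → Cn m}

theorem IsFrame.norm_eq_one (he : IsFrame e) {z : Cn m} (hz : z ≠ 0) (k : Fin (m + 1)) :
    ‖e z k‖ = 1 := (he.orthonormal z hz).1 k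

theorem IsFrame.last_eq (he : IsFrame e) {z : Cn m} (hz : ‖z‖ = 1) : e z (Fin.last m) = z := by
  rw [he.normal z (by rintro rfl; simp at hz), hz]; simp

theorem IsFrame.inner_castSucc (he : IsFrame e) {z : Cn m} (hz : z ≠ 0) (k : Fin m) :
    inner ℂ (e z k.castSucc) z = 0 := by
  have h1 : inner ℂ (e z k.castSucc) (e z (Fin.last m)) = 0 :=
    (he.orthonormal z hz).2 (Fin.castSucc_lt_last k).ne
  rw [he.normal z hz, inner_smul_right] at h1
  refine (mul_eq_zero.1 h1).resolve_left ?_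
  simpa using hz

/-- A tangential vector at `z` is orthogonal to `z`, so its product with `y` only sees `y - z`. This
gain is what permits tangential displacements of size `√ρ`. -/
theorem IsFrame.norm_inner_castSucc_le (he : IsFrame e) {z y : Cn m} (hz : z ≠ 0) (hz1 : ‖z‖ ≤ 1)
    (hy : ‖y‖ ≤ 1) (k : Fin m) :
    ‖inner ℂ y (e z k.castSucc)‖ ≤ Real.sqrt (2 * dist z y) := by
  have h0 : inner ℂ z (e z k.castSucc) = 0 := by
    rw [← inner_conj_symm, he.inner_castSucc hz k, map_zero]
  have h1 : inner ℂ y (e z k.castSucc) = inner ℂ (y - z) (e z k.castSucc) := by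
    rw [inner_sub_left, h0, sub_zero]
  rw [h1]
  refine (norm_inner_le_norm _ _).trans ?_
  rw [he.norm_eq_one hz, mul_one, norm_sub_rev]
  exact norm_sub_le_sqrt hz1 hy

theorem IsFrame.norm_coord_last (he : IsFrame e) {z s : Cn m} (hs : ‖s‖ = 1) :
    ‖coord e z s (Fin.last m)‖ = dist z s := by
  unfold coord dist tau
  rw [he.last_eq hs, inner_sub_right, inner_self_eq_norm_sq_to_K, hs, norm_sub_rev]
  simp

theorem IsFrame.norm_coord_le (he : IsFrame e) {s : Cn m} (hs : s ≠ 0) (z : Cn m)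
    (k : Fin (m + 1)) : ‖coord e z s k‖ ≤ ‖z - s‖ := by
  unfold coord
  refine (norm_inner_le_norm _ _).trans ?_
  rw [he.norm_eq_one hs, one_mul]

/-- The orthonormal basis given by a frame. -/
noncomputable def IsFrame.basis (he : IsFrame e) {z : Cn m} (hz : z ≠ 0) :
    OrthonormalBasis (Fin (m + 1)) ℂ (Cn m) :=
  OrthonormalBasis.mk (he.orthonormal z hz) (by
    refine le_of_eq (Eq.symm ?_)
    exact (he.orthonormal z hz).linearIndependent.span_eq_top_of_card_eq_finrank (by simp))

theorem IsFrame.coe_basis (he : IsFrame e) {z : Cn m} (hz : z ≠ 0) : ⇑(he.basis hz) = e z :=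
  OrthonormalBasis.coe_mk _ _

theorem IsFrame.sum_coord (he : IsFrame e) {s : Cn m} (hs : s ≠ 0) (z : Cn m) :
    z = s + ∑ k, coord e z s k • e s k := by
  have := (he.basis hs).sum_repr' (z - s)
  rw [he.coe_basis] at this
  unfold coord
  rw [this]; abel

end Frame

end Geometry
-- Volumes of non-isotropic balls and surface measure of caps.
section Volume

variable {m : ℕ} {e : Cn m → Fin (m + 1) → Cn m}

/-- Passing to frame coordinates is a unitary map after a translation, so the box becomes a product
of discs; `c` combines the factors `π` with the ratio of two Haar measures. -/
theorem exists_volume_box (m : ℕ) : ∃ c : ENNReal, c ≠ 0 ∧ c ≠ ⊤ ∧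
    ∀ {e : Cn m → Fin (m + 1) → Cn m}, IsFrame e → ∀ {ζ : Cn m}, ζ ≠ 0 →
      ∀ (a : Fin (m + 1) → ℂ) (r : Fin (m + 1) → ℝ),
      volume {z : Cn m | ∀ k, ‖coord e z ζ k - a k‖ < r k} = c * ∏ k, ENNReal.ofReal (r k) ^ 2 := by
  let φ : Cn m ≃L[ℝ] (Fin (m + 1) → ℂ) :=
    PiLp.continuousLinearEquiv 2 ℝ (fun _ : Fin (m + 1) => ℂ)
  have hHaar : ((volume : Measure (Cn m)).map φ).IsAddHaarMeasure :=
    φ.isAddHaarMeasure_map volume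
  set ν := (volume : Measure (Cn m)).map φ
  have hν := Measure.isAddLeftInvariant_eq_smul ν (volume : Measure (Fin (m + 1) → ℂ))
  set c := Measure.addHaarScalarFactor ν (volume : Measure (Fin (m + 1) → ℂ))
  have hc : c ≠ 0 := (Measure.addHaarScalarFactor_pos_of_isAddHaarMeasure _ _).ne'
  refine ⟨c * ∏ _k : Fin (m + 1), (NNReal.pi : ENNReal), ?_, ?_, ?_⟩
  · refine mul_ne_zero (by simpa using hc) ?_
    rw [Finset.prod_const]
    exact pow_ne_zero _ (by simpa using NNReal.pi_pos.ne')
  · rw [Finset.prod_const]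
    exact ENNReal.mul_ne_top ENNReal.coe_ne_top (ENNReal.pow_ne_top ENNReal.coe_ne_top)
  intro e he ζ hζ a r
  let f : Cn m ≃ₗᵢ[ℝ] Cn m :=
    { (he.basis hζ).repr.toLinearEquiv.restrictScalars ℝ with
      norm_map' := (he.basis hζ).repr.norm_map }
  have hf := f.measurePreserving
  have hset : {z : Cn m | ∀ k, ‖coord e z ζ k - a k‖ < r k} =
      (fun z => z - ζ) ⁻¹' (f ⁻¹' (φ ⁻¹' (Set.univ.pi fun k => Metric.ball (a k) (r k)))) := by
    ext z
    simp only [Set.mem_ofPred_eq, Set.mem_preimage, Set.mem_pi, Set.mem_univ, forall_true_left,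
      mem_ball_iff_norm]
    refine forall_congr' fun k => ?_
    have : φ (f (z - ζ)) k = coord e z ζ k := by
      change (he.basis hζ).repr (z - ζ) k = _
      rw [OrthonormalBasis.repr_apply_apply, he.coe_basis]
      rfl
    rw [this]
  have hms : MeasurableSet (Set.univ.pi fun k => Metric.ball (a k) (r k)) :=
    MeasurableSet.univ_pi fun k => measurableSet_ball
  have hms' := f.continuous.measurable (φ.continuous.measurable hms)
  rw [hset, (measurePreserving_sub_right volume ζ).measure_preimage hms'.nullMeasurableSet,
    hf.measure_preimage (φ.continuous.measurable hms).nullMeasurableSet,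
    ← Measure.map_apply φ.continuous.measurable hms]
  change ν _ = _
  rw [hν, Measure.smul_apply, volume_pi, Measure.pi_pi]
  simp only [Complex.volume_ball, Finset.prod_mul_distrib]
  change (c : ENNReal) * _ = _
  ring

theorem prod_last_castSucc (r b : ENNReal) (h : Fin (m + 1) → ENNReal) (h1 : h (Fin.last m) = b)
    (h2 : ∀ k : Fin m, h k.castSucc = r) : ∏ k, h k = r ^ m * b := by
  rw [Fin.prod_univ_castSucc, h1]
  simp [h2]

/-- The ball lies in a box of radius `r` in the normal coordinate and `2√r` in the `m` tangential
ones, of volume a constant times `r² r^m`. The exponent `m + 2` is `n + 1`. -/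
theorem exists_volume_innerBall_le (he : IsFrame e) : ∃ C : ℝ, 0 < C ∧ ∀ ζ : Cn m, ‖ζ‖ = 1 →
    ∀ r : ℝ, 0 < r → volume (innerBall ζ r) ≤ ENNReal.ofReal (C * r ^ (m + 2)) := by
  obtain ⟨c, hc0, hct, hbox⟩ := exists_volume_box m
  refine ⟨c.toReal * 4 ^ m, by have := ENNReal.toReal_pos hc0 hct; positivity, ?_⟩
  intro ζ hζ r hr
  have hζ0 : ζ ≠ 0 := by rintro rfl; simp at hζ
  let ρ : Fin (m + 1) → ℝ := Fin.lastCases r (fun _ => Real.sqrt (4 * r))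
  have hsub : innerBall ζ r ⊆ {z : Cn m | ∀ k, ‖coord e z ζ k - 0‖ < ρ k} := by
    rintro z ⟨hz, hzr⟩ k
    rw [sub_zero]
    have hzr' : dist z ζ < r := by rw [dist_comm]; exact hzr
    rw [mem_ball_zero_iff] at hz
    induction k using Fin.lastCases with
    | last => simpa [ρ, he.norm_coord_last hζ] using hzr'
    | cast k =>
      simp only [ρ, Fin.lastCases_castSucc]
      refine (he.norm_coord_le hζ0 z _).trans_lt ((norm_sub_le_sqrt hz.le hζ.le).trans_lt ?_)
      exact Real.sqrt_lt_sqrt (by have := dist_nonneg z ζ; positivity) (by linarith)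
  refine (measure_mono hsub).trans ?_
  rw [hbox he hζ0 (fun _ => 0) ρ, prod_last_castSucc (ENNReal.ofReal (4 * r)) (ENNReal.ofReal (r ^ 2))]
  · rw [← ENNReal.ofReal_toReal hct, ← ENNReal.ofReal_pow (by positivity),
      ← ENNReal.ofReal_mul (by positivity), ← ENNReal.ofReal_mul (by positivity)]
    refine ENNReal.ofReal_le_ofReal (le_of_eq ?_)
    rw [ENNReal.toReal_ofReal ENNReal.toReal_nonneg]
    ring
  · simp only [ρ, Fin.lastCases_last]
    rw [ENNReal.ofReal_pow hr.le]
  · intro k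
    simp only [ρ, Fin.lastCases_castSucc]
    rw [← ENNReal.ofReal_pow (by positivity), Real.sq_sqrt (by positivity)]

theorem exists_le_volume_innerBall (he : IsFrame e) : ∃ C : ℝ, 0 < C ∧ ∀ ζ : Cn m, ‖ζ‖ = 1 →
    ∀ r : ℝ, 0 < r → r ≤ 2 → ENNReal.ofReal (C * r ^ (m + 2)) ≤ volume (innerBall ζ r) := by
  obtain ⟨c, hc0, hct, hbox⟩ := exists_volume_box m
  -- A box centred at normal depth `r / 2` is inscribed. Its normal coordinate satisfies `|1 + w| ≤
  -- 1 - r / 4`, and `b` makes the tangential squares add up to at most `r / 4`, which keeps the box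
  -- inside the unit ball.
  set b : ℝ := (4 * ((m : ℝ) + 1))⁻¹ with hb
  have hbpos : 0 < b := by positivity
  refine ⟨c.toReal * b ^ m * (1 / 16), by have := ENNReal.toReal_pos hc0 hct; positivity, ?_⟩
  intro ζ hζ r hr hr2
  have hζ0 : ζ ≠ 0 := by rintro rfl; simp at hζ
  let ρ : Fin (m + 1) → ℝ := Fin.lastCases (r / 4) (fun _ => Real.sqrt (b * r))
  let a : Fin (m + 1) → ℂ := Fin.lastCases (-((r / 2 : ℝ) : ℂ)) (fun _ => 0)
  have hsub : {z : Cn m | ∀ k, ‖coord e z ζ k - a k‖ < ρ k} ⊆ innerBall ζ r := by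
    intro z hz
    have hl := hz (Fin.last m)
    simp only [a, ρ, Fin.lastCases_last] at hl
    have hk : ∀ k : Fin m, ‖coord e z ζ k.castSucc‖ ^ 2 ≤ b * r := by
      intro k
      have := hz k.castSucc
      simp only [a, ρ, Fin.lastCases_castSucc, sub_zero] at this
      rw [← Real.sq_sqrt (by positivity : 0 ≤ b * r)]
      gcongr
    set w := coord e z ζ (Fin.last m)
    constructor
    · rw [mem_ball_zero_iff]
      have hw1 : ‖1 + w‖ ≤ 1 - r / 4 := by
        have : 1 + w = ((1 - r / 2 : ℝ) : ℂ) + (w - -((r / 2 : ℝ) : ℂ)) := by push_cast; ring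
        rw [this]
        refine (norm_add_le _ _).trans ?_
        rw [Complex.norm_real, Real.norm_of_nonneg (by linarith)]
        linarith
      have hnorm : ‖z‖ ^ 2 = ‖1 + w‖ ^ 2 + ∑ k : Fin m, ‖coord e z ζ k.castSucc‖ ^ 2 := by
        rw [← (he.basis hζ0).repr.norm_map z, EuclideanSpace.norm_sq_eq, Fin.sum_univ_castSucc,
          add_comm]
        have hrep : ∀ k, (he.basis hζ0).repr z k = inner ℂ (e ζ k) z := fun k => by
          rw [OrthonormalBasis.repr_apply_apply, he.coe_basis]
        congr 1
        · rw [hrep]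
          congr 2
          simp only [w, coord]
          rw [inner_sub_right, he.last_eq hζ, inner_self_eq_norm_sq_to_K, hζ]
          simp
        · refine Finset.sum_congr rfl fun k _ => ?_
          rw [hrep, coord, inner_sub_right, he.inner_castSucc hζ0, sub_zero]
      have hsum : ∑ k : Fin m, ‖coord e z ζ k.castSucc‖ ^ 2 ≤ r / 4 := by
        refine (Finset.sum_le_sum fun k _ => hk k).trans ?_
        rw [Finset.sum_const, Finset.card_univ, Fintype.card_fin, nsmul_eq_mul, hb, inv_mul_eq_div,
          mul_div_assoc', div_le_div_iff₀ (by positivity) (by norm_num)]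
        nlinarith
      have h0 := norm_nonneg (1 + w)
      have : ‖z‖ ^ 2 < 1 := by rw [hnorm]; nlinarith
      nlinarith [norm_nonneg z]
    · change dist ζ z < r
      rw [dist_comm, ← he.norm_coord_last hζ]
      have : w = (w - -((r / 2 : ℝ) : ℂ)) - ((r / 2 : ℝ) : ℂ) := by ring
      change ‖w‖ < r
      rw [this]
      refine (norm_sub_le _ _).trans_lt ?_
      rw [Complex.norm_real, Real.norm_of_nonneg (by linarith)]
      linarith
  refine le_trans ?_ (measure_mono hsub)
  rw [hbox he hζ0 a ρ, prod_last_castSucc (ENNReal.ofReal (b * r)) (ENNReal.ofReal ((r / 4) ^ 2))]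
  · rw [← ENNReal.ofReal_toReal hct, ← ENNReal.ofReal_pow (by positivity),
      ← ENNReal.ofReal_mul (by positivity), ← ENNReal.ofReal_mul (by positivity)]
    refine ENNReal.ofReal_le_ofReal (le_of_eq ?_)
    rw [ENNReal.toReal_ofReal ENNReal.toReal_nonneg]
    ring
  · simp only [ρ, Fin.lastCases_last]
    rw [ENNReal.ofReal_pow (by positivity)]
  · intro k
    simp only [ρ, Fin.lastCases_castSucc]
    rw [← ENNReal.ofReal_pow (by positivity), Real.sq_sqrt (by positivity)]

-- Surface measure is computed from the volume of the cone `K` over the cap. What `K` has outside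
-- `(1 - r) K` lies in `B(ζ, 2r)`, so the volume of `K` times `r` is `O(r^(n+1))`. For `r ≥ 1` the
-- total mass of the sphere suffices.
open scoped Pointwise in
theorem exists_toSphere_dBall_le (he : IsFrame e) : ∃ C : ℝ, 0 < C ∧ ∀ ζ : Cn m, ‖ζ‖ = 1 →
    ∀ r : ℝ, 0 < r → (volume : Measure (Cn m)).toSphere {z | dist (z : Cn m) ζ < r} ≤
      ENNReal.ofReal (C * r ^ (m + 1)) := by
  obtain ⟨C, hC, hvol⟩ := exists_volume_innerBall_le he
  set D : ℕ := Module.finrank ℝ (Cn m) with hD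
  have hDpos : 0 < D := Module.finrank_pos
  set M : ℝ := ((volume : Measure (Cn m)).toSphere Set.univ).toReal
  have hM0 : 0 ≤ M := ENNReal.toReal_nonneg
  refine ⟨M + D * (C * 2 ^ (m + 2)), by positivity, ?_⟩
  intro ζ hζ r hr
  rcases le_or_gt 1 r with h1 | h1
  · refine (measure_mono (Set.subset_univ _)).trans ?_
    rw [← ENNReal.ofReal_toReal (measure_ne_top _ Set.univ)]
    refine ENNReal.ofReal_le_ofReal ?_
    have h2 : (1 : ℝ) ≤ r ^ (m + 1) := one_le_pow₀ h1
    have h3 : 0 ≤ (D : ℝ) * (C * 2 ^ (m + 2)) := by positivity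
    change M ≤ _
    nlinarith
  set A : Set (Metric.sphere (0 : Cn m) 1) := {z | dist (z : Cn m) ζ < r}
  have hA : MeasurableSet A :=
    (isOpen_lt (continuous_dist_comp continuous_subtype_val continuous_const)
      continuous_const).measurableSet
  rw [Measure.toSphere_apply' _ hA, ← hD]
  set K : Set (Cn m) := Set.Ioo (0 : ℝ) 1 • ((↑) '' A : Set (Cn m))
  have hKsub : K ⊆ Metric.ball 0 1 := by
    rintro _ ⟨t, ht, _, ⟨z, hz, rfl⟩, rfl⟩
    rw [mem_ball_zero_iff]
    simp only [norm_smul, Real.norm_of_nonneg ht.1.le, norm_eq_of_mem_sphere, mul_one]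
    exact ht.2
  have hKfin : volume K ≠ ⊤ := ne_top_of_le_ne_top measure_ball_lt_top.ne (measure_mono hKsub)
  have hcover : K ⊆ ((1 - r) • K) ∪ innerBall ζ (2 * r) := by
    rintro _ ⟨t, ht, _, ⟨z, hz, rfl⟩, rfl⟩
    rcases lt_or_ge t (1 - r) with h | h
    · left
      refine ⟨(t / (1 - r)) • (z : Cn m), ⟨t / (1 - r), ⟨div_pos ht.1 (by linarith), ?_⟩, z,
        ⟨z, hz, rfl⟩, rfl⟩, ?_⟩
      · rw [div_lt_one (by linarith)]; exact h
      · simp only [smul_smul]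
        congr 1
        field_simp
    · right
      refine ⟨hKsub ⟨t, ht, _, ⟨z, hz, rfl⟩, rfl⟩, ?_⟩
      change dist ζ (t • (z : Cn m)) < 2 * r
      rw [dist_comm]
      have := (dist_smul_right_le ht.1.le ht.2.le (norm_eq_of_mem_sphere z).le hζ.le).1
      rw [Complex.coe_smul] at this
      have hz' : dist (z : Cn m) ζ < r := hz
      linarith
  have h2 : volume K ≤ ENNReal.ofReal ((1 - r) ^ D) * volume K +
      ENNReal.ofReal (C * (2 * r) ^ (m + 2)) := by
    refine (measure_mono hcover).trans ((measure_union_le _ _).trans ?_)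
    refine add_le_add ?_ (hvol ζ hζ (2 * r) (by positivity))
    rw [Measure.addHaar_smul, abs_of_nonneg (pow_nonneg (by linarith) _)]
  set x : ℝ := (volume K).toReal
  have hx0 : 0 ≤ x := ENNReal.toReal_nonneg
  have hx : volume K = ENNReal.ofReal x := (ENNReal.ofReal_toReal hKfin).symm
  rw [hx, ← ENNReal.ofReal_mul (pow_nonneg (by linarith) _), ← ENNReal.ofReal_add
    (mul_nonneg (pow_nonneg (by linarith) _) hx0) (by positivity),
    ENNReal.ofReal_le_ofReal_iff (by
      have := pow_nonneg (by linarith : (0:ℝ) ≤ 1 - r) D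
      positivity)] at h2
  have h3 : (1 - r) ^ D ≤ 1 - r := pow_le_of_le_one (by linarith) (by linarith) hDpos.ne'
  have h4 : x * r ≤ C * (2 * r) ^ (m + 2) := by nlinarith
  have h5 : x ≤ C * 2 ^ (m + 2) * r ^ (m + 1) := by
    have : x * r ≤ (C * 2 ^ (m + 2) * r ^ (m + 1)) * r := h4.trans_eq (by ring)
    exact le_of_mul_le_mul_right this hr
  rw [hx, ← ENNReal.ofReal_natCast, ← ENNReal.ofReal_mul (by positivity)]
  refine ENNReal.ofReal_le_ofReal ?_
  have h6 : 0 ≤ M * r ^ (m + 1) := by positivity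
  calc (D : ℝ) * x ≤ D * (C * 2 ^ (m + 2) * r ^ (m + 1)) := by gcongr
    _ ≤ _ := by nlinarith

end Volume
-- Upper and lower growth of the measure at all relevant scales.
section GrowthConditions

variable {m : ℕ}

/-- Growth conditions on a measure carried by a closed subset of the sphere: the estimates defining
`U_υ` and `L_λ`, extended to all radii in question and with one constant `A`. -/
structure Growth (E : Set (Cn m)) (μ : Measure (Cn m)) (υ lam A : ℝ) : Prop where
  closed : IsClosed E
  sub : E ⊆ Metric.sphere 0 1
  nonempty : E.Nonempty
  prob : IsProbabilityMeasure μ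
  null : μ Eᶜ = 0
  one_le : 1 ≤ A
  nonneg : 0 ≤ υ
  lam_le : lam ≤ υ
  pos : ∀ x ∈ E, ∀ R : ℝ, 0 < R → 0 < μ.real (dBall x R)
  upper : ∀ x ∈ E, ∀ R R' : ℝ, 0 < R → R ≤ R' →
    μ.real (dBall x R') ≤ A * (R' / R) ^ υ * μ.real (dBall x R)
  lower : ∀ x ∈ E, ∀ R R' : ℝ, 0 < R → R ≤ R' → R' ≤ 2 →
    μ.real (dBall x R) * R' ^ lam ≤ A * μ.real (dBall x R') * R ^ lam

/-- The defining inequalities concern radii at most one; total mass one and a uniform lower bound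
for `μ(B(x,1))` carry them further. Comparing them at one point as `k → ∞` also forces `0 ≤ υ` and
`lam ≤ υ`. -/
theorem MemU.exists_growth {E : Set (Cn m)} {μ : Measure (Cn m)} {υ lam : ℝ} (hE : IsClosed E)
    (hS : E ⊆ Metric.sphere 0 1) (hU : MemU E υ μ) (hL : MemL E lam μ) :
    ∃ A, Growth E μ υ lam A := by
  have hprob := hU.prob
  have hnorm : ∀ x ∈ E, ‖x‖ = 1 := fun x hx => mem_sphere_zero_iff_norm.1 (hS hx)
  have hne : E.Nonempty := by
    rw [Set.nonempty_iff_ne_empty]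
    rintro rfl
    have := hU.compl_null
    simp at this
  have hcpt : IsCompact E := (isCompact_sphere (0 : Cn m) 1).of_isClosed_subset hE hS
  obtain ⟨C₁, hC₁⟩ := hU.growth
  obtain ⟨C₂, hC₂pos, hC₂⟩ := hL.growth
  have hpos : ∀ x ∈ E, ∀ R : ℝ, 0 < R → 0 < μ.real (dBall x R) := fun x hx R hR =>
    ENNReal.toReal_pos (hU.ball_pos x hx R hR).ne' (measure_ne_top _ _)
  have hmono : ∀ x : Cn m, ∀ {R R' : ℝ}, R ≤ R' → μ.real (dBall x R) ≤ μ.real (dBall x R') :=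
    fun x R R' h => measureReal_mono (dBall_mono x h)
  have hle1 : ∀ s : Set (Cn m), μ.real s ≤ 1 := fun s => measureReal_le_one
  have hup : ∀ x ∈ E, ∀ R R' : ℝ, 0 < R → R < R' → R' ≤ 1 →
      μ.real (dBall x R') ≤ C₁ * (R' / R) ^ υ * μ.real (dBall x R) := by
    intro x hx R R' hR hRR' h1
    have h2 : R' / R * R = R' := div_mul_cancel₀ _ hR.ne'
    have := hC₁ x hx R (R' / R) hR (by rwa [h2]) (by rwa [h2])
    rwa [h2] at this
  have hlo : ∀ x ∈ E, ∀ R R' : ℝ, 0 < R → R < R' → R' ≤ 1 →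
      C₂ * (R' / R) ^ lam * μ.real (dBall x R) ≤ μ.real (dBall x R') := by
    intro x hx R R' hR hRR' h1
    have h2 : R' / R * R = R' := div_mul_cancel₀ _ hR.ne'
    have := hC₂ x hx R (R' / R) hR (by rwa [h2]) (by rwa [h2])
    rwa [h2] at this
  obtain ⟨x₀, hx₀⟩ := hne
  have hk : ∀ k : ℝ, 1 < k → 1 ≤ C₁ * k ^ υ ∧ C₂ * k ^ lam ≤ C₁ * k ^ υ := by
    intro k hk
    have hk0 : 0 < k := by linarith
    have hk1 : 1 / k < 1 := by rw [div_lt_one hk0]; exact hk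
    have hV := hpos x₀ hx₀ (1 / k) (by positivity)
    have h1 := hup x₀ hx₀ (1 / k) 1 (by positivity) hk1 le_rfl
    have h2 := hlo x₀ hx₀ (1 / k) 1 (by positivity) hk1 le_rfl
    have h3 := hmono x₀ hk1.le
    rw [one_div_one_div] at h1 h2
    constructor
    · refine le_of_mul_le_mul_right ?_ hV
      linarith
    · exact le_of_mul_le_mul_right (h2.trans h1) hV
  have hC₁pos : 0 < C₁ := by
    have h := (hk 2 (by norm_num)).1
    have h2 : (0 : ℝ) < 2 ^ υ := by positivity
    by_contra hneg
    nlinarith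
  have hυ : 0 ≤ υ := by
    by_contra hneg
    have ht := (tendsto_rpow_neg_atTop (y := -υ) (by linarith)).const_mul C₁
    rw [neg_neg, mul_zero] at ht
    obtain ⟨k, hk1, hk2⟩ := ((ht.eventually_lt_const one_pos).and
      (eventually_gt_atTop (1 : ℝ))).exists
    linarith [(hk k hk2).1]
  have hlam : lam ≤ υ := by
    by_contra! hneg
    have ht := (tendsto_rpow_neg_atTop (y := lam - υ) (by linarith)).const_mul C₁
    rw [mul_zero] at ht
    obtain ⟨k, hk1, hk2⟩ := ((ht.eventually_lt_const hC₂pos).and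
      (eventually_gt_atTop (1 : ℝ))).exists
    have hk0 : 0 < k := by linarith
    have h1 := (hk k hk2).2
    have h2 : k ^ (-(lam - υ)) * k ^ lam = k ^ υ := by
      rw [← Real.rpow_add hk0]; congr 1; ring
    have h3 : 0 < k ^ lam := Real.rpow_pos_of_pos hk0 _
    nlinarith
  -- Near `x` one has `μ(B(x',1)) ≥ μ(B(x,1/6))`, since `3 (1/6 + 1/6) = 1`; compactness of `E`
  -- makes the bound uniform.
  obtain ⟨c₀, hc₀, hc₀V⟩ : ∃ c : ℝ, 0 < c ∧ ∀ x ∈ E, c ≤ μ.real (dBall x 1) := by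
    refine hcpt.induction_on (p := fun s => ∃ c : ℝ, 0 < c ∧ ∀ x ∈ s ∩ E, c ≤ μ.real (dBall x 1))
      ⟨1, one_pos, by simp⟩ (fun s t hst ⟨c, hc, h⟩ => ⟨c, hc, fun x hx => h x ⟨hst hx.1, hx.2⟩⟩)
      (fun s t ⟨c, hc, h⟩ ⟨c', hc', h'⟩ => ⟨min c c', lt_min hc hc', ?_⟩) (fun x hx => ?_)
      |>.imp fun c hc => ⟨hc.1, fun x hx => hc.2 x ⟨hx, hx⟩⟩
    · rintro x ⟨hx | hx, hxE⟩
      · exact (min_le_left _ _).trans (h x ⟨hx, hxE⟩)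
      · exact (min_le_right _ _).trans (h' x ⟨hx, hxE⟩)
    · refine ⟨dBall x (1 / 6), mem_nhdsWithin_of_mem_nhds ((isOpen_dBall _ _).mem_nhds ?_),
        μ.real (dBall x (1 / 6)), hpos x hx _ (by norm_num), ?_⟩
      · change dist x x < 1 / 6
        rw [dist_self_of_norm_one (hnorm x hx)]; norm_num
      · rintro x' ⟨hx', hx'E⟩
        refine ENNReal.toReal_mono (measure_ne_top _ _) ?_
        refine measure_mono_ae ?_
        have hae : ∀ᵐ y ∂μ, y ∈ E := by rw [ae_iff]; exact hU.compl_null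
        filter_upwards [hae] with y hyE hy
        have h1 : dist x x' < 1 / 6 := hx'
        have h2 : dist x y < 1 / 6 := hy
        have := dist_triangle (hnorm x' hx'E).le (hnorm x hx).le (hnorm y hyE).le
        rw [dist_comm x' x] at this
        change dist x' y < 1
        linarith
  -- For radii between 1 and 2 both `R^lam` and its inverse are at most `D`.
  set D : ℝ := 2 ^ |lam|
  have hD1 : 1 ≤ D := Real.one_le_rpow (by norm_num) (abs_nonneg _)
  have hDb : ∀ R : ℝ, 1 ≤ R → R ≤ 2 → R ^ lam ≤ D ∧ 1 ≤ D * R ^ lam := by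
    intro R h1 h2
    have h0 : 0 < R := by linarith
    have h3 : R ^ |lam| ≤ D := Real.rpow_le_rpow h0.le h2 (abs_nonneg _)
    refine ⟨(Real.rpow_le_rpow_of_exponent_le h1 (le_abs_self _)).trans h3, ?_⟩
    have h4 : R ^ (-|lam|) ≤ R ^ lam := Real.rpow_le_rpow_of_exponent_le h1 (neg_abs_le _)
    have h5 : R ^ |lam| * R ^ (-|lam|) = 1 := by
      rw [← Real.rpow_add h0, add_neg_cancel, Real.rpow_zero]
    have h6 : 0 < R ^ (-|lam|) := Real.rpow_pos_of_pos h0 _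
    nlinarith
  have hc₀i : 0 < c₀⁻¹ := inv_pos.2 hc₀
  set A : ℝ := 1 + C₁ + c₀⁻¹ + c₀⁻¹ * C₁ + C₂⁻¹ + D * C₂⁻¹ + D * D
  have hC₂i : 0 < C₂⁻¹ := inv_pos.2 hC₂pos
  have hp1 : 0 < c₀⁻¹ * C₁ := by positivity
  have hp2 : 0 < D * C₂⁻¹ := by positivity
  have hp3 : 0 < D * D := by positivity
  have hA1 : 1 ≤ A := by simp only [A]; linarith
  have hA2 : C₁ ≤ A := by simp only [A]; linarith
  have hA3 : c₀⁻¹ ≤ A := by simp only [A]; linarith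
  have hA4 : c₀⁻¹ * C₁ ≤ A := by simp only [A]; linarith
  have hA5 : C₂⁻¹ ≤ A := by simp only [A]; linarith
  have hA6 : D * C₂⁻¹ ≤ A := by simp only [A]; linarith
  have hA7 : D * D ≤ A := by simp only [A]; linarith
  have hone : ∀ x ∈ E, 1 ≤ c₀⁻¹ * μ.real (dBall x 1) := by
    intro x hx
    rw [inv_mul_eq_div, le_div_iff₀ hc₀, one_mul]
    exact hc₀V x hx
  refine ⟨A, hE, hS, ⟨x₀, hx₀⟩, hprob, hU.compl_null, hA1, hυ, hlam, hpos, ?_, ?_⟩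
  · intro x hx R R' hR hRR'
    have hV := hpos x hx R hR
    have hV0 := hV.le
    have hratio : 1 ≤ R' / R := by rwa [one_le_div hR]
    have hpw : 1 ≤ (R' / R) ^ υ := Real.one_le_rpow hratio hυ
    rcases hRR'.eq_or_lt with rfl | hlt
    · have : 1 * 1 * μ.real (dBall x R) ≤ A * (R / R) ^ υ * μ.real (dBall x R) := by gcongr
      linarith
    rcases le_or_gt R' 1 with h1 | h1
    · exact (hup x hx R R' hR hlt h1).trans (by gcongr)
    rcases lt_or_ge R 1 with h2 | h2
    · calc μ.real (dBall x R') ≤ 1 := hle1 _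
        _ ≤ c₀⁻¹ * μ.real (dBall x 1) := hone x hx
        _ ≤ c₀⁻¹ * (C₁ * (1 / R) ^ υ * μ.real (dBall x R)) := by
          gcongr; exact hup x hx R 1 hR h2 le_rfl
        _ = c₀⁻¹ * C₁ * (1 / R) ^ υ * μ.real (dBall x R) := by ring
        _ ≤ A * (R' / R) ^ υ * μ.real (dBall x R) := by gcongr
    · calc μ.real (dBall x R') ≤ 1 := hle1 _
        _ ≤ c₀⁻¹ * μ.real (dBall x 1) := hone x hx
        _ ≤ c₀⁻¹ * 1 * μ.real (dBall x R) := by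
          rw [mul_one]
          exact mul_le_mul_of_nonneg_left (hmono x h2) hc₀i.le
        _ ≤ A * (R' / R) ^ υ * μ.real (dBall x R) := by gcongr
  · intro x hx R R' hR hRR' hR2
    have hV := hpos x hx R hR
    have hV' := hpos x hx R' (hR.trans_le hRR')
    have hRl : 0 < R ^ lam := Real.rpow_pos_of_pos hR _
    have hR0' : 0 < R' := hR.trans_le hRR'
    have hstep : ∀ T : ℝ, R < T → T ≤ 1 →
        μ.real (dBall x R) * T ^ lam ≤ C₂⁻¹ * μ.real (dBall x T) * R ^ lam := by
      intro T hT hT1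
      have := hlo x hx R T hR hT hT1
      rw [Real.div_rpow (hR.trans hT).le hR.le] at this
      rw [mul_assoc C₂⁻¹, inv_mul_eq_div, le_div_iff₀ hC₂pos]
      calc μ.real (dBall x R) * T ^ lam * C₂
          = (C₂ * (T ^ lam / R ^ lam) * μ.real (dBall x R)) * R ^ lam := by field_simp
        _ ≤ μ.real (dBall x T) * R ^ lam := by gcongr
    rcases hRR'.eq_or_lt with rfl | hlt
    · have : 1 * μ.real (dBall x R) * R ^ lam ≤ A * μ.real (dBall x R) * R ^ lam := by gcongr
      linarith
    rcases le_or_gt R' 1 with h1 | h1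
    · exact (hstep R' hlt h1).trans (by gcongr)
    have hb' := hDb R' h1.le hR2
    rcases lt_or_ge R 1 with h2 | h2
    · have h3 := hstep 1 h2 le_rfl
      rw [Real.one_rpow, mul_one] at h3
      calc μ.real (dBall x R) * R' ^ lam
          ≤ (C₂⁻¹ * μ.real (dBall x 1) * R ^ lam) * D := by gcongr; exact hb'.1
        _ ≤ (C₂⁻¹ * μ.real (dBall x R') * R ^ lam) * D := by
          have := hmono x h1.le
          gcongr ?_ * D
          exact mul_le_mul_of_nonneg_right (mul_le_mul_of_nonneg_left this hC₂i.le) hRl.le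
        _ = (D * C₂⁻¹) * μ.real (dBall x R') * R ^ lam := by ring
        _ ≤ A * μ.real (dBall x R') * R ^ lam := by gcongr
    · have hb := hDb R h2 (hRR'.trans hR2)
      calc μ.real (dBall x R) * R' ^ lam ≤ μ.real (dBall x R') * D := by
            exact mul_le_mul (hmono x hRR') hb'.1 (by positivity) hV'.le
        _ ≤ μ.real (dBall x R') * D * (D * R ^ lam) := le_mul_of_one_le_right (by positivity) hb.2
        _ = (D * D) * μ.real (dBall x R') * R ^ lam := by ring
        _ ≤ A * μ.real (dBall x R') * R ^ lam := by gcongr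

namespace Growth

variable {E : Set (Cn m)} {μ : Measure (Cn m)} {υ lam A : ℝ}

theorem norm_eq (g : Growth E μ υ lam A) {x : Cn m} (hx : x ∈ E) : ‖x‖ = 1 :=
  mem_sphere_zero_iff_norm.1 (g.sub hx)

theorem ne_zero (g : Growth E μ υ lam A) {x : Cn m} (hx : x ∈ E) : x ≠ 0 := by
  rintro rfl; simpa using g.norm_eq hx

theorem ae_mem (g : Growth E μ υ lam A) : ∀ᵐ y ∂μ, y ∈ E := by rw [ae_iff]; exact g.null

theorem A_pos (g : Growth E μ υ lam A) : 0 < A := one_pos.trans_le g.one_le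

theorem isCompact (g : Growth E μ υ lam A) : IsCompact E :=
  (isCompact_sphere (0 : Cn m) 1).of_isClosed_subset g.closed g.sub

theorem real_mono (g : Growth E μ υ lam A) {S T : Set (Cn m)} (h : ∀ y ∈ E, y ∈ S → y ∈ T) :
    μ.real S ≤ μ.real T := by
  have := g.prob
  refine ENNReal.toReal_mono (measure_ne_top _ _) (measure_mono_ae ?_)
  filter_upwards [g.ae_mem] with y hyE hy using h y hyE hy

theorem real_le_one (g : Growth E μ υ lam A) (S : Set (Cn m)) : μ.real S ≤ 1 := by
  have := g.prob; exact measureReal_le_one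

/-- The ball of radius 3 contains all of `E` and so has mass one; the bound is the upper growth
between `r` and 3. -/
theorem rpow_le_real (g : Growth E μ υ lam A) {x : Cn m} (hx : x ∈ E) {r : ℝ} (hr : 0 < r)
    (hr3 : r ≤ 3) : r ^ υ ≤ A * 3 ^ υ * μ.real (dBall x r) := by
  have := g.prob
  have h1 := g.upper x hx r 3 hr hr3
  have h2 : 1 ≤ μ.real (dBall x 3) := by
    rw [← probReal_univ (μ := μ)]
    refine g.real_mono fun y hy _ => ?_
    change dist x y < 3
    linarith [dist_le_two (g.norm_eq hx).le (g.norm_eq hy).le]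
  rw [Real.div_rpow (by norm_num) hr.le] at h1
  have hr' : 0 < r ^ υ := Real.rpow_pos_of_pos hr _
  have h3 : r ^ υ * 1 ≤ r ^ υ * (A * (3 ^ υ / r ^ υ) * μ.real (dBall x r)) := by
    gcongr; linarith
  calc r ^ υ = r ^ υ * 1 := (mul_one _).symm
    _ ≤ _ := h3
    _ = _ := by field_simp

theorem real_le_rpow (g : Growth E μ υ lam A) {x : Cn m} (hx : x ∈ E) {r : ℝ} (hr : 0 < r)
    (hr2 : r ≤ 2) : μ.real (dBall x r) ≤ A * 2 ^ (-lam) * r ^ lam := by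
  have h1 := g.lower x hx r 2 hr hr2 le_rfl
  have h2 := g.real_le_one (dBall x 2)
  have hA := g.A_pos
  have h3 : (0 : ℝ) < 2 ^ lam := by positivity
  have h4 : 0 < r ^ lam := Real.rpow_pos_of_pos hr _
  rw [Real.rpow_neg (by norm_num), mul_assoc, mul_comm, mul_assoc, inv_mul_eq_div, le_div_iff₀ h3]
  calc μ.real (dBall x r) * 2 ^ lam ≤ A * μ.real (dBall x 2) * r ^ lam := h1
    _ ≤ A * 1 * r ^ lam := by gcongr
    _ = r ^ lam * A := by ring

/-- Balls of the same radius about different points. -/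
theorem real_le_of_dist_le (g : Growth E μ υ lam A) {x y : Cn m} (hx : x ∈ E) (hy : y ∈ E)
    {R D : ℝ} (hR : 0 < R) (hD : dist x y ≤ D) :
    μ.real (dBall x R) ≤ A * (3 * (R + D) / R) ^ υ * μ.real (dBall y R) := by
  have hD0 := (dist_nonneg x y).trans hD
  refine le_trans (g.real_mono fun w hw hxw => ?_) (g.upper y hy R (3 * (R + D)) hR (by linarith))
  have h1 : dist x w < R := hxw
  have := dist_triangle (g.norm_eq hy).le (g.norm_eq hx).le (g.norm_eq hw).le
  rw [dist_comm y x] at this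
  change dist y w < _
  linarith

/-- The measure of `B(z, 6 d(z, E))` compares with balls about nearby points of `E`. -/
theorem exists_near (g : Growth E μ υ lam A) {z : Cn m} (hz : ‖z‖ ≤ 1) (hρ : 0 < distSet z E) :
    ∃ w ∈ E, dist z w < 3 / 2 * distSet z E ∧
      μ.real (dBall w (distSet z E / 2)) ≤ μ.real (dBall z (6 * distSet z E)) := by
  -- A point of `E` that nearly attains the distance suffices. The constant `6 = 3 (3/2 + 1/2)` is
  -- what places the part of `B(w, ρ/2)` in `E` inside `B(z, 6ρ)`.
  obtain ⟨w, hw, hzw⟩ := (distSet_lt_iff g.nonempty (z := z)).1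
    (by linarith : distSet z E < 3 / 2 * distSet z E)
  refine ⟨w, hw, hzw, g.real_mono fun y hy hwy => ?_⟩
  have h1 : dist w y < distSet z E / 2 := hwy
  have := dist_triangle hz (g.norm_eq hw).le (g.norm_eq hy).le
  change dist z y < _
  linarith

theorem real_dBall_pos (g : Growth E μ υ lam A) {z : Cn m} (hz : ‖z‖ ≤ 1)
    (hρ : 0 < distSet z E) : 0 < μ.real (dBall z (6 * distSet z E)) := by
  obtain ⟨w, hw, -, h⟩ := g.exists_near hz hρ
  exact (g.pos w hw _ (by linarith)).trans_le h

theorem real_dBall_le (g : Growth E μ υ lam A) {z s : Cn m} (hz : ‖z‖ ≤ 1)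
    (hρ : 0 < distSet z E) (hs : s ∈ E) (hzs : dist z s < 6 * distSet z E) :
    μ.real (dBall z (6 * distSet z E)) ≤ A * 144 ^ υ * μ.real (dBall s (distSet z E)) := by
  have hA := g.A_pos
  have h1 := g.upper s hs (distSet z E) (36 * distSet z E) hρ (by linarith)
  rw [mul_div_assoc, div_self hρ.ne', mul_one] at h1
  calc μ.real (dBall z (6 * distSet z E)) ≤ μ.real (dBall s (36 * distSet z E)) := by
        refine g.real_mono fun y hy hzy => ?_
        have h1 : dist z y < 6 * distSet z E := hzy
        have := dist_triangle (g.norm_eq hs).le hz (g.norm_eq hy).le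
        rw [dist_comm s z] at this
        change dist s y < _
        linarith
    _ ≤ A * 36 ^ υ * μ.real (dBall s (distSet z E)) := h1
    _ ≤ _ := by
      gcongr
      · exact g.nonneg
      · norm_num

theorem le_real_dBall (g : Growth E μ υ lam A) {z s : Cn m} (hz : ‖z‖ ≤ 1)
    (hρ : 0 < distSet z E) (hs : s ∈ E) (hzs : dist z s < 6 * distSet z E) :
    μ.real (dBall s (distSet z E)) ≤ A * 144 ^ υ * μ.real (dBall z (6 * distSet z E)) := by
  have hA := g.A_pos
  obtain ⟨w, hw, hzw, hle⟩ := g.exists_near hz hρ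
  -- Two uses of the quasi-triangle inequality give `d(w,y) < 3 (3 (3/2 + 6) + 1) ρ < 72 ρ`. The
  -- ratio of the radii, 144, serves as the constant in all these comparisons.
  have h1 := g.upper w hw (distSet z E / 2) (72 * distSet z E) (by linarith) (by linarith)
  have h2 : 72 * distSet z E / (distSet z E / 2) = 144 := by field_simp; norm_num
  rw [h2] at h1
  calc μ.real (dBall s (distSet z E)) ≤ μ.real (dBall w (72 * distSet z E)) := by
        refine g.real_mono fun y hy hsy => ?_
        have h1 : dist s y < distSet z E := hsy
        have h3 := dist_triangle (g.norm_eq hw).le hz (g.norm_eq hs).le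
        have h4 := dist_triangle (g.norm_eq hw).le (g.norm_eq hs).le (g.norm_eq hy).le
        rw [dist_comm w z] at h3
        change dist w y < _
        linarith
    _ ≤ _ := h1
    _ ≤ _ := by gcongr

/-- Growth about a point `z` outside `E`: at scales above `d(z,E)` the measure grows as it does
about a nearby point of `E`. -/
theorem real_dBall_le_mul (g : Growth E μ υ lam A) {z : Cn m} (hz : ‖z‖ ≤ 1)
    (hρ : 0 < distSet z E) {r : ℝ} (hr : distSet z E ≤ r) :
    μ.real (dBall z r) ≤
      A * 144 ^ υ * (r / distSet z E) ^ υ * μ.real (dBall z (6 * distSet z E)) := by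
  have hA := g.A_pos
  have hr0 : 0 < r := hρ.trans_le hr
  obtain ⟨w, hw, hzw, hle⟩ := g.exists_near hz hρ
  have h1 := g.upper w hw (distSet z E / 2) (8 * r) (by linarith) (by linarith)
  calc μ.real (dBall z r) ≤ μ.real (dBall w (8 * r)) := by
        refine g.real_mono fun y hy hzy => ?_
        have h1 : dist z y < r := hzy
        have h3 := dist_triangle (g.norm_eq hw).le hz (g.norm_eq hy).le
        rw [dist_comm w z] at h3
        change dist w y < _
        linarith
    _ ≤ A * (8 * r / (distSet z E / 2)) ^ υ * μ.real (dBall w (distSet z E / 2)) := h1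
    _ ≤ A * (144 * (r / distSet z E)) ^ υ * μ.real (dBall z (6 * distSet z E)) := by
      gcongr
      · exact g.nonneg
      · have : 8 * r / (distSet z E / 2) = 16 * (r / distSet z E) := by field_simp; norm_num
        rw [this]
        gcongr
        norm_num
    _ = _ := by rw [Real.mul_rpow (by norm_num) (by positivity)]; ring

end Growth

end GrowthConditions
-- Dyadic radii and integrals over dyadic shells.
section Dyadic

/-- The dyadic radii `2, 1, 1/2, …`. -/
noncomputable def rad (l : ℕ) : ℝ := 2 * (1 / 2) ^ l

theorem rad_pos (l : ℕ) : 0 < rad l := by unfold rad; positivity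

theorem rad_succ (l : ℕ) : rad (l + 1) = rad l / 2 := by unfold rad; rw [pow_succ]; ring

theorem rad_le_two (l : ℕ) : rad l ≤ 2 := by
  unfold rad
  have : ((1 : ℝ) / 2) ^ l ≤ 1 := pow_le_one₀ (by norm_num) (by norm_num)
  linarith

theorem rad_add (k l : ℕ) : rad (k + l) = rad l * (1 / 2) ^ k := by unfold rad; rw [pow_add]; ring

theorem rad_antitone : Antitone rad := by
  refine antitone_nat_of_succ_le fun l => ?_
  rw [rad_succ]; linarith [rad_pos l]

theorem tendsto_rad : Tendsto rad atTop (𝓝 0) := by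
  have := (tendsto_pow_atTop_nhds_zero_of_lt_one (r := (1 / 2 : ℝ)) (by norm_num)
    (by norm_num)).const_mul 2
  rw [mul_zero] at this
  exact this

theorem exists_rad_le {d : ℝ} (hd : 0 < d) : ∃ l, rad l ≤ d :=
  ((tendsto_rad.eventually_lt_const hd).exists).imp fun _ h => h.le

theorem exists_rad_mem {x : ℝ} (h0 : 0 < x) (h2 : x ≤ 2) : ∃ l, rad (l + 1) < x ∧ x ≤ rad l := by
  classical
  have hex : ∃ l, rad (l + 1) < x :=
    ((tendsto_add_atTop_iff_nat 1).2 tendsto_rad |>.eventually_lt_const h0).exists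
  refine ⟨Nat.find hex, Nat.find_spec hex, ?_⟩
  rcases Nat.eq_zero_or_pos (Nat.find hex) with h | h
  · rw [h]; simpa [rad] using h2
  · obtain ⟨k, hk⟩ := Nat.exists_eq_succ_of_ne_zero h.ne'
    have := Nat.find_min hex (m := k) (by omega)
    rw [hk]; exact not_lt.1 this

theorem rad_add_rpow (k l : ℕ) (y : ℝ) : rad (k + l) ^ y = rad l ^ y * ((1 / 2) ^ y) ^ k := by
  rw [rad_add, Real.mul_rpow (rad_pos l).le (by positivity), ← Real.rpow_natCast, ← Real.rpow_natCast,
    ← Real.rpow_mul (by norm_num), ← Real.rpow_mul (by norm_num), mul_comm y]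

theorem half_rpow_lt_one {y : ℝ} (hy : 0 < y) : ((1 : ℝ) / 2) ^ y < 1 :=
  Real.rpow_lt_one (by norm_num) (by norm_num) hy

theorem tsum_geometric_half {y : ℝ} (hy : 0 < y) :
    ∑' k : ℕ, ENNReal.ofReal (((1 / 2 : ℝ) ^ y) ^ k) = ENNReal.ofReal (1 - (1 / 2) ^ y)⁻¹ := by
  have h0 : (0 : ℝ) ≤ (1 / 2) ^ y := by positivity
  rw [← ENNReal.ofReal_tsum_of_nonneg (fun k => by positivity)
    (summable_geometric_of_lt_one h0 (half_rpow_lt_one hy)),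
    tsum_geometric_of_lt_one h0 (half_rpow_lt_one hy)]

theorem tsum_rad_le {y : ℝ} (hy : 0 < y) {d : ℝ} (hd : 0 < d) :
    ∑' l : ℕ, (if rad l ≤ d then ENNReal.ofReal (rad l ^ y) else 0) ≤
      ENNReal.ofReal ((1 - (1 / 2) ^ y)⁻¹ * d ^ y) := by
  classical
  have hex := exists_rad_le hd
  set L := Nat.find hex
  have hL : rad L ≤ d := Nat.find_spec hex
  have hsupp : Function.support (fun l : ℕ => if rad l ≤ d then ENNReal.ofReal (rad l ^ y) else 0) ⊆
      Set.range fun k => k + L := by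
    intro l hl
    have h1 : rad l ≤ d := by
      by_contra h
      simp [h] at hl
    have : L ≤ l := Nat.find_min' hex h1
    exact ⟨l - L, by simp; omega⟩
  rw [← (add_left_injective L).tsum_eq hsupp]
  have hle : ∀ k : ℕ, (if rad (k + L) ≤ d then ENNReal.ofReal (rad (k + L) ^ y) else 0) ≤
      ENNReal.ofReal (d ^ y) * ENNReal.ofReal (((1 / 2 : ℝ) ^ y) ^ k) := by
    intro k
    rw [← ENNReal.ofReal_mul (by positivity)]
    split_ifs
    · refine ENNReal.ofReal_le_ofReal ?_
      rw [rad_add_rpow]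
      have := rad_pos L
      gcongr
    · exact zero_le
  refine (ENNReal.tsum_le_tsum hle).trans ?_
  rw [ENNReal.tsum_mul_left, tsum_geometric_half hy, ← ENNReal.ofReal_mul (by positivity), mul_comm]

theorem tsum_rad_ge {y : ℝ} (hy : 0 < y) {d : ℝ} (hd : 0 < d) :
    ∑' l : ℕ, (if d ≤ rad l then ENNReal.ofReal (rad l ^ (-y)) else 0) ≤
      ENNReal.ofReal ((1 - (1 / 2) ^ y)⁻¹ * d ^ (-y)) := by
  classical
  have hfin : ∃ L, ∀ l, d ≤ rad l → l ≤ L ∧ d ≤ rad L := by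
    by_cases h0 : ∃ l, d ≤ rad l
    · obtain ⟨M, hM⟩ := exists_rad_le (half_pos hd)
      have hb : ∀ l, d ≤ rad l → l ≤ M := by
        intro l hl
        by_contra! hlt
        have := rad_antitone hlt.le
        linarith
      have hP := Nat.findGreatest_spec (P := fun l => d ≤ rad l) (hb _ h0.choose_spec)
        h0.choose_spec
      exact ⟨Nat.findGreatest (fun l => d ≤ rad l) M, fun l hl =>
        ⟨Nat.le_findGreatest (hb l hl) hl, hP⟩⟩
    · push Not at h0
      exact ⟨0, fun l hl => absurd hl (not_le.2 (h0 l))⟩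
  obtain ⟨L, hL⟩ := hfin
  have hle : ∀ l : ℕ, (if d ≤ rad l then ENNReal.ofReal (rad l ^ (-y)) else 0) ≤
      if l ∈ Finset.range (L + 1) then
        ENNReal.ofReal (d ^ (-y)) * ENNReal.ofReal (((1 / 2 : ℝ) ^ y) ^ (L - l)) else 0 := by
    intro l
    split_ifs with h1 h2 h2
    · obtain ⟨hlL, hdL⟩ := hL l h1
      rw [← ENNReal.ofReal_mul (by positivity)]
      refine ENNReal.ofReal_le_ofReal ?_
      have h3 := rad_add_rpow (L - l) l y
      rw [Nat.sub_add_cancel hlL] at h3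
      rw [Real.rpow_neg (rad_pos l).le, Real.rpow_neg hd.le]
      have h4 : 0 < rad l ^ y := Real.rpow_pos_of_pos (rad_pos l) _
      have h5 : d ^ y ≤ rad L ^ y := Real.rpow_le_rpow hd.le hdL hy.le
      have h6 : 0 < d ^ y := Real.rpow_pos_of_pos hd _
      rw [inv_mul_eq_div, le_div_iff₀ h6, inv_mul_le_iff₀ h4, ← h3]
      exact h5
    · exact absurd (Finset.mem_range.2 (Nat.lt_succ_of_le (hL l h1).1)) h2
    · exact zero_le
    · exact zero_le
  refine (ENNReal.tsum_le_tsum hle).trans ?_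
  rw [tsum_eq_sum (s := Finset.range (L + 1)) (fun l hl => if_neg hl)]
  rw [Finset.sum_congr rfl fun l hl => if_pos hl, ← Finset.mul_sum,
    ← Finset.sum_range_reflect]
  have : ∑ j ∈ Finset.range (L + 1), ENNReal.ofReal (((1 / 2 : ℝ) ^ y) ^ (L - (L + 1 - 1 - j))) ≤
      ENNReal.ofReal (1 - (1 / 2) ^ y)⁻¹ := by
    rw [← tsum_geometric_half hy]
    refine le_trans (le_of_eq (Finset.sum_congr rfl fun j hj => ?_)) (ENNReal.sum_le_tsum _)
    have := Finset.mem_range.1 hj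
    congr 2
    omega
  refine (mul_le_mul_right this _).trans ?_
  rw [← ENNReal.ofReal_mul (by positivity), mul_comm]

theorem rad_succ_rpow_neg (l : ℕ) (x : ℝ) : rad (l + 1) ^ (-x) = 2 ^ x * rad l ^ (-x) := by
  rw [rad_succ, Real.div_rpow (rad_pos l).le (by norm_num), Real.rpow_neg (by norm_num : (0:ℝ) ≤ 2),
    div_inv_eq_mul, mul_comm]

variable {Z : Type*} [MeasurableSpace Z] {ν : Measure Z}

/-- The range of `D` is cut into the shells between consecutive radii. The factor `φ` keeps whatever
part of the integrand is not bounded by a constant on a shell. -/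
theorem lintegral_le_tsum_dyadic {D : Z → ℝ} (hD : Measurable D) {φ g : Z → ENNReal}
    (hφ : Measurable φ) {a b : ℕ → ENNReal} (hg : ∀ z, g z ≠ 0 → 0 < D z ∧ D z ≤ 2)
    (hgb : ∀ l z, rad (l + 1) < D z → D z ≤ rad l → g z ≤ b l * φ z)
    (ha : ∀ l, ∫⁻ z in {z | D z ≤ rad l}, φ z ∂ν ≤ a l) :
    ∫⁻ z, g z ∂ν ≤ ∑' l, b l * a l := by
  let S : ℕ → Set Z := fun l => {z | rad (l + 1) < D z ∧ D z ≤ rad l}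
  have hS : ∀ l, MeasurableSet (S l) := fun l =>
    (measurableSet_lt measurable_const hD).inter (measurableSet_le hD measurable_const)
  have h1 : ∫⁻ z, g z ∂ν ≤ ∫⁻ z in ⋃ l, S l, g z ∂ν := by
    rw [← lintegral_indicator (MeasurableSet.iUnion hS)]
    refine lintegral_mono fun z => ?_
    by_cases hz : z ∈ ⋃ l, S l
    · rw [Set.indicator_of_mem hz]
    · rw [Set.indicator_of_notMem hz]
      refine le_of_eq ?_
      by_contra h0
      obtain ⟨l, hl⟩ := exists_rad_mem (hg z h0).1 (hg z h0).2
      exact hz (Set.mem_iUnion.2 ⟨l, hl⟩)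
  refine h1.trans ((lintegral_iUnion_le _ _).trans (ENNReal.tsum_le_tsum fun l => ?_))
  calc ∫⁻ z in S l, g z ∂ν ≤ ∫⁻ z in S l, b l * φ z ∂ν :=
        setLIntegral_mono' (hS l) fun z hz => hgb l z hz.1 hz.2
    _ = b l * ∫⁻ z in S l, φ z ∂ν := lintegral_const_mul _ hφ
    _ ≤ b l * a l := by
      gcongr
      exact (lintegral_mono_set fun z hz => hz.2).trans (ha l)

/-- A negative power of `D` below the dimension `κ` of `ν` is integrable near `D = 0`: the shell
contributions decrease with the factor `2^(-(κ - x))`. -/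
theorem lintegral_rpow_neg_le {D : Z → ℝ} (hD : Measurable D) {C κ x : ℝ} (hC : 0 ≤ C)
    (hx : 0 ≤ x) (hxκ : x < κ)
    (hν : ∀ r, 0 < r → r ≤ 2 → ν {z | D z ≤ r} ≤ ENNReal.ofReal (C * r ^ κ)) {R : ℝ} (hR : 0 < R)
    (hR2 : R ≤ 2) :
    ∫⁻ z in {z | 0 < D z ∧ D z < R}, ENNReal.ofReal (D z ^ (-x)) ∂ν ≤
      ENNReal.ofReal (2 ^ x * C * ((1 - (1 / 2) ^ (κ - x))⁻¹ * (2 * R) ^ (κ - x))) := by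
  have hSm : MeasurableSet {z | 0 < D z ∧ D z < R} :=
    (measurableSet_lt measurable_const hD).inter (measurableSet_lt hD measurable_const)
  rw [← lintegral_indicator hSm]
  refine (lintegral_le_tsum_dyadic (φ := fun _ => 1) hD measurable_const
    (a := fun l => ENNReal.ofReal (C * rad l ^ κ))
    (b := fun l => if rad l ≤ 2 * R then ENNReal.ofReal (2 ^ x * rad l ^ (-x)) else 0)
    ?_ ?_ ?_).trans ?_
  · intro z hz
    have : z ∈ {z | 0 < D z ∧ D z < R} := by
      by_contra h; exact hz (Set.indicator_of_notMem h _)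
    exact ⟨this.1, this.2.le.trans hR2⟩
  · intro l z h1 h2
    rw [mul_one]
    by_cases hz : z ∈ {z | 0 < D z ∧ D z < R}
    · have hz' : D z < R := hz.2
      rw [Set.indicator_of_mem hz, if_pos (by rw [rad_succ] at h1; linarith)]
      refine ENNReal.ofReal_le_ofReal ?_
      rw [← rad_succ_rpow_neg]
      exact Real.rpow_le_rpow_of_nonpos (rad_pos _) h1.le (by linarith)
    · rw [Set.indicator_of_notMem hz]; exact zero_le
  · intro l
    simpa using hν (rad l) (rad_pos l) (rad_le_two l)
  · have h1 : ∀ l, (if rad l ≤ 2 * R then ENNReal.ofReal (2 ^ x * rad l ^ (-x)) else 0) *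
        ENNReal.ofReal (C * rad l ^ κ) =
        ENNReal.ofReal (2 ^ x * C) *
          (if rad l ≤ 2 * R then ENNReal.ofReal (rad l ^ (κ - x)) else 0) := by
      intro l
      have := rad_pos l
      split_ifs
      · rw [← ENNReal.ofReal_mul (by positivity), ← ENNReal.ofReal_mul (by positivity), sub_eq_add_neg,
          Real.rpow_add (rad_pos l)]
        congr 1; ring
      · simp
    simp only [h1]
    rw [ENNReal.tsum_mul_left]
    refine (mul_le_mul_right (tsum_rad_le (sub_pos.2 hxκ) (by positivity : 0 < 2 * R)) _).trans ?_
    rw [← ENNReal.ofReal_mul (by positivity)]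

/-- The decay `q` beats the growth `υ` of the measure, so the integral is no larger than the mass at
the smallest scale `ρ`. All integrals of `|1 - z · ȳ|^(-q)` below rest on this. -/
theorem lintegral_div_rpow_le {D : Z → ℝ} (hD : Measurable D) {B υ q ρ : ℝ} (hB : 0 ≤ B)
    (hυ : 0 ≤ υ) (hq : υ < q) (hρ : 0 < ρ) (hDρ : ∀ᵐ z ∂ν, ρ ≤ D z ∧ D z ≤ 2)
    (hν : ∀ r, ρ ≤ r → ν {z | D z < r} ≤ ENNReal.ofReal (B * (r / ρ) ^ υ)) :
    ∫⁻ z, ENNReal.ofReal ((ρ / D z) ^ q) ∂ν ≤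
      ENNReal.ofReal (2 ^ (q + υ) * (1 - (1 / 2) ^ (q - υ))⁻¹ * B) := by
  have hq0 : 0 < q := hυ.trans_lt hq
  have hSm : MeasurableSet {z | ρ ≤ D z ∧ D z ≤ 2} :=
    (measurableSet_le measurable_const hD).inter (measurableSet_le hD measurable_const)
  have h0 : ∫⁻ z, ENNReal.ofReal ((ρ / D z) ^ q) ∂ν ≤ ∫⁻ z, Set.indicator {z | ρ ≤ D z ∧ D z ≤ 2}
      (fun z => ENNReal.ofReal ((ρ / D z) ^ q)) z ∂ν := by
    refine lintegral_mono_ae ?_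
    filter_upwards [hDρ] with z hz
    exact le_of_eq (Set.indicator_of_mem (s := {z | ρ ≤ D z ∧ D z ≤ 2}) hz
      (fun z => ENNReal.ofReal ((ρ / D z) ^ q))).symm
  -- The indicator of `ρ ≤ D` in the place of `φ` makes the mass of the shells below `ρ` vanish,
  -- where no growth bound is assumed.
  refine h0.trans ((lintegral_le_tsum_dyadic (φ := fun z => if ρ ≤ D z then 1 else 0) hD
    (Measurable.ite (measurableSet_le measurable_const hD) measurable_const measurable_const)
    (a := fun l => if ρ ≤ rad l then ENNReal.ofReal (B * (2 ^ υ * (rad l / ρ) ^ υ)) else 0)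
    (b := fun l => ENNReal.ofReal (2 ^ q * (ρ / rad l) ^ q))
    ?_ ?_ ?_).trans ?_)
  · intro z hz
    have : z ∈ {z | ρ ≤ D z ∧ D z ≤ 2} := by
      by_contra h; exact hz (Set.indicator_of_notMem h _)
    exact ⟨hρ.trans_le this.1, this.2⟩
  · intro l z h1 h2
    by_cases hz : z ∈ {z | ρ ≤ D z ∧ D z ≤ 2}
    · rw [Set.indicator_of_mem hz, if_pos hz.1, mul_one]
      refine ENNReal.ofReal_le_ofReal ?_
      rw [← Real.mul_rpow (by norm_num) (by have := rad_pos l; positivity)]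
      have hDp : 0 < D z := hρ.trans_le hz.1
      refine Real.rpow_le_rpow (by positivity) ?_ hq0.le
      have : 2 * (ρ / rad l) = ρ / rad (l + 1) := by rw [rad_succ]; field_simp
      rw [this]
      exact div_le_div_of_nonneg_left hρ.le (rad_pos _) h1.le
    · rw [Set.indicator_of_notMem hz]; exact zero_le
  · intro l
    have hr := rad_pos l
    split_ifs with h
    · have : ∫⁻ z in {z | D z ≤ rad l}, (if ρ ≤ D z then 1 else 0 : ENNReal) ∂ν ≤
          ν {z | D z < 2 * rad l} := by
        calc _ ≤ ∫⁻ z in {z | D z ≤ rad l}, 1 ∂ν := lintegral_mono fun z => by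
              dsimp only; split_ifs <;> simp
          _ = ν {z | D z ≤ rad l} := by simp
          _ ≤ _ := measure_mono fun z hz => by
            have : D z ≤ rad l := hz
            change D z < 2 * rad l
            linarith
      refine this.trans ((hν (2 * rad l) (by linarith)).trans (ENNReal.ofReal_le_ofReal ?_))
      rw [mul_div_assoc, Real.mul_rpow (by norm_num) (by positivity)]
    · refine le_of_eq ?_
      rw [setLIntegral_congr_fun (g := fun _ => 0) (measurableSet_le hD measurable_const)]
      · simp
      · intro z hz
        have : D z ≤ rad l := hz
        simp only
        rw [if_neg (by linarith)]
  · have h1 : ∀ l, ENNReal.ofReal (2 ^ q * (ρ / rad l) ^ q) *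
        (if ρ ≤ rad l then ENNReal.ofReal (B * (2 ^ υ * (rad l / ρ) ^ υ)) else 0) =
        ENNReal.ofReal (2 ^ (q + υ) * B * ρ ^ (q - υ)) *
          (if ρ ≤ rad l then ENNReal.ofReal (rad l ^ (-(q - υ))) else 0) := by
      intro l
      have := rad_pos l
      split_ifs
      · rw [← ENNReal.ofReal_mul (by positivity), ← ENNReal.ofReal_mul (by positivity)]
        congr 1
        rw [Real.div_rpow hρ.le this.le, Real.div_rpow this.le hρ.le, Real.rpow_add (by norm_num),
          Real.rpow_sub hρ, Real.rpow_neg this.le, Real.rpow_sub this]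
        field_simp
      · simp
    simp only [h1]
    rw [ENNReal.tsum_mul_left]
    refine (mul_le_mul_right (tsum_rad_ge (sub_pos.2 hq) hρ) _).trans ?_
    rw [← ENNReal.ofReal_mul (by positivity)]
    refine ENNReal.ofReal_le_ofReal (le_of_eq ?_)
    rw [Real.rpow_neg hρ.le]
    have : 0 < ρ ^ (q - υ) := Real.rpow_pos_of_pos hρ _
    field_simp

end Dyadic
-- The dyadic kernel and its comparison with the Besov kernel.
section Kernels

variable {m : ℕ}

/-- Hölder's inequality for `X w = (X w^(1/p)) w^(1/p')`, that is, Jensen's inequality for a weight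
that is not normalized. It degenerates to an equality for `p = 1`. -/
theorem lintegral_mul_rpow_le {Z : Type*} [MeasurableSpace Z] {ν : Measure Z} {p : ℝ} (hp : 1 ≤ p)
    {X w : Z → ENNReal} (hX : Measurable X) (hw : Measurable w) :
    (∫⁻ z, X z * w z ∂ν) ^ p ≤ (∫⁻ z, w z ∂ν) ^ (p - 1) * ∫⁻ z, X z ^ p * w z ∂ν := by
  rcases hp.eq_or_lt with rfl | hp1
  · simp
  have hp0 : 0 < p := by linarith
  set p' := p.conjExponent with hp'
  have hconj : p.HolderConjugate p' := Real.HolderConjugate.conjExponent hp1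
  have hp'0 : 0 < p' := hconj.symm.pos
  have h1 := ENNReal.lintegral_mul_le_Lp_mul_Lq ν hconj
    (f := fun z => X z * w z ^ (1 / p)) (g := fun z => w z ^ (1 / p'))
    (by fun_prop) (by fun_prop)
  have hsum : 1 / p + 1 / p' = 1 := by simpa using hconj.inv_add_inv_eq_one
  have e1 : ∀ z, (X z * w z ^ (1 / p)) * w z ^ (1 / p') = X z * w z := fun z => by
    rw [mul_assoc, ← ENNReal.rpow_add_of_nonneg _ _ (by positivity) (by positivity), hsum,
      ENNReal.rpow_one]
  have e2 : ∀ z, (X z * w z ^ (1 / p)) ^ p = X z ^ p * w z := fun z => by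
    rw [ENNReal.mul_rpow_of_nonneg _ _ hp0.le, ← ENNReal.rpow_mul, one_div_mul_cancel hp0.ne',
      ENNReal.rpow_one]
  have e3 : ∀ z, (w z ^ (1 / p')) ^ p' = w z := fun z => by
    rw [← ENNReal.rpow_mul, one_div_mul_cancel hp'0.ne', ENNReal.rpow_one]
  simp only [Pi.mul_apply, e1, e2, e3] at h1
  have h2 := ENNReal.rpow_le_rpow h1 hp0.le
  rw [ENNReal.mul_rpow_of_nonneg _ _ hp0.le, ← ENNReal.rpow_mul, ← ENNReal.rpow_mul,
    one_div_mul_cancel hp0.ne', ENNReal.rpow_one] at h2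
  have e4 : 1 / p' * p = p - 1 := by
    have : 1 / p' = 1 - 1 / p := by linarith
    rw [this]; field_simp
  rw [e4] at h2
  rw [mul_comm]
  exact h2

theorem measurable_real_dBall {μ : Measure (Cn m)} [IsProbabilityMeasure μ] {Z : Type*}
    [MeasurableSpace Z] {π : Z → Cn m} {r : Z → ℝ} (hπ : Measurable π) (hr : Measurable r) :
    Measurable fun z => μ.real (dBall (π z) (r z)) := by
  have hS : MeasurableSet {x : Z × Cn m | dist (π x.1) x.2 < r x.1} :=
    measurableSet_lt (measurable_dist (hπ.comp measurable_fst) measurable_snd)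
      (hr.comp measurable_fst)
  exact (measurable_measure_prodMk_left hS).ennreal_toReal

/-- A term of the dyadic kernel `kernelW`. -/
noncomputable def kernelTerm (μ : Measure (Cn m)) (p α lam q θ : ℝ) (s y : Cn m) (r : ℝ) : ℝ :=
  r ^ (p * (θ - α) + lam) * (μ.real (dBall s r))⁻¹ ^ 2 * (r / (r + dist s y)) ^ q

/-- The kernel `∑ r^{p(θ-α)+λ} μ(B(s,r))⁻² (r / (r + d(s,y)))^q` over dyadic radii `r`. -/
noncomputable def kernelW (μ : Measure (Cn m)) (p α lam q θ : ℝ) (s y : Cn m) : ENNReal :=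
  ∑' l, ENNReal.ofReal (kernelTerm μ p α lam q θ s y (rad l))

/-- The weighted `p`-norm with the kernel `kernelW`; the points are ordered as `(y, s)`. -/
noncomputable def kernelNorm (μ : Measure (Cn m)) (p α lam q θ : ℝ) (X : Cn m × Cn m → ENNReal) :
    ENNReal :=
  ∫⁻ x, X x ^ p * kernelW μ p α lam q θ x.2 x.1 ∂(μ.prod μ)

theorem kernelTerm_nonneg (μ : Measure (Cn m)) (p α lam q θ : ℝ) (s y : Cn m) {r : ℝ} (hr : 0 < r) :
    0 ≤ kernelTerm μ p α lam q θ s y r := by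
  have := dist_nonneg s y
  unfold kernelTerm; positivity

theorem measurable_kernelTerm (μ : Measure (Cn m)) [IsProbabilityMeasure μ] (p α lam q θ r : ℝ)
    {Z : Type*} [MeasurableSpace Z] {s y : Z → Cn m} (hs : Measurable s) (hy : Measurable y) :
    Measurable fun x => kernelTerm μ p α lam q θ (s x) (y x) r := by
  unfold kernelTerm
  have h1 : Measurable fun x => μ.real (dBall (s x) r) := measurable_real_dBall hs measurable_const
  have h2 : Measurable fun x => dist (s x) (y x) := measurable_dist hs hy
  exact ((h1.inv.pow_const 2).const_mul _).mul
    ((measurable_const.div (h2.const_add r)).pow_const q)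

theorem measurable_kernelW (μ : Measure (Cn m)) [IsProbabilityMeasure μ] (p α lam q θ : ℝ)
    {Z : Type*} [MeasurableSpace Z] {s y : Z → Cn m} (hs : Measurable s) (hy : Measurable y) :
    Measurable fun x => kernelW μ p α lam q θ (s x) (y x) := by
  unfold kernelW
  exact Measurable.tsum fun l =>
    (measurable_kernelTerm μ p α lam q θ (rad l) hs hy).ennreal_ofReal

namespace Growth

variable {E : Set (Cn m)} {μ : Measure (Cn m)} {υ lam A : ℝ}

/-- The sum is split at `r = d(s,y)`. For larger `r` the lower growth bounds `r^lam / μ(B(s,r))` by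
its value at `d`, and `r^(-x)` remains. For smaller `r` the upper growth costs `(d/r)^(2υ)`, which
the factor `(r/d)^q` outweighs. Both geometric sums are of the order of their value at `d`. -/
theorem exists_kernelW_le (g : Growth E μ υ lam A) {p α q θ : ℝ} (hx : 0 < p * (α - θ))
    (hq : 2 * υ + p * (α - θ) - lam < q) (hq0 : 0 ≤ q) :
    ∃ C : ℝ, 0 < C ∧ ∀ s ∈ E, ∀ y ∈ E, 0 < dist s y → kernelW μ p α lam q θ s y ≤
      ENNReal.ofReal (C * (dist s y ^ (-(p * (α - θ) - lam)) *
        (μ.real (dBall y (dist s y)))⁻¹ ^ 2)) := by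
  set x := p * (α - θ) with hxdef
  have hA := g.A_pos
  set Y := q - 2 * υ - x + lam with hY
  have hYpos : 0 < Y := by linarith
  have hg1 : 0 < (1 - ((1 : ℝ) / 2) ^ x)⁻¹ := inv_pos.2 (sub_pos.2 (half_rpow_lt_one hx))
  have hg2 : 0 < (1 - ((1 : ℝ) / 2) ^ Y)⁻¹ := inv_pos.2 (sub_pos.2 (half_rpow_lt_one hYpos))
  set C₁ := A * (1 - ((1 : ℝ) / 2) ^ x)⁻¹ + A ^ 2 * (1 - ((1 : ℝ) / 2) ^ Y)⁻¹
  have hC₁ : 0 < C₁ := by positivity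
  refine ⟨C₁ * (A * 6 ^ υ) ^ 2, by positivity, ?_⟩
  intro s hs y hy hd
  set d := dist s y with hddef
  have hd2 : d ≤ 2 := dist_le_two (g.norm_eq hs).le (g.norm_eq hy).le
  set V := μ.real (dBall s d)
  have hV : 0 < V := g.pos s hs d hd
  set V' := μ.real (dBall y d)
  have hV' : 0 < V' := g.pos y hy d hd
  have hterm : ∀ l, ENNReal.ofReal (kernelTerm μ p α lam q θ s y (rad l)) ≤
      ENNReal.ofReal (A * d ^ lam * V⁻¹ ^ 2) *
        (if d ≤ rad l then ENNReal.ofReal (rad l ^ (-x)) else 0) +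
      ENNReal.ofReal (A ^ 2 * V⁻¹ ^ 2 * d ^ (2 * υ - q)) *
        (if rad l ≤ d then ENNReal.ofReal (rad l ^ Y) else 0) := by
    intro l
    have hr := rad_pos l
    set r := rad l
    have hVr : 0 < μ.real (dBall s r) := g.pos s hs r hr
    have he : p * (θ - α) + lam = -x + lam := by rw [hxdef]; ring
    rcases le_total d r with h | h
    · refine le_trans ?_ le_self_add
      rw [if_pos h, ← ENNReal.ofReal_mul (by positivity)]
      refine ENNReal.ofReal_le_ofReal ?_
      have h1 : (r / (r + d)) ^ q ≤ 1 :=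
        Real.rpow_le_one (by positivity) (by rw [div_le_one (by positivity)]; linarith) hq0
      have h2 := g.lower s hs d r hd h (rad_le_two l)
      have h3 : r ^ lam * (μ.real (dBall s r))⁻¹ ≤ A * d ^ lam * V⁻¹ := by
        rw [← div_eq_mul_inv, ← div_eq_mul_inv, div_le_div_iff₀ hVr hV]
        calc r ^ lam * V = V * r ^ lam := mul_comm _ _
          _ ≤ _ := h2
          _ = _ := by ring
      have h4 : (μ.real (dBall s r))⁻¹ ≤ V⁻¹ :=
        inv_anti₀ hV (g.real_mono fun _ _ hw => dBall_mono s h hw)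
      calc kernelTerm μ p α lam q θ s y r
          ≤ r ^ (-x + lam) * (μ.real (dBall s r))⁻¹ ^ 2 * 1 := by
            unfold kernelTerm; rw [he]; gcongr
        _ = r ^ (-x) * (r ^ lam * (μ.real (dBall s r))⁻¹) * (μ.real (dBall s r))⁻¹ := by
            rw [Real.rpow_add hr]; ring
        _ ≤ r ^ (-x) * (A * d ^ lam * V⁻¹) * V⁻¹ := by gcongr
        _ = _ := by ring
    · refine le_trans ?_ le_add_self
      rw [if_pos h, ← ENNReal.ofReal_mul (by positivity)]
      refine ENNReal.ofReal_le_ofReal ?_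
      have h1 : (r / (r + d)) ^ q ≤ (r / d) ^ q := by
        refine Real.rpow_le_rpow (by positivity) ?_ hq0
        exact div_le_div_of_nonneg_left hr.le hd (by linarith)
      have h2 := g.upper s hs r d hr h
      have h3 : (μ.real (dBall s r))⁻¹ ≤ A * (d / r) ^ υ * V⁻¹ := by
        rw [← div_eq_mul_inv, inv_le_iff_one_le_mul₀ hVr, div_mul_eq_mul_div, le_div_iff₀ hV, one_mul]
        exact h2
      calc kernelTerm μ p α lam q θ s y r
          ≤ r ^ (-x + lam) * (A * (d / r) ^ υ * V⁻¹) ^ 2 * (r / d) ^ q := by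
            unfold kernelTerm; rw [he]; gcongr
        _ = _ := by
            rw [hY, Real.div_rpow hd.le hr.le, Real.div_rpow hr.le hd.le, Real.rpow_add hr,
              Real.rpow_add hr, Real.rpow_sub hr, Real.rpow_sub hr, Real.rpow_sub hd,
              mul_comm 2 υ, Real.rpow_mul hr.le, Real.rpow_mul hd.le, Real.rpow_neg hr.le]
            simp only [Real.rpow_two]
            have := Real.rpow_pos_of_pos hr υ
            have := Real.rpow_pos_of_pos hr x
            have := Real.rpow_pos_of_pos hd q
            field_simp
  have hsum : kernelW μ p α lam q θ s y ≤ ENNReal.ofReal (C₁ * (d ^ (-(x - lam)) * V⁻¹ ^ 2)) := by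
    unfold kernelW
    refine (ENNReal.tsum_le_tsum hterm).trans ?_
    rw [ENNReal.tsum_add, ENNReal.tsum_mul_left, ENNReal.tsum_mul_left]
    refine (add_le_add (mul_le_mul_right (tsum_rad_ge hx hd) _)
      (mul_le_mul_right (tsum_rad_le hYpos hd) _)).trans ?_
    rw [← ENNReal.ofReal_mul (by positivity), ← ENNReal.ofReal_mul (by positivity),
      ← ENNReal.ofReal_add (by positivity) (by positivity)]
    refine ENNReal.ofReal_le_ofReal (le_of_eq ?_)
    have e1 : d ^ (-(x - lam)) = d ^ lam * d ^ (-x) := by rw [← Real.rpow_add hd]; congr 1; ring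
    have e2 : d ^ lam * d ^ (-x) = d ^ (2 * υ - q) * d ^ Y := by
      rw [← Real.rpow_add hd, ← Real.rpow_add hd]; congr 1; rw [hY]; ring
    rw [e1]
    simp only [C₁]
    calc _ = A * (1 - (1 / 2) ^ x)⁻¹ * (d ^ lam * d ^ (-x)) * V⁻¹ ^ 2 +
          A ^ 2 * (1 - (1 / 2) ^ Y)⁻¹ * (d ^ (2 * υ - q) * d ^ Y) * V⁻¹ ^ 2 := by ring
      _ = _ := by rw [← e2]; ring
  refine hsum.trans (ENNReal.ofReal_le_ofReal ?_)
  -- The Besov kernel has its ball centred at `y`; at radius `d(s,y)` the centres `s` and `y` are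
  -- interchangeable.
  have h6 : V⁻¹ ≤ A * 6 ^ υ * V'⁻¹ := by
    have := g.real_le_of_dist_le hy hs hd (le_of_eq (dist_comm y s) : dist y s ≤ d)
    rw [show 3 * (d + d) / d = 6 by field_simp; norm_num] at this
    rw [← div_eq_mul_inv, inv_le_iff_one_le_mul₀ hV, div_mul_eq_mul_div, le_div_iff₀ hV', one_mul]
    exact this
  calc C₁ * (d ^ (-(x - lam)) * V⁻¹ ^ 2)
      ≤ C₁ * (d ^ (-(x - lam)) * (A * 6 ^ υ * V'⁻¹) ^ 2) := by gcongr
    _ = _ := by ring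

theorem lintegral_div_add_dist_le (g : Growth E μ υ lam A) {q : ℝ} (hq : υ < q) {s : Cn m}
    (hs : s ∈ E) {r : ℝ} (hr : 0 < r) (hr2 : r ≤ 2) :
    ∫⁻ y, ENNReal.ofReal ((r / (r + dist s y)) ^ q) ∂μ ≤
      ENNReal.ofReal (2 ^ (q + υ) * (1 - (1 / 2) ^ (q - υ))⁻¹ * (A * μ.real (dBall s r))) := by
  have := g.prob
  have hA := g.A_pos
  have hm : Measurable fun y => (r + dist s y) / 2 :=
    ((measurable_dist measurable_const measurable_id).const_add r).div_const 2
  have key := lintegral_div_rpow_le (ν := μ) hm (B := A * μ.real (dBall s r)) (υ := υ) (q := q)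
    (ρ := r / 2) (by positivity) g.nonneg hq (by positivity) ?_ ?_
  · refine le_trans (le_of_eq ?_) key
    refine lintegral_congr fun y => ?_
    rw [div_div_div_cancel_right₀ (by norm_num)]
  · filter_upwards [g.ae_mem] with y hy
    have h1 := dist_nonneg s y
    have h2 := dist_le_two (g.norm_eq hs).le (g.norm_eq hy).le
    constructor <;> linarith
  · intro t ht
    have h1 := g.upper s hs r (2 * t) hr (by linarith)
    calc μ {y | (r + dist s y) / 2 < t} ≤ μ (dBall s (2 * t)) := measure_mono fun y hy => by
          have : (r + dist s y) / 2 < t := hy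
          change dist s y < 2 * t
          linarith
      _ = ENNReal.ofReal (μ.real (dBall s (2 * t))) := (ofReal_measureReal).symm
      _ ≤ _ := by
        refine ENNReal.ofReal_le_ofReal (h1.trans (le_of_eq ?_))
        rw [show t / (r / 2) = 2 * t / r by field_simp]
        ring

/-- Integration in `y` cancels one factor `μ(B(s,r))⁻¹`, and the other is `O(r^(-υ))`. The remaining
power of `r` is positive by `hθ`, so the dyadic sum converges. -/
theorem exists_lintegral_kernelW_le (g : Growth E μ υ lam A) {p α q θ : ℝ} (hq : υ < q)
    (hθ : 0 < p * (θ - α) + lam - υ) :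
    ∃ C : ℝ, 0 < C ∧ ∀ s ∈ E, ∫⁻ y, kernelW μ p α lam q θ s y ∂μ ≤ ENNReal.ofReal C := by
  have := g.prob
  have hA := g.A_pos
  set Y := p * (θ - α) + lam - υ with hY
  set G := 2 ^ (q + υ) * (1 - ((1 : ℝ) / 2) ^ (q - υ))⁻¹ with hG
  have hGpos : 0 < G := mul_pos (by positivity)
    (inv_pos.2 (sub_pos.2 (half_rpow_lt_one (sub_pos.2 hq))))
  have hg2 : 0 < (1 - ((1 : ℝ) / 2) ^ Y)⁻¹ := inv_pos.2 (sub_pos.2 (half_rpow_lt_one hθ))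
  refine ⟨G * A * (A * 3 ^ υ) * ((1 - ((1 : ℝ) / 2) ^ Y)⁻¹ * 2 ^ Y), by positivity, ?_⟩
  intro s hs
  have hmeas : ∀ l, AEMeasurable
      (fun y => ENNReal.ofReal (kernelTerm μ p α lam q θ s y (rad l))) μ := fun l =>
    (measurable_kernelTerm μ p α lam q θ (rad l) measurable_const
      measurable_id).ennreal_ofReal.aemeasurable
  unfold kernelW
  rw [lintegral_tsum hmeas]
  have hterm : ∀ l, ∫⁻ y, ENNReal.ofReal (kernelTerm μ p α lam q θ s y (rad l)) ∂μ ≤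
      ENNReal.ofReal (G * A * (A * 3 ^ υ)) *
        (if rad l ≤ 2 then ENNReal.ofReal (rad l ^ Y) else 0) := by
    intro l
    have hr := rad_pos l
    have hr2 := rad_le_two l
    rw [if_pos hr2]
    set r := rad l
    have hV := g.pos s hs r hr
    unfold kernelTerm
    have e1 : ∀ y, ENNReal.ofReal (r ^ (p * (θ - α) + lam) * (μ.real (dBall s r))⁻¹ ^ 2 *
        (r / (r + dist s y)) ^ q) = ENNReal.ofReal (r ^ (p * (θ - α) + lam) *
          (μ.real (dBall s r))⁻¹ ^ 2) * ENNReal.ofReal ((r / (r + dist s y)) ^ q) := fun y =>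
      ENNReal.ofReal_mul (by positivity)
    simp only [e1]
    rw [lintegral_const_mul' _ _ ENNReal.ofReal_ne_top]
    refine (mul_le_mul_right (g.lintegral_div_add_dist_le hq hs hr hr2) _).trans ?_
    rw [← ENNReal.ofReal_mul (by positivity), ← ENNReal.ofReal_mul (by positivity)]
    refine ENNReal.ofReal_le_ofReal ?_
    have h1 := g.rpow_le_real hs hr (by linarith)
    have h2 : (μ.real (dBall s r))⁻¹ ≤ A * 3 ^ υ * r ^ (-υ) := by
      rw [Real.rpow_neg hr.le, ← div_eq_mul_inv, inv_le_iff_one_le_mul₀ hV, div_mul_eq_mul_div,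
        le_div_iff₀ (Real.rpow_pos_of_pos hr _), one_mul]
      exact h1
    have e2 : r ^ Y = r ^ (p * (θ - α) + lam) * r ^ (-υ) := by
      rw [← Real.rpow_add hr, hY]; congr 1
    calc r ^ (p * (θ - α) + lam) * (μ.real (dBall s r))⁻¹ ^ 2 * (G * (A * μ.real (dBall s r)))
        = G * A * r ^ (p * (θ - α) + lam) * (μ.real (dBall s r))⁻¹ := by field_simp
      _ ≤ G * A * r ^ (p * (θ - α) + lam) * (A * 3 ^ υ * r ^ (-υ)) := by gcongr
      _ = _ := by rw [e2]; ring
  refine (ENNReal.tsum_le_tsum hterm).trans ?_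
  rw [ENNReal.tsum_mul_left]
  refine (mul_le_mul_right (tsum_rad_le hθ two_pos) _).trans ?_
  rw [← ENNReal.ofReal_mul (by positivity)]

/-- The masses of the `r`-balls about `s` and `y` differ by at most `((r + d)/r)^υ` up to a
constant; squared, this lowers `q` by `2υ`. Integrability in the other variable then requires `υ < q
- 2υ`. -/
theorem kernelW_le_swap (g : Growth E μ υ lam A) {p α q θ : ℝ} {s y : Cn m} (hs : s ∈ E)
    (hy : y ∈ E) : kernelW μ p α lam q θ s y ≤
      ENNReal.ofReal ((A * 3 ^ υ) ^ 2) * kernelW μ p α lam (q - 2 * υ) θ y s := by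
  have hA := g.A_pos
  unfold kernelW
  rw [← ENNReal.tsum_mul_left]
  refine ENNReal.tsum_le_tsum fun l => ?_
  have hr := rad_pos l
  rw [← ENNReal.ofReal_mul (by positivity)]
  refine ENNReal.ofReal_le_ofReal ?_
  set r := rad l
  have hd := dist_nonneg s y
  have hV := g.pos s hs r hr
  have hV' := g.pos y hy r hr
  have h1 := g.real_le_of_dist_le hy hs hr (le_of_eq (dist_comm y s))
  have h2 : (μ.real (dBall s r))⁻¹ ≤ A * 3 ^ υ * (r / (r + dist s y)) ^ (-υ) *
      (μ.real (dBall y r))⁻¹ := by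
    rw [← div_eq_mul_inv, inv_le_iff_one_le_mul₀ hV, div_mul_eq_mul_div, le_div_iff₀ hV', one_mul]
    refine h1.trans (le_of_eq ?_)
    rw [mul_div_assoc, Real.mul_rpow (by norm_num) (by positivity), Real.rpow_neg (by positivity),
      ← Real.inv_rpow (by positivity), inv_div]
    ring
  unfold kernelTerm
  rw [dist_comm y s]
  have hpos : 0 < r / (r + dist s y) := by positivity
  calc r ^ (p * (θ - α) + lam) * (μ.real (dBall s r))⁻¹ ^ 2 * (r / (r + dist s y)) ^ q
      ≤ r ^ (p * (θ - α) + lam) * (A * 3 ^ υ * (r / (r + dist s y)) ^ (-υ) *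
      (μ.real (dBall y r))⁻¹) ^ 2 * (r / (r + dist s y)) ^ q := by gcongr
    _ = _ := by
      rw [Real.rpow_sub hpos, Real.rpow_neg hpos.le, mul_comm 2 υ, Real.rpow_mul hpos.le,
        Real.rpow_two]
      have := Real.rpow_pos_of_pos hpos υ
      field_simp

/-- Finiteness of `kernelNorm` for functions of one variable and large exponents. -/
theorem kernelNorm_lt_top_of_large (g : Growth E μ υ lam A) {p α q θ : ℝ} (hq : 3 * υ < q)
    (hθ : 0 < p * (θ - α) + lam - υ) {F : Cn m → ENNReal} (hF : Measurable F)
    (hFp : ∫⁻ y, F y ^ p ∂μ < ⊤) :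
    kernelNorm μ p α lam q θ (fun x => F x.1) < ⊤ ∧
      kernelNorm μ p α lam q θ (fun x => F x.2) < ⊤ := by
  have := g.prob
  have hυ := g.nonneg
  have hA := g.A_pos
  have hW := measurable_kernelW μ p α lam q θ (measurable_snd (α := Cn m) (β := Cn m)) measurable_fst
  constructor
  · obtain ⟨C, hC, hCb⟩ := g.exists_lintegral_kernelW_le (p := p) (α := α) (q := q - 2 * υ) (θ := θ)
      (by linarith) hθ
    have hmeas : AEMeasurable (fun x : Cn m × Cn m => F x.1 ^ p * kernelW μ p α lam q θ x.2 x.1)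
        (μ.prod μ) := (((hF.comp measurable_fst).pow_const p).mul hW).aemeasurable
    unfold kernelNorm
    rw [lintegral_prod _ hmeas]
    have h1 : ∀ y ∈ E, ∫⁻ s, F y ^ p * kernelW μ p α lam q θ s y ∂μ ≤
        F y ^ p * ENNReal.ofReal ((A * 3 ^ υ) ^ 2 * C) := by
      intro y hy
      have hWy : Measurable fun s => kernelW μ p α lam q θ s y :=
        measurable_kernelW μ p α lam q θ measurable_id measurable_const
      rw [lintegral_const_mul _ hWy]
      gcongr
      calc ∫⁻ s, kernelW μ p α lam q θ s y ∂μ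
          ≤ ∫⁻ s, ENNReal.ofReal ((A * 3 ^ υ) ^ 2) *
            kernelW μ p α lam (q - 2 * υ) θ y s ∂μ := by
            refine lintegral_mono_ae ?_
            filter_upwards [g.ae_mem] with s hs using g.kernelW_le_swap hs hy
        _ ≤ _ := by
            rw [lintegral_const_mul' _ _ ENNReal.ofReal_ne_top, ENNReal.ofReal_mul (by positivity)]
            gcongr
            exact hCb y hy
    calc _ ≤ ∫⁻ y, F y ^ p * ENNReal.ofReal ((A * 3 ^ υ) ^ 2 * C) ∂μ := by
          refine lintegral_mono_ae ?_
          filter_upwards [g.ae_mem] with y hy using h1 y hy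
      _ = (∫⁻ y, F y ^ p ∂μ) * ENNReal.ofReal ((A * 3 ^ υ) ^ 2 * C) :=
          lintegral_mul_const' _ _ ENNReal.ofReal_ne_top
      _ < ⊤ := ENNReal.mul_lt_top hFp ENNReal.ofReal_lt_top
  · obtain ⟨C, hC, hCb⟩ := g.exists_lintegral_kernelW_le (p := p) (α := α) (q := q) (θ := θ)
      (by linarith) hθ
    have hmeas : AEMeasurable (fun x : Cn m × Cn m => F x.2 ^ p * kernelW μ p α lam q θ x.2 x.1)
        (μ.prod μ) := (((hF.comp measurable_snd).pow_const p).mul hW).aemeasurable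
    unfold kernelNorm
    rw [lintegral_prod_symm _ hmeas]
    have h1 : ∀ s ∈ E, ∫⁻ y, F s ^ p * kernelW μ p α lam q θ s y ∂μ ≤
        F s ^ p * ENNReal.ofReal C := by
      intro s hs
      have hWs : Measurable fun y => kernelW μ p α lam q θ s y :=
        measurable_kernelW μ p α lam q θ measurable_const measurable_id
      rw [lintegral_const_mul _ hWs]
      gcongr
      exact hCb s hs
    calc _ ≤ ∫⁻ s, F s ^ p * ENNReal.ofReal C ∂μ := by
          refine lintegral_mono_ae ?_
          filter_upwards [g.ae_mem] with s hs using h1 s hs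
      _ = (∫⁻ s, F s ^ p ∂μ) * ENNReal.ofReal C := lintegral_mul_const' _ _ ENNReal.ofReal_ne_top
      _ < ⊤ := ENNReal.mul_lt_top hFp ENNReal.ofReal_lt_top

end Growth
end Kernels
-- Weighted averages over points near z and the Fubini estimate.
section Averages

variable {m : ℕ}

/-- The weight `1_{d(z,s) < 6 d(z,E)} (d(z,E) / d(z,y))^q` at `x = (y, s)`. -/
noncomputable def avgWeight (E : Set (Cn m)) (q : ℝ) (z : Cn m) (x : Cn m × Cn m) : ENNReal :=
  open scoped Classical in
  if dist z x.2 < 6 * distSet z E then ENNReal.ofReal ((distSet z E / dist z x.1) ^ q) else 0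

/-- The weighted mean of `X(y, s)` over `s` near `z` and all `y`, times `d(z,E)^θ`. -/
noncomputable def avgKernel (E : Set (Cn m)) (μ : Measure (Cn m)) (q θ : ℝ)
    (X : Cn m × Cn m → ENNReal) (z : Cn m) : ENNReal :=
  ENNReal.ofReal (distSet z E ^ θ * (μ.real (dBall z (6 * distSet z E)))⁻¹ ^ 2) *
    ∫⁻ x, X x * avgWeight E q z x ∂(μ.prod μ)

theorem measurable_avgWeight {E : Set (Cn m)} (hE : E.Nonempty) (q : ℝ) {Z : Type*}
    [MeasurableSpace Z] {π : Z → Cn m} {x : Z → Cn m × Cn m} (hπ : Measurable π)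
    (hx : Measurable x) : Measurable fun z => avgWeight E q (π z) (x z) := by
  unfold avgWeight
  have hρ := (measurable_distSet hE).comp hπ
  refine Measurable.ite (measurableSet_lt (measurable_dist hπ (measurable_snd.comp hx))
    (hρ.const_mul 6)) ?_ measurable_const
  exact ((hρ.div (measurable_dist hπ (measurable_fst.comp hx))).pow_const q).ennreal_ofReal

theorem measurable_avgKernel {E : Set (Cn m)} (hE : E.Nonempty) (μ : Measure (Cn m))
    [IsProbabilityMeasure μ] (q θ : ℝ) {X : Cn m × Cn m → ENNReal} (hX : Measurable X) :
    Measurable (avgKernel E μ q θ X) := by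
  unfold avgKernel
  have hρ := measurable_distSet (m := m) hE
  have h1 : Measurable fun z : Cn m => μ.real (dBall z (6 * distSet z E)) :=
    measurable_real_dBall measurable_id (hρ.const_mul 6)
  refine (((hρ.pow_const θ).mul (h1.inv.pow_const 2)).ennreal_ofReal).mul ?_
  refine Measurable.lintegral_prod_right' (f := fun a : Cn m × (Cn m × Cn m) =>
    X a.2 * avgWeight E q a.1 a.2) ?_
  exact (hX.comp measurable_snd).mul (measurable_avgWeight hE q measurable_fst measurable_snd)

theorem rpow_le_of_ratio {ρ r c a : ℝ} (hρ : 0 < ρ) (hc : 1 ≤ c) (h1 : ρ ≤ c * r)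
    (h2 : r ≤ c * ρ) : ρ ^ a ≤ c ^ |a| * r ^ a := by
  have hc0 : 0 < c := by linarith
  have hr : 0 < r := by
    by_contra h
    nlinarith
  have e : ρ ^ a = (ρ / r) ^ a * r ^ a := by
    rw [Real.div_rpow hρ.le hr.le, div_mul_cancel₀ _ (Real.rpow_pos_of_pos hr a).ne']
  rw [e]
  gcongr
  rcases le_total 0 a with ha | ha
  · rw [abs_of_nonneg ha]
    refine Real.rpow_le_rpow (by positivity) ?_ ha
    rw [div_le_iff₀ hr]; exact h1
  · rw [abs_of_nonpos ha, Real.rpow_neg hc0.le, ← Real.inv_rpow hc0.le]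
    refine Real.rpow_le_rpow_of_nonpos (by positivity) ?_ ha
    rw [inv_le_iff_one_le_mul₀ hc0, ← mul_div_right_comm, le_div_iff₀ hr, one_mul, mul_comm]
    exact h2

namespace Growth

variable {E : Set (Cn m)} {μ : Measure (Cn m)} {υ lam A : ℝ}

theorem lintegral_distSet_div_le (g : Growth E μ υ lam A) {q : ℝ} (hq : υ < q) {z : Cn m}
    (hz : ‖z‖ < 1) : ∫⁻ y, ENNReal.ofReal ((distSet z E / dist z y) ^ q) ∂μ ≤
      ENNReal.ofReal (2 ^ (q + υ) * (1 - (1 / 2) ^ (q - υ))⁻¹ *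
        (A * 144 ^ υ * μ.real (dBall z (6 * distSet z E)))) := by
  have := g.prob
  have hA := g.A_pos
  have hρ := distSet_pos g.nonempty g.sub hz
  refine lintegral_div_rpow_le (measurable_dist measurable_const measurable_id) (by positivity)
    g.nonneg hq hρ ?_ ?_
  · filter_upwards [g.ae_mem] with y hy
    exact ⟨distSet_le z hy, dist_le_two hz.le (g.norm_eq hy).le⟩
  · intro r hr
    have := g.real_dBall_le_mul hz.le hρ hr
    calc μ {y | dist z y < r} = ENNReal.ofReal (μ.real (dBall z r)) := (ofReal_measureReal).symm
      _ ≤ _ := ENNReal.ofReal_le_ofReal (this.trans (le_of_eq (by ring)))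

theorem lintegral_avgWeight_le (g : Growth E μ υ lam A) {q : ℝ} (hq : υ < q) {z : Cn m}
    (hz : ‖z‖ < 1) : ∫⁻ x, avgWeight E q z x ∂(μ.prod μ) ≤
      ENNReal.ofReal (2 ^ (q + υ) * (1 - (1 / 2) ^ (q - υ))⁻¹ * (A * 144 ^ υ) *
        μ.real (dBall z (6 * distSet z E)) ^ 2) := by
  classical
  have := g.prob
  have hA := g.A_pos
  set U := μ.real (dBall z (6 * distSet z E))
  have hS : MeasurableSet (dBall z (6 * distSet z E)) := measurableSet_dBall _ _
  have e1 : ∀ x : Cn m × Cn m, avgWeight E q z x =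
      ENNReal.ofReal ((distSet z E / dist z x.1) ^ q) *
        (dBall z (6 * distSet z E)).indicator (fun _ => 1) x.2 := by
    intro x
    unfold avgWeight
    by_cases h : dist z x.2 < 6 * distSet z E
    · rw [if_pos h, Set.indicator_of_mem (s := dBall z (6 * distSet z E)) h, mul_one]
    · rw [if_neg h, Set.indicator_of_notMem (s := dBall z (6 * distSet z E)) h, mul_zero]
  simp only [e1]
  have hm1 : Measurable fun y => ENNReal.ofReal ((distSet z E / dist z y) ^ q) :=
    ((measurable_const.div (measurable_dist measurable_const measurable_id)).pow_const
      q).ennreal_ofReal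
  rw [lintegral_prod_mul (f := fun y => ENNReal.ofReal ((distSet z E / dist z y) ^ q))
    (g := (dBall z (6 * distSet z E)).indicator (fun _ => 1)) hm1.aemeasurable
    (measurable_const.indicator hS).aemeasurable, lintegral_indicator_const hS, one_mul]
  rw [← ofReal_measureReal (μ := μ) (s := dBall z (6 * distSet z E))]
  refine (mul_le_mul_left (g.lintegral_distSet_div_le hq hz) _).trans ?_
  have hgeo : 0 < (1 - ((1 : ℝ) / 2) ^ (q - υ))⁻¹ :=
    inv_pos.2 (sub_pos.2 (half_rpow_lt_one (sub_pos.2 hq)))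
  rw [← ENNReal.ofReal_mul (by positivity)]
  refine ENNReal.ofReal_le_ofReal (le_of_eq ?_)
  ring

/-- Jensen's inequality: the total mass of `avgWeight` is `O(U²)` with `U = μ(B(z,6ρ))`, which the
factor `U⁻²` of `avgKernel` compensates. -/
theorem exists_avgKernel_rpow_le (g : Growth E μ υ lam A) {p q : ℝ} (hp : 1 ≤ p) (hq : υ < q)
    (θ : ℝ) : ∃ C : ℝ, 0 < C ∧ ∀ {X : Cn m × Cn m → ENNReal}, Measurable X → ∀ z : Cn m, ‖z‖ < 1 →
      avgKernel E μ q θ X z ^ p ≤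
        ENNReal.ofReal (C * (distSet z E ^ (p * θ) *
          (μ.real (dBall z (6 * distSet z E)))⁻¹ ^ 2)) *
          ∫⁻ x, X x ^ p * avgWeight E q z x ∂(μ.prod μ) := by
  have := g.prob
  have hA := g.A_pos
  have hp0 : 0 < p := by linarith
  have hgeo : 0 < (1 - ((1 : ℝ) / 2) ^ (q - υ))⁻¹ :=
    inv_pos.2 (sub_pos.2 (half_rpow_lt_one (sub_pos.2 hq)))
  set G := 2 ^ (q + υ) * (1 - ((1 : ℝ) / 2) ^ (q - υ))⁻¹ * (A * 144 ^ υ)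
  have hG : 0 < G := by positivity
  refine ⟨G ^ (p - 1), by positivity, ?_⟩
  intro X hX z hz
  have hρ := distSet_pos g.nonempty g.sub hz
  have hU := g.real_dBall_pos hz.le hρ
  have hmass := g.lintegral_avgWeight_le hq hz
  set U := μ.real (dBall z (6 * distSet z E))
  set ρ := distSet z E
  unfold avgKernel
  rw [ENNReal.mul_rpow_of_nonneg _ _ hp0.le]
  have hw : Measurable (avgWeight E q z) :=
    measurable_avgWeight g.nonempty q measurable_const measurable_id
  refine (mul_le_mul_right (lintegral_mul_rpow_le hp hX hw) _).trans ?_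
  rw [← mul_assoc]
  gcongr
  refine (mul_le_mul_right (ENNReal.rpow_le_rpow hmass (by linarith)) _).trans ?_
  rw [ENNReal.ofReal_rpow_of_nonneg (by positivity) hp0.le,
    ENNReal.ofReal_rpow_of_nonneg (by positivity) (by linarith), ← ENNReal.ofReal_mul (by positivity)]
  refine ENNReal.ofReal_le_ofReal (le_of_eq ?_)
  rw [Real.mul_rpow (by positivity) (by positivity), Real.mul_rpow (by positivity) (by positivity),
    ← Real.rpow_mul hρ.le, mul_comm θ p]
  have e : (U⁻¹ ^ 2) ^ p * (U ^ 2) ^ (p - 1) = U⁻¹ ^ 2 := by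
    rw [Real.rpow_sub (by positivity), inv_pow, Real.inv_rpow (by positivity), Real.rpow_one]
    have : (0 : ℝ) < (U ^ 2) ^ p := by positivity
    field_simp
  calc _ = G ^ (p - 1) * (ρ ^ (p * θ) * ((U⁻¹ ^ 2) ^ p * (U ^ 2) ^ (p - 1))) := by ring
    _ = _ := by rw [e]

/-- In the shell `r/2 < d(z,s) ≤ r`, nearness of `s` gives `ρ ≤ r ≤ 12ρ`. All quantities centred at
`z` are then bounded by the corresponding ones centred at `s` at scale `r`, and these form a term of
`kernelW`. -/
theorem exists_pointwise_kernel_le (g : Growth E μ υ lam A) {p α q : ℝ} (hq : 0 ≤ q) (θ κ : ℝ) :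
    ∃ C : ℝ, 0 < C ∧ ∀ z : Cn m, ‖z‖ < 1 → ∀ s ∈ E, ∀ y ∈ E, ∀ r : ℝ, 0 < r →
      dist z s < 6 * distSet z E → r / 2 < dist z s → dist z s ≤ r →
      distSet z E ^ (lam - p * α - κ) * (distSet z E ^ (p * θ) *
        (μ.real (dBall z (6 * distSet z E)))⁻¹ ^ 2) * (distSet z E / dist z y) ^ q ≤
      C * r ^ (-κ) * kernelTerm μ p α lam q θ s y r := by
  have hA := g.A_pos
  set a := lam - p * α - κ + p * θ with ha
  refine ⟨12 ^ |a| * (A * 144 ^ υ * (A * 12 ^ υ)) ^ 2 * 27 ^ q, by positivity, ?_⟩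
  intro z hz s hs y hy r hr h6 hr1 hr2
  have hρ := distSet_pos g.nonempty g.sub hz
  have hU := g.real_dBall_pos hz.le hρ
  have hρs := distSet_le z hs
  have hρy := distSet_le z hy
  have hle := g.le_real_dBall hz.le hρ hs h6
  set U := μ.real (dBall z (6 * distSet z E))
  set ρ := distSet z E
  have hV := g.pos s hs r hr
  have hVρ := g.pos s hs ρ hρ
  have hρr : ρ ≤ r := hρs.trans hr2
  have hrρ : r ≤ 12 * ρ := by linarith
  have h1 : ρ ^ (lam - p * α - κ) * ρ ^ (p * θ) ≤ 12 ^ |a| * r ^ a := by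
    rw [← Real.rpow_add hρ]
    exact rpow_le_of_ratio hρ (by norm_num) (by linarith) hrρ
  have h2 : U⁻¹ ≤ A * 144 ^ υ * (A * 12 ^ υ) * (μ.real (dBall s r))⁻¹ := by
    have h3 := g.upper s hs ρ r hρ hρr
    have h4 : μ.real (dBall s r) ≤ A * 12 ^ υ * μ.real (dBall s ρ) := by
      refine h3.trans ?_
      gcongr
      · exact g.nonneg
      · rw [div_le_iff₀ hρ]; exact hrρ
    rw [← div_eq_mul_inv, inv_le_iff_one_le_mul₀ hU, div_mul_eq_mul_div, le_div_iff₀ hV, one_mul]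
    calc μ.real (dBall s r) ≤ A * 12 ^ υ * μ.real (dBall s ρ) := h4
      _ ≤ A * 12 ^ υ * (A * 144 ^ υ * U) := by gcongr
      _ = _ := by ring
  have hd := dist_nonneg s y
  have hzy : 0 < dist z y := hρ.trans_le hρy
  have h5 : (ρ / dist z y) ^ q ≤ 27 ^ q * (r / (r + dist s y)) ^ q := by
    rw [← Real.mul_rpow (by norm_num) (by positivity)]
    refine Real.rpow_le_rpow (by positivity) ?_ hq
    have h7 := dist_triangle (g.norm_eq hs).le hz.le (g.norm_eq hy).le
    rw [dist_comm s z] at h7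
    rw [← mul_div_assoc, div_le_div_iff₀ hzy (by positivity)]
    have h8 : ρ * dist s y ≤ r * dist s y := by gcongr
    nlinarith
  have e1 : r ^ a = r ^ (-κ) * r ^ (p * (θ - α) + lam) := by
    rw [← Real.rpow_add hr, ha]; congr 1; ring
  calc _ = (ρ ^ (lam - p * α - κ) * ρ ^ (p * θ)) * U⁻¹ ^ 2 * (ρ / dist z y) ^ q := by ring
    _ ≤ (12 ^ |a| * r ^ a) * (A * 144 ^ υ * (A * 12 ^ υ) * (μ.real (dBall s r))⁻¹) ^ 2 *
        (27 ^ q * (r / (r + dist s y)) ^ q) := by gcongr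
    _ = _ := by rw [e1]; unfold kernelTerm; ring

/-- Weighted `p`-th powers of `avgKernel`, integrated against a measure that is
`κ`-dimensional near `E`, are controlled by `kernelNorm`. -/
theorem exists_lintegral_avgKernel_le (g : Growth E μ υ lam A) {p α q : ℝ} (hp : 1 ≤ p)
    (hq : υ < q) (θ : ℝ) {Z : Type*} [MeasurableSpace Z] {ν : Measure Z} [SFinite ν]
    {π : Z → Cn m} {φ : Z → ENNReal} (hπ : Measurable π) (hφ : Measurable φ)
    (hball : ∀ᵐ z ∂ν, ‖π z‖ < 1) {κ c : ℝ} (hc : 0 < c)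
    (hκ : ∀ s ∈ E, ∀ r, 0 < r → r ≤ 2 →
      ∫⁻ z in {z | dist (π z) s ≤ r}, φ z ∂ν ≤ ENNReal.ofReal (c * r ^ κ)) :
    ∃ C : ℝ, 0 < C ∧ ∀ {X : Cn m × Cn m → ENNReal}, Measurable X →
      ∫⁻ z, φ z * ENNReal.ofReal (distSet (π z) E ^ (lam - p * α - κ)) *
        avgKernel E μ q θ X (π z) ^ p ∂ν ≤ ENNReal.ofReal C * kernelNorm μ p α lam q θ X := by
  classical
  have := g.prob
  have hp0 : 0 < p := by linarith
  have hq0 : 0 ≤ q := g.nonneg.trans hq.le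
  obtain ⟨C₁, hC₁, hJ⟩ := g.exists_avgKernel_rpow_le hp hq θ
  obtain ⟨C₂, hC₂, hK⟩ := g.exists_pointwise_kernel_le (p := p) (α := α) hq0 θ κ
  refine ⟨C₁ * C₂ * c, by positivity, ?_⟩
  intro X hX
  have hρm : Measurable fun z => distSet (π z) E := (measurable_distSet g.nonempty).comp hπ
  have hUm : Measurable fun z => μ.real (dBall (π z) (6 * distSet (π z) E)) :=
    measurable_real_dBall hπ (hρm.const_mul 6)
  set ψ : Z → ℝ := fun z => distSet (π z) E ^ (lam - p * α - κ) * (distSet (π z) E ^ (p * θ) *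
        (μ.real (dBall (π z) (6 * distSet (π z) E)))⁻¹ ^ 2) with hψ
  have hψ0 : ∀ z, 0 ≤ ψ z := fun z => by
    have := distSet_nonneg E (π z)
    simp only [hψ]; positivity
  have hψm : Measurable ψ :=
    (hρm.pow_const _).mul ((hρm.pow_const _).mul (hUm.inv.pow_const 2))
  have h1 : ∫⁻ z, φ z * ENNReal.ofReal (distSet (π z) E ^ (lam - p * α - κ)) *
        avgKernel E μ q θ X (π z) ^ p ∂ν ≤
      ∫⁻ z, ∫⁻ x, ENNReal.ofReal C₁ * X x ^ p *
        (φ z * ENNReal.ofReal (ψ z) * if ‖π z‖ < 1 then avgWeight E q (π z) x else 0)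
          ∂(μ.prod μ) ∂ν := by
    refine lintegral_mono_ae ?_
    filter_upwards [hball] with z hz
    simp only [if_pos hz]
    have hw : Measurable fun x => X x ^ p * avgWeight E q (π z) x :=
      (hX.pow_const p).mul (measurable_avgWeight g.nonempty q measurable_const measurable_id)
    calc φ z * ENNReal.ofReal (distSet (π z) E ^ (lam - p * α - κ)) *
          avgKernel E μ q θ X (π z) ^ p
        ≤ φ z * ENNReal.ofReal (distSet (π z) E ^ (lam - p * α - κ)) *
          (ENNReal.ofReal (C₁ * (distSet (π z) E ^ (p * θ) *
          (μ.real (dBall (π z) (6 * distSet (π z) E)))⁻¹ ^ 2)) *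
          ∫⁻ x, X x ^ p * avgWeight E q (π z) x ∂(μ.prod μ)) := by
            gcongr
            exact hJ hX (π z) hz
      _ = (ENNReal.ofReal C₁ * (φ z * ENNReal.ofReal (ψ z))) *
          ∫⁻ x, X x ^ p * avgWeight E q (π z) x ∂(μ.prod μ) := by
            have := distSet_nonneg E (π z)
            have e : ENNReal.ofReal (ψ z) = _ :=
              ENNReal.ofReal_mul (Real.rpow_nonneg this (lam - p * α - κ))
            rw [e, ENNReal.ofReal_mul hC₁.le]
            ring
      _ = ∫⁻ x, ENNReal.ofReal C₁ * (φ z * ENNReal.ofReal (ψ z)) *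
          (X x ^ p * avgWeight E q (π z) x) ∂(μ.prod μ) := (lintegral_const_mul _ hw).symm
      _ = _ := by
            refine lintegral_congr fun x => ?_
            ring
  refine h1.trans ?_
  have hwm : Measurable fun a : Z × (Cn m × Cn m) =>
      if ‖π a.1‖ < 1 then avgWeight E q (π a.1) a.2 else 0 :=
    Measurable.ite (measurableSet_lt (hπ.comp measurable_fst).norm measurable_const)
      (measurable_avgWeight g.nonempty q (hπ.comp measurable_fst) measurable_snd) measurable_const
  have hFm : Measurable fun a : Z × (Cn m × Cn m) => ENNReal.ofReal C₁ * X a.2 ^ p *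
        (φ a.1 * ENNReal.ofReal (ψ a.1) * if ‖π a.1‖ < 1 then avgWeight E q (π a.1) a.2 else 0) :=
    (((hX.comp measurable_snd).pow_const p).const_mul _).mul
      (((hφ.comp measurable_fst).mul (hψm.comp measurable_fst).ennreal_ofReal).mul hwm)
  -- The inner integral now runs over `z` with `(y, s)` fixed. The shell of radius `r` has mass
  -- `O(r^κ)`, which cancels the `r^(-κ)` of the pointwise bound, so the sum over shells is
  -- `kernelW`.
  rw [lintegral_lintegral_swap hFm.aemeasurable]
  unfold kernelNorm
  rw [← lintegral_const_mul' _ _ ENNReal.ofReal_ne_top]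
  have hEE : ∀ᵐ x ∂(μ.prod μ), x.1 ∈ E ∧ x.2 ∈ E := by
    have h1 := Measure.quasiMeasurePreserving_fst (μ := μ) (ν := μ) |>.ae g.ae_mem
    have h2 := Measure.quasiMeasurePreserving_snd (μ := μ) (ν := μ) |>.ae g.ae_mem
    filter_upwards [h1, h2] with x a b using ⟨a, b⟩
  refine lintegral_mono_ae ?_
  filter_upwards [hEE] with x hx
  obtain ⟨hy, hs⟩ := hx
  have hzm : Measurable fun z =>
      φ z * ENNReal.ofReal (ψ z) * if ‖π z‖ < 1 then avgWeight E q (π z) x else 0 :=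
    (hφ.mul hψm.ennreal_ofReal).mul (Measurable.ite (measurableSet_lt hπ.norm measurable_const)
      (measurable_avgWeight g.nonempty q hπ measurable_const) measurable_const)
  rw [lintegral_const_mul _ hzm]
  have h2 : ∫⁻ z, φ z * ENNReal.ofReal (ψ z) *
      (if ‖π z‖ < 1 then avgWeight E q (π z) x else 0) ∂ν ≤
      ∑' l, ENNReal.ofReal (C₂ * rad l ^ (-κ) * kernelTerm μ p α lam q θ x.2 x.1 (rad l)) *
        ENNReal.ofReal (c * rad l ^ κ) := by
    refine lintegral_le_tsum_dyadic (D := fun z => dist (π z) x.2) (φ := φ)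
      (measurable_dist hπ measurable_const) hφ ?_ ?_ ?_
    · intro z hz
      have hz1 : ‖π z‖ < 1 := by
        by_contra h
        simp [h] at hz
      exact ⟨(distSet_pos g.nonempty g.sub hz1).trans_le (distSet_le _ hs),
        dist_le_two hz1.le (g.norm_eq hs).le⟩
    · intro l z hl1 hl2
      by_cases hz1 : ‖π z‖ < 1
      · rw [if_pos hz1, avgWeight]
        split_ifs with h6
        · rw [mul_assoc, mul_comm, ← ENNReal.ofReal_mul (hψ0 z)]
          rw [rad_succ] at hl1
          refine mul_le_mul_left (ENNReal.ofReal_le_ofReal ?_) _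
          exact hK (π z) hz1 x.2 hs x.1 hy (rad l) (rad_pos l) h6 hl1 hl2
        · rw [mul_zero]; exact zero_le
      · rw [if_neg hz1, mul_zero]; exact zero_le
    · intro l
      exact hκ x.2 hs (rad l) (rad_pos l) (rad_le_two l)
  have h3 : ∀ l, ENNReal.ofReal (C₂ * rad l ^ (-κ) * kernelTerm μ p α lam q θ x.2 x.1 (rad l)) *
        ENNReal.ofReal (c * rad l ^ κ) =
      ENNReal.ofReal (C₂ * c) * ENNReal.ofReal (kernelTerm μ p α lam q θ x.2 x.1 (rad l)) := by
    intro l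
    have hr := rad_pos l
    have hk := kernelTerm_nonneg μ p α lam q θ x.2 x.1 hr
    rw [← ENNReal.ofReal_mul (by positivity), ← ENNReal.ofReal_mul (by positivity)]
    congr 1
    rw [Real.rpow_neg hr.le]
    have := Real.rpow_pos_of_pos hr κ
    field_simp
  simp only [h3] at h2
  rw [ENNReal.tsum_mul_left] at h2
  refine (mul_le_mul_right h2 _).trans (le_of_eq ?_)
  rw [show C₁ * C₂ * c = C₁ * (C₂ * c) by ring, ENNReal.ofReal_mul hC₁.le]
  unfold kernelW
  ring

end Growth
end Averages
-- Powers of the distance to E, integrated along rays and over the sphere.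
section SphereIntegrals

variable {m : ℕ}

theorem lintegral_one_sub_rpow_le {a : ℝ} (ha : 0 < a) {r : ℝ} (hr : 0 < r) :
    ∫⁻ t in {t : ℝ | 1 - t ≤ r}, ENNReal.ofReal ((1 - t) ^ (a - 1))
      ∂(volume.restrict (Set.Ioo (0 : ℝ) 1)) ≤ ENNReal.ofReal (r ^ a / a) := by
  have hms : MeasurableSet {t : ℝ | 1 - t ≤ r} :=
    measurableSet_le (measurable_const.sub measurable_id) measurable_const
  rw [Measure.restrict_restrict hms]
  set F : ℝ → ENNReal := (Set.Ioc 0 r).indicator fun u => ENNReal.ofReal (u ^ (a - 1))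
  have h1 : ∫⁻ t in {t : ℝ | 1 - t ≤ r} ∩ Set.Ioo (0 : ℝ) 1, ENNReal.ofReal ((1 - t) ^ (a - 1)) ≤
      ∫⁻ t, F (1 - t) := by
    rw [← lintegral_indicator (hms.inter measurableSet_Ioo)]
    refine lintegral_mono fun t => ?_
    by_cases ht : t ∈ {t : ℝ | 1 - t ≤ r} ∩ Set.Ioo (0 : ℝ) 1
    · have h2 : 1 - t ∈ Set.Ioc 0 r := ⟨by linarith [ht.2.2], ht.1⟩
      rw [Set.indicator_of_mem ht]
      simp only [F]
      rw [Set.indicator_of_mem h2]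
    · rw [Set.indicator_of_notMem ht]; exact zero_le
  refine h1.trans ?_
  rw [lintegral_sub_left_eq_self F (1 : ℝ)]
  simp only [F]
  rw [lintegral_indicator measurableSet_Ioc]
  have hintg : IntervalIntegrable (fun u : ℝ => u ^ (a - 1)) volume 0 r :=
    intervalIntegral.intervalIntegrable_rpow' (by linarith)
  rw [← ofReal_integral_eq_lintegral_ofReal]
  · rw [← intervalIntegral.integral_of_le hr.le, integral_rpow (Or.inl (by linarith))]
    rw [sub_add_cancel, Real.zero_rpow ha.ne', sub_zero]
  · exact (intervalIntegrable_iff_integrableOn_Ioc_of_le hr.le).1 hintg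
  · filter_upwards [ae_restrict_mem measurableSet_Ioc] with u hu
    exact Real.rpow_nonneg hu.1.le _

theorem le_distSet_smul {E : Set (Cn m)} (hE : E.Nonempty) (hS : E ⊆ Metric.sphere 0 1) {z : Cn m}
    (hz : ‖z‖ ≤ 1) {t : ℝ} (ht0 : 0 ≤ t) (ht1 : t ≤ 1) :
    max (1 - t) (distSet z E / 2) ≤ distSet ((t : ℂ) • z) E := by
  refine le_distSet hE fun w hw => max_le ?_ ?_
  · refine le_trans ?_ (one_sub_norm_le_dist _ (mem_sphere_zero_iff_norm.1 (hS hw)).le)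
    rw [norm_smul, Complex.norm_real, Real.norm_of_nonneg ht0]
    nlinarith [norm_nonneg z]
  · have h1 := distSet_le z hw
    have h2 := (dist_smul_right_le ht0 ht1 hz (mem_sphere_zero_iff_norm.1 (hS hw)).le).2
    linarith

/-- Along the ray the distance to `E` is at least `max (1 - t) (d(z,E)/2)`, and `(1 - t)^(a-1) dt`
has dimension `a` near `t = 1`; the additional decay `ε` is what `lintegral_div_rpow_le` needs. -/
theorem exists_lintegral_ray_le {a ε : ℝ} (ha : 0 < a) (hε : 0 < ε) :
    ∃ C : ℝ, 0 < C ∧ ∀ {E : Set (Cn m)}, E.Nonempty → E ⊆ Metric.sphere 0 1 → ∀ z : Cn m, ‖z‖ = 1 →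
      0 < distSet z E →
      ∫⁻ t in Set.Ioo (0 : ℝ) 1, ENNReal.ofReal ((1 - t) ^ (a - 1) *
        distSet ((t : ℂ) • z) E ^ (-(a + ε))) ≤ ENNReal.ofReal (C * distSet z E ^ (-ε)) := by
  have hgeo : 0 < (1 - ((1 : ℝ) / 2) ^ (a + ε - a))⁻¹ :=
    inv_pos.2 (sub_pos.2 (half_rpow_lt_one (by linarith)))
  set G := 2 ^ (a + ε + a) * (1 - ((1 : ℝ) / 2) ^ (a + ε - a))⁻¹
  have hG : 0 < G := by positivity
  refine ⟨G / a * 2 ^ ε, by positivity, ?_⟩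
  intro E hE hS z hz hρ
  set ρ := distSet z E / 2 with hρdef
  have hρ0 : 0 < ρ := by positivity
  have hρ2 : ρ ≤ 1 := by have := distSet_le_two hE hS hz.le; linarith
  set φ : ℝ → ENNReal := fun t => ENNReal.ofReal ((1 - t) ^ (a - 1))
  have hφm : Measurable φ := ((measurable_const.sub measurable_id).pow_const _).ennreal_ofReal
  set D : ℝ → ℝ := fun t => max (1 - t) ρ
  have hD : Measurable D := (measurable_const.sub measurable_id).max measurable_const
  set ν := (volume.restrict (Set.Ioo (0 : ℝ) 1)).withDensity φ with hν
  have hDpos : ∀ t, 0 < D t := fun t => hρ0.trans_le (le_max_right _ _)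
  have key := lintegral_div_rpow_le (ν := ν) hD (B := ρ ^ a / a) (υ := a) (q := a + ε) (ρ := ρ)
    (by positivity) ha.le (by linarith) hρ0 ?_ ?_
  · calc ∫⁻ t in Set.Ioo (0 : ℝ) 1, ENNReal.ofReal ((1 - t) ^ (a - 1) *
        distSet ((t : ℂ) • z) E ^ (-(a + ε)))
        ≤ ∫⁻ t in Set.Ioo (0 : ℝ) 1, ENNReal.ofReal (ρ ^ (-(a + ε))) *
            (φ t * ENNReal.ofReal ((ρ / D t) ^ (a + ε))) := by
          refine setLIntegral_mono' measurableSet_Ioo fun t ht => ?_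
          have h1t : 0 < 1 - t := by linarith [ht.2]
          simp only [φ]
          rw [← ENNReal.ofReal_mul (by positivity), ← ENNReal.ofReal_mul (by positivity)]
          refine ENNReal.ofReal_le_ofReal ?_
          have h1 := le_distSet_smul hE hS hz.le ht.1.le ht.2.le
          have h2 : distSet ((t : ℂ) • z) E ^ (-(a + ε)) ≤ D t ^ (-(a + ε)) :=
            Real.rpow_le_rpow_of_nonpos (hDpos t) h1 (by linarith)
          have h3 : ρ ^ (-(a + ε)) * (ρ / D t) ^ (a + ε) = D t ^ (-(a + ε)) := by
            rw [Real.div_rpow hρ0.le (hDpos t).le, Real.rpow_neg hρ0.le, Real.rpow_neg (hDpos t).le]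
            have := Real.rpow_pos_of_pos hρ0 (a + ε)
            field_simp
          calc (1 - t) ^ (a - 1) * distSet ((t : ℂ) • z) E ^ (-(a + ε))
              ≤ (1 - t) ^ (a - 1) * D t ^ (-(a + ε)) := by gcongr
            _ = _ := by rw [← h3]; ring
      _ = ENNReal.ofReal (ρ ^ (-(a + ε))) * ∫⁻ t, ENNReal.ofReal ((ρ / D t) ^ (a + ε)) ∂ν := by
          have hm : Measurable fun t => ENNReal.ofReal ((ρ / D t) ^ (a + ε)) :=
            ((measurable_const.div hD).pow_const _).ennreal_ofReal
          rw [lintegral_const_mul' _ _ ENNReal.ofReal_ne_top, hν,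
            lintegral_withDensity_eq_lintegral_mul _ hφm hm]
          rfl
      _ ≤ ENNReal.ofReal (ρ ^ (-(a + ε))) * ENNReal.ofReal (G * (ρ ^ a / a)) := by gcongr
      _ = ENNReal.ofReal (G / a * 2 ^ ε * distSet z E ^ (-ε)) := by
          rw [← ENNReal.ofReal_mul (by positivity)]
          congr 1
          have e1 : distSet z E ^ (-ε) = 2 ^ (-ε) * ρ ^ (-ε) := by
            rw [← Real.mul_rpow (by norm_num) hρ0.le]; congr 1; rw [hρdef]; ring
          have e2 : ρ ^ (-(a + ε)) * ρ ^ a = ρ ^ (-ε) := by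
            rw [← Real.rpow_add hρ0]; congr 1; ring
          have e3 : (2 : ℝ) ^ ε * 2 ^ (-ε) = 1 := by
            rw [← Real.rpow_add (by norm_num), add_neg_cancel, Real.rpow_zero]
          rw [e1]
          calc _ = G / a * (ρ ^ (-(a + ε)) * ρ ^ a) := by ring
            _ = G / a * (2 ^ ε * 2 ^ (-ε)) * ρ ^ (-ε) := by rw [e2, e3]; ring
            _ = _ := by ring
  · have hac : ν ≪ volume.restrict (Set.Ioo (0 : ℝ) 1) := withDensity_absolutelyContinuous _ _
    refine hac.ae_le ?_
    filter_upwards [ae_restrict_mem measurableSet_Ioo] with t ht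
    exact ⟨le_max_right _ _, max_le (by linarith [ht.1]) (by linarith)⟩
  · intro r hr
    have hr0 : 0 < r := hρ0.trans_le hr
    rw [hν, withDensity_apply _ (measurableSet_lt hD measurable_const)]
    have hsub : {t | D t < r} ⊆ {t : ℝ | 1 - t ≤ r} := fun t ht => by
      have h1 : D t < r := ht
      have h2 : 1 - t ≤ D t := le_max_left _ _
      exact h2.trans h1.le
    calc ∫⁻ t in {t | D t < r}, φ t ∂(volume.restrict (Set.Ioo (0 : ℝ) 1))
        ≤ ∫⁻ t in {t : ℝ | 1 - t ≤ r}, φ t ∂(volume.restrict (Set.Ioo (0 : ℝ) 1)) :=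
          lintegral_mono_set hsub
      _ ≤ ENNReal.ofReal (r ^ a / a) := lintegral_one_sub_rpow_le ha hr0
      _ ≤ ENNReal.ofReal (ρ ^ a / a * (r / ρ) ^ a) := by
          refine ENNReal.ofReal_le_ofReal (le_of_eq ?_)
          rw [Real.div_rpow hr0.le hρ0.le]
          have := Real.rpow_pos_of_pos hρ0 a
          field_simp

namespace Growth

variable {E : Set (Cn m)} {μ : Measure (Cn m)} {υ lam A : ℝ} {e : Cn m → Fin (m + 1) → Cn m}

/-- On `E` one has `μ(B(z,r)) ≳ r^υ`. Integrating this over `E` with respect to surface measure and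
exchanging the integrals gives `r^υ σ(E) ≲ r^n`; then `r → 0` with `υ < n`. -/
theorem toSphere_eq_zero (g : Growth E μ υ lam A) (he : IsFrame e) (hυ : υ < ((m + 1 : ℕ) : ℝ)) :
    (volume : Measure (Cn m)).toSphere {z | distSet (z : Cn m) E = 0} = 0 := by
  have := g.prob
  have hA := g.A_pos
  obtain ⟨C, hC, hσ⟩ := exists_toSphere_dBall_le he
  set σ := (volume : Measure (Cn m)).toSphere
  set S : Set (Metric.sphere (0 : Cn m) 1) := {z | distSet (z : Cn m) E = 0}
  have hSm : MeasurableSet S :=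
    (measurableSet_singleton (0 : ℝ)).preimage
      ((measurable_distSet g.nonempty).comp measurable_subtype_coe)
  have hSE : ∀ z ∈ S, (z : Cn m) ∈ E := by
    intro z hz
    have hz' : distSet (z : Cn m) E = 0 := hz
    obtain ⟨w, hw, hmin⟩ := g.isCompact.exists_isMinOn g.nonempty
      (f := fun w => dist (z : Cn m) w)
      (continuous_dist_comp continuous_const continuous_id).continuousOn
    have h0 : dist (z : Cn m) w ≤ distSet (z : Cn m) E := le_distSet g.nonempty fun w' hw' => hmin hw'
    have h1 : dist (z : Cn m) w = 0 := le_antisymm (hz' ▸ h0) (dist_nonneg _ _)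
    have := dist_eq_zero_imp (norm_eq_of_mem_sphere z).le (g.norm_eq hw).le h1
    rwa [this]
  have hbound : ∀ l, σ S ≤ ENNReal.ofReal (A * 3 ^ υ * C * rad l ^ (((m + 1 : ℕ) : ℝ) - υ)) := by
    intro l
    have hr := rad_pos l
    have h1 : ENNReal.ofReal ((A * 3 ^ υ)⁻¹ * rad l ^ υ) * σ S ≤
        ENNReal.ofReal (C * rad l ^ (m + 1)) := by
      calc _ = ∫⁻ z in S, ENNReal.ofReal ((A * 3 ^ υ)⁻¹ * rad l ^ υ) ∂σ := by
            rw [setLIntegral_const]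
        _ ≤ ∫⁻ z in S, μ (dBall (z : Cn m) (rad l)) ∂σ := by
            refine setLIntegral_mono' hSm fun z hz => ?_
            rw [← ofReal_measureReal (μ := μ) (s := dBall (z : Cn m) (rad l))]
            refine ENNReal.ofReal_le_ofReal ?_
            rw [inv_mul_le_iff₀ (by positivity)]
            exact g.rpow_le_real (hSE z hz) hr (by linarith [rad_le_two l])
        _ ≤ ∫⁻ z, μ (dBall (z : Cn m) (rad l)) ∂σ := setLIntegral_le_lintegral _ _
        _ = ∫⁻ z, ∫⁻ w, (if dist (z : Cn m) w < rad l then 1 else 0) ∂μ ∂σ := by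
            refine lintegral_congr fun z => ?_
            rw [← setLIntegral_one, ← lintegral_indicator (measurableSet_dBall _ _)]
            rfl
        _ = ∫⁻ w, ∫⁻ z, (if dist (z : Cn m) w < rad l then 1 else 0) ∂σ ∂μ := by
            refine lintegral_lintegral_swap (Measurable.aemeasurable ?_)
            exact Measurable.ite (measurableSet_lt (measurable_dist
              (measurable_subtype_coe.comp measurable_fst) measurable_snd) measurable_const)
              measurable_const measurable_const
        _ ≤ ∫⁻ w, ENNReal.ofReal (C * rad l ^ (m + 1)) ∂μ := by
            refine lintegral_mono_ae ?_
            filter_upwards [g.ae_mem] with w hw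
            have : ∫⁻ z, (if dist (z : Cn m) w < rad l then 1 else 0 : ENNReal) ∂σ =
                σ {z | dist (z : Cn m) w < rad l} := by
              rw [← setLIntegral_one, ← lintegral_indicator (measurableSet_lt
                (measurable_dist measurable_subtype_coe measurable_const) measurable_const)]
              rfl
            rw [this]
            exact hσ w (g.norm_eq hw) (rad l) hr
        _ = _ := by simp
    have h2 : σ S = ENNReal.ofReal (A * 3 ^ υ * rad l ^ (-υ)) *
        (ENNReal.ofReal ((A * 3 ^ υ)⁻¹ * rad l ^ υ) * σ S) := by
      rw [← mul_assoc, ← ENNReal.ofReal_mul (by positivity)]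
      have : A * 3 ^ υ * rad l ^ (-υ) * ((A * 3 ^ υ)⁻¹ * rad l ^ υ) = 1 := by
        rw [Real.rpow_neg hr.le]
        have := Real.rpow_pos_of_pos hr υ
        field_simp
      rw [this]; simp
    rw [h2]
    refine (mul_le_mul_right h1 _).trans ?_
    rw [← ENNReal.ofReal_mul (by positivity)]
    refine ENNReal.ofReal_le_ofReal (le_of_eq ?_)
    rw [sub_eq_add_neg, Real.rpow_add hr, Real.rpow_natCast]
    ring
  have hlim : Tendsto (fun l => ENNReal.ofReal (A * 3 ^ υ * C * rad l ^ (((m + 1 : ℕ) : ℝ) - υ)))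
      atTop (𝓝 0) := by
    have hpos : 0 < ((m + 1 : ℕ) : ℝ) - υ := by linarith
    have h1 : Tendsto (fun l => rad l ^ (((m + 1 : ℕ) : ℝ) - υ)) atTop (𝓝 0) := by
      have := tendsto_rad.rpow_const (p := ((m + 1 : ℕ) : ℝ) - υ) (Or.inr hpos.le)
      rwa [Real.zero_rpow hpos.ne'] at this
    have h2 := ENNReal.tendsto_ofReal (h1.const_mul (A * 3 ^ υ * C))
    simpa using h2
  exact le_antisymm (ge_of_tendsto' hlim hbound) zero_le

-- Since `μ(B(z,6ρ))` is at least of order `(ρ/r)^υ μ(B(s,r))`, the power `ρ^(-η)` is dominated by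
-- an average over `w ∈ E` near `s` of `d(z,w)^(-(η+υ))`. After Fubini only a power below the
-- dimension `n` of the sphere is to be integrated.
set_option maxHeartbeats 1000000 in
theorem exists_lintegral_distSet_rpow_le (g : Growth E μ υ lam A) (he : IsFrame e) {η : ℝ}
    (hη : 0 ≤ η) (hηυ : η + υ < ((m + 1 : ℕ) : ℝ)) :
    ∃ C : ℝ, 0 < C ∧ ∀ s ∈ E, ∀ r, 0 < r → r ≤ 2 →
      ∫⁻ z in {z : Metric.sphere (0 : Cn m) 1 | dist (z : Cn m) s ≤ r},
        ENNReal.ofReal (distSet (z : Cn m) E ^ (-η)) ∂(volume : Measure (Cn m)).toSphere ≤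
      ENNReal.ofReal (C * r ^ (((m + 1 : ℕ) : ℝ) - η)) := by
  have := g.prob
  have hA := g.A_pos
  have hυ0 := g.nonneg
  obtain ⟨C, hC, hσ⟩ := exists_toSphere_dBall_le he
  set n : ℝ := ((m + 1 : ℕ) : ℝ) with hn
  set σ := (volume : Measure (Cn m)).toSphere
  set x := η + υ with hx
  have hx0 : 0 ≤ x := by positivity
  have hgeo : 0 < (1 - ((1 : ℝ) / 2) ^ (n - x))⁻¹ :=
    inv_pos.2 (sub_pos.2 (half_rpow_lt_one (by linarith)))
  set G := 2 ^ x * (C * 16 ^ n) * ((1 - ((1 : ℝ) / 2) ^ (n - x))⁻¹ * 2 ^ (n - x)) with hG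
  have hGpos : 0 < G := by positivity
  -- The points in use satisfy `d(z,w) < 6ρ ≤ 6r`, so `d(z,w)/8 < r ≤ 2`; the division by 8 stays
  -- within the range of `lintegral_rpow_neg_le`.
  have hpow : ∀ w ∈ E, ∀ r, 0 < r → r ≤ 2 →
      ∫⁻ z in {z : Metric.sphere (0 : Cn m) 1 | 0 < dist (z : Cn m) w / 8 ∧ dist (z : Cn m) w / 8 < r},
        ENNReal.ofReal ((dist (z : Cn m) w / 8) ^ (-x)) ∂σ ≤ ENNReal.ofReal (G * r ^ (n - x)) := by
    intro w hw r hr hr2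
    refine (lintegral_rpow_neg_le (ν := σ) (D := fun z => dist (z : Cn m) w / 8) (C := C * 16 ^ n)
      (κ := n) (x := x) ((measurable_dist measurable_subtype_coe measurable_const).div_const 8)
      (by positivity) hx0 hηυ ?_ hr hr2).trans ?_
    · intro t ht _
      calc σ {z : Metric.sphere (0 : Cn m) 1 | dist (z : Cn m) w / 8 ≤ t}
          ≤ σ {z : Metric.sphere (0 : Cn m) 1 | dist (z : Cn m) w < 16 * t} :=
            measure_mono fun z hz => by
              have : dist (z : Cn m) w / 8 ≤ t := hz
              change dist (z : Cn m) w < 16 * t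
              linarith
        _ ≤ _ := hσ w (g.norm_eq hw) (16 * t) (by positivity)
        _ = _ := by
          rw [← Real.rpow_natCast, Real.mul_rpow (by norm_num) ht.le]
          congr 1; rw [hn]; ring
    · refine ENNReal.ofReal_le_ofReal (le_of_eq ?_)
      rw [Real.mul_rpow (by norm_num) hr.le, hG]; ring
  set M := 8 ^ (-x) * 6 ^ x * (A * 51 ^ υ) with hM
  have hMpos : 0 < M := by positivity
  refine ⟨M * (A * 22 ^ υ) * G, by positivity, ?_⟩
  intro s hs r hr hr2
  have hV := g.pos s hs r hr
  set V := μ.real (dBall s r)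
  set P : Metric.sphere (0 : Cn m) 1 → Cn m → ENNReal := fun z w =>
    if (0 < dist (z : Cn m) w / 8 ∧ dist (z : Cn m) w / 8 < r) ∧ dist s w < 22 * r then
      ENNReal.ofReal ((dist (z : Cn m) w / 8) ^ (-x)) else 0 with hP
  have hPm : Measurable fun a : Metric.sphere (0 : Cn m) 1 × Cn m => P a.1 a.2 := by
    have h1 : Measurable fun a : Metric.sphere (0 : Cn m) 1 × Cn m => dist (a.1 : Cn m) a.2 / 8 :=
      (measurable_dist (measurable_subtype_coe.comp measurable_fst) measurable_snd).div_const 8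
    refine Measurable.ite ?_ (h1.pow_const _).ennreal_ofReal measurable_const
    exact ((measurableSet_lt measurable_const h1).inter (measurableSet_lt h1 measurable_const)).inter
      (measurableSet_lt (measurable_dist measurable_const measurable_snd) measurable_const)
  have hpt : ∀ z : Metric.sphere (0 : Cn m) 1, 0 < distSet (z : Cn m) E → dist (z : Cn m) s ≤ r →
      ENNReal.ofReal (distSet (z : Cn m) E ^ (-η)) ≤
        ENNReal.ofReal (M * r ^ υ * V⁻¹) * ∫⁻ w, P z w ∂μ := by
    intro z hρ hzs
    have hz1 : ‖(z : Cn m)‖ ≤ 1 := (norm_eq_of_mem_sphere z).le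
    obtain ⟨w₀, hw₀, hzw₀, hle⟩ := g.exists_near hz1 hρ
    have hU := g.real_dBall_pos hz1 hρ
    set ρ := distSet (z : Cn m) E
    set U := μ.real (dBall (z : Cn m) (6 * ρ))
    have hρr : ρ ≤ r := (distSet_le _ hs).trans hzs
    have h1 : V ≤ A * (51 * r / ρ) ^ υ * U := by
      -- As `ρ ≤ r`, points of `B(s,r)` in `E` are within `3 (3 (3/2 + 1) + 1) r = (51/2) r` of
      -- `w₀`.
      have h2 := g.upper w₀ hw₀ (ρ / 2) (51 / 2 * r) (by linarith) (by linarith)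
      have h3 : V ≤ μ.real (dBall w₀ (51 / 2 * r)) := by
        refine g.real_mono fun y hy hsy => ?_
        have h4 : dist s y < r := hsy
        have h5 := dist_triangle (g.norm_eq hw₀).le hz1 (g.norm_eq hs).le
        have h6 := dist_triangle (g.norm_eq hw₀).le (g.norm_eq hs).le (g.norm_eq hy).le
        rw [dist_comm w₀ z] at h5
        change dist w₀ y < _
        linarith
      rw [show 51 / 2 * r / (ρ / 2) = 51 * r / ρ by field_simp] at h2
      calc V ≤ _ := h3
        _ ≤ _ := h2
        _ ≤ _ := by gcongr
    have h2 : ENNReal.ofReal ((6 * ρ / 8) ^ (-x) * U) ≤ ∫⁻ w, P z w ∂μ := by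
      rw [ENNReal.ofReal_mul (by positivity), ofReal_measureReal,
        ← setLIntegral_const, ← lintegral_indicator (measurableSet_dBall _ _)]
      refine lintegral_mono_ae ?_
      filter_upwards [g.ae_mem] with w hw
      by_cases hzw : w ∈ dBall (z : Cn m) (6 * ρ)
      · rw [Set.indicator_of_mem hzw]
        have h3 : dist (z : Cn m) w < 6 * ρ := hzw
        have h4 : ρ ≤ dist (z : Cn m) w := distSet_le _ hw
        have h5 := dist_triangle (g.norm_eq hs).le hz1 (g.norm_eq hw).le
        rw [dist_comm s z] at h5
        simp only [hP]
        rw [if_pos ⟨⟨by linarith, by linarith⟩, by linarith⟩]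
        refine ENNReal.ofReal_le_ofReal ?_
        exact Real.rpow_le_rpow_of_nonpos (by linarith) (by linarith) (by linarith)
      · rw [Set.indicator_of_notMem hzw]; exact zero_le
    refine le_trans ?_ (mul_le_mul_right h2 _)
    rw [← ENNReal.ofReal_mul (by positivity)]
    refine ENNReal.ofReal_le_ofReal ?_
    have h3 : 1 ≤ A * (51 * r / ρ) ^ υ * U * V⁻¹ := by
      rw [← div_eq_mul_inv, le_div_iff₀ hV, one_mul]; exact h1
    have e1 : (51 * r / ρ) ^ υ = 51 ^ υ * r ^ υ * ρ ^ (-υ) := by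
      rw [Real.div_rpow (by positivity) hρ.le, Real.mul_rpow (by norm_num) hr.le,
        Real.rpow_neg hρ.le, div_eq_mul_inv]
    have e2 : (6 * ρ / 8) ^ (-x) = (6 ^ x)⁻¹ * ρ ^ (-x) * (8 ^ (-x))⁻¹ := by
      rw [Real.div_rpow (by positivity) (by norm_num), Real.mul_rpow (by norm_num) hρ.le,
        Real.rpow_neg (by norm_num : (0:ℝ) ≤ 6), div_eq_mul_inv]
    have e3 : ρ ^ (-x) = ρ ^ (-η) * ρ ^ (-υ) := by
      rw [← Real.rpow_add hρ, hx]; congr 1; ring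
    have h8 : (0 : ℝ) < 8 ^ (-x) := by positivity
    have h6 : (0 : ℝ) < 6 ^ x := by positivity
    calc ρ ^ (-η) ≤ ρ ^ (-η) * (A * (51 * r / ρ) ^ υ * U * V⁻¹) :=
          le_mul_of_one_le_right (by positivity) h3
      _ = _ := by
          rw [e1, e2, e3, hM]
          field_simp
  have hnull := g.toSphere_eq_zero he (by linarith)
  have hpos : ∀ᵐ z : Metric.sphere (0 : Cn m) 1 ∂σ, 0 < distSet (z : Cn m) E := by
    rw [ae_iff]
    refine measure_mono_null (fun z hz => ?_) hnull
    exact le_antisymm (not_lt.1 hz) (distSet_nonneg _ _)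
  have hSm : MeasurableSet {z : Metric.sphere (0 : Cn m) 1 | dist (z : Cn m) s ≤ r} :=
    measurableSet_le (measurable_dist measurable_subtype_coe measurable_const) measurable_const
  calc _ ≤ ∫⁻ z in {z : Metric.sphere (0 : Cn m) 1 | dist (z : Cn m) s ≤ r},
          ENNReal.ofReal (M * r ^ υ * V⁻¹) * ∫⁻ w, P z w ∂μ ∂σ := by
        refine lintegral_mono_ae ?_
        filter_upwards [ae_restrict_mem hSm, ae_restrict_of_ae hpos] with z h1 h2
        exact hpt z h2 h1
    _ ≤ ∫⁻ z, ENNReal.ofReal (M * r ^ υ * V⁻¹) * ∫⁻ w, P z w ∂μ ∂σ := setLIntegral_le_lintegral _ _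
    _ = ENNReal.ofReal (M * r ^ υ * V⁻¹) * ∫⁻ w, ∫⁻ z, P z w ∂σ ∂μ := by
        rw [lintegral_const_mul' _ _ ENNReal.ofReal_ne_top, lintegral_lintegral_swap hPm.aemeasurable]
    _ ≤ ENNReal.ofReal (M * r ^ υ * V⁻¹) *
          (ENNReal.ofReal (G * r ^ (n - x)) * ENNReal.ofReal (A * 22 ^ υ * V)) := by
        refine mul_le_mul_right ?_ _
        calc _ ≤ ∫⁻ w, (dBall s (22 * r)).indicator
              (fun _ => ENNReal.ofReal (G * r ^ (n - x))) w ∂μ := by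
              refine lintegral_mono_ae ?_
              filter_upwards [g.ae_mem] with w hw
              by_cases hsw : w ∈ dBall s (22 * r)
              · rw [Set.indicator_of_mem hsw]
                refine le_trans ?_ (hpow w hw r hr hr2)
                have hmw : Measurable fun z : Metric.sphere (0 : Cn m) 1 => dist (z : Cn m) w / 8 :=
                  (measurable_dist measurable_subtype_coe measurable_const).div_const 8
                have hms : MeasurableSet {z : Metric.sphere (0 : Cn m) 1 |
                    0 < dist (z : Cn m) w / 8 ∧ dist (z : Cn m) w / 8 < r} :=
                  (measurableSet_lt measurable_const hmw).inter
                    (measurableSet_lt hmw measurable_const)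
                rw [← lintegral_indicator hms]
                refine lintegral_mono fun z => ?_
                simp only [hP]
                split_ifs with h
                · exact le_of_eq (Set.indicator_of_mem (s := {z : Metric.sphere (0 : Cn m) 1 |
                    0 < dist (z : Cn m) w / 8 ∧ dist (z : Cn m) w / 8 < r}) h.1
                    (fun z => ENNReal.ofReal ((dist (z : Cn m) w / 8) ^ (-x)))).symm
                · exact zero_le
              · rw [Set.indicator_of_notMem hsw]
                have h22 : ¬ dist s w < 22 * r := hsw
                simp [hP, h22]
          _ = ENNReal.ofReal (G * r ^ (n - x)) * μ (dBall s (22 * r)) :=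
              lintegral_indicator_const (measurableSet_dBall _ _) _
          _ ≤ _ := by
              gcongr
              rw [← ofReal_measureReal (μ := μ) (s := dBall s (22 * r))]
              refine ENNReal.ofReal_le_ofReal ?_
              have := g.upper s hs r (22 * r) hr (by linarith)
              rwa [mul_div_assoc, div_self hr.ne', mul_one] at this
    _ = _ := by
        rw [← ENNReal.ofReal_mul (by positivity), ← ENNReal.ofReal_mul (by positivity)]
        congr 1
        have e1 : r ^ (n - η) = r ^ υ * r ^ (n - x) := by
          rw [← Real.rpow_add hr, hx]; congr 1; ring
        rw [e1]
        field_simp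

end Growth
end SphereIntegrals
-- The mixed norm on the sphere and the rays.
section RayIntegrals

variable {m : ℕ}

namespace Growth

variable {E : Set (Cn m)} {μ : Measure (Cn m)} {υ lam A : ℝ} {e : Cn m → Fin (m + 1) → Cn m}

theorem ae_toSphere_distSet_pos (g : Growth E μ υ lam A) (he : IsFrame e)
    (hυ : υ < ((m + 1 : ℕ) : ℝ)) :
    ∀ᵐ z : Metric.sphere (0 : Cn m) 1 ∂(volume : Measure (Cn m)).toSphere,
      0 < distSet (z : Cn m) E := by
  rw [ae_iff]
  refine measure_mono_null (fun z hz => ?_) (g.toSphere_eq_zero he hυ)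
  exact le_antisymm (not_lt.1 hz) (distSet_nonneg _ _)

/-- That `t z` is within `r` of `s` forces both `d(z,s) ≤ 2r` and `1 - t ≤ r`, so the region lies in
a product and the dimensions `n - η` and `a` add up. -/
theorem exists_lintegral_sphere_prod_le (g : Growth E μ υ lam A) (he : IsFrame e) {a η : ℝ}
    (ha : 0 < a) (hη : 0 ≤ η) (hηυ : η + υ < ((m + 1 : ℕ) : ℝ)) :
    ∃ C : ℝ, 0 < C ∧ ∀ s ∈ E, ∀ r, 0 < r → r ≤ 2 →
      ∫⁻ x in {x : Metric.sphere (0 : Cn m) 1 × ℝ | dist ((x.2 : ℂ) • (x.1 : Cn m)) s ≤ r},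
        ENNReal.ofReal (distSet (x.1 : Cn m) E ^ (-η)) * ENNReal.ofReal ((1 - x.2) ^ (a - 1))
        ∂((volume : Measure (Cn m)).toSphere.prod (volume.restrict (Set.Ioo (0 : ℝ) 1))) ≤
      ENNReal.ofReal (C * r ^ (((m + 1 : ℕ) : ℝ) + a - η)) := by
  obtain ⟨C, hC, hp⟩ := g.exists_lintegral_distSet_rpow_le he hη hηυ
  set n : ℝ := ((m + 1 : ℕ) : ℝ)
  have hυ0 := g.nonneg
  refine ⟨C * 2 ^ (n - η) / a, by positivity, ?_⟩
  intro s hs r hr hr2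
  set σ := (volume : Measure (Cn m)).toSphere
  set ν := (volume : Measure ℝ).restrict (Set.Ioo (0 : ℝ) 1)
  set B₁ : Set (Metric.sphere (0 : Cn m) 1) := {z | dist (z : Cn m) s ≤ min (2 * r) 2}
  set B₂ : Set ℝ := {t | 1 - t ≤ r}
  have hae : ∀ᵐ x ∂(σ.prod ν), x.2 ∈ Set.Ioo (0 : ℝ) 1 :=
    Measure.quasiMeasurePreserving_snd.ae (ae_restrict_mem measurableSet_Ioo)
  have hsub : {x : Metric.sphere (0 : Cn m) 1 × ℝ | dist ((x.2 : ℂ) • (x.1 : Cn m)) s ≤ r}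
      ≤ᵐ[σ.prod ν] B₁ ×ˢ B₂ := by
    filter_upwards [hae] with x hx hxs
    have hxs' : dist ((x.2 : ℂ) • (x.1 : Cn m)) s ≤ r := hxs
    have hx1 : ‖(x.1 : Cn m)‖ = 1 := norm_eq_of_mem_sphere x.1
    have hs1 := g.norm_eq hs
    have h1 := (dist_smul_right_le hx.1.le hx.2.le hx1.le hs1.le).2
    have h2 := one_sub_norm_le_dist ((x.2 : ℂ) • (x.1 : Cn m)) hs1.le
    rw [norm_smul, hx1, Complex.norm_real, Real.norm_of_nonneg hx.1.le, mul_one] at h2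
    refine ⟨le_min ?_ (dist_le_two hx1.le hs1.le), ?_⟩
    · change dist (x.1 : Cn m) s ≤ 2 * r; linarith
    · change 1 - x.2 ≤ r; linarith
  have hm1 : Measurable fun z : Metric.sphere (0 : Cn m) 1 =>
      ENNReal.ofReal (distSet (z : Cn m) E ^ (-η)) :=
    (((measurable_distSet g.nonempty).comp measurable_subtype_coe).pow_const _).ennreal_ofReal
  have hm2 : Measurable fun t : ℝ => ENNReal.ofReal ((1 - t) ^ (a - 1)) :=
    ((measurable_const.sub measurable_id).pow_const _).ennreal_ofReal
  refine (lintegral_mono' (Measure.restrict_mono_ae hsub) le_rfl).trans ?_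
  rw [← Measure.prod_restrict, lintegral_prod_mul hm1.aemeasurable hm2.aemeasurable]
  refine (mul_le_mul' (hp s hs (min (2 * r) 2) (by positivity) (min_le_right _ _))
    (lintegral_one_sub_rpow_le ha hr)).trans ?_
  rw [← ENNReal.ofReal_mul (by positivity)]
  refine ENNReal.ofReal_le_ofReal ?_
  have h1 : min (2 * r) 2 ^ (n - η) ≤ 2 ^ (n - η) * r ^ (n - η) := by
    rw [← Real.mul_rpow (by norm_num) hr.le]
    exact Real.rpow_le_rpow (by positivity) (min_le_left _ _) (by linarith)
  calc C * min (2 * r) 2 ^ (n - η) * (r ^ a / a)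
      ≤ C * (2 ^ (n - η) * r ^ (n - η)) * (r ^ a / a) := by gcongr
    _ = C * 2 ^ (n - η) / a * (r ^ (n - η) * r ^ a) := by ring
    _ = _ := by rw [← Real.rpow_add hr]; congr 2; ring

/-- Hölder's inequality in `t` with the weight `(1-t)^(a-1) d(tz,E)^(-(a+ε))`, whose mass is
`O(d(z,E)^(-ε))`, turns the inner `p`-th power into an integral with the extra factor `d(z,E)^(-η)`.
What results is a single integral over sphere times interval, of the form treated by
`exists_lintegral_avgKernel_le`. -/
theorem lintegral_ray_avgKernel_lt_top (g : Growth E μ υ lam A) (he : IsFrame e)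
    (hυ : υ < ((m + 1 : ℕ) : ℝ)) {p α q a β : ℝ} (hp : 1 ≤ p) (hq : υ < q) (ha : 0 < a)
    (hβ : β = α + (((m + 1 : ℕ) : ℝ) - lam) / p) (θ : ℝ) {X : Cn m × Cn m → ENNReal}
    (hX : Measurable X) (hfin : kernelNorm μ p α lam q θ X < ⊤) :
    ∫⁻ z : Metric.sphere (0 : Cn m) 1,
      (∫⁻ t in Set.Ioo (0 : ℝ) 1, ENNReal.ofReal ((1 - t) ^ (a - 1)) *
        (ENNReal.ofReal (distSet ((t : ℂ) • (z : Cn m)) E ^ (-(a + β))) *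
          avgKernel E μ q θ X ((t : ℂ) • (z : Cn m)))) ^ p
      ∂(volume : Measure (Cn m)).toSphere < ⊤ := by
  have := g.prob
  have hp0 : 0 < p := by linarith
  have hυ0 := g.nonneg
  set n : ℝ := ((m + 1 : ℕ) : ℝ) with hn
  -- This makes `ε p` half of `n - υ`, so that `η = ε (p - 1)` satisfies `η + υ < n`.
  set ε := (n - υ) / (2 * p) with hε
  have hε0 : 0 < ε := div_pos (by linarith) (by linarith)
  have hεp : ε * p = (n - υ) / 2 := by rw [hε]; field_simp
  set η := ε * (p - 1) with hη
  have hη0 : 0 ≤ η := mul_nonneg hε0.le (by linarith)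
  have hηυ : η + υ < n := by rw [hη, mul_sub, hεp, mul_one]; linarith
  obtain ⟨c, hc, hκ⟩ := g.exists_lintegral_sphere_prod_le he ha hη0 hηυ
  obtain ⟨C₁, hC₁, hray⟩ := exists_lintegral_ray_le (m := m) ha hε0
  set κ := n + a - η with hκdef
  set σ := (volume : Measure (Cn m)).toSphere with hσ
  set ν := (volume : Measure ℝ).restrict (Set.Ioo (0 : ℝ) 1) with hν
  set π : Metric.sphere (0 : Cn m) 1 × ℝ → Cn m := fun x => (x.2 : ℂ) • (x.1 : Cn m) with hπ
  have hπm : Measurable π :=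
    (Complex.measurable_ofReal.comp measurable_snd).smul (measurable_subtype_coe.comp measurable_fst)
  have hm1 : Measurable fun z : Metric.sphere (0 : Cn m) 1 =>
      ENNReal.ofReal (distSet (z : Cn m) E ^ (-η)) :=
    (((measurable_distSet g.nonempty).comp measurable_subtype_coe).pow_const _).ennreal_ofReal
  have hm2 : Measurable fun t : ℝ => ENNReal.ofReal ((1 - t) ^ (a - 1)) :=
    ((measurable_const.sub measurable_id).pow_const _).ennreal_ofReal
  have hφm : Measurable fun x : Metric.sphere (0 : Cn m) 1 × ℝ =>
      ENNReal.ofReal (distSet (x.1 : Cn m) E ^ (-η)) * ENNReal.ofReal ((1 - x.2) ^ (a - 1)) :=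
    (hm1.comp measurable_fst).mul (hm2.comp measurable_snd)
  have hball : ∀ᵐ x ∂(σ.prod ν), ‖π x‖ < 1 := by
    have hae : ∀ᵐ x ∂(σ.prod ν), x.2 ∈ Set.Ioo (0 : ℝ) 1 :=
      Measure.quasiMeasurePreserving_snd.ae (ae_restrict_mem measurableSet_Ioo)
    filter_upwards [hae] with x hx
    rw [hπ]
    simp only
    rw [norm_smul, norm_eq_of_mem_sphere x.1, Complex.norm_real, Real.norm_of_nonneg hx.1.le,
      mul_one]
    exact hx.2
  obtain ⟨C, hC, hFub⟩ := g.exists_lintegral_avgKernel_le (α := α) hp hq θ hπm hφm hball hc hκ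
  have hK := measurable_avgKernel g.nonempty μ q θ hX
  have hρm := measurable_distSet (m := m) g.nonempty
  have hpoint : ∀ᵐ z : Metric.sphere (0 : Cn m) 1 ∂σ,
      (∫⁻ t, ENNReal.ofReal ((1 - t) ^ (a - 1)) *
        (ENNReal.ofReal (distSet ((t : ℂ) • (z : Cn m)) E ^ (-(a + β))) *
          avgKernel E μ q θ X ((t : ℂ) • (z : Cn m))) ∂ν) ^ p ≤
      ENNReal.ofReal (C₁ ^ (p - 1)) * ∫⁻ t, ENNReal.ofReal (distSet (z : Cn m) E ^ (-η)) *
        ENNReal.ofReal ((1 - t) ^ (a - 1)) *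
        ENNReal.ofReal (distSet (π (z, t)) E ^ (lam - p * α - κ)) *
          avgKernel E μ q θ X (π (z, t)) ^ p ∂ν := by
    filter_upwards [g.ae_toSphere_distSet_pos he hυ] with z hz
    have hz1 : ‖(z : Cn m)‖ = 1 := norm_eq_of_mem_sphere z
    have hπz : Measurable fun t : ℝ => π (z, t) := hπm.comp measurable_prodMk_left
    have hρz : Measurable fun t : ℝ => distSet (π (z, t)) E := hρm.comp hπz
    have hKz : Measurable fun t : ℝ => avgKernel E μ q θ X (π (z, t)) := hK.comp hπz
    have hρpos : ∀ t ∈ Set.Ioo (0 : ℝ) 1, 0 < distSet (π (z, t)) E := fun t ht =>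
      lt_of_lt_of_le (by linarith [ht.2])
        ((le_max_left _ _).trans (le_distSet_smul g.nonempty g.sub hz1.le ht.1.le ht.2.le))
    set w : ℝ → ENNReal := fun t => ENNReal.ofReal ((1 - t) ^ (a - 1) *
        distSet (π (z, t)) E ^ (-(a + ε))) with hw
    have hwm : Measurable w :=
      (((measurable_const.sub measurable_id).pow_const _).mul (hρz.pow_const _)).ennreal_ofReal
    set Y : ℝ → ENNReal := fun t => ENNReal.ofReal (distSet (π (z, t)) E ^ (ε - β)) *
      avgKernel E μ q θ X (π (z, t)) with hY
    have hYm : Measurable Y := (hρz.pow_const _).ennreal_ofReal.mul hKz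
    have h1 : ∫⁻ t, ENNReal.ofReal ((1 - t) ^ (a - 1)) *
        (ENNReal.ofReal (distSet ((t : ℂ) • (z : Cn m)) E ^ (-(a + β))) *
          avgKernel E μ q θ X ((t : ℂ) • (z : Cn m))) ∂ν = ∫⁻ t, Y t * w t ∂ν := by
      refine setLIntegral_congr_fun measurableSet_Ioo fun t ht => ?_
      have h1t : 0 < 1 - t := by linarith [ht.2]
      have hρt := hρpos t ht
      simp only [hY, hw, hπ] at hρt ⊢
      rw [ENNReal.ofReal_mul (by positivity)]
      have : distSet ((t : ℂ) • (z : Cn m)) E ^ (-(a + β)) =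
          distSet ((t : ℂ) • (z : Cn m)) E ^ (ε - β) *
            distSet ((t : ℂ) • (z : Cn m)) E ^ (-(a + ε)) := by
        rw [← Real.rpow_add hρt]; congr 1; ring
      rw [this, ENNReal.ofReal_mul (by positivity)]
      ring
    rw [h1]
    refine (lintegral_mul_rpow_le hp hYm hwm).trans ?_
    refine (mul_le_mul_left (ENNReal.rpow_le_rpow (hray g.nonempty g.sub (z : Cn m) hz1 hz)
      (by linarith)) _).trans (le_of_eq ?_)
    rw [ENNReal.ofReal_rpow_of_nonneg (by positivity) (by linarith),
      Real.mul_rpow (by positivity) (by positivity), ← Real.rpow_mul hz.le,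
      show -ε * (p - 1) = -η by rw [hη]; ring, ENNReal.ofReal_mul (by positivity), mul_assoc]
    congr 1
    rw [← lintegral_const_mul' _ _ ENNReal.ofReal_ne_top]
    refine setLIntegral_congr_fun measurableSet_Ioo fun t ht => ?_
    have h1t : 0 < 1 - t := by linarith [ht.2]
    have hρt := hρpos t ht
    simp only [hY, hw]
    rw [ENNReal.mul_rpow_of_nonneg _ _ hp0.le, ENNReal.ofReal_rpow_of_nonneg (by positivity) hp0.le,
      ← Real.rpow_mul hρt.le, ENNReal.ofReal_mul (by positivity)]
    -- The exponents agree precisely because `β = α + (n - lam) / p`.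
    have : distSet (π (z, t)) E ^ (lam - p * α - κ) =
        distSet (π (z, t)) E ^ ((ε - β) * p) * distSet (π (z, t)) E ^ (-(a + ε)) := by
      rw [← Real.rpow_add hρt]; congr 1
      rw [hκdef, hη, hβ]
      field_simp
      ring
    rw [this, ENNReal.ofReal_mul (by positivity)]
    ring
  refine (lintegral_mono_ae hpoint).trans_lt ?_
  rw [lintegral_const_mul' _ _ ENNReal.ofReal_ne_top]
  refine ENNReal.mul_lt_top ENNReal.ofReal_lt_top ?_
  have hFm : Measurable fun x : Metric.sphere (0 : Cn m) 1 × ℝ =>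
      ENNReal.ofReal (distSet (x.1 : Cn m) E ^ (-η)) * ENNReal.ofReal ((1 - x.2) ^ (a - 1)) *
        ENNReal.ofReal (distSet (π x) E ^ (lam - p * α - κ)) * avgKernel E μ q θ X (π x) ^ p :=
    (hφm.mul ((hρm.comp hπm).pow_const _).ennreal_ofReal).mul ((hK.comp hπm).pow_const _)
  have h2 := lintegral_prod (μ := σ) (ν := ν) _ hFm.aemeasurable
  rw [← h2]
  exact (hFub hX).trans_lt (ENNReal.mul_lt_top ENNReal.ofReal_lt_top hfin)

end Growth
end RayIntegrals
-- Volume means at boundary points.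
section BoundaryMeans

variable {m : ℕ} {e : Cn m → Fin (m + 1) → Cn m}

/-- The volume means of `H` over `innerBall ζ δ` tend to zero. -/
def VanishingMean (H : Cn m → ENNReal) (ζ : Cn m) : Prop :=
  Tendsto (fun δ : ℝ => (volume (innerBall ζ δ))⁻¹ * ∫⁻ z in innerBall ζ δ, H z) (𝓝[>] 0) (𝓝 0)

theorem measurableSet_innerBall (ζ : Cn m) (δ : ℝ) : MeasurableSet (innerBall ζ δ) :=
  measurableSet_ball.inter (measurableSet_dBall _ _)

theorem IsFrame.volume_innerBall (he : IsFrame e) {ζ : Cn m} (hζ : ‖ζ‖ = 1) {δ : ℝ} (hδ : 0 < δ)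
    (hδ2 : δ ≤ 2) : volume (innerBall ζ δ) ≠ 0 ∧ volume (innerBall ζ δ) ≠ ⊤ := by
  obtain ⟨C, hC, h1⟩ := exists_le_volume_innerBall he
  obtain ⟨C', hC', h2⟩ := exists_volume_innerBall_le he
  refine ⟨ne_of_gt (lt_of_lt_of_le ?_ (h1 ζ hζ δ hδ hδ2)),
    ((h2 ζ hζ δ hδ).trans_lt ENNReal.ofReal_lt_top).ne⟩
  exact ENNReal.ofReal_pos.2 (by positivity)

/-- By Jensen the `p`-th power of the mean is at most the mean of `H^p`. As the volume is of order
`δ^(m+2)` and `d(z,ζ) < δ`, this is at most a constant times the weighted integral over a shrinking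
set, which tends to zero by absolute continuity. -/
theorem VanishingMean.of_lintegral (he : IsFrame e) {p : ℝ} (hp : 1 ≤ p) {ζ : Cn m} (hζ : ‖ζ‖ = 1)
    {H : Cn m → ENNReal} (hH : Measurable H)
    (hfin : ∫⁻ z in Metric.ball (0 : Cn m) 1,
      ENNReal.ofReal (dist z ζ ^ (-((m + 2 : ℕ) : ℝ))) * H z ^ p ≠ ⊤) : VanishingMean H ζ := by
  have hp0 : 0 < p := by linarith
  obtain ⟨c, hc, hlow⟩ := exists_le_volume_innerBall he
  obtain ⟨C, hC, hup⟩ := exists_volume_innerBall_le he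
  set N : ℝ := ((m + 2 : ℕ) : ℝ) with hN
  set Φ : Cn m → ENNReal := fun z => ENNReal.ofReal (dist z ζ ^ (-N)) * H z ^ p
  have hrr : ∀ δ, (volume.restrict (Metric.ball (0 : Cn m) 1)).restrict (dBall ζ δ) =
      volume.restrict (innerBall ζ δ) := fun δ => by
    rw [Measure.restrict_restrict (measurableSet_dBall _ _), Set.inter_comm]; rfl
  have hvol : Tendsto (fun δ : ℝ => volume (innerBall ζ δ)) (𝓝[>] 0) (𝓝 0) := by
    have h1 : Tendsto (fun δ : ℝ => ENNReal.ofReal (C * δ ^ (m + 2))) (𝓝[>] 0) (𝓝 0) := by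
      have : Continuous fun δ : ℝ => ENNReal.ofReal (C * δ ^ (m + 2)) :=
        ENNReal.continuous_ofReal.comp (by fun_prop)
      have h2 := this.tendsto 0
      simp only [ne_eq, Nat.add_eq_zero_iff, OfNat.ofNat_ne_zero, and_false, not_false_eq_true,
        zero_pow, mul_zero, ENNReal.ofReal_zero] at h2
      exact h2.mono_left nhdsWithin_le_nhds
    refine tendsto_of_tendsto_of_tendsto_of_le_of_le' tendsto_const_nhds h1
      (Eventually.of_forall fun _ => zero_le) ?_
    filter_upwards [self_mem_nhdsWithin] with δ hδ
    exact hup ζ hζ δ hδ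
  have hJ : Tendsto (fun δ : ℝ => ∫⁻ z in innerBall ζ δ, Φ z) (𝓝[>] 0) (𝓝 0) := by
    have h1 := tendsto_setLIntegral_zero (μ := volume.restrict (Metric.ball (0 : Cn m) 1))
      (s := fun δ : ℝ => dBall ζ δ) (l := 𝓝[>] 0) hfin ?_
    · simpa only [hrr] using h1
    · refine hvol.congr fun δ => ?_
      rw [Function.comp_apply, Measure.restrict_apply (measurableSet_dBall _ _), Set.inter_comm]
      rfl
  have hJ' : Tendsto (fun δ : ℝ => (ENNReal.ofReal c⁻¹ * ∫⁻ z in innerBall ζ δ, Φ z) ^ (1 / p))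
      (𝓝[>] 0) (𝓝 0) := by
    have h1 := ENNReal.Tendsto.const_mul (a := ENNReal.ofReal c⁻¹) hJ
      (Or.inr ENNReal.ofReal_ne_top)
    have h2 := ((ENNReal.continuous_rpow_const (y := 1 / p)).tendsto _).comp h1
    rw [mul_zero, ENNReal.zero_rpow_of_pos (by positivity)] at h2
    exact h2
  refine tendsto_of_tendsto_of_tendsto_of_le_of_le' tendsto_const_nhds hJ'
      (Eventually.of_forall fun _ => zero_le) ?_
  have h2 : Set.Ioc (0 : ℝ) 2 ∈ 𝓝[>] (0 : ℝ) := Ioc_mem_nhdsGT (by norm_num)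
  filter_upwards [h2] with δ hδ
  obtain ⟨hv0, hvt⟩ := he.volume_innerBall hζ hδ.1 hδ.2
  set v := volume (innerBall ζ δ)
  have hJen := lintegral_mul_rpow_le (ν := volume.restrict (innerBall ζ δ)) hp hH
    (measurable_const (a := (1 : ENNReal)))
  simp only [mul_one, lintegral_const, Measure.restrict_apply_univ, one_mul] at hJen
  rw [one_div, ENNReal.le_rpow_inv_iff hp0, ENNReal.mul_rpow_of_nonneg _ _ hp0.le]
  calc v⁻¹ ^ p * (∫⁻ z in innerBall ζ δ, H z) ^ p
      ≤ v⁻¹ ^ p * (v ^ (p - 1) * ∫⁻ z in innerBall ζ δ, H z ^ p) := by gcongr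
    _ = v⁻¹ * ∫⁻ z in innerBall ζ δ, H z ^ p := by
        rw [← mul_assoc, ENNReal.inv_rpow, ENNReal.rpow_sub _ _ hv0 hvt, ENNReal.rpow_one,
          ENNReal.div_eq_inv_mul, mul_left_comm,
          ENNReal.inv_mul_cancel (ENNReal.rpow_pos (pos_iff_ne_zero.2 hv0) hvt).ne'
            (ENNReal.rpow_ne_top_of_nonneg hp0.le hvt), mul_one]
    _ ≤ (ENNReal.ofReal (c * δ ^ (m + 2)))⁻¹ * ∫⁻ z in innerBall ζ δ, H z ^ p := by
        gcongr
        exact hlow ζ hζ δ hδ.1 hδ.2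
    _ = ENNReal.ofReal c⁻¹ * (ENNReal.ofReal (δ ^ (-N)) * ∫⁻ z in innerBall ζ δ, H z ^ p) := by
        have := hδ.1
        rw [← ENNReal.ofReal_inv_of_pos (by positivity), mul_inv,
          ENNReal.ofReal_mul (by positivity), Real.rpow_neg hδ.1.le, hN, Real.rpow_natCast, mul_assoc]
    _ ≤ _ := by
        gcongr
        rw [← lintegral_const_mul' _ _ ENNReal.ofReal_ne_top]
        refine setLIntegral_mono' (measurableSet_innerBall _ _) fun z hz => ?_
        refine mul_le_mul_left (ENNReal.ofReal_le_ofReal ?_) _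
        have hzd : dist ζ z < δ := hz.2
        have hz1 : ‖z‖ < 1 := by simpa using hz.1
        have hpos : 0 < dist z ζ :=
          lt_of_lt_of_le (by linarith) (one_sub_norm_le_dist z hζ.le)
        rw [dist_comm] at hzd
        exact Real.rpow_le_rpow_of_nonpos hpos hzd.le
          (neg_nonpos.2 (Nat.cast_nonneg _))

theorem VanishingMean.add {H K : Cn m → ENNReal} {ζ : Cn m} (hHm : Measurable H)
    (hH : VanishingMean H ζ) (hK : VanishingMean K ζ) :
    VanishingMean (fun z => H z + K z) ζ := by
  have := Tendsto.add hH hK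
  rw [add_zero] at this
  refine this.congr fun δ => ?_
  rw [lintegral_add_left hHm, mul_add]

theorem VanishingMean.sum {ι : Type*} (s : Finset ι) {H : ι → Cn m → ENNReal} {ζ : Cn m}
    (hHm : ∀ i ∈ s, Measurable (H i)) (hH : ∀ i ∈ s, VanishingMean (H i) ζ) :
    VanishingMean (fun z => ∑ i ∈ s, H i z) ζ := by
  have := tendsto_finsetSum s hH
  simp only [Finset.sum_const_zero] at this
  refine this.congr fun δ => ?_
  rw [lintegral_finsetSum' s fun i hi => (hHm i hi).aemeasurable, Finset.mul_sum]

theorem VanishingMean.const_mul {H : Cn m → ENNReal} {ζ : Cn m} (hH : VanishingMean H ζ)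
    {c : ENNReal} (hc : c ≠ ⊤) : VanishingMean (fun z => c * H z) ζ := by
  have := ENNReal.Tendsto.const_mul (a := c) hH (Or.inr hc)
  rw [mul_zero] at this
  refine this.congr fun δ => ?_
  rw [lintegral_const_mul' _ _ hc, mul_left_comm]

theorem VanishingMean.of_tendsto (he : IsFrame e) {ζ : Cn m} (hζ : ‖ζ‖ = 1) {H : Cn m → ENNReal}
    (hH : Tendsto H (𝓝 ζ) (𝓝 0)) : VanishingMean H ζ := by
  refine ENNReal.tendsto_nhds_zero.2 fun ε hε => ?_
  obtain ⟨r, hr, hball⟩ := Metric.eventually_nhds_iff_ball.1 (ENNReal.tendsto_nhds_zero.1 hH ε hε)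
  have hr2 : (0 : ℝ) < min (r ^ 2 / 2) 2 := by positivity
  filter_upwards [Ioo_mem_nhdsGT hr2] with δ hδ
  have hδ2 : δ ≤ 2 := (hδ.2.trans_le (min_le_right _ _)).le
  obtain ⟨hv0, hvt⟩ := he.volume_innerBall hζ hδ.1 hδ2
  have h1 : ∫⁻ z in innerBall ζ δ, H z ≤ ∫⁻ z in innerBall ζ δ, ε := by
    refine setLIntegral_mono' (measurableSet_innerBall _ _) fun z hz => hball z ?_
    have hz1 : ‖z‖ < 1 := by simpa using hz.1
    have hz2 : dist ζ z < δ := hz.2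
    have h2 := norm_sub_sq_le hζ.le hz1.le
    have h3 : δ < r ^ 2 / 2 := hδ.2.trans_le (min_le_left _ _)
    rw [mem_ball_iff_norm, norm_sub_rev]
    exact lt_of_pow_lt_pow_left₀ 2 hr.le (by linarith)
  rw [setLIntegral_const] at h1
  calc _ ≤ (volume (innerBall ζ δ))⁻¹ * (ε * volume (innerBall ζ δ)) := by gcongr
    _ = ε := by rw [mul_left_comm, ENNReal.inv_mul_cancel hv0 hvt, mul_one]

theorem HasMeanValue.of_vanishingMean (he : IsFrame e) {ζ : Cn m} (hζ : ‖ζ‖ = 1) {G : Cn m → ℂ}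
    (hG : AEStronglyMeasurable G (volume.restrict (Metric.ball 0 1))) {c : ℂ} {H : Cn m → ENNReal}
    (hH : VanishingMean H ζ) (hGH : ∀ z, z ≠ 0 → ‖z‖ < 1 → ‖G z - c‖ₑ ≤ H z) :
    HasMeanValue G ζ c := by
  have hGδ : ∀ δ, AEStronglyMeasurable G (volume.restrict (innerBall ζ δ)) := fun δ =>
    hG.mono_measure (Measure.restrict_mono Set.inter_subset_left le_rfl)
  have hle : ∀ δ, ∫⁻ z in innerBall ζ δ, ‖G z - c‖ₑ ≤ ∫⁻ z in innerBall ζ δ, H z := by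
    refine fun δ => setLIntegral_mono_ae' (measurableSet_innerBall _ _) ?_
    -- A frame is unconstrained at the origin, where the bound need not hold; a single point is
    -- negligible.
    have h0 : ∀ᵐ z : Cn m, z ≠ 0 := compl_mem_ae_iff.2 (measure_singleton 0)
    filter_upwards [h0] with z hz0 hz using hGH z hz0 (by simpa using hz.1)
  -- As soon as the mean of `H` is less than one its integral is finite, and so `G` is integrable.
  have hsmall : ∀ᶠ δ : ℝ in 𝓝[>] 0, (0 < δ ∧ δ ≤ 2) ∧
      (volume (innerBall ζ δ))⁻¹ * ∫⁻ z in innerBall ζ δ, H z < 1 :=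
    Eventually.and (show Set.Ioc (0 : ℝ) 2 ∈ 𝓝[>] (0 : ℝ) from Ioc_mem_nhdsGT (by norm_num))
      (Tendsto.eventually_lt_const one_pos hH)
  have hintg : ∀ᶠ δ : ℝ in 𝓝[>] 0, IntegrableOn (fun z => G z - c) (innerBall ζ δ) ∧
      IntegrableOn G (innerBall ζ δ) ∧ 0 < δ ∧ δ ≤ 2 := by
    filter_upwards [hsmall] with δ hδ
    obtain ⟨hv0, hvt⟩ := he.volume_innerBall hζ hδ.1.1 hδ.1.2
    have hfin : ∫⁻ z in innerBall ζ δ, H z < ⊤ := by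
      by_contra h
      rw [not_lt, top_le_iff] at h
      have h2 := hδ.2
      rw [h, ENNReal.mul_top (ENNReal.inv_ne_zero.2 hvt)] at h2
      exact absurd h2 (by simp)
    have hconst : IntegrableOn (fun _ : Cn m => c) (innerBall ζ δ) :=
      integrableOn_const hvt
    have h1 : IntegrableOn (fun z => G z - c) (innerBall ζ δ) :=
      ⟨(hGδ δ).sub aestronglyMeasurable_const, (hle δ).trans_lt hfin⟩
    refine ⟨h1, ?_, hδ.1⟩
    have := h1.add hconst
    refine this.congr (Eventually.of_forall fun z => ?_)
    simp
  have habs : Tendsto (fun δ : ℝ => ⨍ z in innerBall ζ δ, ‖G z - c‖) (𝓝[>] 0) (𝓝 0) := by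
    have h1 := (ENNReal.continuousAt_toReal (x := 0) (by simp)).tendsto.comp hH
    refine tendsto_of_tendsto_of_tendsto_of_le_of_le' tendsto_const_nhds h1
      (Eventually.of_forall fun δ => ?_) ?_
    · rw [setAverage_eq]
      exact mul_nonneg (by positivity) (integral_nonneg fun _ => norm_nonneg _)
    · filter_upwards [hintg, hsmall] with δ hδ hs
      rw [setAverage_eq, integral_norm_eq_lintegral_enorm hδ.1.1, smul_eq_mul, Function.comp_apply]
      rw [measureReal_def, ← ENNReal.toReal_inv, ← ENNReal.toReal_mul]
      refine ENNReal.toReal_mono (hs.2.trans ENNReal.one_lt_top).ne ?_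
      exact mul_le_mul_right (hle δ) _
  refine ⟨hintg.mono fun δ h => h.2.1, ?_, habs⟩
  rw [tendsto_iff_norm_sub_tendsto_zero]
  refine tendsto_of_tendsto_of_tendsto_of_le_of_le' tendsto_const_nhds habs
    (Eventually.of_forall fun _ => norm_nonneg _) ?_
  filter_upwards [hintg] with δ hδ
  obtain ⟨hv0, hvt⟩ := he.volume_innerBall hζ hδ.2.2.1 hδ.2.2.2
  have h1 : (⨍ z in innerBall ζ δ, G z) - c = ⨍ z in innerBall ζ δ, (G z - c) := by
    rw [setAverage_eq, setAverage_eq, integral_sub hδ.2.1 (integrableOn_const hvt), smul_sub,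
      setIntegral_const, smul_smul, inv_mul_cancel₀, one_smul]
    exact (ENNReal.toReal_pos hv0 hvt).ne'
  rw [h1, setAverage_eq, setAverage_eq, norm_smul, smul_eq_mul, norm_inv,
    Real.norm_of_nonneg measureReal_nonneg]
  gcongr
  exact norm_integral_le_integral_norm _

end BoundaryMeans
-- Vanishing means of the averaged kernel.
section BoundaryKernels

variable {m : ℕ}

/-- The mean of `Y` over the ball of radius `6 d(z,E)` about `z`. -/
noncomputable def nearAvg (E : Set (Cn m)) (μ : Measure (Cn m)) (Y : Cn m → ENNReal) (z : Cn m) :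
    ENNReal :=
  open scoped Classical in
  ENNReal.ofReal (μ.real (dBall z (6 * distSet z E)))⁻¹ *
    ∫⁻ s, Y s * (if dist z s < 6 * distSet z E then 1 else 0) ∂μ

theorem measurable_nearAvg {E : Set (Cn m)} (hE : E.Nonempty) (μ : Measure (Cn m))
    [IsProbabilityMeasure μ] {Z : Type*} [MeasurableSpace Z] {Y : Z → Cn m → ENNReal}
    (hY : Measurable fun x : Z × Cn m => Y x.1 x.2) {π : Z → Cn m} (hπ : Measurable π) :
    Measurable fun x => nearAvg E μ (Y x) (π x) := by
  unfold nearAvg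
  have hρ : Measurable fun x => distSet (π x) E := (measurable_distSet hE).comp hπ
  refine (measurable_real_dBall hπ (hρ.const_mul 6)).inv.ennreal_ofReal.mul ?_
  refine Measurable.lintegral_prod_right' (f := fun a : Z × Cn m =>
    Y a.1 a.2 * (if dist (π a.1) a.2 < 6 * distSet (π a.1) E then 1 else 0)) ?_
  refine hY.mul (Measurable.ite (measurableSet_lt (measurable_dist (hπ.comp measurable_fst)
    measurable_snd) ((hρ.comp measurable_fst).const_mul 6)) measurable_const measurable_const)

namespace Growth

variable {E : Set (Cn m)} {μ : Measure (Cn m)} {υ lam A : ℝ} {e : Cn m → Fin (m + 1) → Cn m}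

theorem nearAvg_rpow_le (g : Growth E μ υ lam A) {p : ℝ} (hp : 1 ≤ p) {Y : Cn m → ENNReal}
    (hY : Measurable Y) {z : Cn m} (hz : ‖z‖ < 1) :
    nearAvg E μ Y z ^ p ≤ nearAvg E μ (fun s => Y s ^ p) z := by
  classical
  have := g.prob
  have hp0 : 0 < p := by linarith
  have hρ := distSet_pos g.nonempty g.sub hz
  have hU := g.real_dBall_pos hz.le hρ
  unfold nearAvg
  set U := μ.real (dBall z (6 * distSet z E))
  have hw : Measurable fun s => if dist z s < 6 * distSet z E then (1 : ENNReal) else 0 :=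
    Measurable.ite (measurableSet_dBall _ _) measurable_const measurable_const
  have hmass : ∫⁻ s, (if dist z s < 6 * distSet z E then (1 : ENNReal) else 0) ∂μ =
      ENNReal.ofReal U := by
    rw [ofReal_measureReal, ← setLIntegral_one, ← lintegral_indicator (measurableSet_dBall _ _)]
    rfl
  rw [ENNReal.mul_rpow_of_nonneg _ _ hp0.le]
  refine (mul_le_mul_right (lintegral_mul_rpow_le hp hY hw) _).trans (le_of_eq ?_)
  rw [hmass, ← mul_assoc]
  congr 1
  · rw [ENNReal.ofReal_rpow_of_nonneg (by positivity) hp0.le,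
      ENNReal.ofReal_rpow_of_nonneg (by positivity) (by linarith),
      ← ENNReal.ofReal_mul (by positivity), Real.rpow_sub hU, Real.inv_rpow hU.le, Real.rpow_one]
    congr 1
    have : 0 < U ^ p := by positivity
    field_simp

/-- At almost every point of `E` the means of `d(z,E)^{-ω} avgKernel` vanish. -/
theorem ae_vanishingMean_avgKernel (g : Growth E μ υ lam A) (he : IsFrame e)
    (hυ : υ < ((m + 1 : ℕ) : ℝ)) {p α q ω : ℝ} (hp : 1 ≤ p) (hq : υ < q) (hω : ω < α) (θ : ℝ)
    {X : Cn m × Cn m → ENNReal} (hX : Measurable X) (hfin : kernelNorm μ p α lam q θ X < ⊤) :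
    ∀ᵐ ζ ∂μ, VanishingMean
      (fun z => ENNReal.ofReal (distSet z E ^ (-ω)) * avgKernel E μ q θ X z) ζ := by
  have := g.prob
  have hp0 : 0 < p := by linarith
  have hA := g.A_pos
  set N : ℝ := ((m + 2 : ℕ) : ℝ) with hN
  have hυN : υ < N := hυ.trans (by rw [hN]; push_cast; linarith)
  obtain ⟨c, hc, hvol⟩ := exists_volume_innerBall_le he
  set ν := volume.restrict (Metric.ball (0 : Cn m) 1) with hν
  have hball : ∀ᵐ z ∂ν, ‖z‖ < 1 := by
    filter_upwards [ae_restrict_mem measurableSet_ball] with z hz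
    simpa using hz
  have hκ : ∀ s ∈ E, ∀ r, 0 < r → r ≤ 2 →
      ∫⁻ z in {z : Cn m | dist z s ≤ r}, 1 ∂ν ≤ ENNReal.ofReal (c * 2 ^ (m + 2) * r ^ N) := by
    intro s hs r hr hr2
    have hms : MeasurableSet {z : Cn m | dist z s ≤ r} :=
      measurableSet_le (measurable_dist measurable_id measurable_const) measurable_const
    rw [setLIntegral_one, hν, Measure.restrict_apply hms]
    refine (measure_mono fun z hz => ?_).trans
      ((hvol s (g.norm_eq hs) (2 * r) (by positivity)).trans (le_of_eq ?_))
    · have h1 : dist z s ≤ r := hz.1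
      refine ⟨hz.2, ?_⟩
      change dist s z < 2 * r
      rw [dist_comm]; linarith
    · rw [hN, Real.rpow_natCast, mul_pow]; congr 1; ring
  obtain ⟨C, hC, hFub⟩ := g.exists_lintegral_avgKernel_le (α := α) hp hq θ measurable_id
    (measurable_const (a := (1 : ENNReal))) hball (by positivity) hκ
  have hF := (hFub hX).trans_lt (ENNReal.mul_lt_top ENNReal.ofReal_lt_top hfin)
  simp only [one_mul, id] at hF
  have hK := measurable_avgKernel g.nonempty μ q θ hX
  have hρm := measurable_distSet (m := m) g.nonempty
  set H : Cn m → ENNReal := fun z => ENNReal.ofReal (distSet z E ^ (-ω)) * avgKernel E μ q θ X z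
  have hH : Measurable H := (hρm.pow_const _).ennreal_ofReal.mul hK
  have hdm : Measurable fun x : Cn m × Cn m => ENNReal.ofReal (dist x.2 x.1 ^ (-N)) :=
    ((measurable_dist measurable_snd measurable_fst).pow_const _).ennreal_ofReal
  have hΦm : Measurable fun x : Cn m × Cn m =>
      ENNReal.ofReal (dist x.2 x.1 ^ (-N)) * H x.2 ^ p :=
    hdm.mul ((hH.comp measurable_snd).pow_const p)
  set G := 2 ^ (N + υ) * (1 - ((1 : ℝ) / 2) ^ (N - υ))⁻¹ * (A * 144 ^ υ) *
    (A * 144 ^ υ * (A * 2 ^ (-lam))) with hG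
  have hgeo : 0 < (1 - ((1 : ℝ) / 2) ^ (N - υ))⁻¹ :=
    inv_pos.2 (sub_pos.2 (half_rpow_lt_one (by linarith)))
  have hGpos : 0 < G := by positivity
  -- Integrating in `ζ` first, `∫ d(z,ζ)^(-N) dμ(ζ) ≲ ρ^(-N) U ≲ ρ^(lam - N)`. With the factor
  -- `ρ^(-ωp)` this is `ρ^(p(α-ω))`, which is bounded as `ω < α`, times `ρ^(lam - pα - N)`; the
  -- Fubini estimate applies with `κ = N = n + 1`, the dimension of volume measure.
  have key : ∫⁻ ζ, ∫⁻ z, ENNReal.ofReal (dist z ζ ^ (-N)) * H z ^ p ∂ν ∂μ < ⊤ := by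
    rw [lintegral_lintegral_swap hΦm.aemeasurable]
    refine lt_of_le_of_lt ?_ (ENNReal.mul_lt_top
      (ENNReal.ofReal_lt_top (r := G * 2 ^ (p * (α - ω)))) hF)
    rw [← lintegral_const_mul' _ _ ENNReal.ofReal_ne_top]
    refine lintegral_mono_ae ?_
    filter_upwards [hball] with z hz
    have hρ := distSet_pos g.nonempty g.sub hz
    have hρ2 := distSet_le_two g.nonempty g.sub hz.le
    have hmz : Measurable fun ζ => ENNReal.ofReal (dist z ζ ^ (-N)) :=
      ((measurable_dist measurable_const measurable_id).pow_const _).ennreal_ofReal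
    rw [lintegral_mul_const _ hmz]
    have hI := g.lintegral_distSet_div_le hυN hz
    obtain ⟨s, hs, hzs, -⟩ := g.exists_near hz.le hρ
    have hU1 := g.real_dBall_le hz.le hρ hs (by linarith)
    have hU2 := g.real_le_rpow hs hρ hρ2
    set ρ := distSet z E
    set U := μ.real (dBall z (6 * ρ))
    have hUle : U ≤ A * 144 ^ υ * (A * 2 ^ (-lam)) * ρ ^ lam := by
      calc U ≤ _ := hU1
        _ ≤ A * 144 ^ υ * (A * 2 ^ (-lam) * ρ ^ lam) := by gcongr
        _ = _ := by ring
    have h1 : ∫⁻ ζ, ENNReal.ofReal (dist z ζ ^ (-N)) ∂μ ≤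
        ENNReal.ofReal (G * ρ ^ (lam - N)) := by
      calc ∫⁻ ζ, ENNReal.ofReal (dist z ζ ^ (-N)) ∂μ
          = ∫⁻ ζ, ENNReal.ofReal (ρ ^ (-N)) * ENNReal.ofReal ((ρ / dist z ζ) ^ N) ∂μ := by
            refine lintegral_congr fun ζ => ?_
            rw [← ENNReal.ofReal_mul (by positivity), Real.div_rpow hρ.le (dist_nonneg _ _),
              Real.rpow_neg hρ.le, Real.rpow_neg (dist_nonneg _ _)]
            congr 1
            have := Real.rpow_pos_of_pos hρ N
            field_simp
        _ ≤ ENNReal.ofReal (ρ ^ (-N)) * ENNReal.ofReal (2 ^ (N + υ) *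
              (1 - ((1 : ℝ) / 2) ^ (N - υ))⁻¹ * (A * 144 ^ υ * U)) := by
            rw [lintegral_const_mul' _ _ ENNReal.ofReal_ne_top]
            exact mul_le_mul_right hI _
        _ ≤ _ := by
            rw [← ENNReal.ofReal_mul (by positivity)]
            refine ENNReal.ofReal_le_ofReal ?_
            calc _ ≤ ρ ^ (-N) * (2 ^ (N + υ) * (1 - ((1 : ℝ) / 2) ^ (N - υ))⁻¹ * (A * 144 ^ υ *
                  (A * 144 ^ υ * (A * 2 ^ (-lam)) * ρ ^ lam))) := by gcongr
              _ = _ := by rw [sub_eq_add_neg lam N, Real.rpow_add hρ, hG]; ring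
    refine (mul_le_mul_left h1 _).trans ?_
    simp only [H]
    rw [ENNReal.mul_rpow_of_nonneg _ _ hp0.le, ← mul_assoc, ← mul_assoc]
    refine mul_le_mul_left ?_ _
    rw [ENNReal.ofReal_rpow_of_nonneg (by positivity) hp0.le, ← ENNReal.ofReal_mul (by positivity),
      ← ENNReal.ofReal_mul (by positivity), ← Real.rpow_mul hρ.le]
    refine ENNReal.ofReal_le_ofReal ?_
    have h2 : ρ ^ (lam - N) * ρ ^ (-ω * p) = ρ ^ (p * (α - ω)) * ρ ^ (lam - p * α - N) := by
      rw [← Real.rpow_add hρ, ← Real.rpow_add hρ]; congr 1; ring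
    have h3 : ρ ^ (p * (α - ω)) ≤ 2 ^ (p * (α - ω)) :=
      Real.rpow_le_rpow hρ.le hρ2 (mul_nonneg hp0.le (by linarith))
    calc G * ρ ^ (lam - N) * ρ ^ (-ω * p)
        = G * (ρ ^ (p * (α - ω)) * ρ ^ (lam - p * α - N)) := by rw [← h2]; ring
      _ ≤ G * (2 ^ (p * (α - ω)) * ρ ^ (lam - p * α - N)) := by gcongr
      _ = _ := by ring
  have hmeas : Measurable fun ζ => ∫⁻ z, ENNReal.ofReal (dist z ζ ^ (-N)) * H z ^ p ∂ν :=
    Measurable.lintegral_prod_right' hΦm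
  filter_upwards [ae_lt_top hmeas key.ne, g.ae_mem] with ζ h1 h2
  exact VanishingMean.of_lintegral he hp (g.norm_eq h2) hH h1.ne

end Growth
end BoundaryKernels
-- Vanishing means of local averages of a jet difference with one point fixed.
section NearMeans

variable {m : ℕ}

/-- `1_{d(z,s) < 6 d(z,E)} d(z,ζ)^x μ(B(z, 6 d(z,E)))⁻¹` for `z` in the unit ball. -/
noncomputable def nearWeight (E : Set (Cn m)) (μ : Measure (Cn m)) (x : ℝ) (ζ s z : Cn m) :
    ENNReal :=
  open scoped Classical in
  if ‖z‖ < 1 ∧ dist z s < 6 * distSet z E then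
    ENNReal.ofReal (dist z ζ ^ x * (μ.real (dBall z (6 * distSet z E)))⁻¹) else 0

theorem measurable_nearWeight {E : Set (Cn m)} (hE : E.Nonempty) (μ : Measure (Cn m))
    [IsProbabilityMeasure μ] (x : ℝ) (ζ : Cn m) {Z : Type*} [MeasurableSpace Z] {s z : Z → Cn m}
    (hs : Measurable s) (hz : Measurable z) :
    Measurable fun a => nearWeight E μ x ζ (s a) (z a) := by
  have hρ : Measurable fun a => distSet (z a) E := (measurable_distSet hE).comp hz
  unfold nearWeight
  refine Measurable.ite ?_ ?_ measurable_const
  · exact (measurableSet_lt hz.norm measurable_const).inter (measurableSet_lt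
      (measurable_dist hz hs) (hρ.const_mul 6))
  · exact (((measurable_dist hz measurable_const).pow_const _).mul
      (measurable_real_dBall hz (hρ.const_mul 6)).inv).ennreal_ofReal

namespace Growth

variable {E : Set (Cn m)} {μ : Measure (Cn m)} {υ lam A : ℝ} {e : Cn m → Fin (m + 1) → Cn m}

/-- `E ∩ B(ζ,r)` lies in `B(s,66r)`, so growth about `s` from `ρ` to `66r` compares the masses. As
`ρ` and `d(z,s)` are comparable, the loss is written as a power of `d(z,s)`, which can be integrated
in `z`. -/
theorem exists_inv_real_dBall_le (g : Growth E μ υ lam A) : ∃ C : ℝ, 0 < C ∧ ∀ z : Cn m, ‖z‖ < 1 →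
    ∀ ζ ∈ E, ∀ s ∈ E, ∀ r, dist z ζ ≤ r → dist z s < 6 * distSet z E →
      (μ.real (dBall z (6 * distSet z E)))⁻¹ ≤
        C * r ^ υ * (dist z s / 8) ^ (-υ) * (μ.real (dBall ζ r))⁻¹ := by
  have hA := g.A_pos
  refine ⟨A * 66 ^ υ * (A * 144 ^ υ), by positivity, ?_⟩
  intro z hz ζ hζ s hs r hr h6
  have hρ := distSet_pos g.nonempty g.sub hz
  have hU := g.real_dBall_pos hz.le hρ
  have hle := g.le_real_dBall hz.le hρ hs h6
  have hρs := distSet_le z hs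
  have hρζ := distSet_le z hζ
  set ρ := distSet z E
  set U := μ.real (dBall z (6 * ρ))
  have hr0 : 0 < r := hρ.trans_le (hρζ.trans hr)
  have hV := g.pos ζ hζ r hr0
  set V := μ.real (dBall ζ r)
  have h1 : V ≤ μ.real (dBall s (66 * r)) := by
    refine g.real_mono fun y hy hζy => ?_
    have h2 : dist ζ y < r := hζy
    have h3 := dist_triangle (g.norm_eq hs).le (g.norm_eq hζ).le (g.norm_eq hy).le
    have h4 := dist_triangle (g.norm_eq hs).le hz.le (g.norm_eq hζ).le
    rw [dist_comm s z] at h4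
    change dist s y < 66 * r
    linarith
  have h2 := g.upper s hs ρ (66 * r) hρ (by linarith)
  have hds : 0 < dist z s := hρ.trans_le hρs
  have h3 : (66 * r / ρ) ^ υ ≤ 66 ^ υ * r ^ υ * (dist z s / 8) ^ (-υ) := by
    rw [Real.rpow_neg (by positivity), ← Real.inv_rpow (by positivity),
      ← Real.mul_rpow (by norm_num) hr0.le, ← Real.mul_rpow (by positivity) (by positivity),
      div_eq_mul_inv]
    refine Real.rpow_le_rpow (by positivity) ?_ g.nonneg
    gcongr
    linarith
  have hVs := g.pos s hs ρ hρ
  rw [← div_eq_mul_inv, inv_le_iff_one_le_mul₀ hU, div_mul_eq_mul_div, le_div_iff₀ hV, one_mul]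
  calc V ≤ A * (66 * r / ρ) ^ υ * μ.real (dBall s ρ) := h1.trans h2
    _ ≤ A * (66 ^ υ * r ^ υ * (dist z s / 8) ^ (-υ)) * (A * 144 ^ υ * U) :=
        mul_le_mul (mul_le_mul_of_nonneg_left h3 hA.le) hle hVs.le (by positivity)
    _ = _ := by ring

/-- When `d(z,ζ)` is of order `r` and `s` is near `z`, the distance of `ζ` and `s` is `O(r)`, so the
factor `(r/(r + d(ζ,s)))^q` may be inserted at the cost of a constant. The singularity `d(z,s)^(-υ)`
integrates over a ball of radius comparable to `r` to `O(r^(N-υ))`, and the shells about `ζ` sum to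
`kernelW`. -/
theorem exists_lintegral_near_le (g : Growth E μ υ lam A) (he : IsFrame e)
    (hυ : υ < ((m + 1 : ℕ) : ℝ)) {p α q ω : ℝ} (hp : 1 ≤ p) (hq : 0 ≤ q) (hω : ω < α) (θ : ℝ) :
    ∃ C : ℝ, 0 < C ∧ ∀ ζ ∈ E, ∀ s ∈ E,
      ∫⁻ z in Metric.ball (0 : Cn m) 1,
        nearWeight E μ (-((m + 2 : ℕ) : ℝ) + p * (θ - ω)) ζ s z ≤
      ENNReal.ofReal C * kernelW μ p α lam q θ ζ s := by
  classical
  have hA := g.A_pos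
  have := g.prob
  have hp0 : 0 < p := by linarith
  set N : ℝ := ((m + 2 : ℕ) : ℝ) with hN
  have hυN : υ < N := hυ.trans (by rw [hN]; push_cast; linarith)
  obtain ⟨C₁, hC₁, hU⟩ := g.exists_inv_real_dBall_le
  obtain ⟨c, hc, hvol⟩ := exists_volume_innerBall_le he
  have hgeo : 0 < (1 - ((1 : ℝ) / 2) ^ (N - υ))⁻¹ :=
    inv_pos.2 (sub_pos.2 (half_rpow_lt_one (by linarith)))
  set G := 2 ^ υ * (c * 16 ^ (m + 2)) * ((1 - ((1 : ℝ) / 2) ^ (N - υ))⁻¹ * 2 ^ (N - υ)) with hG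
  have hGpos : 0 < G := by positivity
  set x := -N + p * (θ - ω) with hx
  set M := 2 ^ |x| * 2 ^ (p * (α - ω)) * C₁ * 22 ^ q with hM
  have hMpos : 0 < M := by positivity
  refine ⟨M * G * (A * 2 ^ (-lam)), by positivity, ?_⟩
  intro ζ hζ s hs
  set ν := volume.restrict (Metric.ball (0 : Cn m) 1) with hν
  have hdm : ∀ w : Cn m, Measurable fun z : Cn m => dist z w := fun w =>
    measurable_dist measurable_id measurable_const
  set φ : Cn m → ENNReal := fun z =>
    if 0 < dist z s / 8 ∧ dist z s / 8 < dist z ζ then ENNReal.ofReal ((dist z s / 8) ^ (-υ)) else 0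
    with hφ
  have hds8 : Measurable fun z : Cn m => dist z s / 8 := (hdm s).div_const 8
  have hφm : Measurable φ := Measurable.ite ((measurableSet_lt measurable_const hds8).inter
    (measurableSet_lt hds8 (hdm ζ))) (hds8.pow_const _).ennreal_ofReal measurable_const
  have hd0 := dist_nonneg ζ s
  refine (lintegral_le_tsum_dyadic (ν := ν) (hdm ζ) hφm
    (b := fun l => ENNReal.ofReal (M * rad l ^ (-N + p * (θ - α)) * rad l ^ υ *
      (μ.real (dBall ζ (rad l)))⁻¹ * (rad l / (rad l + dist ζ s)) ^ q))
    (a := fun l => ENNReal.ofReal (G * rad l ^ (N - υ))) ?_ ?_ ?_).trans ?_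
  · intro z hz
    have hz1 : ‖z‖ < 1 := by
      by_contra h
      simp [nearWeight, h] at hz
    exact ⟨(distSet_pos g.nonempty g.sub hz1).trans_le (distSet_le _ hζ),
      dist_le_two hz1.le (g.norm_eq hζ).le⟩
  · intro l z hl1 hl2
    have hr := rad_pos l
    rw [rad_succ] at hl1
    unfold nearWeight
    split_ifs with hif
    · obtain ⟨hz, h6⟩ := hif
      have hρ := distSet_pos g.nonempty g.sub hz
      have hρs := distSet_le z hs
      have hρζ := distSet_le z hζ
      have h1 := hU z hz ζ hζ s hs (rad l) hl2 h6
      set r := rad l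
      have hVr := g.pos ζ hζ r hr
      simp only [hφ]
      rw [if_pos ⟨by linarith, by linarith⟩, ← ENNReal.ofReal_mul (by positivity)]
      refine ENNReal.ofReal_le_ofReal ?_
      have h2 : dist z ζ ^ x ≤ 2 ^ |x| * r ^ x :=
        rpow_le_of_ratio (by linarith) (by norm_num) (by linarith) (by linarith)
      -- The surplus power `r^(p(α-ω))` is bounded, since `ω < α` and `r ≤ 2`.
      have h3 : r ^ x ≤ r ^ (-N + p * (θ - α)) * 2 ^ (p * (α - ω)) := by
        have : r ^ x = r ^ (-N + p * (θ - α)) * r ^ (p * (α - ω)) := by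
          rw [← Real.rpow_add hr, hx]; congr 1; ring
        rw [this]
        refine mul_le_mul_of_nonneg_left ?_ (by positivity)
        exact Real.rpow_le_rpow hr.le (rad_le_two l) (mul_nonneg hp0.le (by linarith))
      have h4 : 1 ≤ 22 ^ q * (r / (r + dist ζ s)) ^ q := by
        rw [← Real.mul_rpow (by norm_num) (by positivity)]
        refine Real.one_le_rpow ?_ hq
        rw [← mul_div_assoc, le_div_iff₀ (by positivity)]
        have := dist_triangle (g.norm_eq hζ).le hz.le (g.norm_eq hs).le
        rw [dist_comm ζ z] at this
        linarith
      have h5 : 0 < dist z s / 8 := by linarith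
      calc dist z ζ ^ x * (μ.real (dBall z (6 * distSet z E)))⁻¹
          ≤ (2 ^ |x| * (r ^ (-N + p * (θ - α)) * 2 ^ (p * (α - ω)))) *
            (C₁ * r ^ υ * (dist z s / 8) ^ (-υ) * (μ.real (dBall ζ r))⁻¹) := by
            refine mul_le_mul (h2.trans (mul_le_mul_of_nonneg_left h3 (by positivity))) h1
              (by positivity) (by positivity)
        _ ≤ (2 ^ |x| * (r ^ (-N + p * (θ - α)) * 2 ^ (p * (α - ω)))) *
            (C₁ * r ^ υ * (dist z s / 8) ^ (-υ) * (μ.real (dBall ζ r))⁻¹) *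
            (22 ^ q * (r / (r + dist ζ s)) ^ q) :=
            le_mul_of_one_le_right (by positivity) h4
        _ = _ := by rw [hM]; ring
    · exact zero_le
  · intro l
    have hr := rad_pos l
    have hsub : ∀ z ∈ {z : Cn m | dist z ζ ≤ rad l}, φ z ≤
        {z : Cn m | 0 < dist z s / 8 ∧ dist z s / 8 < rad l}.indicator
          (fun z => ENNReal.ofReal ((dist z s / 8) ^ (-υ))) z := by
      intro z hz
      simp only [hφ]
      split_ifs with h
      · rw [Set.indicator_of_mem]
        exact ⟨h.1, h.2.trans_le hz⟩
      · exact zero_le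
    have hms1 : MeasurableSet {z : Cn m | dist z ζ ≤ rad l} :=
      measurableSet_le (hdm ζ) measurable_const
    have hms2 : MeasurableSet {z : Cn m | 0 < dist z s / 8 ∧ dist z s / 8 < rad l} :=
      (measurableSet_lt measurable_const hds8).inter (measurableSet_lt hds8 measurable_const)
    refine (setLIntegral_mono' hms1 hsub).trans ?_
    refine (setLIntegral_le_lintegral _ _).trans ?_
    rw [lintegral_indicator hms2]
    refine (lintegral_rpow_neg_le (ν := ν) (C := c * 16 ^ (m + 2)) (κ := N) hds8 (by positivity)
      g.nonneg hυN ?_ hr (rad_le_two l)).trans (ENNReal.ofReal_le_ofReal (le_of_eq ?_))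
    · intro t ht _
      rw [hν, Measure.restrict_apply (measurableSet_le hds8 measurable_const)]
      refine (measure_mono fun z hz => ?_).trans
        ((hvol s (g.norm_eq hs) (16 * t) (by positivity)).trans (le_of_eq ?_))
      · have h1 : dist z s / 8 ≤ t := hz.1
        refine ⟨hz.2, ?_⟩
        change dist s z < 16 * t
        rw [dist_comm]; linarith
      · rw [hN, Real.rpow_natCast, mul_pow]; congr 1; ring
    · rw [Real.mul_rpow (by norm_num) hr.le, hG]; ring
  · unfold kernelW
    rw [← ENNReal.tsum_mul_left]
    refine ENNReal.tsum_le_tsum fun l => ?_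
    have hr := rad_pos l
    have hV := g.pos ζ hζ (rad l) hr
    have h1 := g.real_le_rpow hζ hr (rad_le_two l)
    have hk := kernelTerm_nonneg μ p α lam q θ ζ s hr
    set r := rad l
    rw [← ENNReal.ofReal_mul (by positivity), ← ENNReal.ofReal_mul (by positivity)]
    refine ENNReal.ofReal_le_ofReal ?_
    -- The lower growth supplies the second factor `μ(B(ζ,r))⁻¹` of the kernel together with its
    -- `r^lam`.
    have h2 : 1 ≤ A * 2 ^ (-lam) * r ^ lam * (μ.real (dBall ζ r))⁻¹ := by
      rw [← div_eq_mul_inv, le_div_iff₀ hV, one_mul]; exact h1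
    have e1 : r ^ (-N + p * (θ - α)) * r ^ υ * r ^ (N - υ) = r ^ (p * (θ - α)) := by
      rw [← Real.rpow_add hr, ← Real.rpow_add hr]; congr 1; ring
    calc M * r ^ (-N + p * (θ - α)) * r ^ υ * (μ.real (dBall ζ r))⁻¹ * (r / (r + dist ζ s)) ^ q *
          (G * r ^ (N - υ))
        = M * G * (r ^ (-N + p * (θ - α)) * r ^ υ * r ^ (N - υ)) * (μ.real (dBall ζ r))⁻¹ *
            (r / (r + dist ζ s)) ^ q := by ring
      _ ≤ M * G * (r ^ (-N + p * (θ - α)) * r ^ υ * r ^ (N - υ)) * (μ.real (dBall ζ r))⁻¹ *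
            (r / (r + dist ζ s)) ^ q * (A * 2 ^ (-lam) * r ^ lam * (μ.real (dBall ζ r))⁻¹) :=
          le_mul_of_one_le_right (by positivity) h2
      _ = _ := by
          rw [e1]; unfold kernelTerm; rw [Real.rpow_add hr]; ring

theorem _root_.NonIso.kernelNorm_eq_iterated (μ : Measure (Cn m)) [IsProbabilityMeasure μ]
    (p α lam q θ : ℝ) {X : Cn m × Cn m → ENNReal} (hX : Measurable X) :
    kernelNorm μ p α lam q θ X =
      ∫⁻ ζ, ∫⁻ s, X (s, ζ) ^ p * kernelW μ p α lam q θ ζ s ∂μ ∂μ := by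
  have hm : Measurable fun x : Cn m × Cn m => X x ^ p * kernelW μ p α lam q θ x.2 x.1 :=
    (hX.pow_const p).mul (measurable_kernelW μ p α lam q θ measurable_snd measurable_fst)
  exact lintegral_prod_symm' _ hm

/-- At almost every point `ζ` of `E` the means of the local averages of `X(·, ζ)` vanish. -/
theorem ae_vanishingMean_nearAvg (g : Growth E μ υ lam A) (he : IsFrame e)
    (hυ : υ < ((m + 1 : ℕ) : ℝ)) {p α q ω : ℝ} (hp : 1 ≤ p) (hq : 0 ≤ q) (hω : ω < α) (θ : ℝ)
    {X : Cn m × Cn m → ENNReal} (hX : Measurable X) (hfin : kernelNorm μ p α lam q θ X < ⊤) :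
    ∀ᵐ ζ ∂μ, VanishingMean
      (fun z => ENNReal.ofReal (dist z ζ ^ (θ - ω)) * nearAvg E μ (fun s => X (s, ζ)) z) ζ := by
  classical
  have := g.prob
  have hp0 : 0 < p := by linarith
  set N : ℝ := ((m + 2 : ℕ) : ℝ) with hN
  obtain ⟨C, hC, hnear⟩ := g.exists_lintegral_near_le he hυ hp hq hω θ
  set ν := volume.restrict (Metric.ball (0 : Cn m) 1) with hν
  have hball : ∀ᵐ z ∂ν, ‖z‖ < 1 := by
    filter_upwards [ae_restrict_mem measurableSet_ball] with z hz
    simpa using hz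
  have hρm := measurable_distSet (m := m) g.nonempty
  set H : Cn m → Cn m → ENNReal := fun ζ z =>
    ENNReal.ofReal (dist z ζ ^ (θ - ω)) * nearAvg E μ (fun s => X (s, ζ)) z with hH
  have hHm : Measurable fun x : Cn m × Cn m => H x.1 x.2 := by
    refine ((measurable_dist measurable_snd measurable_fst).pow_const _).ennreal_ofReal.mul ?_
    refine measurable_nearAvg g.nonempty μ (Z := Cn m × Cn m) (Y := fun x s => X (s, x.1)) ?_
      measurable_snd
    exact hX.comp (measurable_snd.prodMk (measurable_fst.comp measurable_fst))
  have hΦm : Measurable fun x : Cn m × Cn m =>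
      ENNReal.ofReal (dist x.2 x.1 ^ (-N)) * H x.1 x.2 ^ p :=
    ((measurable_dist measurable_snd measurable_fst).pow_const _).ennreal_ofReal.mul
      (hHm.pow_const p)
  have hHζ : ∀ ζ, Measurable (H ζ) := fun ζ =>
    Measurable.of_uncurry_left (f := H) hHm
  have hXζ : ∀ ζ, Measurable fun s => X (s, ζ) := fun ζ =>
    hX.comp (measurable_id.prodMk measurable_const)
  -- Jensen for the average over `s`, then Fubini: the integral in `z` becomes `kernelW` centred at
  -- `ζ`, and a further integration in `ζ` gives `kernelNorm`.
  have hstep : ∀ᵐ ζ ∂μ, ∫⁻ z, ENNReal.ofReal (dist z ζ ^ (-N)) * H ζ z ^ p ∂ν ≤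
      ENNReal.ofReal C * ∫⁻ s, X (s, ζ) ^ p * kernelW μ p α lam q θ ζ s ∂μ := by
    filter_upwards [g.ae_mem] with ζ hζ
    calc ∫⁻ z, ENNReal.ofReal (dist z ζ ^ (-N)) * H ζ z ^ p ∂ν
        ≤ ∫⁻ z, ∫⁻ s, X (s, ζ) ^ p * nearWeight E μ (-N + p * (θ - ω)) ζ s z ∂μ ∂ν := by
          refine lintegral_mono_ae ?_
          filter_upwards [hball] with z hz
          have hdz : 0 < dist z ζ :=
            (distSet_pos g.nonempty g.sub hz).trans_le (distSet_le _ hζ)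
          simp only [hH]
          rw [ENNReal.mul_rpow_of_nonneg _ _ hp0.le,
            ENNReal.ofReal_rpow_of_nonneg (by positivity) hp0.le, ← Real.rpow_mul hdz.le,
            ← mul_assoc, ← ENNReal.ofReal_mul (by positivity), ← Real.rpow_add hdz]
          refine (mul_le_mul_right (g.nearAvg_rpow_le hp (hXζ ζ) hz) _).trans (le_of_eq ?_)
          unfold nearAvg
          rw [← mul_assoc, ← ENNReal.ofReal_mul (by positivity),
            ← lintegral_const_mul' _ _ ENNReal.ofReal_ne_top]
          refine lintegral_congr fun s => ?_
          simp only [nearWeight, hz, true_and]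
          rw [mul_comm (θ - ω) p]
          split_ifs
          · ring
          · simp
      _ = ∫⁻ s, ∫⁻ z, X (s, ζ) ^ p * nearWeight E μ (-N + p * (θ - ω)) ζ s z ∂ν ∂μ := by
          refine lintegral_lintegral_swap (Measurable.aemeasurable ?_)
          exact (((hXζ ζ).comp measurable_snd).pow_const p).mul
            (measurable_nearWeight g.nonempty μ _ ζ measurable_snd measurable_fst)
      _ ≤ ∫⁻ s, ENNReal.ofReal C * (X (s, ζ) ^ p * kernelW μ p α lam q θ ζ s) ∂μ := by
          refine lintegral_mono_ae ?_
          filter_upwards [g.ae_mem] with s hs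
          have hTs : Measurable fun z => nearWeight E μ (-N + p * (θ - ω)) ζ s z :=
            measurable_nearWeight g.nonempty μ _ ζ measurable_const measurable_id
          rw [lintegral_const_mul _ hTs, mul_left_comm]
          exact mul_le_mul_right (hnear ζ hζ s hs) _
      _ = _ := lintegral_const_mul' _ _ ENNReal.ofReal_ne_top
  have key : ∫⁻ ζ, ∫⁻ z, ENNReal.ofReal (dist z ζ ^ (-N)) * H ζ z ^ p ∂ν ∂μ < ⊤ := by
    refine (lintegral_mono_ae hstep).trans_lt ?_
    rw [lintegral_const_mul' _ _ ENNReal.ofReal_ne_top]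
    refine ENNReal.mul_lt_top ENNReal.ofReal_lt_top ?_
    rw [← kernelNorm_eq_iterated μ p α lam q θ hX]
    exact hfin
  have hmeas : Measurable fun ζ => ∫⁻ z, ENNReal.ofReal (dist z ζ ^ (-N)) * H ζ z ^ p ∂ν :=
    Measurable.lintegral_prod_right' (f := fun x : Cn m × Cn m =>
      ENNReal.ofReal (dist x.2 x.1 ^ (-N)) * H x.1 x.2 ^ p) hΦm
  filter_upwards [ae_lt_top hmeas key.ne, g.ae_mem] with ζ h1 h2
  exact VanishingMean.of_lintegral he hp (g.norm_eq h2) (hHζ ζ) h1.ne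

end Growth
end NearMeans
-- Taylor polynomials re-expanded about another point.
section TaylorAlgebra

variable {m : ℕ} {e : Cn m → Fin (m + 1) → Cn m}

theorem hasFDerivAt_coord (e : Cn m → Fin (m + 1) → Cn m) (s : Cn m) (k : Fin (m + 1)) (z : Cn m) :
    HasFDerivAt (fun z => coord e z s k) (innerSL ℂ (e s k)) z :=
  (innerSL ℂ (e s k)).hasFDerivAt.comp z ((hasFDerivAt_id z).sub_const s)

theorem differentiable_coord (e : Cn m → Fin (m + 1) → Cn m) (s : Cn m) (k : Fin (m + 1)) :
    Differentiable ℂ fun z => coord e z s k := fun z =>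
  (hasFDerivAt_coord e s k z).differentiableAt

/-- By orthonormality the derivative along `e s l` sees only the `l`-th coordinate, so a single term
of the product rule survives. Products of arbitrary one-variable functions are used because this
form is preserved by further derivatives. -/
theorem IsFrame.fderiv_prod_coord (he : IsFrame e) {s : Cn m} (hs : s ≠ 0)
    {h : Fin (m + 1) → ℂ → ℂ} (hh : ∀ k, Differentiable ℂ (h k)) (l : Fin (m + 1)) (z : Cn m) :
    fderiv ℂ (fun z => ∏ k, h k (coord e z s k)) z (e s l) =
      ∏ k, Function.update h l (deriv (h l)) k (coord e z s k) := by
  classical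
  have h1 : ∀ k ∈ Finset.univ, HasFDerivAt (fun z => h k (coord e z s k))
      (deriv (h k) (coord e z s k) • innerSL ℂ (e s k)) z := fun k _ =>
    ((hh k _).hasDerivAt).comp_hasFDerivAt z (hasFDerivAt_coord e s k z)
  rw [(HasFDerivAt.finsetProd h1).fderiv]
  have horth := orthonormal_iff_ite.1 (he.orthonormal s hs)
  have hsum : ∀ k, ((∏ j ∈ Finset.univ.erase k, h j (coord e z s j)) •
      (deriv (h k) (coord e z s k) • innerSL ℂ (e s k))) (e s l) =
      if k = l then (∏ j ∈ Finset.univ.erase l, h j (coord e z s j)) *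
        deriv (h l) (coord e z s l) else 0 := by
    intro k
    have hin : (innerSL ℂ (e s k)) (e s l) = if k = l then 1 else 0 := horth k l
    simp only [_root_.smul_apply, smul_eq_mul, hin]
    split_ifs with hkl
    · rw [hkl, mul_one]
    · simp
  rw [_root_.sum_apply, Finset.sum_congr rfl fun k _ => hsum k, Finset.sum_ite_eq' Finset.univ l,
    if_pos (Finset.mem_univ l), ← Finset.prod_erase_mul _ _ (Finset.mem_univ l),
    Function.update_self]
  congr 1
  refine Finset.prod_congr rfl fun j hj => ?_
  rw [Function.update_of_ne (Finset.ne_of_mem_erase hj)]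

theorem differentiable_iterate_deriv {h : ℂ → ℂ} (hh : Differentiable ℂ h) (n : ℕ) :
    Differentiable ℂ (deriv^[n] h) := by
  induction n with
  | zero => exact hh
  | succ n ih =>
    rw [Function.iterate_succ_apply']
    have := ih.differentiableOn (s := Set.univ) |>.deriv isOpen_univ
    rwa [differentiableOn_univ] at this

theorem IsFrame.iterate_fderiv_prod_coord (he : IsFrame e) {s : Cn m} (hs : s ≠ 0)
    {h : Fin (m + 1) → ℂ → ℂ} (hh : ∀ k, Differentiable ℂ (h k)) (l : Fin (m + 1)) (n : ℕ) :
    (fun (H : Cn m → ℂ) (z : Cn m) => fderiv ℂ H z (e s l))^[n]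
      (fun z => ∏ k, h k (coord e z s k)) =
      fun z => ∏ k, Function.update h l (deriv^[n] (h l)) k (coord e z s k) := by
  induction n with
  | zero => simp
  | succ n ih =>
    rw [Function.iterate_succ_apply', ih]
    funext z
    rw [he.fderiv_prod_coord hs (h := Function.update h l (deriv^[n] (h l))) ?_ l z]
    · rw [Function.update_self, Function.update_idem, Function.iterate_succ_apply']
    · intro k
      by_cases hk : k = l
      · subst hk; rw [Function.update_self]; exact differentiable_iterate_deriv (hh k) n
      · rw [Function.update_of_ne hk]; exact hh k

theorem IsFrame.foldr_prod_coord (he : IsFrame e) {s : Cn m} (hs : s ≠ 0)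
    {h : Fin (m + 1) → ℂ → ℂ} (hh : ∀ k, Differentiable ℂ (h k)) (j : Fin (m + 1) → ℕ)
    (L : List (Fin (m + 1))) (hL : L.Nodup) :
    L.foldr (fun k G => (fun (H : Cn m → ℂ) (z : Cn m) => fderiv ℂ H z (e s k))^[j k] G)
      (fun z => ∏ k, h k (coord e z s k)) =
      fun z => ∏ k, (if k ∈ L then deriv^[j k] (h k) else h k) (coord e z s k) := by
  induction L with
  | nil => simp
  | cons a L ih =>
    obtain ⟨haL, hL'⟩ := List.nodup_cons.1 hL
    rw [List.foldr_cons, ih hL', he.iterate_fderiv_prod_coord hs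
      (h := fun k => if k ∈ L then deriv^[j k] (h k) else h k)]
    · funext z
      refine Finset.prod_congr rfl fun k _ => ?_
      by_cases hk : k = a
      · subst hk; simp [haL]
      · rw [Function.update_of_ne hk]; simp [hk]
    · intro k
      split_ifs
      · exact differentiable_iterate_deriv (hh k) _
      · exact hh k

theorem iterate_deriv_pow_zero (i j : ℕ) :
    deriv^[j] (fun x : ℂ => x ^ i) 0 = if i = j then (j.factorial : ℂ) else 0 := by
  rw [iter_deriv_pow]
  rcases lt_trichotomy i j with h | h | h
  · rw [if_neg h.ne]
    rw [Finset.prod_eq_zero (Finset.mem_range.2 h) (sub_self _), zero_mul]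
  · subst h
    rw [if_pos rfl, Nat.sub_self, pow_zero, mul_one, ← Nat.descFactorial_self,
      Nat.descFactorial_eq_prod_range, Nat.cast_prod]
    exact Finset.prod_congr rfl fun k hk => (Nat.cast_sub (Finset.mem_range.1 hk).le).symm
  · rw [if_neg h.ne', zero_pow (Nat.sub_ne_zero_of_lt h), mul_zero]

theorem IsFrame.dirDeriv_monomial (he : IsFrame e) {s : Cn m} (hs : s ≠ 0)
    (i j : Fin (m + 1) → ℕ) :
    dirDeriv (e s) j (fun z => ∏ k, coord e z s k ^ i k) s =
      if i = j then ∏ k, ((j k).factorial : ℂ) else 0 := by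
  unfold dirDeriv
  rw [he.foldr_prod_coord hs (h := fun k x => x ^ i k) (fun k => differentiable_pow _) j _
    (List.nodup_finRange _)]
  have hc : ∀ k, coord e s s k = 0 := fun k => by simp [coord]
  simp only [List.mem_finRange, if_true, hc, iterate_deriv_pow_zero]
  split_ifs with h
  · subst h; simp
  · obtain ⟨k, hk⟩ := Function.ne_iff.1 h
    exact Finset.prod_eq_zero (Finset.mem_univ k) (if_neg hk)

/-- The multi-indices with all entries at most `d`. -/
def box (m d : ℕ) : Finset (Fin (m + 1) → ℕ) := Fintype.piFinset fun _ => Finset.range (d + 1)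

theorem mem_box {d : ℕ} {i : Fin (m + 1) → ℕ} : i ∈ box m d ↔ ∀ k, i k ≤ d := by
  simp [box]

theorem exists_box_of_mvPolynomial {d : ℕ} (P : MvPolynomial (Fin (m + 1)) ℂ)
    (hP : P.totalDegree ≤ d) : ∃ c : (Fin (m + 1) → ℕ) → ℂ, ∀ x : Fin (m + 1) → ℂ,
      MvPolynomial.eval x P = ∑ i ∈ box m d, c i * ∏ k, x k ^ i k := by
  classical
  refine ⟨fun i => P.coeff (Finsupp.equivFunOnFinite.symm i), fun x => ?_⟩
  rw [MvPolynomial.eval_eq']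
  refine Finset.sum_of_injOn (fun f => ⇑f) (fun a _ b _ hab => DFunLike.coe_injective hab) ?_ ?_ ?_
  · intro f hf
    rw [Finset.mem_coe, mem_box]
    intro k
    have h1 := (MvPolynomial.le_totalDegree hf).trans hP
    rw [Finsupp.sum_fintype _ _ (fun _ => rfl)] at h1
    exact (Finset.single_le_sum (f := fun k => f k) (fun _ _ => Nat.zero_le _)
      (Finset.mem_univ k)).trans h1
  · intro i _ hi
    have : P.coeff (Finsupp.equivFunOnFinite.symm i) = 0 := by
      by_contra hne
      exact hi ⟨Finsupp.equivFunOnFinite.symm i, MvPolynomial.mem_support_iff.2 hne, by ext; simp⟩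
    simp only [this, zero_mul]
  · intro f _
    have : Finsupp.equivFunOnFinite.symm (⇑f) = f := by ext; simp
    simp only [this]

/-- The coordinates at `y` are affine functions of those at `s`; hence a Taylor polynomial at `y` is
a polynomial of controlled degree in the coordinates at `s`. Tangential directions at `y` need not
be tangential at `s`, so weights above `α` can appear. -/
theorem IsFrame.coord_eq_sum (he : IsFrame e) {s : Cn m} (hs : s ≠ 0) (x y : Cn m)
    (k : Fin (m + 1)) :
    coord e x y k = coord e s y k + ∑ l, coord e x s l * inner ℂ (e y k) (e s l) := by
  have h := he.sum_coord hs x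
  unfold coord at h ⊢
  conv_lhs => rw [h]
  rw [add_sub_right_comm, inner_add_right, inner_sum]
  simp_rw [inner_smul_right]

theorem IsFrame.exists_mvPolynomial_monomial (he : IsFrame e) {s : Cn m} (hs : s ≠ 0) (y : Cn m)
    {d : ℕ} (j : Fin (m + 1) → ℕ) (hj : ∀ k, j k ≤ d) :
    ∃ P : MvPolynomial (Fin (m + 1)) ℂ, P.totalDegree ≤ (m + 1) * d ∧
      ∀ x, ∏ k, coord e x y k ^ j k = MvPolynomial.eval (coord e x s) P := by
  refine ⟨∏ k, (MvPolynomial.C (coord e s y k) +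
    ∑ l, MvPolynomial.X l * MvPolynomial.C (inner ℂ (e y k) (e s l))) ^ j k, ?_, fun x => ?_⟩
  · refine (MvPolynomial.totalDegree_finsetProd _ _).trans ?_
    have : ∀ k ∈ Finset.univ, ((MvPolynomial.C (coord e s y k) +
        ∑ l, MvPolynomial.X l * MvPolynomial.C (inner ℂ (e y k) (e s l))) ^ j k :
          MvPolynomial (Fin (m + 1)) ℂ).totalDegree ≤ d := by
      intro k _
      refine (MvPolynomial.totalDegree_pow _ _).trans ?_
      have h1 : (MvPolynomial.C (coord e s y k) + ∑ l, MvPolynomial.X l *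
          MvPolynomial.C (inner ℂ (e y k) (e s l)) :
            MvPolynomial (Fin (m + 1)) ℂ).totalDegree ≤ 1 := by
        refine (MvPolynomial.totalDegree_add _ _).trans (max_le (by simp) ?_)
        refine MvPolynomial.totalDegree_finsetSum_le fun l _ => ?_
        refine (MvPolynomial.totalDegree_mul _ _).trans ?_
        rw [MvPolynomial.totalDegree_X, MvPolynomial.totalDegree_C]
      nlinarith [hj k]
    refine (Finset.sum_le_card_nsmul _ _ _ this).trans ?_
    simp
  · rw [map_prod]
    refine Finset.prod_congr rfl fun k _ => ?_
    rw [map_pow, he.coord_eq_sum hs x y k]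
    simp

theorem differentiable_prod_coord (e : Cn m → Fin (m + 1) → Cn m) (s : Cn m)
    (i : Fin (m + 1) → ℕ) : Differentiable ℂ fun z => ∏ k, coord e z s k ^ i k :=
  fun z => (HasFDerivAt.finsetProd fun k _ =>
    (((differentiable_coord e s k) z).pow (i k)).hasFDerivAt).differentiableAt

theorem differentiable_taylor (e : Cn m → Fin (m + 1) → Cn m) (α : ℝ) (f : Jet m) (y : Cn m) :
    Differentiable ℂ (taylor e α f y) :=
  Differentiable.fun_sum fun j _ => (differentiable_prod_coord e y j).const_mul _

/-- The bound on the exponents in the expansion of a Taylor polynomial. -/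
noncomputable def boxDeg (m : ℕ) (α : ℝ) : ℕ := (m + 1) * ⌊2 * α⌋₊

theorem le_of_mem_indices {α : ℝ} {j : Fin (m + 1) → ℕ} (hj : j ∈ indices m α) (k : Fin (m + 1)) :
    j k ≤ ⌊2 * α⌋₊ := by
  classical
  simp only [indices, Finset.mem_filter, Fintype.mem_piFinset, Finset.mem_range,
    Nat.lt_succ_iff] at hj
  exact hj.1 k

/-- Expansion of a Taylor polynomial about another point. -/
theorem IsFrame.taylor_eq_sum (he : IsFrame e) (α : ℝ) (f : Jet m) {s : Cn m} (hs : s ≠ 0)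
    (y x : Cn m) : taylor e α f y x = ∑ i ∈ box m (boxDeg m α),
      (dirDeriv (e s) i (taylor e α f y) s * (∏ k, ((i k).factorial : ℂ))⁻¹) *
        ∏ k, coord e x s k ^ i k := by
  have h1 : ∀ j : Fin (m + 1) → ℕ, ∃ c : (Fin (m + 1) → ℕ) → ℂ, j ∈ indices m α → ∀ x,
      ∏ k, coord e x y k ^ j k = ∑ i ∈ box m (boxDeg m α), c i * ∏ k, coord e x s k ^ i k := by
    intro j
    by_cases hj : j ∈ indices m α
    · obtain ⟨P, hP, hPx⟩ := he.exists_mvPolynomial_monomial hs y j (le_of_mem_indices hj)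
      obtain ⟨c, hc⟩ := exists_box_of_mvPolynomial P hP
      exact ⟨c, fun _ x => by rw [hPx x, hc]; rfl⟩
    · exact ⟨0, fun h => absurd h hj⟩
  choose c hc using h1
  set a : (Fin (m + 1) → ℕ) → ℂ := fun i => ∑ j ∈ indices m α,
    (∏ k, ((j k).factorial : ℂ))⁻¹ * f j y * c j i
  have h2 : ∀ x, taylor e α f y x = ∑ i ∈ box m (boxDeg m α), a i * ∏ k, coord e x s k ^ i k := by
    intro x
    simp only [a, Finset.sum_mul]
    rw [Finset.sum_comm]
    refine Finset.sum_congr rfl fun j hj => ?_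
    rw [hc j hj x, Finset.mul_sum]
    refine Finset.sum_congr rfl fun i _ => ?_
    ring
  -- The `i`-th derivative at `s` isolates one coefficient, which identifies the abstract
  -- coefficient `a i` as a derivative of the Taylor polynomial.
  have h3 : ∀ i ∈ box m (boxDeg m α), dirDeriv (e s) i (taylor e α f y) s =
      a i * ∏ k, ((i k).factorial : ℂ) := by
    intro i hi
    rw [dirDeriv_eq_sum isOpen_univ (box m (boxDeg m α)) a
      (G := fun i z => ∏ k, coord e z s k ^ i k)
      (fun i _ => (differentiable_prod_coord e s i).differentiableOn) (fun z _ => h2 z) (e s) i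
      (Set.mem_univ s)]
    simp only [he.dirDeriv_monomial hs, mul_ite, mul_zero]
    rw [Finset.sum_ite_eq' _ i, if_pos hi]
  rw [h2]
  refine Finset.sum_congr rfl fun i hi => ?_
  rw [h3 i hi, mul_assoc (a i), mul_inv_cancel₀, mul_one]
  exact Finset.prod_ne_zero_iff.2 fun k _ => Nat.cast_ne_zero.2 (Nat.factorial_ne_zero _)

theorem IsFrame.wDeriv_taylor_self (he : IsFrame e) (α : ℝ) (f : Jet m) {s : Cn m} (hs : s ≠ 0)
    {j : Fin (m + 1) → ℕ} (hj : weight j ≤ α) : dirDeriv (e s) j (taylor e α f s) s = f j s := by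
  rw [dirDeriv_eq_sum (F := taylor e α f s) isOpen_univ (indices m α)
    (fun j => (∏ k, ((j k).factorial : ℂ))⁻¹ * f j s)
    (G := fun i z => ∏ k, coord e z s k ^ i k)
    (fun i _ => (differentiable_prod_coord e s i).differentiableOn) (fun z _ => rfl) (e s) j
    (Set.mem_univ s)]
  simp only [he.dirDeriv_monomial hs, mul_ite, mul_zero]
  rw [Finset.sum_ite_eq' _ j, if_pos (mem_indices.2 hj), mul_right_comm, inv_mul_cancel₀, one_mul]
  exact Finset.prod_ne_zero_iff.2 fun k _ => Nat.cast_ne_zero.2 (Nat.factorial_ne_zero _)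

end TaylorAlgebra
-- Jet differences and the finiteness of their kernel norms.
section JetDifferences

variable {m : ℕ} {e : Cn m → Fin (m + 1) → Cn m}

theorem differentiable_finsetProd_pow {X : Type*} [NormedAddCommGroup X] [NormedSpace ℂ X]
    {ι : Type*} [Fintype ι] {F : ι → X → ℂ} (hF : ∀ k, Differentiable ℂ (F k)) (j : ι → ℕ) :
    Differentiable ℂ fun x => ∏ k, F k x ^ j k := by
  classical
  exact fun x => (HasFDerivAt.finsetProd fun k _ =>
    ((hF k x).pow (j k)).hasFDerivAt).differentiableAt

/-- The frame is merely Borel. Its values at both points are made parameters of a polynomial `G`,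
whose directional derivatives are jointly holomorphic in point, directions and parameters;
measurability follows by composition with a Borel map. -/
theorem measurable_dirDeriv_monomial (he : IsFrame e) (i j : Fin (m + 1) → ℕ) {Z : Type*}
    [MeasurableSpace Z] {y s : Z → Cn m} (hy : Measurable y) (hs : Measurable s) :
    Measurable fun x => dirDeriv (e (s x)) i (fun z => ∏ k, coord e z (y x) k ^ j k) (s x) := by
  set G : (((Fin (m + 1) → Fin (m + 1) → ℂ) × (Fin (m + 1) → ℂ)) × (Fin (m + 1) → Cn m)) × Cn m →
      ℂ := fun x => ∏ k, (∑ l, x.1.1.1 k l * x.2 l - x.1.1.2 k) ^ j k with hG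
  have hGd : Differentiable ℂ G := by
    refine differentiable_finsetProd_pow (fun k => ?_) j
    refine Differentiable.sub (Differentiable.fun_sum fun l _ => ?_) ?_
    · refine Differentiable.mul ?_ ?_
      · exact differentiable_pi.1 (differentiable_pi.1
          (differentiable_fst.comp (differentiable_fst.comp differentiable_fst)) k) l
      · exact ((EuclideanSpace.proj l : Cn m →L[ℂ] ℂ).differentiable).comp differentiable_snd
    · exact (differentiable_pi.1 (differentiable_snd.comp
        (differentiable_fst.comp differentiable_fst))) k
  have hd := differentiableOn_dirDeriv_param (O := Set.univ) isOpen_univ hGd.differentiableOn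
    (V := fun p => p.2) differentiable_snd i
  have hc := (differentiableOn_univ.1 hd).continuous
  have hey : Measurable fun x => e (y x) := he.measurable.comp hy
  have heyk : ∀ k, Measurable fun x => e (y x) k := fun k => (measurable_pi_apply k).comp hey
  -- The conjugated entries of `e (y x) k` are taken as parameters, since the inner product is
  -- conjugate-linear in that slot and `G` has to be holomorphic.
  have hmap : Measurable fun x =>
      ((((fun k l => star (e (y x) k l), fun k => inner ℂ (e (y x) k) (y x)), e (s x)), s x) :
      (((Fin (m + 1) → Fin (m + 1) → ℂ) × (Fin (m + 1) → ℂ)) × (Fin (m + 1) → Cn m)) × Cn m) := by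
    refine ((Measurable.prodMk ?_ ?_).prodMk (he.measurable.comp hs)).prodMk hs
    · refine measurable_pi_lambda _ fun k => measurable_pi_lambda _ fun l => ?_
      exact ((continuous_star.comp
        (EuclideanSpace.proj l : Cn m →L[ℂ] ℂ).continuous).measurable).comp (heyk k)
    · exact measurable_pi_lambda _ fun k => (heyk k).inner hy
  have hcomp := hc.measurable.comp hmap
  have heq : (fun x => dirDeriv (e (s x)) i (fun z => ∏ k, coord e z (y x) k ^ j k) (s x)) = fun x =>
      dirDeriv (e (s x)) i (fun z => G (((fun k l => star (e (y x) k l),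
        fun k => inner ℂ (e (y x) k) (y x)), e (s x)), z)) (s x) := by
    funext x
    congr 1
    funext z
    simp only [hG]
    refine Finset.prod_congr rfl fun k _ => ?_
    congr 1
    rw [coord, inner_sub_right, PiLp.inner_apply]
    congr 1
    refine Finset.sum_congr rfl fun l _ => ?_
    rw [RCLike.inner_apply, mul_comm]
    rfl
  rw [heq]
  exact hcomp

theorem dirDeriv_taylor_eq_sum (e : Cn m → Fin (m + 1) → Cn m) (α : ℝ) (f : Jet m)
    (v : Fin (m + 1) → Cn m) (i : Fin (m + 1) → ℕ) (y s : Cn m) :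
    dirDeriv v i (taylor e α f y) s = ∑ j ∈ indices m α,
      ((∏ k, ((j k).factorial : ℂ))⁻¹ * f j y) *
        dirDeriv v i (fun z => ∏ k, coord e z y k ^ j k) s :=
  dirDeriv_eq_sum isOpen_univ (indices m α) (fun j => (∏ k, ((j k).factorial : ℂ))⁻¹ * f j y)
    (G := fun j z => ∏ k, coord e z y k ^ j k)
    (fun j _ => (differentiable_prod_coord e y j).differentiableOn) (fun _ _ => rfl) v i
    (Set.mem_univ s)

theorem measurable_dirDeriv_taylor (he : IsFrame e) {α : ℝ} {f : Jet m}
    (hf : ∀ j ∈ indices m α, Measurable (f j)) (i : Fin (m + 1) → ℕ) {Z : Type*}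
    [MeasurableSpace Z] {y s : Z → Cn m} (hy : Measurable y) (hs : Measurable s) :
    Measurable fun x => dirDeriv (e (s x)) i (taylor e α f (y x)) (s x) := by
  simp only [dirDeriv_taylor_eq_sum]
  exact Finset.measurable_fun_sum _ fun j hj => (((hf j hj).comp hy).const_mul _).mul
    (measurable_dirDeriv_monomial he i j hy hs)

/-- Cauchy's estimate in the polydisc of polyradius one about `s`, where `‖x - y‖ ≤ 1 + (m + 1) + 1
= m + 3`. -/
theorem exists_norm_dirDeriv_monomial_le (i j : Fin (m + 1) → ℕ) : ∃ C : ℝ, 0 < C ∧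
    ∀ {e : Cn m → Fin (m + 1) → Cn m}, IsFrame e → ∀ s y : Cn m, ‖s‖ = 1 → ‖y‖ = 1 →
      ‖dirDeriv (e s) i (fun z => ∏ k, coord e z y k ^ j k) s‖ ≤ C := by
  obtain ⟨C, hC, h⟩ := exists_norm_dirDeriv_le i
  refine ⟨C * ∏ k, ((m : ℝ) + 3) ^ j k, by positivity, ?_⟩
  intro e he s y hs hy
  have hs0 : s ≠ 0 := by rintro rfl; simp at hs
  have hy0 : y ≠ 0 := by rintro rfl; simp at hy
  have := h (U := Set.univ) (F := fun z => ∏ k, coord e z y k ^ j k) (v := e s) (z := s)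
    (r := fun _ => 1) (M := ∏ k, ((m : ℝ) + 3) ^ j k) isOpen_univ
    (differentiable_prod_coord e y j).differentiableOn (fun _ => one_pos) (Set.subset_univ _) ?_
  · simpa using this
  · rintro x ⟨ξ, hξ, rfl⟩
    rw [norm_prod]
    refine Finset.prod_le_prod (fun _ _ => norm_nonneg _) fun k _ => ?_
    rw [norm_pow]
    refine pow_le_pow_left₀ (norm_nonneg _) ?_ _
    refine (he.norm_coord_le hy0 _ k).trans ?_
    have h1 : ‖∑ k, ξ k • e s k‖ ≤ m + 1 := by
      refine (norm_sum_le _ _).trans ?_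
      refine (Finset.sum_le_card_nsmul _ _ 1 fun k _ => ?_).trans (by simp)
      rw [norm_smul, he.norm_eq_one hs0, mul_one]
      exact hξ k
    calc ‖s + ∑ k, ξ k • e s k - y‖ ≤ ‖s + ∑ k, ξ k • e s k‖ + ‖y‖ := norm_sub_le _ _
      _ ≤ ‖s‖ + ‖∑ k, ξ k • e s k‖ + ‖y‖ := by gcongr; exact norm_add_le _ _
      _ ≤ _ := by rw [hs, hy]; linarith

/-- The difference at `s` of the `i`-th derivatives of the Taylor polynomials at `y` and at `s`,
where `x = (y, s)`. -/
noncomputable def jetDiff (e : Cn m → Fin (m + 1) → Cn m) (α : ℝ) (f : Jet m)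
    (i : Fin (m + 1) → ℕ) (x : Cn m × Cn m) : ℂ :=
  dirDeriv (e x.2) i (taylor e α f x.1) x.2 - dirDeriv (e x.2) i (taylor e α f x.2) x.2

theorem measurable_jetDiff (he : IsFrame e) {α : ℝ} {f : Jet m}
    (hf : ∀ j ∈ indices m α, Measurable (f j)) (i : Fin (m + 1) → ℕ) :
    Measurable (jetDiff e α f i) :=
  (measurable_dirDeriv_taylor he hf i measurable_fst measurable_snd).sub
    (measurable_dirDeriv_taylor he hf i measurable_snd measurable_snd)

theorem exists_norm_dirDeriv_taylor_le (α : ℝ) (i : Fin (m + 1) → ℕ) : ∃ C : ℝ, 0 < C ∧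
    ∀ {e : Cn m → Fin (m + 1) → Cn m}, IsFrame e → ∀ (f : Jet m) (s y : Cn m), ‖s‖ = 1 → ‖y‖ = 1 →
      ‖dirDeriv (e s) i (taylor e α f y) s‖ₑ ≤ ENNReal.ofReal C * ∑ j ∈ indices m α, ‖f j y‖ₑ := by
  choose C hC hb using fun j => exists_norm_dirDeriv_monomial_le (m := m) i j
  refine ⟨∑ j ∈ indices m α, C j + 1, by
    have := Finset.sum_nonneg fun j (_ : j ∈ indices m α) => (hC j).le
    linarith, ?_⟩
  intro e he f s y hs hy
  rw [dirDeriv_taylor_eq_sum, Finset.mul_sum]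
  refine (enorm_sum_le _ _).trans (Finset.sum_le_sum fun j hj => ?_)
  rw [enorm_mul, enorm_mul]
  have h1 : ‖(∏ k, ((j k).factorial : ℂ))⁻¹‖ₑ ≤ 1 := by
    rw [← ofReal_norm, ← ENNReal.ofReal_one]
    refine ENNReal.ofReal_le_ofReal ?_
    rw [norm_inv, ← Nat.cast_prod, Complex.norm_natCast]
    refine inv_le_one_of_one_le₀ ?_
    exact_mod_cast Nat.one_le_iff_ne_zero.2
      (Finset.prod_ne_zero_iff.2 fun k _ => Nat.factorial_ne_zero _)
  have h2 : ‖dirDeriv (e s) i (fun z => ∏ k, coord e z y k ^ j k) s‖ₑ ≤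
      ENNReal.ofReal (∑ j ∈ indices m α, C j + 1) := by
    rw [← ofReal_norm]
    refine ENNReal.ofReal_le_ofReal ((hb j he s y hs hy).trans ?_)
    have := Finset.single_le_sum (fun j (_ : j ∈ indices m α) => (hC j).le) hj
    linarith
  calc _ ≤ 1 * ‖f j y‖ₑ * ENNReal.ofReal (∑ j ∈ indices m α, C j + 1) := by gcongr
    _ = _ := by rw [one_mul, mul_comm]

theorem kernelNorm_lt_top_of_le_sum {μ : Measure (Cn m)} [IsProbabilityMeasure μ] {p : ℝ}
    (hp : 1 ≤ p) (α lam q θ : ℝ) {ι : Type*} (t : Finset ι) {X : Cn m × Cn m → ENNReal}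
    {Y : ι → Cn m × Cn m → ENNReal} (hY : ∀ a ∈ t, Measurable (Y a)) {C : ENNReal} (hC : C ≠ ⊤)
    (hX : ∀ᵐ x ∂(μ.prod μ), X x ≤ C * ∑ a ∈ t, Y a x)
    (hfin : ∀ a ∈ t, kernelNorm μ p α lam q θ (Y a) < ⊤) : kernelNorm μ p α lam q θ X < ⊤ := by
  have hp0 : 0 < p := by linarith
  have hW : Measurable fun x : Cn m × Cn m => kernelW μ p α lam q θ x.2 x.1 :=
    measurable_kernelW μ p α lam q θ measurable_snd measurable_fst
  have h1 : kernelNorm μ p α lam q θ X ≤ C ^ p * (t.card : ENNReal) ^ (p - 1) *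
      ∑ a ∈ t, kernelNorm μ p α lam q θ (Y a) := by
    have hm : ∀ a ∈ t, AEMeasurable (fun x => Y a x ^ p * kernelW μ p α lam q θ x.2 x.1)
        (μ.prod μ) := fun a ha => (((hY a ha).pow_const p).mul hW).aemeasurable
    unfold kernelNorm
    rw [← lintegral_finsetSum' t hm,
      ← lintegral_const_mul' _ _ (ENNReal.mul_ne_top (ENNReal.rpow_ne_top_of_nonneg hp0.le hC)
        (ENNReal.rpow_ne_top_of_nonneg (by linarith) (ENNReal.natCast_ne_top _)))]
    refine lintegral_mono_ae ?_
    filter_upwards [hX] with x hx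
    calc X x ^ p * kernelW μ p α lam q θ x.2 x.1
        ≤ (C * ∑ a ∈ t, Y a x) ^ p * kernelW μ p α lam q θ x.2 x.1 := by gcongr
      _ ≤ (C ^ p * ((t.card : ENNReal) ^ (p - 1) * ∑ a ∈ t, Y a x ^ p)) *
            kernelW μ p α lam q θ x.2 x.1 := by
          rw [ENNReal.mul_rpow_of_nonneg _ _ hp0.le]
          gcongr
          exact ENNReal.rpow_sum_le_const_mul_sum_rpow t _ hp
      _ = _ := by rw [← Finset.sum_mul]; ring
  refine h1.trans_lt (ENNReal.mul_lt_top (ENNReal.mul_lt_top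
    (ENNReal.rpow_lt_top_of_nonneg hp0.le hC)
    (ENNReal.rpow_lt_top_of_nonneg (by linarith) (ENNReal.natCast_ne_top _))) ?_)
  exact ENNReal.sum_lt_top.2 hfin

theorem exists_int_weight (i : Fin (m + 1) → ℕ) : ∃ N : ℤ, (N : ℝ) / 2 = weight i := by
  refine ⟨2 * (i (Fin.last m) : ℤ) + ∑ k : Fin m, (i k.castSucc : ℤ), ?_⟩
  unfold weight
  push_cast
  ring

theorem weight_nonneg (i : Fin (m + 1) → ℕ) : 0 ≤ weight i := by unfold weight; positivity

namespace Growth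

variable {E : Set (Cn m)} {μ : Measure (Cn m)} {υ lam A : ℝ}

theorem ae_prod_mem (g : Growth E μ υ lam A) : ∀ᵐ x ∂(μ.prod μ), x.1 ∈ E ∧ x.2 ∈ E := by
  have := g.prob
  have h1 := Measure.quasiMeasurePreserving_fst (μ := μ) (ν := μ) |>.ae g.ae_mem
  have h2 := Measure.quasiMeasurePreserving_snd (μ := μ) (ν := μ) |>.ae g.ae_mem
  filter_upwards [h1, h2] with x a b using ⟨a, b⟩

theorem lintegral_enorm_rpow_lt_top {p : ℝ} (hp : 1 ≤ p) {F : Cn m → ℂ}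
    (hF : MemLp F (ENNReal.ofReal p) μ) : ∫⁻ y, ‖F y‖ₑ ^ p ∂μ < ⊤ := by
  have hp0 : 0 < p := by linarith
  have := lintegral_rpow_enorm_lt_top_of_eLpNorm_lt_top (p := ENNReal.ofReal p)
    (by simpa using hp0) ENNReal.ofReal_ne_top hF.2
  rwa [ENNReal.toReal_ofReal hp0.le] at this

/-- Half-integrality of the weight and `hhalf` leave two cases. Below `α` the jet difference is
minus the remainder and the kernel is dominated by the Besov kernel. Above `α + (υ - lam) / p` no
smoothness is needed: the difference is bounded by values of the jet at the two points, and the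
kernel is integrable in either variable. -/
theorem kernelNorm_jetDiff_lt_top (g : Growth E μ υ lam A) (he : IsFrame e) {p α q : ℝ}
    (hp : 1 ≤ p) (hhalf : ∀ i : ℤ, (i : ℝ) / 2 ∉ Set.Icc α (α + (υ - lam) / p))
    (hq : 3 * υ < q) (hq2 : 2 * υ + p * α - lam < q) {f : Jet m}
    (hf : ∀ j ∈ indices m α, Measurable (f j)) (hB : MemBesov e p α lam μ f)
    (i : Fin (m + 1) → ℕ) :
    kernelNorm μ p α lam q (weight i) (fun x => ‖jetDiff e α f i x‖ₑ) < ⊤ := by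
  have := g.prob
  have hp0 : 0 < p := by linarith
  have hυ0 := g.nonneg
  obtain ⟨N, hN⟩ := exists_int_weight i
  have hnot := hhalf N
  rw [hN, Set.mem_Icc, not_and_or, not_le, not_le] at hnot
  rcases hnot with hlt | hgt
  · have hw := weight_nonneg i
    obtain ⟨C, hC, hk⟩ := g.exists_kernelW_le (p := p) (α := α) (q := q) (θ := weight i)
      (mul_pos hp0 (by linarith)) (by nlinarith) (by linarith)
    have hBi := (hB i hlt.le).2
    refine lt_of_le_of_lt ?_ (ENNReal.mul_lt_top (ENNReal.ofReal_lt_top (r := C)) hBi)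
    unfold kernelNorm
    rw [← lintegral_const_mul' _ _ ENNReal.ofReal_ne_top]
    refine lintegral_mono_ae ?_
    filter_upwards [g.ae_prod_mem] with x hx
    have hx2 : x.2 ≠ 0 := g.ne_zero hx.2
    have hj : jetDiff e α f i x = -remainder e α f i x.1 x.2 := by
      unfold jetDiff remainder wDeriv
      rw [he.wDeriv_taylor_self α f hx2 hlt.le]; ring
    -- On the diagonal the kernel comparison is unavailable, but the jet difference is zero there.
    rcases (dist_nonneg x.2 x.1).eq_or_lt with h0 | hpos
    · have hxx := dist_eq_zero_imp (g.norm_eq hx.2).le (g.norm_eq hx.1).le h0.symm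
      have : jetDiff e α f i x = 0 := by unfold jetDiff; rw [hxx, sub_self]
      rw [this, enorm_zero, ENNReal.zero_rpow_of_pos hp0, zero_mul]
      exact zero_le
    · have hV := g.pos x.1 hx.1 _ hpos
      refine (mul_le_mul_right (hk x.2 hx.2 x.1 hx.1 hpos) _).trans (le_of_eq ?_)
      rw [hj, enorm_neg, ENNReal.ofReal_mul hC.le, ENNReal.ofReal_mul (by positivity),
        ENNReal.ofReal_pow (by positivity), ENNReal.ofReal_inv_of_pos hV, ofReal_measureReal,
        dist_comm x.1 x.2, ENNReal.inv_pow]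
      ring
  · obtain ⟨C, hC, hb⟩ := exists_norm_dirDeriv_taylor_le (m := m) α i
    have hθ : 0 < p * (weight i - α) + lam - υ := by
      have h1 : (υ - lam) / p < weight i - α := by linarith
      rw [div_lt_iff₀ hp0] at h1
      linarith
    have hpow : ∀ j ∈ indices m α, ∫⁻ y, ‖f j y‖ₑ ^ p ∂μ < ⊤ := fun j hj =>
      lintegral_enorm_rpow_lt_top hp (hB j (mem_indices.1 hj)).1
    have hk := fun j (hj : j ∈ indices m α) =>
      g.kernelNorm_lt_top_of_large (α := α) hq hθ (hf j hj).enorm (hpow j hj)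
    refine kernelNorm_lt_top_of_le_sum hp α lam q (weight i) ((indices m α).disjSum (indices m α))
      (Y := Sum.elim (fun j x => ‖f j x.1‖ₑ) fun j x => ‖f j x.2‖ₑ) (C := ENNReal.ofReal C) ?_
      ENNReal.ofReal_ne_top ?_ ?_
    · rintro (j | j) hj
      · exact ((hf j (by simpa using hj)).comp measurable_fst).enorm
      · exact ((hf j (by simpa using hj)).comp measurable_snd).enorm
    · filter_upwards [g.ae_prod_mem] with x hx
      rw [Finset.sum_disjSum, mul_add]
      refine enorm_sub_le.trans (add_le_add ?_ ?_)
      · exact hb he f x.2 x.1 (g.norm_eq hx.2) (g.norm_eq hx.1)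
      · exact hb he f x.2 x.2 (g.norm_eq hx.2) (g.norm_eq hx.2)
    · rintro (j | j) hj
      · exact (hk j (by simpa using hj)).1
      · exact (hk j (by simpa using hj)).2

end Growth
end JetDifferences
-- Holomorphy of the extension, also slightly beyond the unit ball.
section Holomorphy

variable {m : ℕ} {e : Cn m → Fin (m + 1) → Cn m}

/-- The points at which the principal branch of `(1 - z · ȳ)^{-q}` is holomorphic for all
`y ∈ E`. -/
def branchSet (E : Set (Cn m)) : Set (Cn m) := {z | ∀ y ∈ E, tau z y ∈ Complex.slitPlane}

theorem isOpen_branchSet {E : Set (Cn m)} (hE : IsCompact E) : IsOpen (branchSet E) := by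
  rw [isOpen_iff_mem_nhds]
  intro z hz
  refine hE.eventually_forall_of_forall_eventually (x₀ := z)
    (P := fun z y => tau z y ∈ Complex.slitPlane) fun y hy => ?_
  have hc : Continuous fun x : Cn m × Cn m => tau x.1 x.2 :=
    continuous_tau_comp continuous_fst continuous_snd
  exact hc.continuousAt.eventually_mem (Complex.isOpen_slitPlane.mem_nhds (hz y hy))

theorem ball_subset_branchSet {E : Set (Cn m)} (hS : E ⊆ Metric.sphere 0 1) :
    Metric.ball 0 1 ⊆ branchSet E := by
  intro z hz y hy
  have hz1 : ‖z‖ < 1 := by simpa using hz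
  exact Or.inl (re_tau_pos hz1 (mem_sphere_zero_iff_norm.1 (hS hy)).le)

theorem differentiableAt_tau_cpow {z y : Cn m} (h : tau z y ∈ Complex.slitPlane) (q : ℂ) :
    DifferentiableAt ℂ (fun z => tau z y ^ q) z := by
  have h1 : DifferentiableAt ℂ (fun z => tau z y) z :=
    ((innerSL ℂ y).differentiableAt).const_sub 1
  exact h1.cpow_const h

theorem exists_norm_tau_cpow_le {E : Set (Cn m)} (hE : IsCompact E) (q : ℂ) {z₀ : Cn m}
    (hz₀ : z₀ ∈ branchSet E) : ∃ ε M : ℝ, 0 < ε ∧ ε ≤ 1 ∧ 0 ≤ M ∧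
      Metric.ball z₀ ε ⊆ branchSet E ∧ ∀ z ∈ Metric.ball z₀ ε, ∀ y ∈ E, ‖tau z y ^ q‖ ≤ M := by
  obtain ⟨ε, hε, hsub⟩ := Metric.nhds_basis_closedBall.mem_iff.1
    ((isOpen_branchSet hE).mem_nhds hz₀)
  have hsub' : Metric.closedBall z₀ (min ε 1) ⊆ branchSet E :=
    (Metric.closedBall_subset_closedBall (min_le_left _ _)).trans hsub
  have hK : IsCompact (Metric.closedBall z₀ (min ε 1) ×ˢ E) :=
    (isCompact_closedBall _ _).prod hE
  have hcont : ContinuousOn (fun x : Cn m × Cn m => tau x.1 x.2 ^ q)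
      (Metric.closedBall z₀ (min ε 1) ×ˢ E) := by
    intro x hx
    have hc : Continuous fun x : Cn m × Cn m => tau x.1 x.2 :=
      continuous_tau_comp continuous_fst continuous_snd
    exact (hc.continuousAt.cpow continuousAt_const (hsub' hx.1 x.2 hx.2)).continuousWithinAt
  obtain ⟨M, hM⟩ := hK.exists_bound_of_continuousOn hcont
  refine ⟨min ε 1, max M 0, by positivity, min_le_right _ _, le_max_right _ _,
    Metric.ball_subset_closedBall.trans hsub', fun z hz y hy => ?_⟩
  exact (hM (z, y) ⟨Metric.ball_subset_closedBall hz, hy⟩).trans (le_max_left _ _)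

theorem differentiableAt_integral_mul_tau_cpow {E : Set (Cn m)} (hE : IsCompact E)
    {μ : Measure (Cn m)} (hμ : ∀ᵐ y ∂μ, y ∈ E) (q : ℂ) {z₀ : Cn m} (hz₀ : z₀ ∈ branchSet E)
    {φ : Cn m → Cn m → ℂ} {b : Cn m → ℝ} (hφm : ∀ z, AEStronglyMeasurable (φ z) μ)
    (hφd : ∀ y, Differentiable ℂ fun z => φ z y)
    (hφb : ∀ᵐ y ∂μ, ∀ z ∈ Metric.ball z₀ 1, ‖φ z y‖ ≤ b y) (hb : Integrable b μ) :
    DifferentiableAt ℂ (fun z => ∫ y, φ z y * tau z y ^ q ∂μ) z₀ ∧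
      Integrable (fun y => φ z₀ y * tau z₀ y ^ q) μ := by
  obtain ⟨ε, M, hε, hε1, hM, hsub, hbd⟩ := exists_norm_tau_cpow_le hE q hz₀
  have hm : ∀ z, AEStronglyMeasurable (fun y => φ z y * tau z y ^ q) μ := fun z =>
    (hφm z).mul ((measurable_tau measurable_const measurable_id).pow_const q).aestronglyMeasurable
  have hbb : ∀ᵐ y ∂μ, ∀ z ∈ Metric.ball z₀ ε, ‖φ z y * tau z y ^ q‖ ≤ b y * M := by
    filter_upwards [hμ, hφb] with y hy hb z hz
    rw [norm_mul]
    have h1 := hb z (Metric.ball_subset_ball hε1 hz)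
    exact mul_le_mul h1 (hbd z hz y hy) (norm_nonneg _) ((norm_nonneg _).trans h1)
  refine ⟨differentiableAt_integral_of_bound hε (fun z _ => hm z) ?_ hbb (hb.mul_const M), ?_⟩
  · filter_upwards [hμ] with y hy z hz
    exact ((hφd y z).mul (differentiableAt_tau_cpow (hsub hz y hy) q)).differentiableWithinAt
  · refine (hb.mul_const M).mono' (hm z₀) ?_
    filter_upwards [hbb] with y hy using hy z₀ (Metric.mem_ball_self hε)

theorem exists_norm_taylor_le (α R : ℝ) (hR : 0 ≤ R) : ∃ C : ℝ, 0 < C ∧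
    ∀ {e : Cn m → Fin (m + 1) → Cn m}, IsFrame e → ∀ (f : Jet m) (y x : Cn m), ‖y‖ = 1 → ‖x‖ ≤ R →
      ‖taylor e α f y x‖ ≤ C * ∑ j ∈ indices m α, ‖f j y‖ := by
  have hpos : ∀ j : Fin (m + 1) → ℕ, 0 < ∏ k, (R + 1) ^ j k := fun j =>
    Finset.prod_pos fun k _ => by positivity
  have hsum0 : 0 ≤ ∑ j ∈ indices m α, ∏ k, (R + 1) ^ j k := Finset.sum_nonneg fun j _ => (hpos j).le
  refine ⟨∑ j ∈ indices m α, ∏ k, (R + 1) ^ j k + 1, by linarith, ?_⟩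
  intro e he f y x hy hx
  have hy0 : y ≠ 0 := by rintro rfl; simp at hy
  unfold taylor
  rw [Finset.mul_sum]
  refine (norm_sum_le _ _).trans (Finset.sum_le_sum fun j hj => ?_)
  rw [norm_mul, norm_mul]
  have h1 : ‖(∏ k, ((j k).factorial : ℂ))⁻¹‖ ≤ 1 := by
    rw [norm_inv, ← Nat.cast_prod, Complex.norm_natCast]
    refine inv_le_one_of_one_le₀ ?_
    exact_mod_cast Nat.one_le_iff_ne_zero.2
      (Finset.prod_ne_zero_iff.2 fun k _ => Nat.factorial_ne_zero _)
  have h2 : ‖∏ k, coord e x y k ^ j k‖ ≤ ∏ k, (R + 1) ^ j k := by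
    rw [norm_prod]
    refine Finset.prod_le_prod (fun _ _ => norm_nonneg _) fun k _ => ?_
    rw [norm_pow]
    refine pow_le_pow_left₀ (norm_nonneg _) ((he.norm_coord_le hy0 x k).trans ?_) _
    exact (norm_sub_le _ _).trans (by rw [hy]; linarith)
  have h3 := Finset.single_le_sum (fun j (_ : j ∈ indices m α) => (hpos j).le) hj
  calc _ ≤ 1 * ‖f j y‖ * ∏ k, (R + 1) ^ j k := by gcongr
    _ ≤ 1 * ‖f j y‖ * (∑ j ∈ indices m α, ∏ k, (R + 1) ^ j k + 1) := by gcongr; linarith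
    _ = _ := by ring

theorem measurable_taylor (he : IsFrame e) {α : ℝ} {f : Jet m}
    (hf : ∀ j ∈ indices m α, Measurable (f j)) (x : Cn m) :
    Measurable fun y => taylor e α f y x := by
  unfold taylor
  refine Finset.measurable_fun_sum _ fun j hj => ((hf j hj).const_mul _).mul ?_
  refine Finset.measurable_fun_prod _ fun k _ => Measurable.pow_const ?_ _
  have hek : Measurable fun y => e y k := (measurable_pi_apply k).comp he.measurable
  exact hek.inner (measurable_const.sub measurable_id)

namespace Growth

variable {E : Set (Cn m)} {μ : Measure (Cn m)} {υ lam A : ℝ}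

theorem differentiableAt_hq (g : Growth E μ υ lam A) (q : ℝ) {z : Cn m} (hz : z ∈ branchSet E) :
    DifferentiableAt ℂ (hq q μ) z ∧ Integrable (fun y => tau z y ^ (-(q : ℂ))) μ := by
  have := g.prob
  have h := differentiableAt_integral_mul_tau_cpow g.isCompact g.ae_mem (-(q : ℂ)) hz
    (φ := fun _ _ => 1) (b := fun _ => 1) (fun _ => aestronglyMeasurable_const)
    (fun _ => differentiable_const _) (by simp) (integrable_const _)
  simp only [one_mul] at h
  exact h

theorem differentiableAt_integral_taylor (g : Growth E μ υ lam A) (he : IsFrame e) {α : ℝ}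
    {f : Jet m} (hf : ∀ j ∈ indices m α, Measurable (f j))
    (hfi : ∀ j ∈ indices m α, Integrable (f j) μ) (q : ℝ) {z : Cn m} (hz : z ∈ branchSet E) :
    DifferentiableAt ℂ (fun z => ∫ y, taylor e α f y z * tau z y ^ (-(q : ℂ)) ∂μ) z ∧
      Integrable (fun y => taylor e α f y z * tau z y ^ (-(q : ℂ))) μ := by
  obtain ⟨C, hC, hb⟩ := exists_norm_taylor_le (m := m) α (‖z‖ + 1) (by positivity)
  refine differentiableAt_integral_mul_tau_cpow g.isCompact g.ae_mem (-(q : ℂ)) hz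
    (φ := fun z y => taylor e α f y z) (b := fun y => C * ∑ j ∈ indices m α, ‖f j y‖)
    (fun z => (measurable_taylor he hf z).aestronglyMeasurable)
    (fun y => differentiable_taylor e α f y) ?_
    ((integrable_finsetSum _ fun j hj => (hfi j hj).norm).const_mul C)
  filter_upwards [g.ae_mem] with y hy x hx
  refine hb he f y x (g.norm_eq hy) ?_
  have h1 : ‖x - z‖ < 1 := mem_ball_iff_norm.1 hx
  have h2 := norm_sub_norm_le x z
  linarith

theorem differentiableAt_ext (g : Growth E μ υ lam A) (he : IsFrame e) {α : ℝ}
    {f : Jet m} (hf : ∀ j ∈ indices m α, Measurable (f j))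
    (hfi : ∀ j ∈ indices m α, Integrable (f j) μ) (q : ℝ) {z : Cn m} (hz : z ∈ branchSet E)
    (hh : hq q μ z ≠ 0) : DifferentiableAt ℂ (ext e q α μ f) z :=
  (((g.differentiableAt_hq q hz).1).inv hh).mul (g.differentiableAt_integral_taylor he hf hfi q hz).1

theorem isOpen_ext_domain (g : Growth E μ υ lam A) (q : ℝ) :
    IsOpen (branchSet E ∩ {z | hq q μ z ≠ 0}) := by
  have hc : ContinuousOn (hq q μ) (branchSet E) := fun z hz =>
    (g.differentiableAt_hq q hz).1.continuousAt.continuousWithinAt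
  exact hc.isOpen_inter_preimage (isOpen_branchSet g.isCompact) isOpen_compl_singleton

/-- The normalized weights integrate to one, so `taylor e α f s z` may be moved under the integral.
-/
theorem ext_sub_taylor (g : Growth E μ υ lam A) (he : IsFrame e) {α : ℝ}
    {f : Jet m} (hf : ∀ j ∈ indices m α, Measurable (f j))
    (hfi : ∀ j ∈ indices m α, Integrable (f j) μ) (q : ℝ) {z : Cn m} (hz : z ∈ branchSet E)
    (hh : hq q μ z ≠ 0) (s : Cn m) : ext e q α μ f z - taylor e α f s z =
      (hq q μ z)⁻¹ * ∫ y, (taylor e α f y z - taylor e α f s z) * tau z y ^ (-(q : ℂ)) ∂μ := by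
  have h1 := (g.differentiableAt_integral_taylor he hf hfi q hz).2
  have h2 := (g.differentiableAt_hq q hz).2
  simp only [sub_mul]
  rw [integral_sub h1 (h2.const_mul _), integral_const_mul, mul_sub]
  unfold ext
  congr 1
  change _ = (hq q μ z)⁻¹ * (taylor e α f s z * hq q μ z)
  rw [mul_left_comm, inv_mul_cancel₀ hh, mul_one]

end Growth
end Holomorphy
-- Stability of the kernel and of the lower bound under small displacements.
section Perturbation

variable {m : ℕ} {e : Cn m → Fin (m + 1) → Cn m}

/-- Two arguments in (−π/2, π/2) have their sum in (−π, π). The multiplicativity of principal powers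
in `mul_cpow_of_re_pos` has the same reason. -/
theorem mul_mem_slitPlane_of_re_pos {a b : ℂ} (ha : 0 < a.re) (hb : 0 < b.re) :
    a * b ∈ Complex.slitPlane := by
  by_contra h
  rw [Complex.mem_slitPlane_iff, not_or, not_lt, not_not, Complex.mul_re, Complex.mul_im] at h
  nlinarith [h.1, h.2, mul_pos ha hb, sq_nonneg b.im, sq_nonneg a.im,
    mul_nonneg hb.le (sq_nonneg a.im), mul_nonneg ha.le (sq_nonneg b.im)]

theorem mul_cpow_of_re_pos {a b : ℂ} (ha : 0 < a.re) (hb : 0 < b.re) (x : ℂ) :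
    (a * b) ^ x = a ^ x * b ^ x := by
  have ha0 : a ≠ 0 := by rintro rfl; simp at ha
  have hb0 : b ≠ 0 := by rintro rfl; simp at hb
  have h1 := abs_lt.1 (Complex.abs_arg_lt_pi_div_two_iff.2 (Or.inl ha))
  have h2 := abs_lt.1 (Complex.abs_arg_lt_pi_div_two_iff.2 (Or.inl hb))
  rw [Complex.cpow_def_of_ne_zero (mul_ne_zero ha0 hb0), Complex.cpow_def_of_ne_zero ha0,
    Complex.cpow_def_of_ne_zero hb0, Complex.log_mul ha0 hb0
      ⟨by linarith [h1.1, h2.1], by linarith [h1.2, h2.2]⟩, add_mul, Complex.exp_add]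

theorem exists_norm_one_sub_cpow_sub_one_le (x : ℂ) {ε : ℝ} (hε : 0 < ε) :
    ∃ c : ℝ, 0 < c ∧ c ≤ 1 / 2 ∧ ∀ u : ℂ, ‖u‖ ≤ c → ‖(1 - u) ^ x - 1‖ ≤ ε := by
  have hc : ContinuousAt (fun u : ℂ => (1 - u) ^ x) 0 :=
    (continuousAt_const.sub continuousAt_id).cpow continuousAt_const (by simp)
  obtain ⟨δ, hδ, h⟩ := Metric.continuousAt_iff.1 hc ε hε
  refine ⟨min (δ / 2) (1 / 2), by positivity, min_le_right _ _, fun u hu => ?_⟩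
  have h1 : ‖u‖ < δ := lt_of_le_of_lt (hu.trans (min_le_left _ _)) (by linarith)
  have := h (x := u) (by simpa using h1)
  simpa [dist_eq_norm] using this.le

/-- Displacements of `z` that change all `1 - z · ȳ`, `y ∈ E`, by a factor close to one. -/
def Admissible (E : Set (Cn m)) (c : ℝ) (z v : Cn m) : Prop :=
  (∀ y ∈ E, ‖inner ℂ y v‖ ≤ c * dist z y) ∧ ‖v‖ ≤ Real.sqrt (distSet z E)

namespace Growth

variable {E : Set (Cn m)} {μ : Measure (Cn m)} {υ lam A : ℝ}

theorem exists_le_norm_hq (g : Growth E μ υ lam A) {q : ℝ} (hL : HasLowerBound E q μ) :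
    ∃ c : ℝ, 0 < c ∧ ∀ z : Cn m, ‖z‖ < 1 →
      c * distSet z E ^ (-q) * μ.real (dBall z (6 * distSet z E)) ≤ ‖hq q μ z‖ := by
  have hA := g.A_pos
  obtain ⟨C, hC, h⟩ := hL
  refine ⟨C * (A * 144 ^ υ)⁻¹, by positivity, fun z hz => ?_⟩
  obtain ⟨z₀, hz₀, hd, hb⟩ := h z (by simpa using hz)
  have hρ := distSet_pos g.nonempty g.sub hz
  have h1 := g.real_dBall_le hz.le hρ hz₀ (by rw [hd]; linarith)
  have h2 : μ.real (dBall z₀ (distSet z E)) ≤ μ.real (dBall z₀ (3 * distSet z E)) :=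
    g.real_mono fun y _ hy => dBall_mono z₀ (by linarith) hy
  refine le_trans ?_ hb
  have h3 : (A * 144 ^ υ)⁻¹ * μ.real (dBall z (6 * distSet z E)) ≤
      μ.real (dBall z₀ (3 * distSet z E)) := by
    rw [inv_mul_le_iff₀ (by positivity)]
    exact h1.trans (mul_le_mul_of_nonneg_left h2 (by positivity))
  calc _ = C * distSet z E ^ (-q) * ((A * 144 ^ υ)⁻¹ * μ.real (dBall z (6 * distSet z E))) := by ring
    _ ≤ _ := mul_le_mul_of_nonneg_left h3 (by positivity)

/-- Each `1 - z · ȳ` is multiplied by some `1 - u` with `|u| ≤ c`, so its power changes by a small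
relative amount, uniformly in `y`. The total change of `h_q` is a small multiple of `∫ d(z,y)^(-q)
dμ(y) ≲ ρ^(-q) U`, the same size as the lower bound. -/
theorem exists_perturbation (g : Growth E μ υ lam A) {q : ℝ} (hυq : υ < q)
    (hL : HasLowerBound E q μ) : ∃ c c' : ℝ, 0 < c ∧ c ≤ 1 / 2 ∧ 0 < c' ∧ ∀ z : Cn m, ‖z‖ < 1 →
      ∀ v, Admissible E c z v → z + v ∈ branchSet E ∧
        c' * distSet z E ^ (-q) * μ.real (dBall z (6 * distSet z E)) ≤ ‖hq q μ (z + v)‖ := by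
  have := g.prob
  have hA := g.A_pos
  obtain ⟨c₀, hc₀, hlow⟩ := g.exists_le_norm_hq hL
  have hgeo : 0 < (1 - ((1 : ℝ) / 2) ^ (q - υ))⁻¹ :=
    inv_pos.2 (sub_pos.2 (half_rpow_lt_one (sub_pos.2 hυq)))
  set G := 2 ^ (q + υ) * (1 - ((1 : ℝ) / 2) ^ (q - υ))⁻¹ * (A * 144 ^ υ) with hG
  have hGpos : 0 < G := by positivity
  -- As `∫ d(z,y)^(-q) dμ(y) ≤ G ρ^(-q) U`, this relative error keeps the change of `h_q` below half
  -- of `c₀ ρ^(-q) U`.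
  obtain ⟨c, hc, hc2, hcp⟩ := exists_norm_one_sub_cpow_sub_one_le (-(q : ℂ))
    (ε := c₀ / (2 * G)) (by positivity)
  refine ⟨c, c₀ / 2, hc, hc2, by positivity, ?_⟩
  intro z hz v hv
  have hρ := distSet_pos g.nonempty g.sub hz
  have hI := g.lintegral_distSet_div_le hυq hz
  have hl := hlow z hz
  have hU := g.real_dBall_pos hz.le hρ
  set ρ := distSet z E
  set U := μ.real (dBall z (6 * ρ))
  have hfac : ∀ y ∈ E, 0 < (tau z y).re ∧ tau (z + v) y = tau z y * (1 - inner ℂ y v / tau z y) ∧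
      ‖inner ℂ y v / tau z y‖ ≤ c ∧ 0 < (1 - inner ℂ y v / tau z y).re := by
    intro y hy
    have h1 := re_tau_pos hz (g.norm_eq hy).le
    have h0 : tau z y ≠ 0 := by intro h; rw [h] at h1; simp at h1
    have h2 : ‖inner ℂ y v / tau z y‖ ≤ c := by
      rw [norm_div, div_le_iff₀ (norm_pos_iff.2 h0)]; exact hv.1 y hy
    refine ⟨h1, ?_, h2, ?_⟩
    · rw [tau_add]; field_simp
    · have := (Complex.abs_re_le_norm (inner ℂ y v / tau z y)).trans h2
      rw [Complex.sub_re, Complex.one_re]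
      linarith [le_abs_self (inner ℂ y v / tau z y).re]
  have hmem : z + v ∈ branchSet E := fun y hy => by
    obtain ⟨h1, h2, -, h4⟩ := hfac y hy
    rw [h2]
    exact mul_mem_slitPlane_of_re_pos h1 h4
  refine ⟨hmem, ?_⟩
  have hi1 := (g.differentiableAt_hq q hmem).2
  have hi0 := (g.differentiableAt_hq q
    (ball_subset_branchSet g.sub (by simpa using hz : z ∈ Metric.ball 0 1))).2
  have hdiff : ‖hq q μ (z + v) - hq q μ z‖ₑ ≤ ENNReal.ofReal (c₀ / 2 * ρ ^ (-q) * U) := by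
    unfold hq
    rw [← integral_sub hi1 hi0]
    refine (enorm_integral_le_lintegral_enorm _).trans ?_
    calc ∫⁻ y, ‖tau (z + v) y ^ (-(q : ℂ)) - tau z y ^ (-(q : ℂ))‖ₑ ∂μ
        ≤ ∫⁻ y, ENNReal.ofReal (c₀ / (2 * G) * ρ ^ (-q)) *
            ENNReal.ofReal ((ρ / dist z y) ^ q) ∂μ := by
          refine lintegral_mono_ae ?_
          filter_upwards [g.ae_mem] with y hy
          obtain ⟨h1, h2, h3, h4⟩ := hfac y hy
          have hd : 0 < dist z y := hρ.trans_le (distSet_le z hy)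
          rw [h2, mul_cpow_of_re_pos h1 h4, ← mul_sub_one, ← ofReal_norm, norm_mul,
            ← ENNReal.ofReal_mul (by positivity)]
          refine ENNReal.ofReal_le_ofReal ?_
          have h5 : ‖tau z y ^ (-(q : ℂ))‖ = ρ ^ (-q) * (ρ / dist z y) ^ q := by
            rw [← Complex.ofReal_neg, Complex.norm_cpow_real, Real.div_rpow hρ.le hd.le,
              Real.rpow_neg hρ.le, Real.rpow_neg (norm_nonneg _)]
            have := Real.rpow_pos_of_pos hρ q
            change (dist z y ^ q)⁻¹ = _
            field_simp
          rw [h5]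
          calc _ ≤ ρ ^ (-q) * (ρ / dist z y) ^ q * (c₀ / (2 * G)) := by
                gcongr; exact hcp _ h3
            _ = _ := by ring
      _ ≤ ENNReal.ofReal (c₀ / (2 * G) * ρ ^ (-q)) * ENNReal.ofReal (2 ^ (q + υ) *
            (1 - ((1 : ℝ) / 2) ^ (q - υ))⁻¹ * (A * 144 ^ υ * U)) := by
          rw [lintegral_const_mul' _ _ ENNReal.ofReal_ne_top]
          exact mul_le_mul_right hI _
      _ = _ := by
          rw [← ENNReal.ofReal_mul (by positivity)]
          congr 1
          have : 2 ^ (q + υ) * (1 - ((1 : ℝ) / 2) ^ (q - υ))⁻¹ * (A * 144 ^ υ * U) = G * U := by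
            rw [hG]; ring
          rw [this]
          field_simp
  rw [← ofReal_norm, ENNReal.ofReal_le_ofReal_iff (by positivity)] at hdiff
  have h1 := norm_sub_norm_le (hq q μ z) (hq q μ (z + v))
  rw [norm_sub_rev] at h1
  have e1 : c₀ / 2 * ρ ^ (-q) * U = c₀ * ρ ^ (-q) * U / 2 := by ring
  rw [e1] at hdiff ⊢
  linarith

end Growth
end Perturbation
-- The pointwise comparison of the extension with nearby Taylor polynomials.
section PointwiseBounds

variable {m : ℕ} {e : Cn m → Fin (m + 1) → Cn m}

/-- The radii `√r` in the complex-tangential directions and `r` in the normal one. -/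
noncomputable def anisRadius (m : ℕ) (r : ℝ) (k : Fin (m + 1)) : ℝ :=
  if k = Fin.last m then r else Real.sqrt r

theorem anisRadius_pos {r : ℝ} (hr : 0 < r) (k : Fin (m + 1)) : 0 < anisRadius m r k := by
  unfold anisRadius; split_ifs
  · exact hr
  · exact Real.sqrt_pos.2 hr

theorem prod_anisRadius_pow {r : ℝ} (hr : 0 < r) (i : Fin (m + 1) → ℕ) :
    ∏ k, anisRadius m r k ^ i k = r ^ weight i := by
  rw [Fin.prod_univ_castSucc]
  have h1 : ∀ k : Fin m, anisRadius m r k.castSucc = Real.sqrt r := fun k =>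
    if_neg (Fin.castSucc_lt_last k).ne
  have h2 : anisRadius m r (Fin.last m) = r := if_pos rfl
  simp only [h1, h2]
  rw [Finset.prod_pow_eq_pow_sum, Real.sqrt_eq_rpow, ← Real.rpow_natCast, ← Real.rpow_mul hr.le,
    ← Real.rpow_natCast r, ← Real.rpow_add hr]
  congr 1
  unfold weight
  push_cast
  ring

theorem prod_inv_anisRadius_pow {r : ℝ} (hr : 0 < r) (i : Fin (m + 1) → ℕ) :
    ∏ k, (anisRadius m r k)⁻¹ ^ i k = r ^ (-weight i) := by
  simp only [inv_pow]
  rw [Finset.prod_inv_distrib, prod_anisRadius_pow hr, Real.rpow_neg hr.le]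

theorem norm_prod_coord_le {r K : ℝ} (hr : 0 < r) (hK : 1 ≤ K) {x s : Cn m} {d : ℕ}
    {i : Fin (m + 1) → ℕ} (hi : i ∈ box m d) (h : ∀ k, ‖coord e x s k‖ ≤ K * anisRadius m r k) :
    ‖∏ k, coord e x s k ^ i k‖ ≤ K ^ ((m + 1) * d) * r ^ weight i := by
  rw [norm_prod, ← prod_anisRadius_pow hr]
  calc ∏ k, ‖coord e x s k ^ i k‖ ≤ ∏ k, K ^ d * anisRadius m r k ^ i k := by
        refine Finset.prod_le_prod (fun _ _ => norm_nonneg _) fun k _ => ?_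
        have ha := anisRadius_pos hr k
        rw [norm_pow]
        calc ‖coord e x s k‖ ^ i k ≤ (K * anisRadius m r k) ^ i k :=
              pow_le_pow_left₀ (norm_nonneg _) (h k) _
          _ = K ^ i k * anisRadius m r k ^ i k := mul_pow _ _ _
          _ ≤ _ := by
            gcongr
            exact mem_box.1 hi k
    _ = _ := by
        rw [Finset.prod_mul_distrib, Finset.prod_const, Finset.card_univ, Fintype.card_fin,
          ← pow_mul, mul_comm d]

theorem IsFrame.norm_coord_le_anisRadius (he : IsFrame e) {x s : Cn m} (hs : ‖s‖ = 1) {r K : ℝ}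
    (h1 : ‖x - s‖ ≤ K * Real.sqrt r) (h2 : dist x s ≤ K * r) (k : Fin (m + 1)) :
    ‖coord e x s k‖ ≤ K * anisRadius m r k := by
  have hs0 : s ≠ 0 := by rintro rfl; simp at hs
  unfold anisRadius
  split_ifs with hk
  · rw [hk, he.norm_coord_last hs]; exact h2
  · exact (he.norm_coord_le hs0 x k).trans h1

/-- Both polynomials are expanded about `s`. The difference of the coefficients is a jet difference
up to a factorial, and the anisotropic radii turn the monomial of index `i` into `r ^ weight i`. -/
theorem IsFrame.enorm_taylor_sub_le (he : IsFrame e) (α : ℝ) (f : Jet m) {s : Cn m} (hs : ‖s‖ = 1)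
    (y x : Cn m) {r K : ℝ} (hr : 0 < r) (hK : 1 ≤ K)
    (h : ∀ k, ‖coord e x s k‖ ≤ K * anisRadius m r k) :
    ‖taylor e α f y x - taylor e α f s x‖ₑ ≤ ENNReal.ofReal (K ^ ((m + 1) * boxDeg m α)) *
      ∑ i ∈ box m (boxDeg m α), ‖jetDiff e α f i (y, s)‖ₑ * ENNReal.ofReal (r ^ weight i) := by
  have hs0 : s ≠ 0 := by rintro rfl; simp at hs
  rw [he.taylor_eq_sum α f hs0 y x, he.taylor_eq_sum α f hs0 s x, ← Finset.sum_sub_distrib,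
    Finset.mul_sum]
  refine (enorm_sum_le _ _).trans (Finset.sum_le_sum fun i hi => ?_)
  have h1 : ‖(∏ k, ((i k).factorial : ℂ))⁻¹‖ₑ ≤ 1 := by
    rw [← ofReal_norm, ← ENNReal.ofReal_one]
    refine ENNReal.ofReal_le_ofReal ?_
    rw [norm_inv, ← Nat.cast_prod, Complex.norm_natCast]
    refine inv_le_one_of_one_le₀ ?_
    exact_mod_cast Nat.one_le_iff_ne_zero.2
      (Finset.prod_ne_zero_iff.2 fun k _ => Nat.factorial_ne_zero _)
  have h2 : ‖∏ k, coord e x s k ^ i k‖ₑ ≤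
      ENNReal.ofReal (K ^ ((m + 1) * boxDeg m α) * r ^ weight i) := by
    rw [← ofReal_norm]
    exact ENNReal.ofReal_le_ofReal (norm_prod_coord_le hr hK hi h)
  rw [← sub_mul, ← sub_mul, enorm_mul, enorm_mul]
  calc _ ≤ ‖jetDiff e α f i (y, s)‖ₑ * 1 *
        ENNReal.ofReal (K ^ ((m + 1) * boxDeg m α) * r ^ weight i) := by
        gcongr
        exact le_rfl
    _ = _ := by rw [ENNReal.ofReal_mul (by positivity)]; ring

/-- The bound for `𝓔(f) - T_s` near `z`. -/
noncomputable def localBound (E : Set (Cn m)) (μ : Measure (Cn m)) (e : Cn m → Fin (m + 1) → Cn m)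
    (q α : ℝ) (f : Jet m) (s z : Cn m) : ENNReal :=
  ENNReal.ofReal (μ.real (dBall z (6 * distSet z E)))⁻¹ * ∑ i ∈ box m (boxDeg m α),
    ENNReal.ofReal (distSet z E ^ weight i) *
      ∫⁻ y, ‖jetDiff e α f i (y, s)‖ₑ * ENNReal.ofReal ((distSet z E / dist z y) ^ q) ∂μ

theorem Admissible.dist_add_le {E : Set (Cn m)} {c : ℝ} {z v : Cn m} (hv : Admissible E c z v)
    {y : Cn m} (hy : y ∈ E) : dist (z + v) y ≤ (1 + c) * dist z y ∧
      (1 - c) * dist z y ≤ dist (z + v) y := by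
  have h1 := hv.1 y hy
  have h2 : dist (z + v) y = ‖tau z y - inner ℂ y v‖ := by unfold dist; rw [tau_add]
  have h3 := norm_sub_le (tau z y) (inner ℂ y v)
  have h4 := norm_sub_norm_le (tau z y) (inner ℂ y v)
  unfold dist at h1 h2 ⊢
  rw [h2]
  constructor <;> linarith

namespace Growth

variable {E : Set (Cn m)} {μ : Measure (Cn m)} {υ lam A : ℝ}

/-- The central estimate. It holds at all displaced points `z + v` with a bound depending only on
`z` and `s`, which is the form that Cauchy's estimates require. -/
theorem exists_enorm_ext_sub_taylor_le (g : Growth E μ υ lam A) (he : IsFrame e) {q : ℝ}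
    (hυq : υ < q) (hL : HasLowerBound E q μ) {α : ℝ} {f : Jet m}
    (hf : ∀ j ∈ indices m α, Measurable (f j)) (hfi : ∀ j ∈ indices m α, Integrable (f j) μ) :
    ∃ c C : ℝ, 0 < c ∧ c ≤ 1 / 2 ∧ 0 < C ∧ ∀ z : Cn m, ‖z‖ < 1 → ∀ v, Admissible E c z v →
      z + v ∈ branchSet E ∩ {z | hq q μ z ≠ 0} ∧ ∀ s ∈ E, dist z s < 6 * distSet z E →
        ‖ext e q α μ f (z + v) - taylor e α f s (z + v)‖ₑ ≤
          ENNReal.ofReal C * localBound E μ e q α f s z := by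
  have := g.prob
  have hq0 : 0 ≤ q := g.nonneg.trans hυq.le
  obtain ⟨c, c', hc, hc2, hc', hpert⟩ := g.exists_perturbation hυq hL
  set D := (m + 1) * boxDeg m α
  refine ⟨c, c'⁻¹ * 2 ^ q * 9 ^ D, hc, hc2, by positivity, ?_⟩
  intro z hz v hv
  obtain ⟨hmem, hlow⟩ := hpert z hz v hv
  have hρ := distSet_pos g.nonempty g.sub hz
  have hU := g.real_dBall_pos hz.le hρ
  have hh : hq q μ (z + v) ≠ 0 := by
    intro h
    rw [h, norm_zero] at hlow
    exact absurd hlow (not_le.2 (by positivity))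
  refine ⟨⟨hmem, hh⟩, fun s hs h6 => ?_⟩
  unfold localBound
  set ρ := distSet z E with hρdef
  set U := μ.real (dBall z (6 * ρ))
  have hs1 := g.norm_eq hs
  -- `‖z + v - s‖ ≤ 4√ρ + √ρ`, and `d(z + v, s) ≤ (3/2) · 6ρ = 9ρ`.
  have hcoord : ∀ k, ‖coord e (z + v) s k‖ ≤ 9 * anisRadius m ρ k := by
    refine he.norm_coord_le_anisRadius hs1 ?_ ?_
    · have h1 := norm_sub_le_sqrt hz.le hs1.le
      have h2 : Real.sqrt (2 * dist z s) ≤ 4 * Real.sqrt ρ := by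
        rw [show (4 : ℝ) = Real.sqrt 16 by
          rw [show (16 : ℝ) = 4 ^ 2 by norm_num]; simp, ← Real.sqrt_mul (by norm_num)]
        exact Real.sqrt_le_sqrt (by linarith)
      have h3 : ‖z + v - s‖ ≤ ‖z - s‖ + ‖v‖ := by
        rw [show z + v - s = (z - s) + v by abel]; exact norm_add_le _ _
      have h4 := hv.2
      have h5 := Real.sqrt_nonneg ρ
      rw [← hρdef] at h4
      linarith
    · have h1 := (hv.dist_add_le hs).1
      have h2 := dist_nonneg z s
      nlinarith
  have hinv : ‖(hq q μ (z + v))⁻¹‖ₑ ≤ ENNReal.ofReal (c'⁻¹ * ρ ^ q * U⁻¹) := by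
    rw [← ofReal_norm, norm_inv]
    refine ENNReal.ofReal_le_ofReal ?_
    refine (inv_anti₀ (by positivity) hlow).trans (le_of_eq ?_)
    rw [mul_inv, mul_inv, Real.rpow_neg hρ.le, inv_inv]
  have hJm : ∀ i, Measurable fun y => ‖jetDiff e α f i (y, s)‖ₑ := fun i =>
    ((measurable_jetDiff he hf i).comp (measurable_id.prodMk measurable_const)).enorm
  have hintg : ∫⁻ y, ‖(taylor e α f y (z + v) - taylor e α f s (z + v)) *
      tau (z + v) y ^ (-(q : ℂ))‖ₑ ∂μ ≤ ENNReal.ofReal (9 ^ D * (2 ^ q * ρ ^ (-q))) *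
        ∑ i ∈ box m (boxDeg m α), ENNReal.ofReal (ρ ^ weight i) *
          ∫⁻ y, ‖jetDiff e α f i (y, s)‖ₑ * ENNReal.ofReal ((ρ / dist z y) ^ q) ∂μ := by
    have hwm : Measurable fun y => ENNReal.ofReal ((ρ / dist z y) ^ q) :=
      ((measurable_const.div (measurable_dist measurable_const measurable_id)).pow_const
        q).ennreal_ofReal
    have hsum : ∑ i ∈ box m (boxDeg m α), ENNReal.ofReal (ρ ^ weight i) *
          ∫⁻ y, ‖jetDiff e α f i (y, s)‖ₑ * ENNReal.ofReal ((ρ / dist z y) ^ q) ∂μ =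
        ∫⁻ y, ∑ i ∈ box m (boxDeg m α), ENNReal.ofReal (ρ ^ weight i) *
          (‖jetDiff e α f i (y, s)‖ₑ * ENNReal.ofReal ((ρ / dist z y) ^ q)) ∂μ := by
      have hm : ∀ i ∈ box m (boxDeg m α), Measurable fun y => ENNReal.ofReal (ρ ^ weight i) *
          (‖jetDiff e α f i (y, s)‖ₑ * ENNReal.ofReal ((ρ / dist z y) ^ q)) := fun i _ =>
        ((hJm i).mul hwm).const_mul _
      rw [lintegral_finsetSum _ hm]
      exact Finset.sum_congr rfl fun i _ =>
        (lintegral_const_mul' _ _ ENNReal.ofReal_ne_top).symm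
    rw [hsum, ← lintegral_const_mul' _ _ ENNReal.ofReal_ne_top]
    refine lintegral_mono_ae ?_
    filter_upwards [g.ae_mem] with y hy
    have hd : 0 < dist z y := hρ.trans_le (distSet_le z hy)
    have h1 := he.enorm_taylor_sub_le α f hs1 y (z + v) hρ (by norm_num : (1 : ℝ) ≤ 9) hcoord
    have h2 : ‖tau (z + v) y ^ (-(q : ℂ))‖ₑ ≤
        ENNReal.ofReal (2 ^ q * ρ ^ (-q) * (ρ / dist z y) ^ q) := by
      rw [← ofReal_norm]
      refine ENNReal.ofReal_le_ofReal ?_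
      rw [← Complex.ofReal_neg, Complex.norm_cpow_real]
      have h3 := (hv.dist_add_le hy).2
      have h4 : dist z y / 2 ≤ ‖tau (z + v) y‖ := by
        change dist z y / 2 ≤ dist (z + v) y
        nlinarith
      refine (Real.rpow_le_rpow_of_nonpos (by positivity) h4 (by linarith)).trans (le_of_eq ?_)
      rw [Real.div_rpow hd.le (by norm_num), Real.div_rpow hρ.le hd.le, Real.rpow_neg hρ.le,
        Real.rpow_neg hd.le, Real.rpow_neg (by norm_num)]
      have := Real.rpow_pos_of_pos hρ q
      field_simp
    rw [enorm_mul]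
    refine (mul_le_mul' h1 h2).trans (le_of_eq ?_)
    rw [ENNReal.ofReal_mul (p := 2 ^ q * ρ ^ (-q)) (by positivity),
      ENNReal.ofReal_mul (p := 9 ^ D) (by positivity), Finset.mul_sum, Finset.mul_sum,
      Finset.sum_mul]
    refine Finset.sum_congr rfl fun i _ => ?_
    ring
  rw [g.ext_sub_taylor he hf hfi q hmem hh s, enorm_mul]
  refine (mul_le_mul' hinv ((enorm_integral_le_lintegral_enorm _).trans hintg)).trans (le_of_eq ?_)
  rw [← mul_assoc (ENNReal.ofReal (c'⁻¹ * ρ ^ q * U⁻¹)), ← ENNReal.ofReal_mul (by positivity),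
    ← mul_assoc (ENNReal.ofReal (c'⁻¹ * 2 ^ q * 9 ^ D)), ← ENNReal.ofReal_mul (by positivity)]
  congr 2
  rw [Real.rpow_neg hρ.le]
  have := Real.rpow_pos_of_pos hρ q
  field_simp

end Growth
end PointwiseBounds
-- Derivatives by Cauchy estimates in anisotropic polydiscs.
section DerivativeBounds

variable {m : ℕ} {e : Cn m → Fin (m + 1) → Cn m}

theorem anisRadius_le {r : ℝ} (hr : 0 ≤ r) (hr2 : r ≤ 2) (k : Fin (m + 1)) :
    anisRadius m r k ≤ 2 * Real.sqrt r := by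
  have h0 := Real.sqrt_nonneg r
  have h1 := Real.sq_sqrt hr
  unfold anisRadius
  split_ifs
  · have h2 : Real.sqrt r ≤ 2 := by
      rw [Real.sqrt_le_left (by norm_num)]; linarith
    nlinarith
  · linarith

theorem IsFrame.norm_displacement_le (he : IsFrame e) {z : Cn m} (hz : z ≠ 0) {a r : ℝ}
    (ha : 0 ≤ a) (hr : 0 ≤ r) (hr2 : r ≤ 2) {ξ : Fin (m + 1) → ℂ}
    (hξ : ∀ k, ‖ξ k‖ ≤ a * anisRadius m r k) :
    ‖∑ k, ξ k • e z k‖ ≤ 2 * (m + 1) * a * Real.sqrt r := by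
  refine (norm_sum_le _ _).trans ?_
  refine (Finset.sum_le_card_nsmul _ _ (a * (2 * Real.sqrt r)) fun k _ => ?_).trans (le_of_eq ?_)
  · rw [norm_smul, he.norm_eq_one hz, mul_one]
    exact (hξ k).trans (mul_le_mul_of_nonneg_left (anisRadius_le hr hr2 k) ha)
  · simp; ring

/-- A tangential component of size `√r` is paired with a vector whose product with `y` is at most
`√(2d)`, and the normal one has size `r` already; with `r ≤ d(z,y)` each contributes `O(d(z,y))`.
This is why the polydisc may be as wide as `√ρ` tangentially. -/
theorem IsFrame.norm_inner_displacement_le (he : IsFrame e) {z y : Cn m} (hz : z ≠ 0)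
    (hz1 : ‖z‖ ≤ 1) (hy : ‖y‖ ≤ 1) {a r : ℝ} (ha : 0 ≤ a) (hr : 0 ≤ r) (hry : r ≤ dist z y)
    {ξ : Fin (m + 1) → ℂ} (hξ : ∀ k, ‖ξ k‖ ≤ a * anisRadius m r k) :
    ‖inner ℂ y (∑ k, ξ k • e z k)‖ ≤ 2 * (m + 1) * a * dist z y := by
  have hd := dist_nonneg z y
  rw [inner_sum]
  refine (norm_sum_le _ _).trans ?_
  refine (Finset.sum_le_card_nsmul _ _ (a * (2 * dist z y)) fun k _ => ?_).trans (le_of_eq ?_)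
  · rw [inner_smul_right, norm_mul]
    have hk := hξ k
    induction k using Fin.lastCases with
    | last =>
      have h1 : ‖inner ℂ y (e z (Fin.last m))‖ ≤ 1 :=
        norm_inner_le_one hy (he.norm_eq_one hz _).le
      have h2 : anisRadius m r (Fin.last m) = r := if_pos rfl
      rw [h2] at hk
      calc _ ≤ a * r * 1 := by gcongr
        _ ≤ a * (2 * dist z y) := by
          rw [mul_one]; exact mul_le_mul_of_nonneg_left (by linarith) ha
    | cast k =>
      have h1 := he.norm_inner_castSucc_le hz hz1 hy k
      have h2 : anisRadius m r k.castSucc = Real.sqrt r := if_neg (Fin.castSucc_lt_last k).ne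
      rw [h2] at hk
      have h3 : Real.sqrt r * Real.sqrt (2 * dist z y) ≤ 2 * dist z y := by
        rw [← Real.sqrt_mul hr, Real.sqrt_le_left (by positivity)]
        nlinarith
      calc _ ≤ a * Real.sqrt r * Real.sqrt (2 * dist z y) := by gcongr
        _ = a * (Real.sqrt r * Real.sqrt (2 * dist z y)) := by ring
        _ ≤ _ := mul_le_mul_of_nonneg_left h3 ha
  · simp; ring

theorem prod_inv_mul_anisRadius_pow {a r : ℝ} (hr : 0 < r) (γ : Fin (m + 1) → ℕ) :
    ∏ k, (a * anisRadius m r k)⁻¹ ^ γ k = (∏ k, a⁻¹ ^ γ k) * r ^ (-weight γ) := by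
  rw [← prod_inv_anisRadius_pow hr, ← Finset.prod_mul_distrib]
  exact Finset.prod_congr rfl fun k _ => by rw [mul_inv, mul_pow]

/-- Derivatives of differences of Taylor polynomials. -/
theorem exists_enorm_dirDeriv_taylor_sub_le (m : ℕ) (α : ℝ) (γ : Fin (m + 1) → ℕ) :
    ∃ C : ℝ, 0 < C ∧ ∀ {e : Cn m → Fin (m + 1) → Cn m}, IsFrame e → ∀ (f : Jet m) (z ζ s : Cn m),
      z ≠ 0 → ‖z‖ < 1 → ‖ζ‖ = 1 →
      ‖dirDeriv (e z) γ (taylor e α f s) z - dirDeriv (e z) γ (taylor e α f ζ) z‖ₑ ≤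
        ENNReal.ofReal C * ∑ i ∈ box m (boxDeg m α),
          ENNReal.ofReal (dist z ζ ^ (weight i - weight γ)) * ‖jetDiff e α f i (s, ζ)‖ₑ := by
  obtain ⟨C, hC, hcau⟩ := exists_norm_dirDeriv_le γ
  -- In the polydisc the distance to `ζ` is at most `2√r`, coming from `d(z,ζ) = r`, plus `2(m +
  -- 1)√r` from the displacement; `K` exceeds the total factor.
  set K : ℝ := 2 * m + 5 with hKdef
  have hK : 1 ≤ K := by rw [hKdef]; linarith [(Nat.cast_nonneg m : (0 : ℝ) ≤ m)]
  refine ⟨C * K ^ ((m + 1) * boxDeg m α), by positivity, ?_⟩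
  intro e he f z ζ s hz0 hz hζ
  set r := dist z ζ with hrdef
  have hr : 0 < r := lt_of_lt_of_le (by linarith) (one_sub_norm_le_dist z hζ.le)
  have hr2 : r ≤ 2 := dist_le_two hz.le hζ.le
  set Sg := ∑ i ∈ box m (boxDeg m α), ‖jetDiff e α f i (s, ζ)‖ₑ * ENNReal.ofReal (r ^ weight i)
    with hSg
  have hSgt : Sg ≠ ⊤ := ENNReal.sum_ne_top.2 fun i _ =>
    ENNReal.mul_ne_top enorm_ne_top ENNReal.ofReal_ne_top
  set M := (ENNReal.ofReal (K ^ ((m + 1) * boxDeg m α)) * Sg).toReal with hM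
  have hMt : ENNReal.ofReal (K ^ ((m + 1) * boxDeg m α)) * Sg ≠ ⊤ :=
    ENNReal.mul_ne_top ENNReal.ofReal_ne_top hSgt
  have hdT := differentiable_taylor e α f
  have key := hcau (U := Set.univ) (F := fun x => taylor e α f s x - taylor e α f ζ x) (v := e z)
    (z := z) (r := anisRadius m r) (M := M) isOpen_univ
    ((hdT s).sub (hdT ζ)).differentiableOn (anisRadius_pos hr) (Set.subset_univ _) ?_
  · rw [dirDeriv_sub isOpen_univ (hdT s).differentiableOn (hdT ζ).differentiableOn (e z) γ
      (Set.mem_univ z), prod_inv_anisRadius_pow hr] at key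
    rw [← ofReal_norm]
    refine (ENNReal.ofReal_le_ofReal key).trans (le_of_eq ?_)
    rw [ENNReal.ofReal_mul (by positivity), ENNReal.ofReal_mul hC.le, hM, ENNReal.ofReal_toReal hMt,
      ENNReal.ofReal_mul hC.le, hSg]
    simp only [Finset.mul_sum, Finset.sum_mul]
    refine Finset.sum_congr rfl fun i _ => ?_
    rw [sub_eq_add_neg, Real.rpow_add hr, ENNReal.ofReal_mul (by positivity)]
    ring
  · rintro x ⟨ξ, hξ, rfl⟩
    have hξ' : ∀ k, ‖ξ k‖ ≤ 1 * anisRadius m r k := fun k => by rw [one_mul]; exact hξ k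
    have h1 := he.norm_displacement_le hz0 zero_le_one hr.le hr2 hξ'
    have h2 := he.norm_inner_displacement_le hz0 hz.le hζ.le zero_le_one hr.le le_rfl hξ'
    set v := ∑ k, ξ k • e z k
    rw [← hrdef] at h2
    have h3 := norm_sub_le_sqrt hz.le hζ.le
    rw [← hrdef] at h3
    have h4 : Real.sqrt (2 * r) ≤ 2 * Real.sqrt r := by
      rw [Real.sqrt_mul (by norm_num)]
      gcongr
      rw [Real.sqrt_le_left (by norm_num)]; norm_num
    have h5 := Real.sqrt_nonneg r
    have hcoord := he.norm_coord_le_anisRadius (x := z + v) (r := r) (K := K) hζ ?_ ?_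
    · have h6 := he.enorm_taylor_sub_le α f hζ s (z + v) hr hK hcoord
      rw [← toReal_enorm]
      exact ENNReal.toReal_mono hMt h6
    · have h6 : ‖z + v - ζ‖ ≤ ‖z - ζ‖ + ‖v‖ := by
        rw [show z + v - ζ = (z - ζ) + v by abel]; exact norm_add_le _ _
      rw [hKdef]
      nlinarith
    · have h6 : dist (z + v) ζ ≤ r + ‖inner ℂ ζ v‖ := by
        rw [hrdef]; unfold dist; rw [tau_add]; exact norm_sub_le _ _
      rw [hKdef]
      nlinarith

namespace Growth

variable {E : Set (Cn m)} {μ : Measure (Cn m)} {υ lam A : ℝ}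

/-- A polydisc about `z` with radii a small multiple of `√ρ` and `ρ` consists of admissible
displacements, so Cauchy's estimate applies to the central bound. The polydisc may leave the unit
ball, hence the domain given by the branch set and the nonvanishing of `h_q`. -/
theorem exists_enorm_dirDeriv_ext_sub_le (g : Growth E μ υ lam A) (he : IsFrame e) {q : ℝ}
    (hυq : υ < q) (hL : HasLowerBound E q μ) {α : ℝ} {f : Jet m}
    (hf : ∀ j ∈ indices m α, Measurable (f j)) (hfi : ∀ j ∈ indices m α, Integrable (f j) μ)
    (γ : Fin (m + 1) → ℕ) : ∃ C : ℝ, 0 < C ∧ ∀ z : Cn m, z ≠ 0 → ‖z‖ < 1 → ∀ s ∈ E,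
      dist z s < 6 * distSet z E →
      ‖dirDeriv (e z) γ (ext e q α μ f) z - dirDeriv (e z) γ (taylor e α f s) z‖ₑ ≤
        ENNReal.ofReal (C * distSet z E ^ (-weight γ)) * localBound E μ e q α f s z := by
  obtain ⟨c, C₁, hc, hc2, hC₁, hpt⟩ := g.exists_enorm_ext_sub_taylor_le he hυq hL hf hfi
  obtain ⟨C₂, hC₂, hcau⟩ := exists_norm_dirDeriv_le γ
  -- The displacement bounds carry the factor `2 (m + 1) a`, which is thus exactly `c`.
  set a : ℝ := c / (2 * (m + 1)) with ha
  have ha0 : 0 < a := by positivity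
  have hac : 2 * (m + 1) * a = c := by rw [ha]; field_simp
  have hprod : 0 < ∏ k, a⁻¹ ^ γ k := Finset.prod_pos fun k _ => by positivity
  refine ⟨C₂ * C₁ * ∏ k, a⁻¹ ^ γ k, by positivity, ?_⟩
  intro z hz0 hz s hs h6
  have hρ := distSet_pos g.nonempty g.sub hz
  have hρ2 := distSet_le_two g.nonempty g.sub hz.le
  set ρ := distSet z E with hρdef
  -- An infinite bound leaves nothing to prove; a finite one can serve as the real constant in
  -- Cauchy's estimate.
  rcases eq_or_ne (localBound E μ e q α f s z) ⊤ with htop | htop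
  · rw [htop, ENNReal.mul_top]
    · exact le_top
    · exact (ENNReal.ofReal_pos.2 (by positivity)).ne'
  have hMt : ENNReal.ofReal C₁ * localBound E μ e q α f s z ≠ ⊤ :=
    ENNReal.mul_ne_top ENNReal.ofReal_ne_top htop
  set U := branchSet E ∩ {z | hq q μ z ≠ 0}
  have hU : IsOpen U := g.isOpen_ext_domain q
  have hF : DifferentiableOn ℂ (ext e q α μ f) U := fun x hx =>
    (g.differentiableAt_ext he hf hfi q hx.1 hx.2).differentiableWithinAt
  have hT : DifferentiableOn ℂ (taylor e α f s) U := (differentiable_taylor e α f s).differentiableOn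
  have hadm : ∀ ξ : Fin (m + 1) → ℂ, (∀ k, ‖ξ k‖ ≤ a * anisRadius m ρ k) →
      Admissible E c z (∑ k, ξ k • e z k) := by
    intro ξ hξ
    refine ⟨fun y hy => ?_, ?_⟩
    · have := he.norm_inner_displacement_le hz0 hz.le (g.norm_eq hy).le ha0.le hρ.le
        (distSet_le z hy) hξ
      rwa [hac] at this
    · have := he.norm_displacement_le hz0 ha0.le hρ.le hρ2 hξ
      rw [hac] at this
      have h0 := Real.sqrt_nonneg ρ
      nlinarith
  have hzU : z ∈ U := by
    have := (hpt z hz 0 ⟨fun y _ => by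
      rw [inner_zero_right, norm_zero]; exact mul_nonneg hc.le (dist_nonneg _ _), by simp⟩).1
    simpa using this
  have key := hcau (U := U) (F := fun x => ext e q α μ f x - taylor e α f s x) (v := e z) (z := z)
    (r := fun k => a * anisRadius m ρ k) (M := (ENNReal.ofReal C₁ * localBound E μ e q α f s z).toReal)
    hU (hF.sub hT) (fun k => mul_pos ha0 (anisRadius_pos hρ k)) ?_ ?_
  · rw [dirDeriv_sub hU hF hT (e z) γ hzU, prod_inv_mul_anisRadius_pow hρ] at key
    rw [← ofReal_norm]
    refine (ENNReal.ofReal_le_ofReal key).trans (le_of_eq ?_)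
    rw [ENNReal.ofReal_mul (by positivity), ENNReal.ofReal_mul hC₂.le, ENNReal.ofReal_toReal hMt,
      mul_assoc (C₂ * C₁), ENNReal.ofReal_mul (p := C₂ * C₁) (by positivity),
      ENNReal.ofReal_mul (p := C₂) hC₂.le]
    ring
  · rintro x ⟨ξ, hξ, rfl⟩
    exact (hpt z hz _ (hadm ξ hξ)).1
  · rintro x ⟨ξ, hξ, rfl⟩
    rw [← toReal_enorm]
    exact ENNReal.toReal_mono hMt ((hpt z hz _ (hadm ξ hξ)).2 s hs h6)

end Growth
end DerivativeBounds
-- Iterated radial derivatives of the extension.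
section RadialBounds

variable {m : ℕ} {e : Cn m → Fin (m + 1) → Cn m}

theorem norm_exp_le_three {ξ : ℂ} (hξ : ‖ξ‖ ≤ 1) : ‖Complex.exp ξ‖ ≤ 3 := by
  have h1 := Complex.norm_exp_le_exp_norm ξ
  have h2 : Real.exp ‖ξ‖ ≤ Real.exp 1 := Real.exp_le_exp.2 hξ
  linarith [Real.exp_one_lt_d9]

/-- Cauchy's estimate for the derivatives of `ξ ↦ e^ξ G(e^ξ z)` at the origin. -/
theorem contDiffAt_and_norm_iteratedDeriv_exp_le {U : Set (Cn m)} (hU : IsOpen U) {G : Cn m → ℂ}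
    (hG : DifferentiableOn ℂ G U) {z : Cn m} {r M : ℝ} (hr : 0 < r) (hr1 : r ≤ 1)
    (hmem : ∀ ξ : ℂ, ‖ξ‖ ≤ r → Complex.exp ξ • z ∈ U)
    (hM : ∀ ξ : ℂ, ‖ξ‖ ≤ r → ‖G (Complex.exp ξ • z)‖ ≤ M) (k : ℕ) :
    ContDiffAt ℂ k (fun ξ : ℂ => Complex.exp ξ * G (Complex.exp ξ • z)) 0 ∧
    ‖iteratedDeriv k (fun ξ : ℂ => Complex.exp ξ * G (Complex.exp ξ • z)) 0‖ ≤
      k.factorial * (3 * M) / r ^ k := by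
  have hcont : Continuous fun ξ : ℂ => Complex.exp ξ • z := by fun_prop
  have hV : IsOpen {ξ : ℂ | Complex.exp ξ • z ∈ U} := hU.preimage hcont
  have hd : DifferentiableOn ℂ (fun ξ : ℂ => Complex.exp ξ * G (Complex.exp ξ • z))
      {ξ : ℂ | Complex.exp ξ • z ∈ U} := by
    refine Complex.differentiable_exp.differentiableOn.mul ?_
    exact hG.comp (Complex.differentiable_exp.smul_const z).differentiableOn fun ξ hξ => hξ
  have h0 : (0 : ℂ) ∈ {ξ : ℂ | Complex.exp ξ • z ∈ U} := hmem 0 (by simpa using hr.le)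
  refine ⟨(hd.analyticAt (hV.mem_nhds h0)).contDiffAt, ?_⟩
  refine Complex.norm_iteratedDeriv_le_of_forall_mem_sphere_norm_le k hr
    (hd.diffContOnCl_ball fun ξ hξ => hmem ξ (by simpa using hξ)) fun ξ hξ => ?_
  have hξ' : ‖ξ‖ ≤ r := by
    rw [mem_sphere_zero_iff_norm] at hξ; exact hξ.le
  rw [norm_mul]
  exact mul_le_mul (norm_exp_le_three (hξ'.trans hr1)) (hM ξ hξ') (norm_nonneg _) (by norm_num)

namespace Growth

variable {E : Set (Cn m)} {μ : Measure (Cn m)} {υ lam A : ℝ}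

/-- The iterates of `I + N` are derivatives in one variable `ξ` along `e^ξ z`, for which `|ξ| ≤
cρ/4` is admissible. Cauchy's estimate on this circle handles the difference with the Taylor
polynomial; the polynomial itself is estimated on the unit circle and costs no power of `ρ`. -/
theorem exists_enorm_iterate_radial_ext_le (g : Growth E μ υ lam A) (he : IsFrame e) {q : ℝ}
    (hυq : υ < q) (hL : HasLowerBound E q μ) {α : ℝ} {f : Jet m}
    (hf : ∀ j ∈ indices m α, Measurable (f j)) (hfi : ∀ j ∈ indices m α, Integrable (f j) μ)
    (k : ℕ) : ∃ C : ℝ, 0 < C ∧ ∀ z : Cn m, ‖z‖ < 1 → ∀ s ∈ E, dist z s < 6 * distSet z E →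
      ‖(radial^[k] (ext e q α μ f)) z‖ₑ ≤
        ENNReal.ofReal (C * distSet z E ^ (-(k : ℝ))) * localBound E μ e q α f s z +
          ENNReal.ofReal C * ∑ j ∈ indices m α, ‖f j s‖ₑ := by
  obtain ⟨c, C₁, hc, hc2, hC₁, hpt⟩ := g.exists_enorm_ext_sub_taylor_le he hυq hL hf hfi
  obtain ⟨C₂, hC₂, htay⟩ := exists_norm_taylor_le (m := m) α 3 (by norm_num)
  have hfac : (0 : ℝ) < k.factorial := by positivity
  refine ⟨k.factorial * (3 * C₁) * (c / 4)⁻¹ ^ k + k.factorial * (3 * C₂), by positivity, ?_⟩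
  intro z hz s hs h6
  have hρ := distSet_pos g.nonempty g.sub hz
  have hρ2 := distSet_le_two g.nonempty g.sub hz.le
  set ρ := distSet z E with hρdef
  rcases eq_or_ne (localBound E μ e q α f s z) ⊤ with htop | htop
  · rw [htop, ENNReal.mul_top, top_add]
    · exact le_top
    · exact (ENNReal.ofReal_pos.2 (by positivity)).ne'
  have hMt : ENNReal.ofReal C₁ * localBound E μ e q α f s z ≠ ⊤ :=
    ENNReal.mul_ne_top ENNReal.ofReal_ne_top htop
  set U := branchSet E ∩ {z | hq q μ z ≠ 0}
  have hU : IsOpen U := g.isOpen_ext_domain q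
  have hF : DifferentiableOn ℂ (ext e q α μ f) U := fun x hx =>
    (g.differentiableAt_ext he hf hfi q hx.1 hx.2).differentiableWithinAt
  have hT : DifferentiableOn ℂ (taylor e α f s) U := (differentiable_taylor e α f s).differentiableOn
  have hr1 : c / 4 * ρ ≤ 1 := by nlinarith
  have hadm : ∀ ξ : ℂ, ‖ξ‖ ≤ c / 4 * ρ → Admissible E c z ((Complex.exp ξ - 1) • z) := by
    intro ξ hξ
    have h1 : ‖Complex.exp ξ - 1‖ ≤ 2 * ‖ξ‖ := Complex.norm_exp_sub_one_le (hξ.trans hr1)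
    have h2 : ‖Complex.exp ξ - 1‖ ≤ c / 2 * ρ := by linarith
    have h3 : ‖(Complex.exp ξ - 1) • z‖ ≤ c / 2 * ρ := by
      rw [norm_smul]
      calc _ ≤ c / 2 * ρ * 1 := mul_le_mul h2 hz.le (norm_nonneg _) (by positivity)
        _ = _ := mul_one _
    refine ⟨fun y hy => ?_, h3.trans ?_⟩
    · refine (norm_inner_le_norm y _).trans ?_
      rw [g.norm_eq hy, one_mul]
      have := distSet_le z hy
      nlinarith
    · have h4 := Real.sq_sqrt hρ.le
      have h5 := Real.sqrt_nonneg ρ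
      have h6 : Real.sqrt ρ ≤ 2 := by rw [Real.sqrt_le_left (by norm_num)]; linarith
      nlinarith
  have hexp : ∀ ξ : ℂ, Complex.exp ξ • z = z + (Complex.exp ξ - 1) • z := fun ξ => by
    rw [sub_smul, one_smul]; abel
  have hmem : ∀ ξ : ℂ, ‖ξ‖ ≤ c / 4 * ρ → Complex.exp ξ • z ∈ U := fun ξ hξ => by
    rw [hexp]; exact (hpt z hz _ (hadm ξ hξ)).1
  have hzU : z ∈ U := by simpa using hmem 0 (by simpa using (by positivity))
  obtain ⟨hcd₁, hb₁⟩ := contDiffAt_and_norm_iteratedDeriv_exp_le hU (hF.sub hT) (z := z)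
    (M := (ENNReal.ofReal C₁ * localBound E μ e q α f s z).toReal) (by positivity) hr1 hmem
    (fun ξ hξ => by
      rw [← toReal_enorm, hexp]
      exact ENNReal.toReal_mono hMt ((hpt z hz _ (hadm ξ hξ)).2 s hs h6)) k
  obtain ⟨hcd₂, hb₂⟩ := contDiffAt_and_norm_iteratedDeriv_exp_le isOpen_univ
    (differentiable_taylor e α f s).differentiableOn (z := z)
    (M := C₂ * ∑ j ∈ indices m α, ‖f j s‖) one_pos le_rfl (fun _ _ => Set.mem_univ _)
    (fun ξ hξ => by
      refine htay he f s _ (g.norm_eq hs) ?_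
      rw [norm_smul]
      calc _ ≤ (3 : ℝ) * 1 := mul_le_mul (norm_exp_le_three hξ) hz.le (norm_nonneg _) (by norm_num)
        _ = 3 := mul_one _) k
  have hsplit : (radial^[k] (ext e q α μ f)) z =
      iteratedDeriv k (fun ξ : ℂ => Complex.exp ξ *
        (ext e q α μ f - taylor e α f s) (Complex.exp ξ • z)) 0 +
      iteratedDeriv k (fun ξ : ℂ => Complex.exp ξ * taylor e α f s (Complex.exp ξ • z)) 0 := by
    rw [(iterate_radial_eq_iteratedDeriv hU k hF).2 z hzU, ← iteratedDeriv_fun_add hcd₁ hcd₂]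
    congr 1
    funext ξ
    simp only [Pi.sub_apply]
    ring
  rw [hsplit]
  refine (enorm_add_le _ _).trans (add_le_add ?_ ?_)
  · rw [← ofReal_norm]
    refine (ENNReal.ofReal_le_ofReal hb₁).trans ?_
    have : (k.factorial : ℝ) * (3 * (ENNReal.ofReal C₁ * localBound E μ e q α f s z).toReal) /
        (c / 4 * ρ) ^ k = k.factorial * 3 * (c / 4)⁻¹ ^ k * ρ ^ (-(k : ℝ)) *
          (ENNReal.ofReal C₁ * localBound E μ e q α f s z).toReal := by
      rw [Real.rpow_neg hρ.le, Real.rpow_natCast, mul_pow, inv_pow]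
      field_simp
    rw [this, ENNReal.ofReal_mul (by positivity), ENNReal.ofReal_toReal hMt, ← mul_assoc,
      ← ENNReal.ofReal_mul (by positivity)]
    refine mul_le_mul_left (ENNReal.ofReal_le_ofReal ?_) _
    have h0 : 0 < ρ ^ (-(k : ℝ)) := Real.rpow_pos_of_pos hρ _
    have h1 : 0 ≤ (k.factorial : ℝ) * (3 * C₂) * ρ ^ (-(k : ℝ)) := by positivity
    linarith
  · rw [← ofReal_norm]
    refine (ENNReal.ofReal_le_ofReal hb₂).trans ?_
    have : (k.factorial : ℝ) * (3 * (C₂ * ∑ j ∈ indices m α, ‖f j s‖)) / 1 ^ k =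
        k.factorial * (3 * C₂) * ∑ j ∈ indices m α, ‖f j s‖ := by
      rw [one_pow]; ring
    rw [this, ENNReal.ofReal_mul (by positivity), ENNReal.ofReal_sum_of_nonneg
      fun _ _ => norm_nonneg _]
    simp only [ofReal_norm]
    refine mul_le_mul_left (ENNReal.ofReal_le_ofReal ?_) _
    have : 0 < (k.factorial : ℝ) * (3 * C₁) * (c / 4)⁻¹ ^ k := by positivity
    linarith

end Growth
end RadialBounds
-- Averaging the pointwise bounds over nearby points of E.
section Averaging

variable {m : ℕ} {e : Cn m → Fin (m + 1) → Cn m} {E : Set (Cn m)} {μ : Measure (Cn m)}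

theorem measurable_near_indicator (z : Cn m) (r : ℝ) [∀ s, Decidable (dist z s < r)] :
    Measurable fun s => if dist z s < r then (1 : ENNReal) else 0 :=
  Measurable.ite (measurableSet_dBall _ _) measurable_const measurable_const

theorem nearAvg_add {Y Y' : Cn m → ENNReal} (hY : Measurable Y) (z : Cn m) :
    nearAvg E μ (fun s => Y s + Y' s) z = nearAvg E μ Y z + nearAvg E μ Y' z := by
  classical
  unfold nearAvg
  simp only [add_mul]
  have hm : Measurable fun s => Y s * (if dist z s < 6 * distSet z E then (1 : ENNReal) else 0) :=
    hY.mul (measurable_near_indicator _ _)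
  rw [lintegral_add_left hm, mul_add]

theorem nearAvg_const_mul {c : ENNReal} (hc : c ≠ ⊤) (Y : Cn m → ENNReal) (z : Cn m) :
    nearAvg E μ (fun s => c * Y s) z = c * nearAvg E μ Y z := by
  unfold nearAvg
  simp only [mul_assoc]
  rw [lintegral_const_mul' _ _ hc, mul_left_comm]

theorem nearAvg_sum {ι : Type*} (t : Finset ι) {Y : ι → Cn m → ENNReal}
    (hY : ∀ i ∈ t, Measurable (Y i)) (z : Cn m) :
    nearAvg E μ (fun s => ∑ i ∈ t, Y i s) z = ∑ i ∈ t, nearAvg E μ (Y i) z := by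
  classical
  unfold nearAvg
  simp only [Finset.sum_mul]
  have hm : ∀ i ∈ t, AEMeasurable
      (fun s => Y i s * (if dist z s < 6 * distSet z E then (1 : ENNReal) else 0)) μ := fun i hi =>
    ((hY i hi).mul (measurable_near_indicator _ _)).aemeasurable
  rw [lintegral_finsetSum' t hm, Finset.mul_sum]

/-- The mean over `s` near `z` of a weighted mean over `y` is `avgKernel`. -/
theorem nearAvg_eq_avgKernel [IsProbabilityMeasure μ] (hE : E.Nonempty) (q θ : ℝ)
    {X : Cn m × Cn m → ENNReal} (hX : Measurable X) {z : Cn m} (hρ : 0 < distSet z E) :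
    nearAvg E μ (fun s => ENNReal.ofReal (μ.real (dBall z (6 * distSet z E)))⁻¹ *
      (ENNReal.ofReal (distSet z E ^ θ) *
        ∫⁻ y, X (y, s) * ENNReal.ofReal ((distSet z E / dist z y) ^ q) ∂μ)) z =
      avgKernel E μ q θ X z := by
  classical
  rw [nearAvg_const_mul ENNReal.ofReal_ne_top, nearAvg_const_mul ENNReal.ofReal_ne_top]
  unfold nearAvg avgKernel
  have hm : Measurable fun x : Cn m × Cn m => X x * avgWeight E q z x :=
    hX.mul (measurable_avgWeight hE q measurable_const measurable_id)
  rw [lintegral_prod_symm _ hm.aemeasurable, ENNReal.ofReal_mul (by positivity),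
    ENNReal.ofReal_pow (by positivity)]
  have : ∀ s, (∫⁻ y, X (y, s) * avgWeight E q z (y, s) ∂μ) =
      (∫⁻ y, X (y, s) * ENNReal.ofReal ((distSet z E / dist z y) ^ q) ∂μ) *
        (if dist z s < 6 * distSet z E then 1 else 0) := by
    intro s
    unfold avgWeight
    by_cases h : dist z s < 6 * distSet z E
    · simp only [if_pos h, mul_one]
    · simp only [if_neg h, mul_zero, lintegral_zero]
  simp only [this]
  ring

theorem nearAvg_localBound [IsProbabilityMeasure μ] (hE : E.Nonempty) (he : IsFrame e) (q : ℝ)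
    {α : ℝ} {f : Jet m} (hf : ∀ j ∈ indices m α, Measurable (f j)) {z : Cn m}
    (hρ : 0 < distSet z E) :
    nearAvg E μ (fun s => localBound E μ e q α f s z) z = ∑ i ∈ box m (boxDeg m α),
      avgKernel E μ q (weight i) (fun x => ‖jetDiff e α f i x‖ₑ) z := by
  have hX : ∀ i, Measurable fun x => ‖jetDiff e α f i x‖ₑ := fun i =>
    (measurable_jetDiff he hf i).enorm
  unfold localBound
  simp only [Finset.mul_sum]
  rw [nearAvg_sum]
  · exact Finset.sum_congr rfl fun i _ => nearAvg_eq_avgKernel hE q _ (hX i) hρ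
  · intro i _
    have hm : Measurable fun x : Cn m × Cn m => ‖jetDiff e α f i (x.2, x.1)‖ₑ *
        ENNReal.ofReal ((distSet z E / dist z x.2) ^ q) :=
      ((hX i).comp measurable_swap).mul ((measurable_const.div
        (measurable_dist measurable_const measurable_snd)).pow_const q).ennreal_ofReal
    exact (hm.lintegral_prod_right'.const_mul _).const_mul _

theorem measurable_localBound [IsProbabilityMeasure μ] (he : IsFrame e) (q : ℝ)
    {α : ℝ} {f : Jet m} (hf : ∀ j ∈ indices m α, Measurable (f j)) (z : Cn m) :
    Measurable fun s => localBound E μ e q α f s z := by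
  unfold localBound
  refine (Finset.measurable_sum _ fun i _ => ?_).const_mul _
  have hm : Measurable fun x : Cn m × Cn m => ‖jetDiff e α f i (x.2, x.1)‖ₑ *
      ENNReal.ofReal ((distSet z E / dist z x.2) ^ q) :=
    ((measurable_jetDiff he hf i).enorm.comp measurable_swap).mul ((measurable_const.div
      (measurable_dist measurable_const measurable_snd)).pow_const q).ennreal_ofReal
  exact hm.lintegral_prod_right'.const_mul _

namespace Growth

variable {υ lam A : ℝ}

theorem lintegral_near_eq (g : Growth E μ υ lam A) (z : Cn m) (r : ℝ)
    [∀ s, Decidable (dist z s < r)] :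
    ∫⁻ s, (if dist z s < r then (1 : ENNReal) else 0) ∂μ = ENNReal.ofReal (μ.real (dBall z r)) := by
  have := g.prob
  rw [ofReal_measureReal, ← setLIntegral_one, ← lintegral_indicator (measurableSet_dBall _ _)]
  refine lintegral_congr fun s => ?_
  by_cases h : dist z s < r
  · rw [if_pos h, Set.indicator_of_mem (show s ∈ dBall z r from h)]
  · rw [if_neg h, Set.indicator_of_notMem (show s ∉ dBall z r from h)]

theorem le_nearAvg (g : Growth E μ υ lam A) {z : Cn m} (hz : ‖z‖ < 1) {a : ENNReal}
    {Y : Cn m → ENNReal} (h : ∀ s ∈ E, dist z s < 6 * distSet z E → a ≤ Y s) :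
    a ≤ nearAvg E μ Y z := by
  classical
  have := g.prob
  have hρ := distSet_pos g.nonempty g.sub hz
  have hU := g.real_dBall_pos hz.le hρ
  calc a = ENNReal.ofReal (μ.real (dBall z (6 * distSet z E)))⁻¹ *
        ∫⁻ s, a * (if dist z s < 6 * distSet z E then 1 else 0) ∂μ := by
        rw [lintegral_const_mul _ (measurable_near_indicator _ _), g.lintegral_near_eq,
          mul_left_comm, ← ENNReal.ofReal_mul (by positivity), inv_mul_cancel₀ hU.ne',
          ENNReal.ofReal_one, mul_one]
    _ ≤ _ := by
      unfold nearAvg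
      refine mul_le_mul_right (lintegral_mono_ae ?_) _
      filter_upwards [g.ae_mem] with s hs
      by_cases h' : dist z s < 6 * distSet z E
      · simpa only [if_pos h', mul_one] using h s hs h'
      · simp only [if_neg h', mul_zero, le_refl]

/-- The weight in `y` has mass at least `6^(-q) U`, so a superfluous integration over `y` costs only
a constant, and `θ` is free because its power of `ρ` is compensated. Terms in the values of the jet
thereby come under the same kernel estimates. -/
theorem nearAvg_le_avgKernel (g : Growth E μ υ lam A) {q : ℝ} (hq : 0 ≤ q) (θ : ℝ)
    {Y : Cn m → ENNReal} (hY : Measurable Y) {z : Cn m} (hz : ‖z‖ < 1) :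
    nearAvg E μ Y z ≤ ENNReal.ofReal (6 ^ q * distSet z E ^ (-θ)) *
      avgKernel E μ q θ (fun x => Y x.2) z := by
  classical
  have := g.prob
  have hρ := distSet_pos g.nonempty g.sub hz
  have hU := g.real_dBall_pos hz.le hρ
  have hX : Measurable fun x : Cn m × Cn m => Y x.2 := hY.comp measurable_snd
  rw [← nearAvg_eq_avgKernel g.nonempty q θ hX hρ, ← nearAvg_const_mul ENNReal.ofReal_ne_top]
  unfold nearAvg
  gcongr with s
  have hw : Measurable fun y => ENNReal.ofReal ((distSet z E / dist z y) ^ q) :=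
    ((measurable_const.div (measurable_dist measurable_const measurable_id)).pow_const q).ennreal_ofReal
  dsimp only
  rw [lintegral_const_mul _ hw]
  have h1 : ENNReal.ofReal (6 ^ (-q)) * ENNReal.ofReal (μ.real (dBall z (6 * distSet z E))) ≤
      ∫⁻ y, ENNReal.ofReal ((distSet z E / dist z y) ^ q) ∂μ := by
    rw [← g.lintegral_near_eq, ← lintegral_const_mul _ (measurable_near_indicator _ _)]
    refine lintegral_mono_ae ?_
    filter_upwards [g.ae_mem] with y hy
    by_cases h : dist z y < 6 * distSet z E
    · rw [if_pos h, mul_one]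
      refine ENNReal.ofReal_le_ofReal ?_
      have hd : 0 < dist z y := hρ.trans_le (distSet_le z hy)
      rw [Real.rpow_neg (by norm_num), ← Real.inv_rpow (by norm_num)]
      refine Real.rpow_le_rpow (by norm_num) ?_ hq
      rw [le_div_iff₀ hd]; linarith
    · rw [if_neg h, mul_zero]; exact zero_le
  set U := μ.real (dBall z (6 * distSet z E))
  set ρ := distSet z E
  calc Y s = Y s * ENNReal.ofReal ((6 ^ q * ρ ^ (-θ)) * (U⁻¹ * (ρ ^ θ * (6 ^ (-q) * U)))) := by
        have h2 : (6 ^ q * ρ ^ (-θ)) * (U⁻¹ * (ρ ^ θ * (6 ^ (-q) * U))) = 1 := by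
          rw [Real.rpow_neg hρ.le, Real.rpow_neg (by norm_num)]
          have := Real.rpow_pos_of_pos hρ θ
          have : (0 : ℝ) < 6 ^ q := by positivity
          field_simp
        rw [h2, ENNReal.ofReal_one, mul_one]
    _ = ENNReal.ofReal (6 ^ q * ρ ^ (-θ)) * (ENNReal.ofReal U⁻¹ * (ENNReal.ofReal (ρ ^ θ) *
        (Y s * (ENNReal.ofReal (6 ^ (-q)) * ENNReal.ofReal U)))) := by
        have h3 : 0 ≤ ρ ^ θ := (Real.rpow_pos_of_pos hρ θ).le
        have h4 : 0 ≤ ρ ^ (-θ) := (Real.rpow_pos_of_pos hρ _).le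
        rw [ENNReal.ofReal_mul (p := 6 ^ q * ρ ^ (-θ)) (by positivity),
          ENNReal.ofReal_mul (p := U⁻¹) (by positivity), ENNReal.ofReal_mul (p := ρ ^ θ) h3,
          ENNReal.ofReal_mul (p := 6 ^ (-q)) (by positivity)]
        ring
    _ ≤ _ := by gcongr

/-- Pointwise bound for the iterated radial derivatives of the extension. -/
theorem exists_enorm_iterate_radial_ext_le_avgKernel (g : Growth E μ υ lam A) (he : IsFrame e)
    {q : ℝ} (hυq : υ < q) (hL : HasLowerBound E q μ) {α : ℝ} {f : Jet m}
    (hf : ∀ j ∈ indices m α, Measurable (f j)) (hfi : ∀ j ∈ indices m α, Integrable (f j) μ)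
    (k : ℕ) : ∃ C : ℝ, 0 < C ∧ ∀ z : Cn m, ‖z‖ < 1 →
      ‖(radial^[k] (ext e q α μ f)) z‖ₑ ≤ ENNReal.ofReal (C * distSet z E ^ (-(k : ℝ))) *
        (∑ i ∈ box m (boxDeg m α), avgKernel E μ q (weight i) (fun x => ‖jetDiff e α f i x‖ₑ) z +
          ∑ j ∈ indices m α, avgKernel E μ q k (fun x => ‖f j x.2‖ₑ) z) := by
  have := g.prob
  have hq0 : 0 ≤ q := g.nonneg.trans hυq.le
  obtain ⟨C, hC, hb⟩ := g.exists_enorm_iterate_radial_ext_le he hυq hL hf hfi k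
  refine ⟨C + C * 6 ^ q, by positivity, fun z hz => ?_⟩
  have hρ := distSet_pos g.nonempty g.sub hz
  have hρk := Real.rpow_pos_of_pos hρ (-(k : ℝ))
  refine (g.le_nearAvg hz (hb z hz)).trans ?_
  rw [nearAvg_add ((measurable_localBound he q hf z).const_mul _),
    nearAvg_const_mul ENNReal.ofReal_ne_top, nearAvg_const_mul ENNReal.ofReal_ne_top,
    nearAvg_localBound g.nonempty he q hf hρ, nearAvg_sum _ fun j hj => (hf j hj).enorm, mul_add]
  refine add_le_add (mul_le_mul_left (ENNReal.ofReal_le_ofReal ?_) _) ?_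
  · have : 0 < C * 6 ^ q * distSet z E ^ (-(k : ℝ)) := by positivity
    linarith
  · rw [Finset.mul_sum, Finset.mul_sum]
    refine Finset.sum_le_sum fun j hj => ?_
    refine (mul_le_mul_right (g.nearAvg_le_avgKernel hq0 (k : ℝ) (hf j hj).enorm hz) _).trans ?_
    rw [← mul_assoc, ← ENNReal.ofReal_mul hC.le]
    refine mul_le_mul_left (ENNReal.ofReal_le_ofReal ?_) _
    have : 0 < C * distSet z E ^ (-(k : ℝ)) := by positivity
    linarith

/-- Pointwise bound for the distance of the derivatives of the extension to a number. -/
theorem exists_enorm_wDeriv_ext_sub_le (g : Growth E μ υ lam A) (he : IsFrame e)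
    {q : ℝ} (hυq : υ < q) (hL : HasLowerBound E q μ) {α : ℝ} {f : Jet m}
    (hf : ∀ j ∈ indices m α, Measurable (f j)) (hfi : ∀ j ∈ indices m α, Integrable (f j) μ)
    (γ : Fin (m + 1) → ℕ) : ∃ C : ℝ, 0 < C ∧ ∀ ζ ∈ E, ∀ (b : ℂ) (z : Cn m), z ≠ 0 → ‖z‖ < 1 →
      ‖wDeriv e γ (ext e q α μ f) z - b‖ₑ ≤
        ∑ i ∈ box m (boxDeg m α), ENNReal.ofReal C * (ENNReal.ofReal (distSet z E ^ (-weight γ)) *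
          avgKernel E μ q (weight i) (fun x => ‖jetDiff e α f i x‖ₑ) z) +
        (∑ i ∈ box m (boxDeg m α), ENNReal.ofReal C *
          (ENNReal.ofReal (dist z ζ ^ (weight i - weight γ)) *
            nearAvg E μ (fun s => ‖jetDiff e α f i (s, ζ)‖ₑ) z) +
        ‖wDeriv e γ (taylor e α f ζ) z - b‖ₑ) := by
  have := g.prob
  obtain ⟨C₁, hC₁, hb₁⟩ := g.exists_enorm_dirDeriv_ext_sub_le he hυq hL hf hfi γ
  obtain ⟨C₂, hC₂, hb₂⟩ := exists_enorm_dirDeriv_taylor_sub_le m α γ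
  refine ⟨max C₁ C₂, by positivity, fun ζ hζ b z hz0 hz => ?_⟩
  have hρ := distSet_pos g.nonempty g.sub hz
  have hργ := Real.rpow_pos_of_pos hρ (-weight γ)
  have hX : ∀ i, Measurable fun s => ‖jetDiff e α f i (s, ζ)‖ₑ := fun i =>
    (measurable_jetDiff he hf i).enorm.comp (measurable_id.prodMk measurable_const)
  have key : ‖wDeriv e γ (ext e q α μ f) z - wDeriv e γ (taylor e α f ζ) z‖ₑ ≤
      nearAvg E μ (fun s => ENNReal.ofReal (C₁ * distSet z E ^ (-weight γ)) *
        localBound E μ e q α f s z + ENNReal.ofReal C₂ * ∑ i ∈ box m (boxDeg m α),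
          ENNReal.ofReal (dist z ζ ^ (weight i - weight γ)) * ‖jetDiff e α f i (s, ζ)‖ₑ) z := by
    refine g.le_nearAvg hz fun s hs h6 => ?_
    unfold wDeriv
    rw [← sub_add_sub_cancel _ (dirDeriv (e z) γ (taylor e α f s) z)]
    exact (enorm_add_le _ _).trans (add_le_add (hb₁ z hz0 hz s hs h6)
      (hb₂ he f z ζ s hz0 hz (g.norm_eq hζ)))
  rw [nearAvg_add ((measurable_localBound he q hf z).const_mul _),
    nearAvg_const_mul ENNReal.ofReal_ne_top, nearAvg_const_mul ENNReal.ofReal_ne_top,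
    nearAvg_localBound g.nonempty he q hf hρ,
    nearAvg_sum _ fun i _ => (hX i).const_mul _] at key
  simp only [nearAvg_const_mul ENNReal.ofReal_ne_top] at key
  rw [← sub_add_sub_cancel _ (wDeriv e γ (taylor e α f ζ) z), ← add_assoc]
  refine (enorm_add_le _ _).trans (add_le_add_left (key.trans (add_le_add ?_ ?_)) _)
  · rw [Finset.mul_sum]
    refine Finset.sum_le_sum fun i _ => ?_
    rw [ENNReal.ofReal_mul hC₁.le, mul_assoc]
    exact mul_le_mul_left (ENNReal.ofReal_le_ofReal (le_max_left _ _)) _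
  · rw [Finset.mul_sum]
    refine Finset.sum_le_sum fun i _ => ?_
    exact mul_le_mul_left (ENNReal.ofReal_le_ofReal (le_max_right _ _)) _

end Growth
end Averaging
-- Membership in the Triebel–Lizorkin space and boundary values, for measurable jets.
section Extension

variable {m : ℕ} {e : Cn m → Fin (m + 1) → Cn m} {E : Set (Cn m)} {μ : Measure (Cn m)}

namespace Growth

variable {υ lam A : ℝ}

theorem ball_subset_ext_domain (g : Growth E μ υ lam A) {q : ℝ} (hL : HasLowerBound E q μ) :
    Metric.ball 0 1 ⊆ branchSet E ∩ {z | hq q μ z ≠ 0} := by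
  intro z hz
  refine ⟨ball_subset_branchSet g.sub hz, ?_⟩
  obtain ⟨C, hC, h⟩ := hL
  obtain ⟨z₀, hz₀, -, hb⟩ := h z hz
  have hρ := distSet_pos g.nonempty g.sub (by simpa using hz)
  have hU := g.pos z₀ hz₀ (3 * distSet z E) (by positivity)
  exact norm_pos_iff.1 (lt_of_lt_of_le (by positivity) hb)

theorem lintegral_ray_lt_top_of_le (g : Growth E μ υ lam A) (he : IsFrame e)
    (hυ : υ < ((m + 1 : ℕ) : ℝ)) {p α q a β : ℝ} (hp : 1 ≤ p) (hq : υ < q) (ha : 0 < a)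
    (hβ : β = α + (((m + 1 : ℕ) : ℝ) - lam) / p) {ι : Type*} (T : Finset ι) {θ : ι → ℝ}
    {X : ι → Cn m × Cn m → ENNReal} (hX : ∀ i ∈ T, Measurable (X i))
    (hfin : ∀ i ∈ T, kernelNorm μ p α lam q (θ i) (X i) < ⊤) {H : Cn m → ENNReal} {C : ENNReal}
    (hC : C ≠ ⊤) (hH : ∀ z, ‖z‖ < 1 → H z ≤ C * (ENNReal.ofReal (distSet z E ^ (-(a + β))) *
      ∑ i ∈ T, avgKernel E μ q (θ i) (X i) z)) :
    ∫⁻ z : Metric.sphere (0 : Cn m) 1, (∫⁻ t in Set.Ioo (0 : ℝ) 1,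
      ENNReal.ofReal ((1 - t) ^ (a - 1)) * H ((t : ℂ) • (z : Cn m))) ^ p
      ∂(volume : Measure (Cn m)).toSphere < ⊤ := by
  have := g.prob
  have hp0 : 0 < p := by linarith
  have hmap : Measurable fun x : Metric.sphere (0 : Cn m) 1 × ℝ => (x.2 : ℂ) • (x.1 : Cn m) := by
    fun_prop
  have hJm : ∀ i ∈ T, Measurable fun x : Metric.sphere (0 : Cn m) 1 × ℝ =>
      ENNReal.ofReal ((1 - x.2) ^ (a - 1)) *
        (ENNReal.ofReal (distSet ((x.2 : ℂ) • (x.1 : Cn m)) E ^ (-(a + β))) *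
          avgKernel E μ q (θ i) (X i) ((x.2 : ℂ) • (x.1 : Cn m))) := fun i hi =>
    ((measurable_const.sub measurable_snd).pow_const _).ennreal_ofReal.mul
      ((((measurable_distSet g.nonempty).comp hmap).pow_const _).ennreal_ofReal.mul
        ((measurable_avgKernel g.nonempty μ q (θ i) (hX i hi)).comp hmap))
  have hIm : ∀ i ∈ T, Measurable fun z : Metric.sphere (0 : Cn m) 1 =>
      ∫⁻ t in Set.Ioo (0 : ℝ) 1, ENNReal.ofReal ((1 - t) ^ (a - 1)) *
        (ENNReal.ofReal (distSet ((t : ℂ) • (z : Cn m)) E ^ (-(a + β))) *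
          avgKernel E μ q (θ i) (X i) ((t : ℂ) • (z : Cn m))) := fun i hi =>
    (hJm i hi).lintegral_prod_right'
  have hJ1 : ∀ z : Metric.sphere (0 : Cn m) 1, ∀ i ∈ T, AEMeasurable (fun t : ℝ =>
      ENNReal.ofReal ((1 - t) ^ (a - 1)) *
        (ENNReal.ofReal (distSet ((t : ℂ) • (z : Cn m)) E ^ (-(a + β))) *
          avgKernel E μ q (θ i) (X i) ((t : ℂ) • (z : Cn m))))
      (volume.restrict (Set.Ioo (0 : ℝ) 1)) := fun z i hi =>
    ((hJm i hi).comp (measurable_const.prodMk measurable_id)).aemeasurable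
  have hbound : ∀ z : Metric.sphere (0 : Cn m) 1, (∫⁻ t in Set.Ioo (0 : ℝ) 1,
      ENNReal.ofReal ((1 - t) ^ (a - 1)) * H ((t : ℂ) • (z : Cn m))) ^ p ≤
      C ^ p * (T.card : ENNReal) ^ (p - 1) * ∑ i ∈ T, (∫⁻ t in Set.Ioo (0 : ℝ) 1,
        ENNReal.ofReal ((1 - t) ^ (a - 1)) *
          (ENNReal.ofReal (distSet ((t : ℂ) • (z : Cn m)) E ^ (-(a + β))) *
            avgKernel E μ q (θ i) (X i) ((t : ℂ) • (z : Cn m)))) ^ p := by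
    intro z
    have h1 : (∫⁻ t in Set.Ioo (0 : ℝ) 1,
        ENNReal.ofReal ((1 - t) ^ (a - 1)) * H ((t : ℂ) • (z : Cn m))) ≤
        C * ∑ i ∈ T, ∫⁻ t in Set.Ioo (0 : ℝ) 1, ENNReal.ofReal ((1 - t) ^ (a - 1)) *
          (ENNReal.ofReal (distSet ((t : ℂ) • (z : Cn m)) E ^ (-(a + β))) *
            avgKernel E μ q (θ i) (X i) ((t : ℂ) • (z : Cn m))) := by
      rw [← lintegral_finsetSum' T (hJ1 z), ← lintegral_const_mul' _ _ hC]
      refine setLIntegral_mono' measurableSet_Ioo fun t ht => ?_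
      have hz : ‖(t : ℂ) • (z : Cn m)‖ < 1 := by
        rw [norm_smul, mem_sphere_zero_iff_norm.1 z.2, mul_one, Complex.norm_real,
          Real.norm_of_nonneg ht.1.le]
        exact ht.2
      refine (mul_le_mul_right (hH _ hz) _).trans (le_of_eq ?_)
      simp only [Finset.mul_sum]
      exact Finset.sum_congr rfl fun i _ => by ring
    refine (ENNReal.rpow_le_rpow h1 hp0.le).trans ?_
    rw [ENNReal.mul_rpow_of_nonneg _ _ hp0.le, mul_assoc]
    exact mul_le_mul_right (ENNReal.rpow_sum_le_const_mul_sum_rpow T _ hp) _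
  refine (lintegral_mono hbound).trans_lt ?_
  have hK : C ^ p * (T.card : ENNReal) ^ (p - 1) ≠ ⊤ :=
    ENNReal.mul_ne_top (ENNReal.rpow_ne_top_of_nonneg hp0.le hC)
      (ENNReal.rpow_ne_top_of_nonneg (by linarith) (ENNReal.natCast_ne_top _))
  rw [lintegral_const_mul' _ _ hK,
    lintegral_finsetSum' T fun i hi => ((hIm i hi).pow_const p).aemeasurable]
  exact ENNReal.mul_lt_top hK.lt_top (ENNReal.sum_lt_top.2 fun i hi =>
    g.lintegral_ray_avgKernel_lt_top he hυ hp hq ha hβ (θ i) (hX i hi) (hfin i hi))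

/-- The jet differences are controlled by the Besov hypothesis. The terms in `f j` carry the
exponent `θ = k = ⌊β⌋₊ + 1`, and `k > β ≥ α + (υ - lam) / p` puts them in the range where `L^p`
bounds suffice. -/
theorem memHF_ext (g : Growth E μ υ lam A) (he : IsFrame e) (hυ : υ < ((m + 1 : ℕ) : ℝ))
    {p α q : ℝ} (hp : 1 ≤ p) (hα : 0 < α)
    (hhalf : ∀ i : ℤ, (i : ℝ) / 2 ∉ Set.Icc α (α + (υ - lam) / p))
    (hq : 3 * υ < q) (hq2 : 2 * υ + p * α - lam < q) (hL : HasLowerBound E q μ) {f : Jet m}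
    (hf : ∀ j ∈ indices m α, Measurable (f j)) (hfi : ∀ j ∈ indices m α, Integrable (f j) μ)
    (hB : MemBesov e p α lam μ f) :
    MemHF p 1 (α + (((m + 1 : ℕ) : ℝ) - lam) / p) (ext e q α μ f) := by
  have hp0 : 0 < p := by linarith
  have hυ0 := g.nonneg
  have hυq : υ < q := by linarith
  have hlam := g.lam_le
  set β := α + (((m + 1 : ℕ) : ℝ) - lam) / p with hβ
  have hβ0 : 0 ≤ β := by
    have : 0 ≤ (((m + 1 : ℕ) : ℝ) - lam) / p := div_nonneg (by linarith) hp0.le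
    linarith
  refine ⟨fun z hz => ((g.differentiableAt_ext he hf hfi q (g.ball_subset_ext_domain hL hz).1
    (g.ball_subset_ext_domain hL hz).2).differentiableWithinAt), ?_⟩
  set k := ⌊β⌋₊ + 1 with hk
  obtain ⟨C, hC, hb⟩ := g.exists_enorm_iterate_radial_ext_le_avgKernel he hυq hL hf hfi k
  have hkβ : β < k := by rw [hk]; push_cast; exact Nat.lt_floor_add_one β
  have hkβ' : (k : ℝ) - β ≤ 1 := by
    rw [hk]; push_cast; linarith [Nat.floor_le hβ0]
  have hθ : 0 < p * ((k : ℝ) - α) + lam - υ := by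
    have h1 : (((m + 1 : ℕ) : ℝ) - lam) / p < k - α := by linarith
    rw [div_lt_iff₀ hp0] at h1
    linarith
  have key := g.lintegral_ray_lt_top_of_le (H := fun z => ‖(radial^[k] (ext e q α μ f)) z‖ₑ)
    (C := ENNReal.ofReal C) (a := k - β) he hυ hp hυq (by linarith) hβ
    ((box m (boxDeg m α)).disjSum (indices m α)) (θ := Sum.elim weight fun _ => (k : ℝ))
    (X := Sum.elim (fun i x => ‖jetDiff e α f i x‖ₑ) fun j x => ‖f j x.2‖ₑ) ?_ ?_
    ENNReal.ofReal_ne_top ?_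
  · refine lt_of_le_of_lt (lintegral_mono fun z => ?_) key
    rw [div_one]
    refine ENNReal.rpow_le_rpow (setLIntegral_mono' measurableSet_Ioo fun t ht => ?_) hp0.le
    rw [ENNReal.rpow_one, mul_one]
    refine mul_le_mul_left (ENNReal.ofReal_le_ofReal ?_) _
    have h1 : (⌊β⌋₊ : ℝ) + 1 - β - 1 = k - β - 1 := by rw [hk]; push_cast; ring
    rw [h1]
    have := ht.1
    have := ht.2
    -- The exponent `k - β - 1` is nonpositive and `1 - t² ≥ 1 - t`.
    exact Real.rpow_le_rpow_of_nonpos (by linarith) (by nlinarith) (by linarith)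
  · intro i hi
    rcases Finset.mem_disjSum.1 hi with ⟨i, hi, rfl⟩ | ⟨j, hj, rfl⟩
    · exact (measurable_jetDiff he hf i).enorm
    · exact (hf j hj).enorm.comp measurable_snd
  · intro i hi
    rcases Finset.mem_disjSum.1 hi with ⟨i, hi, rfl⟩ | ⟨j, hj, rfl⟩
    · exact g.kernelNorm_jetDiff_lt_top he hp hhalf hq hq2 hf hB i
    · exact (g.kernelNorm_lt_top_of_large hq hθ (hf j hj).enorm
        (lintegral_enorm_rpow_lt_top hp (hB j (mem_indices.1 hj)).1)).2
  · intro z hz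
    refine (hb z hz).trans (le_of_eq ?_)
    rw [Finset.sum_disjSum, sub_add_cancel, ENNReal.ofReal_mul hC.le, mul_assoc]
    rfl

/-- The directions depend on `z` only measurably; the derivative is jointly continuous in directions
and point, and is composed with the Borel map `z ↦ (e z, z)`. -/
theorem aestronglyMeasurable_wDeriv_ext (g : Growth E μ υ lam A) (he : IsFrame e) {q : ℝ}
    (hL : HasLowerBound E q μ) {α : ℝ} {f : Jet m} (hf : ∀ j ∈ indices m α, Measurable (f j))
    (hfi : ∀ j ∈ indices m α, Integrable (f j) μ) (γ : Fin (m + 1) → ℕ) :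
    AEStronglyMeasurable (wDeriv e γ (ext e q α μ f)) (volume.restrict (Metric.ball 0 1)) := by
  classical
  set U := branchSet E ∩ {z | hq q μ z ≠ 0} with hUdef
  have hO : IsOpen {x : (Fin (m + 1) → Cn m) × Cn m | x.2 ∈ U} :=
    (g.isOpen_ext_domain q).preimage continuous_snd
  have hd : DifferentiableOn ℂ (fun x : (Fin (m + 1) → Cn m) × Cn m => ext e q α μ f x.2)
      {x | x.2 ∈ U} := fun x hx =>
    ((g.differentiableAt_ext he hf hfi q hx.1 hx.2).comp x differentiableAt_snd).differentiableWithinAt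
  have hcont := (differentiableOn_dirDeriv_param hO hd (V := id) differentiable_id γ).continuousOn
  have hm := hcont.measurable_piecewise (continuousOn_const (c := (0 : ℂ))) hO.measurableSet
  have hme : Measurable fun z : Cn m => (e z, z) := he.measurable.prodMk measurable_id
  refine (hm.comp hme).aestronglyMeasurable.congr ?_
  filter_upwards [ae_restrict_mem measurableSet_ball] with z hz
  exact Set.piecewise_eq_of_mem _ _ _ (show z ∈ U from g.ball_subset_ext_domain hL hz)

/-- At `ζ` itself the derivative of the polynomial is `f γ ζ`. Nearby it is taken in the frame at
`z`, so continuity of the frame at `ζ` is what is needed. -/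
theorem tendsto_wDeriv_taylor (he : IsFrame e) {α : ℝ} (f : Jet m) {γ : Fin (m + 1) → ℕ}
    (hγ : weight γ ≤ α) {ζ : Cn m} (hζ : ζ ≠ 0) (hc : ContinuousAt e ζ) :
    Tendsto (fun z => ‖wDeriv e γ (taylor e α f ζ) z - f γ ζ‖ₑ) (𝓝 ζ) (𝓝 0) := by
  have hd : Differentiable ℂ (fun x : (Fin (m + 1) → Cn m) × Cn m => taylor e α f ζ x.2) :=
    (differentiable_taylor e α f ζ).comp differentiable_snd
  have hcont := (differentiableOn_dirDeriv_param isOpen_univ hd.differentiableOn (V := id)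
    differentiable_id γ).continuousOn
  rw [continuousOn_univ] at hcont
  have h1 : ContinuousAt (fun z => wDeriv e γ (taylor e α f ζ) z) ζ :=
    ContinuousAt.comp (f := fun z => (e z, z)) hcont.continuousAt (hc.prodMk continuousAt_id)
  have h2 : Tendsto (fun z => wDeriv e γ (taylor e α f ζ) z - f γ ζ) (𝓝 ζ) (𝓝 0) := by
    have h3 : Tendsto (fun z => wDeriv e γ (taylor e α f ζ) z - f γ ζ) (𝓝 ζ)
        (𝓝 (wDeriv e γ (taylor e α f ζ) ζ - f γ ζ)) := h1.tendsto.sub_const _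
    have h4 : wDeriv e γ (taylor e α f ζ) ζ = f γ ζ := he.wDeriv_taylor_self α f hζ hγ
    rwa [h4, sub_self] at h3
  have h5 := (continuous_enorm.tendsto (0 : ℂ)).comp h2
  rwa [enorm_zero] at h5

/-- The bound by `avgKernel`, by local averages of the jet differences at `ζ`, and by the Taylor
polynomial at `ζ` is summed; for almost every `ζ` each of the three parts has vanishing means. -/
theorem ae_hasMeanValue_ext (g : Growth E μ υ lam A) (he : IsFrame e)
    (hυ : υ < ((m + 1 : ℕ) : ℝ)) {p α q : ℝ} (hp : 1 ≤ p)
    (hhalf : ∀ i : ℤ, (i : ℝ) / 2 ∉ Set.Icc α (α + (υ - lam) / p))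
    (hq : 3 * υ < q) (hq2 : 2 * υ + p * α - lam < q) (hL : HasLowerBound E q μ) {f : Jet m}
    (hf : ∀ j ∈ indices m α, Measurable (f j)) (hfi : ∀ j ∈ indices m α, Integrable (f j) μ)
    (hB : MemBesov e p α lam μ f) (hc : ∀ᵐ ζ ∂μ, ContinuousAt e ζ) {γ : Fin (m + 1) → ℕ}
    (hγ : weight γ < α) : ∀ᵐ ζ ∂μ, HasMeanValue (wDeriv e γ (ext e q α μ f)) ζ (f γ ζ) := by
  have := g.prob
  have hυ0 := g.nonneg
  have hυq : υ < q := by linarith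
  have hX : ∀ i, Measurable fun x => ‖jetDiff e α f i x‖ₑ := fun i =>
    (measurable_jetDiff he hf i).enorm
  have hfin := fun i => g.kernelNorm_jetDiff_lt_top he hp hhalf hq hq2 hf hB i
  obtain ⟨C, hC, hb⟩ := g.exists_enorm_wDeriv_ext_sub_le he hυq hL hf hfi γ
  have h1 : ∀ᵐ ζ ∂μ, ∀ i ∈ box m (boxDeg m α), _ := (Filter.eventually_all_finset _).2 fun i _ =>
    g.ae_vanishingMean_avgKernel he hυ hp hυq hγ (weight i) (hX i) (hfin i)
  have h2 : ∀ᵐ ζ ∂μ, ∀ i ∈ box m (boxDeg m α), _ := (Filter.eventually_all_finset _).2 fun i _ =>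
    g.ae_vanishingMean_nearAvg he hυ hp (by linarith) hγ (weight i) (hX i) (hfin i)
  filter_upwards [h1, h2, hc, g.ae_mem] with ζ hζ1 hζ2 hζc hζE
  have hζ := g.norm_eq hζE
  have hρ := measurable_distSet (m := m) g.nonempty
  have hdist : Measurable fun z : Cn m => dist z ζ := measurable_dist measurable_id measurable_const
  have hm1 : ∀ i ∈ box m (boxDeg m α), Measurable fun z => ENNReal.ofReal C *
      (ENNReal.ofReal (distSet z E ^ (-weight γ)) *
        avgKernel E μ q (weight i) (fun x => ‖jetDiff e α f i x‖ₑ) z) := fun i _ =>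
    ((hρ.pow_const _).ennreal_ofReal.mul
      (measurable_avgKernel g.nonempty μ q _ (hX i))).const_mul _
  have hm2 : ∀ i ∈ box m (boxDeg m α), Measurable fun z => ENNReal.ofReal C *
      (ENNReal.ofReal (dist z ζ ^ (weight i - weight γ)) *
        nearAvg E μ (fun s => ‖jetDiff e α f i (s, ζ)‖ₑ) z) := fun i _ =>
    ((hdist.pow_const _).ennreal_ofReal.mul (measurable_nearAvg g.nonempty μ
      (Y := fun (_ : Cn m) s => ‖jetDiff e α f i (s, ζ)‖ₑ)
      ((hX i).comp (measurable_snd.prodMk measurable_const)) measurable_id)).const_mul _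
  refine HasMeanValue.of_vanishingMean he hζ (g.aestronglyMeasurable_wDeriv_ext he hL hf hfi γ) ?_
    (hb ζ hζE (f γ ζ))
  refine VanishingMean.add (Finset.measurable_sum _ hm1) ?_
    (VanishingMean.add (Finset.measurable_sum _ hm2) ?_ ?_)
  · exact VanishingMean.sum _ hm1 fun i hi => (hζ1 i hi).const_mul ENNReal.ofReal_ne_top
  · exact VanishingMean.sum _ hm2 fun i hi => (hζ2 i hi).const_mul ENNReal.ofReal_ne_top
  · exact VanishingMean.of_tendsto he hζ (tendsto_wDeriv_taylor he f hγ.le (g.ne_zero hζE) hζc)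

end Growth
end Extension
-- Replacing the components of a jet by Borel representatives.
section MeasurableJets

variable {m : ℕ} {e : Cn m → Fin (m + 1) → Cn m} {μ : Measure (Cn m)}

theorem taylor_congr (e : Cn m → Fin (m + 1) → Cn m) {α : ℝ} {f f' : Jet m} {y : Cn m}
    (h : ∀ j ∈ indices m α, f j y = f' j y) : taylor e α f y = taylor e α f' y := by
  funext x
  unfold taylor
  exact Finset.sum_congr rfl fun j hj => by rw [h j hj]

theorem ext_congr (e : Cn m → Fin (m + 1) → Cn m) (q : ℝ) {α : ℝ} {f f' : Jet m}
    (h : ∀ᵐ y ∂μ, ∀ j ∈ indices m α, f j y = f' j y) : ext e q α μ f = ext e q α μ f' := by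
  funext z
  unfold ext
  congr 1
  refine integral_congr_ae ?_
  filter_upwards [h] with y hy
  rw [taylor_congr e hy]

theorem MemBesov.congr [SFinite μ] {p α lam : ℝ} {f f' : Jet m} (hB : MemBesov e p α lam μ f)
    (h : ∀ᵐ y ∂μ, ∀ j ∈ indices m α, f j y = f' j y) : MemBesov e p α lam μ f' := by
  intro j hj
  obtain ⟨h1, h2⟩ := hB j hj
  refine ⟨h1.ae_eq (h.mono fun y hy => hy j (mem_indices.2 hj)), lt_of_eq_of_lt ?_ h2⟩
  refine lintegral_congr_ae ?_
  have hfst := Measure.quasiMeasurePreserving_fst (μ := μ) (ν := μ) |>.ae h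
  have hsnd := Measure.quasiMeasurePreserving_snd (μ := μ) (ν := μ) |>.ae h
  filter_upwards [hfst, hsnd] with x hx1 hx2
  unfold remainder
  rw [taylor_congr e hx1, hx2 j (mem_indices.2 hj)]

theorem MemBesov.exists_measurable {p α lam : ℝ} {f : Jet m} (hB : MemBesov e p α lam μ f) :
    ∃ f' : Jet m, (∀ j ∈ indices m α, Measurable (f' j)) ∧
      ∀ᵐ y ∂μ, ∀ j ∈ indices m α, f j y = f' j y := by
  have h : ∀ j, ∃ φ : Cn m → ℂ, j ∈ indices m α → Measurable φ ∧ f j =ᵐ[μ] φ := by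
    intro j
    by_cases hj : j ∈ indices m α
    · have h1 := (hB j (mem_indices.1 hj)).1.1
      exact ⟨h1.mk _, fun _ => ⟨h1.stronglyMeasurable_mk.measurable, h1.ae_eq_mk⟩⟩
    · exact ⟨0, fun h => absurd h hj⟩
  choose f' hf' using h
  exact ⟨f', fun j hj => (hf' j hj).1,
    (Filter.eventually_all_finset _).2 fun j hj => (hf' j hj).2⟩

end MeasurableJets
end NonIso

/-! ### Conclusion. -/

theorem theorem8 (m : ℕ) (p α υ lam : ℝ) (hp : 1 ≤ p) (hα : 0 < α)
    (hυ : υ < ((m + 1 : ℕ) : ℝ))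
    (hhalf : ∀ i : ℤ, (i : ℝ) / 2 ∉ Set.Icc α (α + (υ - lam) / p)) :
    ∃ q₀ : ℝ, ∀ (E : Set (NonIso.Cn m)) (μ : MeasureTheory.Measure (NonIso.Cn m))
      (e : NonIso.Cn m → Fin (m + 1) → NonIso.Cn m),
      IsClosed E → E ⊆ Metric.sphere 0 1 →
      NonIso.upperDim E < ((m + 1 : ℕ) : ℝ) →
      NonIso.upperDim E ≤ υ → lam ≤ NonIso.lowerDim E →
      NonIso.MemU E υ μ → NonIso.MemL E lam μ →
      NonIso.IsFrame e → (∀ᵐ ζ ∂μ, ContinuousAt e ζ) →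
      ∀ q : ℝ, q₀ ≤ q → NonIso.HasLowerBound E q μ →
      ∀ f : NonIso.Jet m, NonIso.MemBesov e p α lam μ f →
        NonIso.MemHF p 1 (α + (((m + 1 : ℕ) : ℝ) - lam) / p) (NonIso.ext e q α μ f) ∧
        ∀ γ : Fin (m + 1) → ℕ, NonIso.weight γ < α →
          ∀ᵐ ζ ∂μ,
            NonIso.HasMeanValue (NonIso.wDeriv e γ (NonIso.ext e q α μ f)) ζ (f γ ζ) := by
  -- `3υ < q` makes the dyadic kernels of large weight integrable in both variables; `2υ + pα - lam
  -- < q` gives the comparison with the Besov kernel for every weight between 0 and `α`.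
  refine ⟨max (3 * υ + 1) (2 * υ + p * α - lam + 1), ?_⟩
  intro E μ e hE hS _ _ _ hU hL he hc q hq hlow f hB
  obtain ⟨A, g⟩ := hU.exists_growth hE hS hL
  have := g.prob
  have hq1 : 3 * υ < q := by linarith [(le_max_left _ _).trans hq]
  have hq2 : 2 * υ + p * α - lam < q := by linarith [(le_max_right _ _).trans hq]
  obtain ⟨f', hf', heq⟩ := hB.exists_measurable
  have hB' := hB.congr heq
  have hfi : ∀ j ∈ NonIso.indices m α, Integrable (f' j) μ := fun j hj =>
    (hB' j (NonIso.mem_indices.1 hj)).1.integrable (ENNReal.one_le_ofReal.2 hp)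
  -- The extension is defined by integrals and is unchanged, whereas the boundary value `f γ ζ`
  -- agrees with that of the representative only for almost every `ζ`.
  rw [NonIso.ext_congr e q heq]
  refine ⟨g.memHF_ext he hυ hp hα hhalf hq1 hq2 hlow hf' hfi hB', fun γ hγ => ?_⟩
  filter_upwards [g.ae_hasMeanValue_ext he hυ hp hhalf hq1 hq2 hlow hf' hfi hB' hc hγ, heq]
    with ζ h1 h2
  rw [h2 γ (NonIso.mem_indices.2 hγ.le)]
  exact h1
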